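/- **Setting.** Let $X\subset\mathbb R^d$ be a compact connected set, $\Psi_1,\dots,\Psi_N$ strictly contractive similitudes of $\mathbb R^d$ with distinct fixed points $x_1,\dots,x_N$, such that $X=\bigcup_i\Psi_i(X)$, and let $F\subset\{x_1,\dots,x_N\}$ satisfy $\Psi_i(X)\cap\Psi_j(X)=\Psi_i(F)\cap\Psi_j(F)$ for $i\neq j$. Let $\alpha_i,\beta_i\in(0,1)$ with $\sum_i\beta_i=1$ and $\alpha_i\beta_i$ independent of $i$. Endow $\Omega=\{1,\dots,N\}^{\mathbb N}$ with the product of the uniform measure. For $\omega\in\Omega$ let $\Phi_n=\Psi_{\omega_1}^{-1}\circ\dots\circ\Psi_{\omega_n}^{-1}$, $\Psi_w=\Psi_{w_1}\circ\dots\circ\Psi_{w_n}$, $\alpha_w=\alpha_{w_1}\cdots\alpha_{w_n}$, $\beta_w=\beta_{w_1}\cdots\beta_{w_n}$ for $w\in\{1,\dots,N\}^n$, $X_{<n>}=\Phi_n(X)$, $F_{<n>}=\Phi_n(\bigcup_{w}\Psi_w(F))$, $\partial X_{<n>}=\partial F_{<n>}=\Phi_n(F)$; let $X_{<\infty>}=\bigcup_n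 X_{<n>}$, $F_{<\infty>}=\bigcup_n F_{<n>}$ and $\partial X_{<\infty>}=\partial F_{<\infty>}=\bigcap_n\bigcup_{m\ge n}\partial X_{<m>}$. Write $\alpha_{\omega,n}=\alpha_{\omega_1}\cdots\alpha_{\omega_n}$ and $\beta_{\omega,n}=\beta_{\omega_1}\cdots\beta_{\omega_n}$. Consider one of the following two cases. *Lattice case.* Let $Af(x)=-\sum_{y\ne x}a_{x,y}(f(y)-f(x))$ on $\mathbb R^F$ with $a_{x,y}=a_{y,x}\ge0$ and connected graph $\{a_{x,y}>0\}$, and let $b$ be a strictly positive measure on $F$. Put, for $f,g\in\mathcal D_{<n>}^+=\mathbb R^{F_{<n>}}$, $$a_{<n>}(f,g)=\sum_{w\in\{1,\dots,N\}^n}\alpha_{\omega,n}\,\alpha_w^{-1}\,\langle A(f\circ\Phi_n\circ\Psi_w),g\circ\Phi_n\circ\Psi_w\rangle_{\mathbb R^F},\qquad m_{<n>}=\sum_{w}\beta_{\omega,n}^{-1}\,\beta_w\,(\Phi_n\circ\Psi_w)_*b .$$ *Continuous case.* Let $m$ be the probability measure on $X$ with $m=\sum_i\beta_i(\Psi_i)_*m$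 and let $(a,\mathcal D)$ be a local, regular, conservative Dirichlet form on $L^2(X,m)$ whose domain consists of continuous functions, self-similar with weights $\alpha$: a continuous $f$ is in $\mathcal D$ iff all $f\circ\Psi_i$ are, and then $a(f,f)=\sum_i\alpha_i^{-1}a(f\circ\Psi_i,f\circ\Psi_i)$. Put $m_{<n>}=\beta_{\omega,n}^{-1}(\Phi_n)_*m$, $\mathcal D_{<n>}^+=\{f:\ f\circ\Phi_n\in\mathcal D\}$ and $a_{<n>}(f,g)=\alpha_{\omega,n}\,a(f\circ\Phi_n,g\circ\Phi_n)$. In both cases let $m_{<\infty>}$ be the increasing limit of the $m_{<n>}$ and $\mathcal D_{<\infty>}^+$ the set of $f\in L^2(m_{<\infty>})$ whose restriction to level $n$ is in $\mathcal D_{<n>}^+$ for all $n$ with $\sup_na_{<n>}(f,f)<\infty$ (in the lattice case this is all of $L^2(m_{<\infty>})$); $\mathcal D_{<\infty>}^-$ consists of those vanishing on $\partial X_{<\infty>}$, and $a_{<\infty>}=\lim_na_{<n>}$. Let $H_{<\infty>}^\pm$ be the operator on the closure of $\mathcal D_{<\infty>}^\pm$ in $L^2(m_{<\infty>})$ associated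 with this form: $H_{<\infty>}^\pm f=h$ iff $f\in\mathcal D^\pm_{<\infty>}$ and $a_{<\infty>}(f,g)=-\int hg\,dm_{<\infty>}$ for all $g\in\mathcal D^\pm_{<\infty>}$. Let $\mathcal H_{ac}^\pm,\mathcal H_{sc}^\pm,\mathcal H_{pp}^\pm$ be the subspaces of vectors whose spectral measure for $H^\pm_{<\infty>}$ is absolutely continuous, singular continuous, pure point. A Neumann–Dirichlet eigenfunction of level $n$ is an $f\in\mathcal D^+_{<n>}$ with $f=0$ on $\partial X_{<n>}$ for which there is $\lambda\in\mathbb R$ with $a_{<n>}(f,g)=-\lambda\int fg\,dm_{<n>}$ for all $g\in\mathcal D^+_{<n>}$; it is extended by $0$. Let $\mathcal H_{ND}$ be the closed subspace of $L^2(m_{<\infty>})$ generated by those of all levels, and $\tilde{\mathcal H}^\pm_{pp}=\mathcal H^\pm_{pp}\ominus\mathcal H_{ND}$. Let $\Sigma^\pm(\omega)$, $\Sigma_{ac}^\pm(\omega)$, $\Sigma_{sc}^\pm(\omega)$, $\Sigma_{pp}^\pm(\omega)$, $\tilde\Sigma_{pp}^\pm(\omega)$, $\Sigma_{ND}^\pm(\omega)$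 be the topological spectra of $H^\pm_{<\infty>}$ and of its restrictions to $\mathcal H_{ac}^\pm$, $\mathcal H_{sc}^\pm$, $\mathcal H_{pp}^\pm$, $\tilde{\mathcal H}_{pp}^\pm$, $\mathcal H_{ND}$. **Proposition.** In the lattice case and in the continuous case, there exist deterministic sets $\Sigma,\Sigma_{ac},\Sigma_{sc},\Sigma_{pp},\tilde\Sigma_{pp},\Sigma_{ND}\subset\mathbb R$ (independent of $\omega$) such that for almost every $\omega\in\Omega$ and for both signs $\pm$, $$\Sigma^\pm(\omega)=\Sigma,\quad \Sigma^\pm_{ac}(\omega)=\Sigma_{ac},\quad \Sigma^\pm_{sc}(\omega)=\Sigma_{sc},\quad \Sigma^\pm_{pp}(\omega)=\Sigma_{pp},\quad \tilde\Sigma^\pm_{pp}(\omega)=\tilde\Sigma_{pp},\quad \Sigma^\pm_{ND}(\omega)=\Sigma_{ND}.$$ -/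

import Mathlib

open MeasureTheory Filter Topology

noncomputable section

namespace FractalBlowUp

/-! ### Spectral theory of an operator given by its graph

An (unbounded) operator `H` in a real Hilbert space `L`, acting in a closed subspace `V`, is
represented by its graph `Γ = {(f, h) | f ∈ dom H, H f = h} ⊆ V × V`. -/

section SpectralTheory

variable {L : Type*} [NormedAddCommGroup L] [InnerProductSpace ℝ L] [CompleteSpace L]

/-- Topological spectrum of the restriction of the operator with graph `Γ` to the subspace `W`:
`t` is outside of the spectrum iff `t - H` restricted to `W` has an everywhere defined bounded
inverse `R : W → W`. -/
def spectrumOn (Γ : Set (L × L)) (W : Submodule ℝ L) : Set ℝ :=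
  {t | ¬ ∃ R : W →L[ℝ] W, ∀ u v : W, R v = u ↔ ((u : L), t • (u : L) - (v : L)) ∈ Γ}

/-- A spectral resolution `P(dt)` on the closed subspace `V` of the operator with graph `Γ`,
together with the spectral measures `σ f (A) = ‖P(A) f‖ ^ 2`. -/
structure SpectralResolution (Γ : Set (L × L)) (V : Submodule ℝ L) where
  /-- the projection-valued measure -/
  P : Set ℝ → L →L[ℝ] L
  /-- the spectral measures -/
  σ : L → Measure ℝ
  isStarProjection : ∀ A, MeasurableSet A → IsStarProjection (P A)
  /-- `P ℝ` is the orthogonal projection on `V`, i.e. the identity of `V` -/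
  univ_apply_eq_iff : ∀ f, P Set.univ f = f ↔ f ∈ V
  empty : P ∅ = 0
  inter : ∀ A B, MeasurableSet A → MeasurableSet B → P (A ∩ B) = P A * P B
  iUnion : ∀ A : ℕ → Set ℝ, (∀ n, MeasurableSet (A n)) → Pairwise (fun m n => Disjoint (A m) (A n)) →
    ∀ f, HasSum (fun n => P (A n) f) (P (⋃ n, A n) f)
  σ_apply : ∀ f A, MeasurableSet A → σ f A = ENNReal.ofReal (‖P A f‖ ^ 2)
  /-- `H = ∫ t P(dt)`: the domain of `H` is `{f ∈ V | ∫ t ^ 2 dσ(f) < ∞}` and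
  `⟪H f, g⟫ = ∫ t d⟪P(t) f, g⟫` for `f` and `g` in the domain, where the signed measure
  `⟪P(A) f, g⟫` is written as `(σ (f + g) (A) - σ (f - g) (A)) / 4`. -/
  mem_graph_iff : ∀ f h, (f, h) ∈ Γ ↔ f ∈ V ∧ h ∈ V ∧ Integrable (fun t : ℝ => t ^ 2) (σ f) ∧
    ∀ g ∈ V, Integrable (fun t : ℝ => t ^ 2) (σ g) →
      inner ℝ h g = (∫ t, t ∂(σ (f + g)) - ∫ t, t ∂(σ (f - g))) / 4

/-- A measure on `ℝ` is purely punctual if it is carried by a countable set. -/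
def PurePoint (σ : Measure ℝ) : Prop := ∃ s : Set ℝ, s.Countable ∧ σ sᶜ = 0

/-- A measure on `ℝ` is singular continuous if it has no atoms and is singular with respect to
the Lebesgue measure. -/
def SingularContinuous (σ : Measure ℝ) : Prop :=
  (∀ t : ℝ, σ {t} = 0) ∧ Measure.MutuallySingular σ volume

/-- The subspace of the vectors of `V` whose spectral measure satisfies `p`. (For the three
properties used below, those vectors already form a closed subspace; taking the closed span only
bundles it.) -/
def spectralSubspace (Γ : Set (L × L)) (V : Submodule ℝ L) (p : Measure ℝ → Prop) :
    Submodule ℝ L :=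
  (Submodule.span ℝ {f | f ∈ V ∧ ∃ R : SpectralResolution Γ V, p (R.σ f)}).topologicalClosure

/-- `ℋ_ac` -/
def acSubspace (Γ : Set (L × L)) (V : Submodule ℝ L) : Submodule ℝ L :=
  spectralSubspace Γ V (fun σ => σ ≪ volume)

/-- `ℋ_sc` -/
def scSubspace (Γ : Set (L × L)) (V : Submodule ℝ L) : Submodule ℝ L :=
  spectralSubspace Γ V SingularContinuous

/-- `ℋ_pp` -/
def ppSubspace (Γ : Set (L × L)) (V : Submodule ℝ L) : Submodule ℝ L :=
  spectralSubspace Γ V PurePoint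

end SpectralTheory

/-! ### Increasing sequences of forms and their limit operators -/

/-- Boundary condition: `neumann` is the sign `+`, `dirichlet` is the sign `-`. -/
inductive BC
  | neumann
  | dirichlet

/-- The data attached to a blow-up at all finite levels `n`. Functions are functions on the ambient
space `E`, of which only the values on `carrier n` matter at level `n`. -/
structure FormSequence (E : Type*) [MeasurableSpace E] where
  /-- `X_<n>`, resp. `F_<n>` -/
  carrier : ℕ → Set E
  /-- `∂X_<n> = ∂F_<n>` -/
  boundary : ℕ → Set E
  /-- `m_<n>`, resp. `b_<n>` -/
  measure : ℕ → Measure E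
  /-- the domain `𝓓_<n>⁺` -/
  dom : ℕ → Set (E → ℝ)
  /-- `a_<n>(f, g)`, resp. `⟨A_<n> f, g⟩` -/
  form : ℕ → (E → ℝ) → (E → ℝ) → ℝ

namespace FormSequence

variable {E : Type*} [MeasurableSpace E] (T : FormSequence E)

/-- `m_<∞>`, resp. `b_<∞>`: the limit of the increasing sequence of measures. -/
def limMeasure : Measure E := ⨆ n, T.measure n

/-- `∂X_<∞> = ⋂ n, ⋃ m ≥ n, ∂X_<m>`. -/
def limBoundary : Set E := ⋂ n, ⋃ m, ⋃ (_ : n ≤ m), T.boundary m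

/-- The Hilbert space `L²(X_<∞>, m_<∞>)`, resp. `L²(F_<∞>, b_<∞>)`. -/
abbrev L2 : Type _ := Lp ℝ 2 T.limMeasure

/-- The domain `𝓓_<∞>⁺` of the limit form, and the subspace `𝓓_<∞>⁻` of its elements that vanish
on `∂X_<∞>`. -/
def limDom : BC → Set (E → ℝ)
  | .neumann => {u | MemLp u 2 T.limMeasure ∧ (∀ n, u ∈ T.dom n) ∧
      BddAbove (Set.range fun n => T.form n u u)}
  | .dirichlet => {u | (MemLp u 2 T.limMeasure ∧ (∀ n, u ∈ T.dom n) ∧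
      BddAbove (Set.range fun n => T.form n u u)) ∧ ∀ x ∈ T.limBoundary, u x = 0}

/-- The Hilbert space in which `H_<∞>^±` acts: the closure of `𝓓_<∞>^±` in `L²`. -/
def space (ε : BC) : Submodule ℝ T.L2 :=
  (Submodule.span ℝ {f : T.L2 | ∃ u ∈ T.limDom ε, f =ᵐ[T.limMeasure] u}).topologicalClosure

/-- The graph of `H_<∞>^±`: `H f = h` iff `f ∈ 𝓓_<∞>^±` and `a_<∞>(f, g) = - ∫ h g dm_<∞>` for all
`g ∈ 𝓓_<∞>^±`, where `a_<∞>(f, g) = lim_n a_<n>(f, g)`. -/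
def graph (ε : BC) : Set (T.L2 × T.L2) :=
  {p | p.2 ∈ T.space ε ∧ ∃ u ∈ T.limDom ε, p.1 =ᵐ[T.limMeasure] u ∧ ∀ v ∈ T.limDom ε,
    Tendsto (fun n => T.form n u v) atTop (𝓝 (-∫ x, p.2 x * v x ∂T.limMeasure))}

/-- The Neumann-Dirichlet eigenfunctions of `H_<n>`, extended by `0`. -/
def ndEigenfunctions (n : ℕ) : Set (E → ℝ) :=
  {u | u ∈ T.dom n ∧ (∀ x ∈ T.boundary n, u x = 0) ∧ (∀ x, x ∉ T.carrier n → u x = 0) ∧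
    ∃ t : ℝ, ∀ v ∈ T.dom n, T.form n u v = -t * ∫ x, u x * v x ∂T.measure n}

/-- `ℋ_ND`: the closed subspace generated by the Neumann-Dirichlet eigenfunctions of all levels. -/
def ndSubspace : Submodule ℝ T.L2 :=
  (Submodule.span ℝ
    {f : T.L2 | ∃ n, ∃ u ∈ T.ndEigenfunctions n, f =ᵐ[T.limMeasure] u}).topologicalClosure

/-- The spectrum `Σ^±` of `H_<∞>^±`. -/
def spec (ε : BC) : Set ℝ := spectrumOn (T.graph ε) (T.space ε)

/-- `Σ_ac^±` -/
def acSpec (ε : BC) : Set ℝ := spectrumOn (T.graph ε) (acSubspace (T.graph ε) (T.space ε))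

/-- `Σ_sc^±` -/
def scSpec (ε : BC) : Set ℝ := spectrumOn (T.graph ε) (scSubspace (T.graph ε) (T.space ε))

/-- `Σ_pp^±` -/
def ppSpec (ε : BC) : Set ℝ := spectrumOn (T.graph ε) (ppSubspace (T.graph ε) (T.space ε))

/-- `Σ̃_pp^±`: spectrum on the orthogonal supplement of `ℋ_ND` in `ℋ_pp^±`. -/
def ppTildeSpec (ε : BC) : Set ℝ :=
  spectrumOn (T.graph ε) (ppSubspace (T.graph ε) (T.space ε) ⊓ T.ndSubspaceᗮ)

/-- `Σ_ND` (computed with `H_<∞>^±`) -/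
def ndSpec (ε : BC) : Set ℝ := spectrumOn (T.graph ε) T.ndSubspace

end FormSequence

/-! ### Self-similar sets and their blow-ups -/

/-- A finitely ramified self-similar set in `ℝ^d` with `N` cells. -/
structure SelfSimilarSet (d N : ℕ) where
  /-- the similitudes -/
  Ψ : Fin N → (EuclideanSpace ℝ (Fin d) ≃ᵈ EuclideanSpace ℝ (Fin d))
  /-- their fixed points -/
  pt : Fin N → EuclideanSpace ℝ (Fin d)
  /-- the self-similar set -/
  X : Set (EuclideanSpace ℝ (Fin d))
  /-- its boundary -/
  F : Finset (EuclideanSpace ℝ (Fin d))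
  ratio_lt_one : ∀ i, Dilation.ratio (Ψ i) < 1
  apply_pt : ∀ i, Ψ i (pt i) = pt i
  pt_injective : Function.Injective pt
  isCompact : IsCompact X
  isConnected : IsConnected X
  eq_iUnion : X = ⋃ i, Ψ i '' X
  F_subset : (F : Set (EuclideanSpace ℝ (Fin d))) ⊆ Set.range pt
  inter_eq : ∀ i j, i ≠ j → Ψ i '' X ∩ Ψ j '' X = Ψ i '' F ∩ Ψ j '' F

namespace SelfSimilarSet

variable {d N : ℕ} (S : SelfSimilarSet d N)

lemma map_mem (i : Fin N) {x : EuclideanSpace ℝ (Fin d)} (hx : x ∈ S.X) : S.Ψ i x ∈ S.X := by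
  rw [S.eq_iUnion]
  exact Set.mem_iUnion.2 ⟨i, x, hx, rfl⟩

/-- `Ψ_i` as a map from `X` to `X`. -/
def cellMap (i : Fin N) (x : S.X) : S.X := ⟨S.Ψ i x, S.map_mem i x.2⟩

/-- `Ψ_{w_1} ∘ ⋯ ∘ Ψ_{w_n}` -/
def wordMap {n : ℕ} (w : Fin n → Fin N) : EuclideanSpace ℝ (Fin d) ≃ᵈ EuclideanSpace ℝ (Fin d) :=
  (List.ofFn fun k => S.Ψ (w k)).prod

/-- `Ψ_{ω_1}⁻¹ ∘ ⋯ ∘ Ψ_{ω_n}⁻¹`, where the sequence `ω` is indexed from `0`. -/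
def blowMap (ω : ℕ → Fin N) (n : ℕ) : EuclideanSpace ℝ (Fin d) ≃ᵈ EuclideanSpace ℝ (Fin d) :=
  (List.ofFn fun k : Fin n => (S.Ψ (ω k))⁻¹).prod

/-- `X_<n>` -/
def blowX (ω : ℕ → Fin N) (n : ℕ) : Set (EuclideanSpace ℝ (Fin d)) := S.blowMap ω n '' S.X

/-- `∂X_<n> = ∂F_<n>` -/
def blowBoundary (ω : ℕ → Fin N) (n : ℕ) : Set (EuclideanSpace ℝ (Fin d)) :=
  S.blowMap ω n '' S.F

/-- `F_<n>` -/
def blowF (ω : ℕ → Fin N) (n : ℕ) : Set (EuclideanSpace ℝ (Fin d)) :=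
  S.blowMap ω n '' ⋃ w : Fin n → Fin N, S.wordMap w '' S.F

/-! #### The lattice case -/

/-- `A f (x) = - ∑ y ≠ x, a_{x,y} (f y - f x)` for `f : F → ℝ`. -/
def laplacian (a : S.F → S.F → ℝ) (f : S.F → ℝ) (x : S.F) : ℝ :=
  -∑ y ∈ Finset.univ.erase x, a x y * (f y - f x)

/-- Assumptions on the coefficients of `A`: symmetric, non-negative, irreducible. -/
structure IsConductance (a : S.F → S.F → ℝ) : Prop where
  symm : ∀ x y, x ≠ y → a x y = a y x
  nonneg : ∀ x y, x ≠ y → 0 ≤ a x y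
  irreducible : (SimpleGraph.fromRel fun x y : S.F => 0 < a x y).Connected

/-- The point of the `0`-cell `F_{<n>, w_1, …, w_n}` that corresponds to `x ∈ F`. -/
def cellPoint (ω : ℕ → Fin N) {n : ℕ} (w : Fin n → Fin N) (x : S.F) : EuclideanSpace ℝ (Fin d) :=
  S.blowMap ω n (S.wordMap w x)

/-- The measure `b_<n>`: the sum over the `0`-cells of `F_<n>` of the copies of `b`, with weights
`β_{ω_1}⁻¹ ⋯ β_{ω_n}⁻¹ β_{w_1} ⋯ β_{w_n}`. -/
def latticeMeasure (β : Fin N → ℝ) (b : S.F → ℝ) (ω : ℕ → Fin N) (n : ℕ) :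
    Measure (EuclideanSpace ℝ (Fin d)) :=
  ∑ w : Fin n → Fin N, ∑ x : S.F,
    ENNReal.ofReal ((∏ k : Fin n, (β (ω k))⁻¹) * (∏ k, β (w k)) * b x) •
      Measure.dirac (S.cellPoint ω w x)

/-- `⟨A_<n> f, g⟩`, where `A_<n>` is the sum over the `0`-cells of `F_<n>` of the copies of `A`,
with weights `α_{ω_1} ⋯ α_{ω_n} α_{w_1}⁻¹ ⋯ α_{w_n}⁻¹`. -/
def latticeForm (α : Fin N → ℝ) (a : S.F → S.F → ℝ) (ω : ℕ → Fin N) (n : ℕ)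
    (f g : EuclideanSpace ℝ (Fin d) → ℝ) : ℝ :=
  ∑ w : Fin n → Fin N, (∏ k : Fin n, α (ω k)) * (∏ k, (α (w k))⁻¹) *
    ∑ x : S.F, S.laplacian a (fun y => f (S.cellPoint ω w y)) x * g (S.cellPoint ω w x)

/-- The blow-up `ω` of the lattice. -/
def lattice (α β : Fin N → ℝ) (a : S.F → S.F → ℝ) (b : S.F → ℝ) (ω : ℕ → Fin N) :
    FormSequence (EuclideanSpace ℝ (Fin d)) where
  carrier := S.blowF ω
  boundary := S.blowBoundary ω
  measure := S.latticeMeasure β b ω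
  dom := fun _ => Set.univ
  form := S.latticeForm α a ω

/-! #### The continuous case -/

/-- `m` is the self-similar (probability) measure on `X` with weights `β`. -/
def IsSelfSimilarMeasure (β : Fin N → ℝ) (m : Measure S.X) : Prop :=
  IsProbabilityMeasure m ∧ m = ∑ i, ENNReal.ofReal (β i) • m.map (S.cellMap i)

/-- A local, regular, conservative Dirichlet form on `L²(X, m)`, self-similar with respect to the
weights `α`. The elements of the domain are continuous; they are identified with their classes in
`L²(X, m)`. The values of `form` outside of `dom` are irrelevant. -/
structure DirichletForm (α : Fin N → ℝ) (m : Measure S.X) where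
  /-- the domain -/
  dom : Submodule ℝ (S.X → ℝ)
  /-- the form -/
  form : (S.X → ℝ) → (S.X → ℝ) → ℝ
  continuous : ∀ u ∈ dom, Continuous u
  form_add : ∀ u ∈ dom, ∀ v ∈ dom, ∀ w ∈ dom, form (u + v) w = form u w + form v w
  form_smul : ∀ c : ℝ, ∀ u ∈ dom, ∀ v ∈ dom, form (c • u) v = c * form u v
  form_symm : ∀ u ∈ dom, ∀ v ∈ dom, form u v = form v u
  form_nonneg : ∀ u ∈ dom, 0 ≤ form u u
  /-- the form is closed: `dom` is complete for `form u u + ∫ u ^ 2 dm` -/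
  closed : ∀ u : ℕ → S.X → ℝ, (∀ n, u n ∈ dom) →
    (∀ δ > 0, ∃ n₀, ∀ p ≥ n₀, ∀ q ≥ n₀,
      form (u p - u q) (u p - u q) + ∫ x, (u p x - u q x) ^ 2 ∂m < δ) →
    ∃ v ∈ dom, Tendsto (fun n => form (u n - v) (u n - v) + ∫ x, (u n x - v x) ^ 2 ∂m)
      atTop (𝓝 0)
  /-- the unit contraction operates -/
  markov : ∀ u ∈ dom, (fun x => min (max (u x) 0) 1) ∈ dom ∧
    form (fun x => min (max (u x) 0) 1) (fun x => min (max (u x) 0) 1) ≤ form u u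
  /-- `dom` is uniformly dense in the space of continuous functions -/
  regular : ∀ f : S.X → ℝ, Continuous f → ∀ δ > 0, ∃ u ∈ dom, ∀ x, |f x - u x| < δ
  locality : ∀ u ∈ dom, ∀ v ∈ dom, Disjoint (tsupport u) (tsupport v) → form u v = 0
  conservative : (fun _ => 1) ∈ dom ∧ form (fun _ => 1) (fun _ => 1) = 0
  mem_dom_iff : ∀ u : S.X → ℝ, Continuous u → (u ∈ dom ↔ ∀ i, u ∘ S.cellMap i ∈ dom)
  self_similar : ∀ u ∈ dom,
    form u u = ∑ i, (α i)⁻¹ * form (u ∘ S.cellMap i) (u ∘ S.cellMap i)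

/-- The measure `m_<n>`. -/
def continuumMeasure (β : Fin N → ℝ) (m : Measure S.X) (ω : ℕ → Fin N) (n : ℕ) :
    Measure (EuclideanSpace ℝ (Fin d)) :=
  ENNReal.ofReal (∏ k : Fin n, (β (ω k))⁻¹) • m.map (fun x : S.X => S.blowMap ω n x)

/-- The function `f ∘ Ψ_{ω_1}⁻¹ ∘ ⋯ ∘ Ψ_{ω_n}⁻¹` on `X`. -/
def pull (ω : ℕ → Fin N) (n : ℕ) (f : EuclideanSpace ℝ (Fin d) → ℝ) : S.X → ℝ :=
  fun x => f (S.blowMap ω n x)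

/-- The blow-up `ω` of the self-similar set. -/
def continuum {α : Fin N → ℝ} (β : Fin N → ℝ) {m : Measure S.X} (a : S.DirichletForm α m)
    (ω : ℕ → Fin N) : FormSequence (EuclideanSpace ℝ (Fin d)) where
  carrier := S.blowX ω
  boundary := S.blowBoundary ω
  measure := S.continuumMeasure β m ω
  dom := fun n => {f | S.pull ω n f ∈ a.dom}
  form := fun n f g => (∏ k : Fin n, α (ω k)) * a.form (S.pull ω n f) (S.pull ω n g)

end SelfSimilarSet

/-- The product on `{1, …, N} ^ ℕ` of the uniform measure on `{1, …, N}`. -/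
def blowUpLaw (N : ℕ) [NeZero N] : Measure (ℕ → Fin N) :=
  Measure.infinitePi fun _ : ℕ => (PMF.uniformOfFintype (Fin N)).toMeasure

/-- The spectrum and its components are almost surely deterministic. -/
def HasDeterministicSpectra {N : ℕ} [NeZero N] {E : Type*} [MeasurableSpace E]
    (T : (ℕ → Fin N) → FormSequence E) : Prop :=
  ∃ Sig Sig_ac Sig_sc Sig_pp Sig_pp_tilde Sig_ND : Set ℝ, ∀ᵐ ω ∂(blowUpLaw N), ∀ ε : BC,
    (T ω).spec ε = Sig ∧ (T ω).acSpec ε = Sig_ac ∧ (T ω).scSpec ε = Sig_sc ∧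
    (T ω).ppSpec ε = Sig_pp ∧ (T ω).ppTildeSpec ε = Sig_pp_tilde ∧ (T ω).ndSpec ε = Sig_ND

end FractalBlowUp

end

/-! Fix one of the six spectra and an open interval with rational endpoints. The event that the
spectrum misses the interval is measurable and is not affected by changing finitely many letters of
ω, so it has probability 0 or 1. A closed set of reals is determined by the rational intervals that
it misses (`isClosed_eq_of_inter_Ioo`), so each spectrum is almost surely constant
(`hasDeterministicSpectra`). Three facts carry this.

The sign is irrelevant. There are at least two similitudes, so some word drives every point of F out
of F (`exists_exit_word`), and almost surely this word is read in ω at arbitrarily large places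
(`ae_exists_word`). The boundaries then leave every finite level: the limit boundary is empty, the
operators for both signs coincide, and the limit measure is finite on each level because each level
lies inside the interior of a later one.

Invariance. If ω and ω' agree from n on, a similitude carries one blow-up onto the other from level
n on. It multiplies the forms by a ratio of products of α and the measures by a ratio of products of
1/β. As α_i β_i does not depend on i, the two factors agree (`prod_inv_shift`), so a unitary map
intertwines the two operators with no rescaling of the spectrum (`IsConj.spectra_eq`).

Measurability is the long part. The vector (1 - H)⁻¹ e minimizes a(u, u) + ‖u - e‖², and ⟨(1 - H)⁻¹
e, e⟩ is ‖e‖² minus the minimum (`inner_resolvent_toLp`). The minimum is the increasing limit of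
minima at finite levels, each depending on finitely many letters. The space L² itself depends on ω,
so everything is tested on a countable total family of indicators e_i. The moments ⟨R^k e_i, e_i⟩ of
the resolvent R then depend measurably on ω, and so do the spectral measures (`measurable_σ`). A
jointly measurable Lebesgue decomposition and the measurability of the atoms give sets whose
spectral projections cut out the ac, sc and pp parts of e_i. The spectrum on a reducing subspace
misses an interval exactly when the spectral projection of the interval kills the components of all
e_i in the subspace. For Neumann-Dirichlet eigenfunctions, the norm of the relevant component is a
supremum over combinations of eigenfunctions of finite level (`lt_norm_sq_P_starProjection_iff`,
`exists_span_ndClasses_iff`).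

The spectral theorem underneath comes from the Hausdorff moment problem for a positive contraction
(`exists_measure`). Since `spectralSubspace` refers to an arbitrary resolution, uniqueness of the
spectral measures is needed too (`SpectralResolution.σ_eq`). -/

noncomputable section

namespace FractalBlowUp

/-! ### Spectral measures of positive contractions -/

section PositiveContractions

variable {L : Type*} [NormedAddCommGroup L] [InnerProductSpace ℝ L]

/-- Self-adjoint operators `R` with `0 ≤ R ≤ 1`. -/
structure IsPosContraction (R : L →L[ℝ] L) : Prop where
  symm : ∀ x y, inner ℝ (R x) y = inner ℝ x (R y)
  nonneg : ∀ x, 0 ≤ inner ℝ (R x) x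
  le_one : ∀ x, inner ℝ (R x) x ≤ inner ℝ x x

namespace IsPosContraction

variable {R : L →L[ℝ] L}

lemma pow_symm (hR : IsPosContraction R) (k : ℕ) (x y : L) :
    inner ℝ ((R ^ k) x) y = inner ℝ x ((R ^ k) y) := by
  induction k generalizing x y with
  | zero => simp
  | succ k ih =>
    have h1 : ((R ^ (k + 1)) x) = (R ^ k) (R x) := by rw [pow_succ]; rfl
    have h2 : ((R ^ (k + 1)) y) = R ((R ^ k) y) := by rw [pow_succ']; rfl
    rw [h1, ih, hR.symm, h2]

open Polynomial in
/-- Positivity of the polynomial functional calculus, by compression to a Krylov space. -/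
lemma inner_aeval_nonneg (hR : IsPosContraction R) (f : L) (p : ℝ[X])
    (hp : ∀ s ∈ Set.Icc (0 : ℝ) 1, 0 ≤ p.eval s) : 0 ≤ inner ℝ (aeval R p f) f := by
  set n := p.natDegree with hn
  let K : Submodule ℝ L := Submodule.span ℝ (Set.range fun j : Fin (n + 1) => (R ^ (j : ℕ)) f)
  have : FiniteDimensional ℝ K := FiniteDimensional.span_of_finite ℝ (Set.finite_range _)
  -- The compression of R to the Krylov space is symmetric and inherits 0 ≤ S ≤ 1. In finite
  -- dimension it is diagonalizable, with eigenvalues in [0, 1].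
  let S : K →ₗ[ℝ] K := (K.orthogonalProjectionOnto ∘L R ∘L K.subtypeL : K →L[ℝ] K)
  have hSin : ∀ x y : K, inner ℝ (S x) y = inner ℝ (R x) (y : L) := fun x y => by
    simp [S]
  have hS : S.IsSymmetric := fun x y => by
    rw [hSin, hR.symm, ← real_inner_comm x (S y), hSin, real_inner_comm]
  have hmem : ∀ j ≤ n, (R ^ j) f ∈ K := fun j hj =>
    Submodule.subset_span ⟨⟨j, by omega⟩, rfl⟩
  have hf : f ∈ K := by simpa using hmem 0 (Nat.zero_le _)
  let f' : K := ⟨f, hf⟩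
  -- Up to the degree of p the powers of R applied to f stay in K, so the projection does nothing
  -- and p(S) f = p(R) f.
  have hpow : ∀ j ≤ n, (((S ^ j) f' : K) : L) = (R ^ j) f := by
    intro j hj
    induction j with
    | zero => simp [f']
    | succ j ih =>
      have h1 : (S ^ (j + 1)) f' = S ((S ^ j) f') := by rw [pow_succ']; rfl
      have h2 : (R ^ (j + 1)) f = R ((R ^ j) f) := by rw [pow_succ']; rfl
      have h3 : S ((S ^ j) f') = K.orthogonalProjectionOnto (R ((S ^ j) f')) := rfl
      rw [h1, h3, ih (by omega), ← h2]
      exact congrArg Subtype.val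
        (K.orthogonalProjectionOnto_mem_subspace_eq_self ⟨_, hmem (j + 1) hj⟩)
  have haeval : ((aeval S p f' : K) : L) = aeval R p f := by
    rw [aeval_eq_sum_range, aeval_eq_sum_range]
    simp only [LinearMap.sum_apply, LinearMap.smul_apply, _root_.sum_apply, _root_.smul_apply,
      Submodule.coe_sum, Submodule.coe_smul]
    refine Finset.sum_congr rfl fun j hj => ?_
    rw [hpow j (by simpa [Nat.lt_succ_iff] using hj)]
  let b := hS.eigenvectorBasis (rfl : Module.finrank ℝ K = _)
  let μ := hS.eigenvalues (rfl : Module.finrank ℝ K = _)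
  have hb : ∀ i, S (b i) = μ i • b i := fun i => by
    exact hS.apply_eigenvectorBasis rfl i
  have hμ : ∀ i, μ i ∈ Set.Icc (0 : ℝ) 1 := by
    intro i
    have h1 : μ i = inner ℝ (R (b i)) (b i : L) := by
      rw [← hSin, hb, inner_smul_left, real_inner_self_eq_norm_sq, b.norm_eq_one]; simp
    have h2 : inner ℝ (b i : L) (b i : L) = (1 : ℝ) := by
      have h3 : inner ℝ (b i : L) (b i : L) = inner ℝ (b i) (b i) := rfl
      rw [h3, real_inner_self_eq_norm_sq, b.norm_eq_one, one_pow]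
    exact ⟨h1 ▸ hR.nonneg _, by rw [h1, ← h2]; exact hR.le_one _⟩
  have hpb : ∀ i, aeval S p (b i) = p.eval (μ i) • b i := fun i =>
    Module.End.aeval_apply_of_hasEigenvector (hS.hasEigenvector_eigenvectorBasis rfl i)
  have key : inner ℝ (aeval R p f) f = ∑ i, p.eval (μ i) * (inner ℝ (b i) f') ^ 2 := by
    have h1 : inner ℝ (aeval R p f) f = inner ℝ (aeval S p f') f' := by
      rw [← haeval]; rfl
    rw [h1]
    have h2 : aeval S p f' = ∑ i, (inner ℝ (b i) f' : ℝ) • p.eval (μ i) • b i := by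
      conv_lhs => rw [← b.sum_repr' f']
      simp [hpb]
    rw [h2, sum_inner]
    refine Finset.sum_congr rfl fun i _ => ?_
    simp only [inner_smul_left, conj_trivial]
    ring
  rw [key]
  exact Finset.sum_nonneg fun i _ => mul_nonneg (hp _ (hμ i)) (sq_nonneg _)

open Polynomial in
/-- Existence of the spectral measure, as the solution of a Hausdorff moment problem. -/
lemma exists_measure (hR : IsPosContraction R) (f : L) :
    ∃ σ : Measure ℝ, IsFiniteMeasure σ ∧ σ (Set.Icc 0 1)ᶜ = 0 ∧
      ∀ k : ℕ, ∫ s, s ^ k ∂σ = inner ℝ ((R ^ k) f) f := by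
  let I := Set.Icc (0 : ℝ) 1
  let φ : ℝ[X] →ₗ[ℝ] C(I, ℝ) := (Polynomial.toContinuousMapOnAlgHom I).toLinearMap
  have hφ : ∀ p s, φ p s = p.eval (s : ℝ) := fun p s => rfl
  -- A polynomial is determined by its values on [0, 1], so p ↦ ⟨p(R) f, f⟩ is well defined on
  -- polynomial functions.
  have hinj : Function.Injective φ := by
    intro p q h
    refine Polynomial.eq_of_infinite_eval_eq p q
      ((Set.Icc_infinite (zero_lt_one' ℝ)).mono fun s hs => ?_)
    simpa [hφ] using DFunLike.congr_fun h (⟨s, hs⟩ : I)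
  let ℓ : ℝ[X] →ₗ[ℝ] ℝ :=
    (innerₗ L f) ∘ₗ (ContinuousLinearMap.apply ℝ L f).toLinearMap ∘ₗ (aeval R).toLinearMap
  have hℓ : ∀ p, ℓ p = inner ℝ (aeval R p f) f := fun p => by
    rw [real_inner_comm]; rfl
  let F : C(I, ℝ) →ₗ.[ℝ] ℝ :=
    { domain := LinearMap.range φ
      toFun := ℓ ∘ₗ (LinearEquiv.ofInjective φ hinj).symm.toLinearMap }
  have hF : ∀ p, F ⟨φ p, LinearMap.mem_range_self φ p⟩ = ℓ p := fun p => by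
    have : (LinearEquiv.ofInjective φ hinj).symm ⟨φ p, LinearMap.mem_range_self φ p⟩ = p := by
      rw [LinearEquiv.symm_apply_eq]; rfl
    exact congrArg ℓ this
  -- The functional is nonnegative on nonnegative polynomial functions. Adding the constant ‖y‖
  -- makes any continuous y nonnegative, which is the cofinality needed for a positive extension.
  obtain ⟨g, hg, hg0⟩ := riesz_extension
    (PointedCone.positive ℝ C(I, ℝ)) F (by
      rintro ⟨x, p, rfl⟩ hx
      rw [hF, hℓ]
      refine hR.inner_aeval_nonneg f p fun s hs => ?_
      exact (PointedCone.mem_positive ℝ _).1 hx ⟨s, hs⟩) (by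
      intro y
      refine ⟨⟨φ (C ‖y‖), LinearMap.mem_range_self _ _⟩, ?_⟩
      rw [PointedCone.mem_positive]
      intro s
      have := (abs_le.1 (y.norm_coe_le_norm s)).1
      change (0 : ℝ) ≤ φ (C ‖y‖) s + y s
      rw [hφ, eval_C]
      linarith)
  -- A positive functional on C([0, 1]) is a measure, by Riesz-Markov-Kakutani; it is then pushed
  -- forward to ℝ.
  let Λ : CompactlySupportedContinuousMap I ℝ →ₚ[ℝ] ℝ :=
    PositiveLinearMap.mk₀
      { toFun := fun u => g u.toContinuousMap
        map_add' := fun u v => map_add g u.toContinuousMap v.toContinuousMap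
        map_smul' := fun c u => map_smul g c u.toContinuousMap }
      (fun u hu => hg0 _ ((PointedCone.mem_positive ℝ _).2 fun s => hu s))
  refine ⟨(RealRMK.rieszMeasure Λ).map Subtype.val, inferInstance, ?_, fun k => ?_⟩
  · rw [Measure.map_apply measurable_subtype_coe measurableSet_Icc.compl]
    simp [I]
  · rw [integral_map measurable_subtype_coe.aemeasurable (by fun_prop)]
    have := RealRMK.integral_rieszMeasure Λ
      ⟨φ (X ^ k), HasCompactSupport.of_compactSpace _⟩
    have h2 : g (φ (X ^ k)) = inner ℝ ((R ^ k) f) f := by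
      rw [hg ⟨φ (X ^ k), LinearMap.mem_range_self _ _⟩, hF, hℓ]; simp
    rw [← h2]
    refine Eq.trans ?_ this
    refine integral_congr_ae (Eventually.of_forall fun s => ?_)
    change (s : ℝ) ^ k = φ (X ^ k) s
    simp [hφ]

end IsPosContraction

/-- Finite measures on `[0, 1]` are determined by their moments. -/
lemma measure_ext_of_moments {μ ν : Measure ℝ} [IsFiniteMeasure μ] [IsFiniteMeasure ν]
    (hμ : μ (Set.Icc 0 1)ᶜ = 0) (hν : ν (Set.Icc 0 1)ᶜ = 0)
    (h : ∀ k : ℕ, ∫ s, s ^ k ∂μ = ∫ s, s ^ k ∂ν) : μ = ν := by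
  have hint : ∀ (ρ : Measure ℝ) [IsFiniteMeasure ρ], ρ (Set.Icc 0 1)ᶜ = 0 → ∀ g : ℝ → ℝ,
      Continuous g → Integrable g ρ := by
    intro ρ _ hρ g hg
    have : ρ.restrict (Set.Icc 0 1) = ρ := Measure.restrict_eq_self_of_ae_mem hρ
    rw [← this]
    exact hg.continuousOn.integrableOn_compact isCompact_Icc
  have hpoly : ∀ p : Polynomial ℝ, ∫ s, p.eval s ∂μ = ∫ s, p.eval s ∂ν := by
    intro p
    simp only [Polynomial.eval_eq_sum_range]
    rw [integral_finsetSum _ fun i _ => hint μ hμ _ (by fun_prop),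
      integral_finsetSum _ fun i _ => hint ν hν _ (by fun_prop)]
    simp [integral_const_mul, h]
  refine ext_of_forall_integral_eq_of_IsFiniteMeasure fun g => ?_
  by_contra hne
  set c := μ.real Set.univ + ν.real Set.univ with hc
  have hc0 : 0 ≤ c := by positivity
  set d := |∫ x, g x ∂μ - ∫ x, g x ∂ν| with hd
  have hd0 : 0 < d := abs_pos.2 (sub_ne_zero.2 hne)
  -- With accuracy d / (c + 1), where c is the total mass of both measures, the two errors add up to
  -- less than the gap d.
  obtain ⟨p, hp⟩ := exists_polynomial_near_of_continuousOn 0 1 g g.continuous.continuousOn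
    (d / (c + 1)) (by positivity)
  have hb : ∀ (ρ : Measure ℝ) [IsFiniteMeasure ρ], ρ (Set.Icc 0 1)ᶜ = 0 →
      |∫ x, g x ∂ρ - ∫ x, p.eval x ∂ρ| ≤ d / (c + 1) * ρ.real Set.univ := by
    intro ρ _ hρ
    rw [← integral_sub (hint ρ hρ _ g.continuous) (hint ρ hρ _ (by fun_prop))]
    rw [← Real.norm_eq_abs]
    refine norm_integral_le_of_norm_le_const ?_
    have : ∀ᵐ x ∂ρ, x ∈ Set.Icc (0 : ℝ) 1 := hρ
    filter_upwards [this] with x hx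
    rw [Real.norm_eq_abs, abs_sub_comm]
    exact (hp x hx).le
  have h1 := hb μ hμ
  have h2 := hb ν hν
  rw [hpoly p] at h1
  have h3 : d ≤ d / (c + 1) * c := by
    rw [hc, mul_add]
    refine le_trans ?_ (add_le_add h1 h2)
    rw [hd, abs_sub_comm (∫ x, g x ∂ν)]
    exact abs_sub_le _ _ _
  have h4 : d / (c + 1) * c < d := by
    rw [div_mul_eq_mul_div, div_lt_iff₀ (by positivity)]
    nlinarith
  linarith

end PositiveContractions

/-! ### Bounded Borel functional calculus -/

section FunctionalCalculus

/-- Measurable functions that are bounded on `[0, 1]`. -/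
structure BddMeas (h : ℝ → ℝ) : Prop where
  measurable : Measurable h
  bdd : ∃ M : ℝ, ∀ s ∈ Set.Icc (0 : ℝ) 1, |h s| ≤ M

namespace BddMeas

lemma of_continuous {h : ℝ → ℝ} (hh : Continuous h) : BddMeas h := by
  refine ⟨hh.measurable, ?_⟩
  obtain ⟨M, hM⟩ := isCompact_Icc.exists_bound_of_continuousOn (s := Set.Icc (0 : ℝ) 1)
    hh.continuousOn
  exact ⟨M, hM⟩

lemma const (c : ℝ) : BddMeas fun _ => c := of_continuous continuous_const

lemma id : BddMeas fun s => s := of_continuous continuous_id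

lemma pow (k : ℕ) : BddMeas fun s => s ^ k := of_continuous (by fun_prop)

variable {h k : ℝ → ℝ}

lemma add (hh : BddMeas h) (hk : BddMeas k) : BddMeas fun s => h s + k s := by
  obtain ⟨M, hM⟩ := hh.bdd
  obtain ⟨M', hM'⟩ := hk.bdd
  exact ⟨hh.measurable.add hk.measurable, M + M', fun s hs =>
    (abs_add_le _ _).trans (add_le_add (hM s hs) (hM' s hs))⟩

lemma mul (hh : BddMeas h) (hk : BddMeas k) : BddMeas fun s => h s * k s := by
  obtain ⟨M, hM⟩ := hh.bdd
  obtain ⟨M', hM'⟩ := hk.bdd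
  refine ⟨hh.measurable.mul hk.measurable, M * M', fun s hs => ?_⟩
  rw [abs_mul]
  exact mul_le_mul (hM s hs) (hM' s hs) (abs_nonneg _) ((abs_nonneg _).trans (hM s hs))

lemma neg (hh : BddMeas h) : BddMeas fun s => -h s := by
  simpa using (const (-1)).mul hh

lemma sub (hh : BddMeas h) (hk : BddMeas k) : BddMeas fun s => h s - k s := by
  simpa [sub_eq_add_neg] using hh.add hk.neg

lemma indicator (hh : BddMeas h) {A : Set ℝ} (hA : MeasurableSet A) : BddMeas (A.indicator h) := by
  obtain ⟨M, hM⟩ := hh.bdd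
  refine ⟨hh.measurable.indicator hA, M, fun s hs => ?_⟩
  by_cases hsA : s ∈ A
  · simpa [hsA] using hM s hs
  · simpa [hsA] using (abs_nonneg _).trans (hM s hs)

lemma indicator_one {A : Set ℝ} (hA : MeasurableSet A) : BddMeas (A.indicator fun _ => 1) :=
  (const 1).indicator hA

lemma integrable (hh : BddMeas h) {μ : Measure ℝ} [IsFiniteMeasure μ]
    (hμ : μ (Set.Icc 0 1)ᶜ = 0) : Integrable h μ := by
  obtain ⟨M, hM⟩ := hh.bdd
  refine Integrable.of_bound hh.measurable.aestronglyMeasurable M ?_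
  have : ∀ᵐ x ∂μ, x ∈ Set.Icc (0 : ℝ) 1 := hμ
  filter_upwards [this] with x hx using hM x hx

end BddMeas

/-- A signed combination of weighted finite measures on `[0, 1]` whose moments vanish is zero. -/
lemma sum_integral_eq_zero_of_moments {ι : Type*} (t : Finset ι) (μ : ι → Measure ℝ)
    [∀ i, IsFiniteMeasure (μ i)] (hμ : ∀ i, μ i (Set.Icc 0 1)ᶜ = 0) (w : ι → ℝ → ℝ)
    (hw : ∀ i, BddMeas (w i)) (h0 : ∀ k : ℕ, ∑ i ∈ t, ∫ s, s ^ k * w i s ∂(μ i) = 0)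
    {h : ℝ → ℝ} (hh : BddMeas h) : ∑ i ∈ t, ∫ s, h s * w i s ∂(μ i) = 0 := by
  -- The weights are split into positive and negative parts. The measures collecting them are
  -- finite, live on [0, 1] and have equal moments, so they coincide.
  let P : (ι → ℝ → ℝ) → Measure ℝ := fun v =>
    ∑ i ∈ t, (μ i).withDensity fun s => ENNReal.ofReal (v i s)
  have hfin : ∀ v : ι → ℝ → ℝ, (∀ i, BddMeas (v i)) → ∀ i,
      IsFiniteMeasure ((μ i).withDensity fun s => ENNReal.ofReal (v i s)) := fun v hv i =>
    isFiniteMeasure_withDensity_ofReal ((hv i).integrable (hμ i)).2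
  have hconc : ∀ (v : ι → ℝ → ℝ) i,
      (μ i).withDensity (fun s => ENNReal.ofReal (v i s)) (Set.Icc 0 1)ᶜ = 0 := fun v i =>
    withDensity_absolutelyContinuous _ _ (hμ i)
  have hPfin : ∀ v : ι → ℝ → ℝ, (∀ i, BddMeas (v i)) → IsFiniteMeasure (P v) := fun v hv => by
    have := hfin v hv
    infer_instance
  have hPconc : ∀ v, P v (Set.Icc 0 1)ᶜ = 0 := fun v => by
    simp [P, Measure.finsetSum_apply, hconc]
  have hPint : ∀ v : ι → ℝ → ℝ, (∀ i, BddMeas (v i)) → ∀ g, BddMeas g →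
      ∫ s, g s ∂(P v) = ∑ i ∈ t, ∫ s, max (v i s) 0 * g s ∂(μ i) := by
    intro v hv g hg
    have := hfin v hv
    rw [integral_finsetSum_measure fun i _ => hg.integrable (hconc v i)]
    refine Finset.sum_congr rfl fun i _ => ?_
    rw [integral_withDensity_eq_integral_toReal_smul
      (hv i).measurable.ennreal_ofReal (Eventually.of_forall fun s => ENNReal.ofReal_lt_top)]
    simp [ENNReal.toReal_ofReal']
  have hwn : ∀ i, BddMeas fun s => - w i s := fun i => (hw i).neg
  have hmax : ∀ v : ι → ℝ → ℝ, (∀ i, BddMeas (v i)) → ∀ i, BddMeas fun s => max (v i s) 0 := by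
    intro v hv i
    obtain ⟨M, hM⟩ := (hv i).bdd
    refine ⟨(hv i).measurable.max measurable_const, M, fun s hs => ?_⟩
    rw [abs_of_nonneg (le_max_right _ _)]
    exact max_le ((le_abs_self _).trans (hM s hs)) ((abs_nonneg _).trans (hM s hs))
  have hdiff : ∀ g, BddMeas g → ∫ s, g s ∂(P w) - ∫ s, g s ∂(P fun i s => - w i s) =
      ∑ i ∈ t, ∫ s, g s * w i s ∂(μ i) := by
    intro g hg
    rw [hPint w hw g hg, hPint _ hwn g hg, ← Finset.sum_sub_distrib]
    refine Finset.sum_congr rfl fun i _ => ?_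
    rw [← integral_sub (((hmax w hw i).mul hg).integrable (hμ i))
      (((hmax _ hwn i).mul hg).integrable (hμ i))]
    refine integral_congr_ae (Eventually.of_forall fun s => ?_)
    simp only
    rw [← sub_mul, mul_comm (g s)]
    congr 1
    rcases le_total (w i s) 0 with h | h
    · rw [max_eq_right h, max_eq_left (by linarith)]; ring
    · rw [max_eq_left h, max_eq_right (by linarith)]; ring
  have := hPfin w hw
  have := hPfin _ hwn
  have heq : P w = P fun i s => - w i s := by
    refine measure_ext_of_moments (hPconc _) (hPconc _) fun k => ?_
    rw [← sub_eq_zero, hdiff _ (BddMeas.pow k), h0]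
  rw [← hdiff h hh, heq, sub_self]

variable {L : Type*} [NormedAddCommGroup L] [InnerProductSpace ℝ L] {R : L →L[ℝ] L}

namespace IsPosContraction

/-- The spectral measure of a vector. -/
def σ (hR : IsPosContraction R) (f : L) : Measure ℝ := (hR.exists_measure f).choose

instance (hR : IsPosContraction R) (f : L) : IsFiniteMeasure (hR.σ f) :=
  (hR.exists_measure f).choose_spec.1

variable (hR : IsPosContraction R)

lemma σ_compl (f : L) : hR.σ f (Set.Icc 0 1)ᶜ = 0 := (hR.exists_measure f).choose_spec.2.1

lemma ae_mem_Icc (f : L) : ∀ᵐ s ∂(hR.σ f), s ∈ Set.Icc (0 : ℝ) 1 := hR.σ_compl f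

lemma integral_pow (f : L) (k : ℕ) : ∫ s, s ^ k ∂(hR.σ f) = inner ℝ ((R ^ k) f) f :=
  (hR.exists_measure f).choose_spec.2.2 k

/-- The sesquilinear form `∫ h d⟪E f, g⟫`, defined by polarization. -/
def pair (h : ℝ → ℝ) (f g : L) : ℝ :=
  (∫ s, h s ∂(hR.σ (f + g)) - ∫ s, h s ∂(hR.σ (f - g))) / 4

lemma pair_pow (k : ℕ) (f g : L) : hR.pair (fun s => s ^ k) f g = inner ℝ ((R ^ k) f) g := by
  have : inner ℝ ((R ^ k) g) f = inner ℝ ((R ^ k) f) g := by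
    rw [hR.pow_symm, real_inner_comm]
  simp only [pair, integral_pow, map_add, map_sub, inner_add_left, inner_add_right,
    inner_sub_left, inner_sub_right, this]
  ring

lemma sum_integral_eq_zero {n : ℕ} (v : Fin n → L) (w : Fin n → ℝ → ℝ) (hw : ∀ i, BddMeas (w i))
    (h0 : ∀ k : ℕ, ∑ i, ∫ s, s ^ k * w i s ∂(hR.σ (v i)) = 0) {h : ℝ → ℝ} (hh : BddMeas h) :
    ∑ i, ∫ s, h s * w i s ∂(hR.σ (v i)) = 0 :=
  sum_integral_eq_zero_of_moments Finset.univ (fun i => hR.σ (v i)) (fun _ => hR.σ_compl _) w hw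
    h0 hh

/-- A linear identity between the quadratic forms of all powers of R passes to every bounded Borel
function of R. Bilinearity, symmetry and the commutation properties of `pair` below all come from an
instance of this. -/
lemma sum_const_mul_integral_eq_zero {n : ℕ} (v : Fin n → L) (c : Fin n → ℝ)
    (h0 : ∀ k : ℕ, ∑ i, c i * inner ℝ ((R ^ k) (v i)) (v i) = 0) {h : ℝ → ℝ} (hh : BddMeas h) :
    ∑ i, c i * ∫ s, h s ∂(hR.σ (v i)) = 0 := by
  have := hR.sum_integral_eq_zero v (fun i _ => c i) (fun _ => BddMeas.const _) (fun k => by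
    rw [← h0 k]
    refine Finset.sum_congr rfl fun i _ => ?_
    rw [integral_mul_const, hR.integral_pow, mul_comm]) hh
  rw [← this]
  refine Finset.sum_congr rfl fun i _ => ?_
  rw [integral_mul_const, mul_comm]

lemma pow_comm_inner (hR : IsPosContraction R) (k : ℕ) (f g : L) :
    inner ℝ ((R ^ k) f) g = inner ℝ ((R ^ k) g) f := by
  rw [hR.pow_symm, real_inner_comm]

variable {h : ℝ → ℝ}

lemma pair_add_left (hh : BddMeas h) (f₁ f₂ g : L) :
    hR.pair h (f₁ + f₂) g = hR.pair h f₁ g + hR.pair h f₂ g := by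
  have := hR.sum_const_mul_integral_eq_zero
    ![f₁ + f₂ + g, f₁ + f₂ - g, f₁ + g, f₁ - g, f₂ + g, f₂ - g] ![1, -1, -1, 1, -1, 1]
    (fun k => by
      simp only [Fin.sum_univ_succ, Matrix.cons_val_zero, Matrix.cons_val_succ, map_add, map_sub,
        inner_add_left, inner_add_right, inner_sub_left, inner_sub_right, Finset.univ_eq_empty,
        Finset.sum_empty, hR.pow_comm_inner k g, hR.pow_comm_inner k f₂ f₁]
      ring) hh
  simp only [Fin.sum_univ_succ, Matrix.cons_val_zero, Matrix.cons_val_succ, Finset.univ_eq_empty,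
    Finset.sum_empty] at this
  simp only [pair]
  linarith

lemma pair_smul_left (hh : BddMeas h) (c : ℝ) (f g : L) :
    hR.pair h (c • f) g = c * hR.pair h f g := by
  have := hR.sum_const_mul_integral_eq_zero
    ![c • f + g, c • f - g, f + g, f - g] ![1, -1, -c, c]
    (fun k => by
      simp only [Fin.sum_univ_succ, Matrix.cons_val_zero, Matrix.cons_val_succ, map_add, map_sub,
        inner_add_left, inner_add_right, inner_sub_left, inner_sub_right, Finset.univ_eq_empty,
        Finset.sum_empty, hR.pow_comm_inner k g, map_smul, inner_smul_left, inner_smul_right,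
        conj_trivial]
      ring) hh
  simp only [Fin.sum_univ_succ, Matrix.cons_val_zero, Matrix.cons_val_succ, Finset.univ_eq_empty,
    Finset.sum_empty] at this
  simp only [pair]
  linarith

lemma pair_comm (hh : BddMeas h) (f g : L) : hR.pair h f g = hR.pair h g f := by
  have := hR.sum_const_mul_integral_eq_zero ![f - g, g - f] ![1, -1]
    (fun k => by
      simp only [Fin.sum_univ_succ, Matrix.cons_val_zero, Matrix.cons_val_succ, map_sub,
        inner_sub_left, inner_sub_right, Finset.univ_eq_empty, Finset.sum_empty]
      ring) hh
  simp only [Fin.sum_univ_succ, Matrix.cons_val_zero, Matrix.cons_val_succ, Finset.univ_eq_empty,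
    Finset.sum_empty] at this
  simp only [pair, add_comm g f]
  linarith

lemma pair_self (hh : BddMeas h) (f : L) : hR.pair h f f = ∫ s, h s ∂(hR.σ f) := by
  have := hR.sum_const_mul_integral_eq_zero ![f + f, f - f, f] ![1, -1, -4]
    (fun k => by
      simp only [Fin.sum_univ_succ, Matrix.cons_val_zero, Matrix.cons_val_succ, map_sub, map_add,
        inner_add_left, inner_add_right,
        inner_sub_left, inner_sub_right, Finset.univ_eq_empty, Finset.sum_empty]
      ring) hh
  simp only [Fin.sum_univ_succ, Matrix.cons_val_zero, Matrix.cons_val_succ, Finset.univ_eq_empty,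
    Finset.sum_empty] at this
  simp only [pair]
  linarith

lemma pair_congr {h k : ℝ → ℝ} (hk : ∀ s ∈ Set.Icc (0 : ℝ) 1, h s = k s) (f g : L) :
    hR.pair h f g = hR.pair k f g := by
  have : ∀ u, ∫ s, h s ∂(hR.σ u) = ∫ s, k s ∂(hR.σ u) := fun u =>
    integral_congr_ae ((hR.ae_mem_Icc u).mono fun s hs => hk s hs)
  simp only [pair, this]

/-- The moments determine d⟨E u, g⟩ as k d⟨E f, g⟩, and bounded Borel functions follow. This is the
source of multiplicativity of the functional calculus. -/
lemma pair_of_moments {k : ℝ → ℝ} (hk : BddMeas k) (hh : BddMeas h) (u f g : L)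
    (h0 : ∀ n : ℕ, inner ℝ ((R ^ n) u) g = hR.pair (fun s => s ^ n * k s) f g) :
    hR.pair h u g = hR.pair (fun s => h s * k s) f g := by
  have := hR.sum_integral_eq_zero ![u + g, u - g, f + g, f - g]
    ![fun _ => 1, fun _ => -1, fun s => - k s, k]
    (by
      simp only [Fin.forall_fin_succ, Matrix.cons_val_zero, Matrix.cons_val_succ]
      exact ⟨BddMeas.const _, BddMeas.const _, hk.neg, hk, fun i => i.elim0⟩)
    (fun n => by
      have h1 := h0 n
      rw [← hR.pair_pow] at h1
      simp only [pair] at h1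
      simp only [Fin.sum_univ_succ, Matrix.cons_val_zero, Matrix.cons_val_succ, mul_neg, mul_one,
        integral_neg, Finset.univ_eq_empty, Finset.sum_empty]
      linarith) hh
  simp only [Fin.sum_univ_succ, Matrix.cons_val_zero, Matrix.cons_val_succ, mul_neg, mul_one,
    integral_neg, Finset.univ_eq_empty, Finset.sum_empty] at this
  simp only [pair]
  linarith

lemma σ_real_univ (f : L) : (hR.σ f).real Set.univ = ‖f‖ ^ 2 := by
  have := hR.integral_pow f 0
  simpa using this

lemma abs_integral_le {M : ℝ} (hM : ∀ s ∈ Set.Icc (0 : ℝ) 1, |h s| ≤ M) (f : L) :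
    |∫ s, h s ∂(hR.σ f)| ≤ M * ‖f‖ ^ 2 := by
  rw [← hR.σ_real_univ, ← Real.norm_eq_abs]
  exact norm_integral_le_of_norm_le_const ((hR.ae_mem_Icc f).mono fun s hs => hM s hs)

/-- Polarization and the parallelogram law give M (‖f‖² + ‖g‖²) / 2; normalizing f and g turns this
into the product bound. -/
lemma abs_pair_le (hh : BddMeas h) {M : ℝ} (hM : ∀ s ∈ Set.Icc (0 : ℝ) 1, |h s| ≤ M) (f g : L) :
    |hR.pair h f g| ≤ M * ‖f‖ * ‖g‖ := by
  have hsmul_right : ∀ (c : ℝ) f g, hR.pair h f (c • g) = c * hR.pair h f g := fun c f g => by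
    rw [hR.pair_comm hh, hR.pair_smul_left hh, hR.pair_comm hh]
  have base : ∀ f g : L, |hR.pair h f g| ≤ M * (‖f‖ ^ 2 + ‖g‖ ^ 2) / 2 := by
    intro f g
    have h1 := abs_le.1 (hR.abs_integral_le hM (f + g))
    have h2 := abs_le.1 (hR.abs_integral_le hM (f - g))
    have h3 := parallelogram_law_with_norm ℝ f g
    have h4 : M * ‖f + g‖ ^ 2 + M * ‖f - g‖ ^ 2 = M * (2 * (‖f‖ ^ 2 + ‖g‖ ^ 2)) := by
      rw [← h3]; ring
    simp only [pair]
    rw [abs_le]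
    constructor <;> linarith
  rcases eq_or_ne f 0 with rfl | hf
  · have := hR.pair_smul_left hh 0 0 g
    simp only [zero_smul, zero_mul] at this
    simp [this]
  rcases eq_or_ne g 0 with rfl | hg
  · have := hsmul_right 0 f 0
    simp only [zero_smul, zero_mul] at this
    simp [this]
  have hf' := norm_pos_iff.2 hf
  have hg' := norm_pos_iff.2 hg
  have := base (‖f‖⁻¹ • f) (‖g‖⁻¹ • g)
  rw [hR.pair_smul_left hh, hsmul_right, norm_smul, norm_smul, norm_inv, norm_norm, norm_inv,
    norm_norm, inv_mul_cancel₀ hf'.ne', inv_mul_cancel₀ hg'.ne', abs_mul, abs_mul,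
    abs_of_pos (inv_pos.2 hf'), abs_of_pos (inv_pos.2 hg')] at this
  have h4 : |hR.pair h f g| = ‖f‖ * ‖g‖ * (‖f‖⁻¹ * (‖g‖⁻¹ * |hR.pair h f g|)) := by
    field_simp
  rw [h4]
  have h5 : 0 < ‖f‖ * ‖g‖ := mul_pos hf' hg'
  nlinarith [mul_le_mul_of_nonneg_left this h5.le]

lemma pair_add {k : ℝ → ℝ} (hh : BddMeas h) (hk : BddMeas k) (f g : L) :
    hR.pair (fun s => h s + k s) f g = hR.pair h f g + hR.pair k f g := by
  simp only [pair, integral_add (hh.integrable (hR.σ_compl _)) (hk.integrable (hR.σ_compl _))]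
  ring

lemma pair_sub {k : ℝ → ℝ} (hh : BddMeas h) (hk : BddMeas k) (f g : L) :
    hR.pair (fun s => h s - k s) f g = hR.pair h f g - hR.pair k f g := by
  simp only [pair, integral_sub (hh.integrable (hR.σ_compl _)) (hk.integrable (hR.σ_compl _))]
  ring

lemma pair_apply_pow (n : ℕ) (hh : BddMeas h) (f g : L) :
    hR.pair h ((R ^ n) f) g = hR.pair (fun s => h s * s ^ n) f g := by
  refine hR.pair_of_moments (BddMeas.pow n) hh _ f g fun m => ?_
  have : (fun s : ℝ => s ^ m * s ^ n) = fun s => s ^ (m + n) := by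
    ext s; rw [pow_add]
  rw [this, hR.pair_pow, pow_add]
  rfl

variable [CompleteSpace L]

lemma exists_operator (hh : BddMeas h) :
    ∃ T : L →L[ℝ] L, ∀ f g, inner ℝ (T f) g = hR.pair h f g := by
  obtain ⟨M, hM⟩ := hh.bdd
  have hadd : ∀ f g₁ g₂, hR.pair h f (g₁ + g₂) = hR.pair h f g₁ + hR.pair h f g₂ :=
    fun f g₁ g₂ => by
      rw [hR.pair_comm hh, hR.pair_add_left hh, hR.pair_comm hh g₁, hR.pair_comm hh g₂]
  have hsmul : ∀ (c : ℝ) f g, hR.pair h f (c • g) = c • hR.pair h f g := fun c f g => by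
    rw [hR.pair_comm hh, hR.pair_smul_left hh, hR.pair_comm hh, smul_eq_mul]
  let B : L →L⋆[ℝ] L →L[ℝ] ℝ := LinearMap.mkContinuous₂
    (LinearMap.mk₂'ₛₗ (starRingEnd ℝ) (RingHom.id ℝ) (hR.pair h)
      (fun f₁ f₂ g => hR.pair_add_left hh f₁ f₂ g)
      (fun c f g => hR.pair_smul_left hh c f g) hadd hsmul) M
      (fun f g => hR.abs_pair_le hh hM f g)
  refine ⟨InnerProductSpace.continuousLinearMapOfBilin B, fun f g => ?_⟩
  rw [InnerProductSpace.continuousLinearMapOfBilin_apply]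
  rfl

open Classical in
/-- The bounded Borel functional calculus of `R`. -/
def T (h : ℝ → ℝ) : L →L[ℝ] L :=
  if hh : BddMeas h then (hR.exists_operator hh).choose else 0

lemma inner_T (hh : BddMeas h) (f g : L) : inner ℝ (hR.T h f) g = hR.pair h f g := by
  rw [T, dif_pos hh]
  exact (hR.exists_operator hh).choose_spec f g

lemma inner_T_self (hh : BddMeas h) (f : L) : inner ℝ (hR.T h f) f = ∫ s, h s ∂(hR.σ f) := by
  rw [hR.inner_T hh, hR.pair_self hh]

lemma T_symm (hh : BddMeas h) (f g : L) : inner ℝ (hR.T h f) g = inner ℝ f (hR.T h g) := by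
  rw [hR.inner_T hh, hR.pair_comm hh, ← hR.inner_T hh, real_inner_comm]

lemma T_congr {k : ℝ → ℝ} (hh : BddMeas h) (hk : BddMeas k)
    (e : ∀ s ∈ Set.Icc (0 : ℝ) 1, h s = k s) : hR.T h = hR.T k := by
  ext f
  refine ext_inner_right ℝ fun g => ?_
  rw [hR.inner_T hh, hR.inner_T hk, hR.pair_congr e]

lemma T_pow (k : ℕ) : hR.T (fun s => s ^ k) = R ^ k := by
  ext f
  refine ext_inner_right ℝ fun g => ?_
  rw [hR.inner_T (BddMeas.pow k), hR.pair_pow]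

lemma T_id : hR.T (fun s => s) = R := by simpa using hR.T_pow 1

lemma T_one : hR.T (fun _ => 1) = 1 := by simpa using hR.T_pow 0

lemma T_add {k : ℝ → ℝ} (hh : BddMeas h) (hk : BddMeas k) :
    hR.T (fun s => h s + k s) = hR.T h + hR.T k := by
  ext f
  refine ext_inner_right ℝ fun g => ?_
  rw [hR.inner_T (hh.add hk), hR.pair_add hh hk, _root_.add_apply, inner_add_left,
    hR.inner_T hh, hR.inner_T hk]

lemma T_sub {k : ℝ → ℝ} (hh : BddMeas h) (hk : BddMeas k) :
    hR.T (fun s => h s - k s) = hR.T h - hR.T k := by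
  ext f
  refine ext_inner_right ℝ fun g => ?_
  rw [hR.inner_T (hh.sub hk), hR.pair_sub hh hk, _root_.sub_apply, inner_sub_left,
    hR.inner_T hh, hR.inner_T hk]

lemma T_smul (c : ℝ) (hh : BddMeas h) : hR.T (fun s => c * h s) = c • hR.T h := by
  ext f
  refine ext_inner_right ℝ fun g => ?_
  rw [hR.inner_T ((BddMeas.const c).mul hh), _root_.smul_apply, inner_smul_left,
    hR.inner_T hh]
  simp only [pair, integral_const_mul, conj_trivial]
  ring

/-- The powers of R are handled first, by `pair_apply_pow`; then `pair_of_moments` replaces one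
factor after the other by a Borel function. -/
lemma T_mul {k : ℝ → ℝ} (hh : BddMeas h) (hk : BddMeas k) :
    hR.T (fun s => h s * k s) = hR.T h * hR.T k := by
  ext f
  refine ext_inner_right ℝ fun g => ?_
  rw [hR.inner_T (hh.mul hk), mul_apply_eq_comp, hR.inner_T hh]
  symm
  refine hR.pair_of_moments hk hh _ f g fun n => ?_
  rw [hR.pow_symm, hR.inner_T hk, hR.pair_comm hk, hR.pair_apply_pow n hk, hR.pair_comm
    (hk.mul (BddMeas.pow n))]
  simp only [mul_comm]

lemma T_mul_apply {k : ℝ → ℝ} (hh : BddMeas h) (hk : BddMeas k) (f : L) :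
    hR.T h (hR.T k f) = hR.T (fun s => h s * k s) f := by
  rw [hR.T_mul hh hk]; rfl

lemma norm_T_sq (hh : BddMeas h) (f : L) : ‖hR.T h f‖ ^ 2 = ∫ s, h s ^ 2 ∂(hR.σ f) := by
  rw [← real_inner_self_eq_norm_sq, hR.T_symm hh, hR.T_mul_apply hh hh, real_inner_comm,
    hR.inner_T_self (hh.mul hh)]
  simp only [sq]

/-- Operators commuting with `R` commute with the functional calculus. -/
lemma T_comm (hh : BddMeas h) {B : L →L[ℝ] L} (hB : ∀ f, B (R f) = R (B f)) (f : L) :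
    B (hR.T h f) = hR.T h (B f) := by
  have hBpow : ∀ (n : ℕ) f, B ((R ^ n) f) = (R ^ n) (B f) := by
    intro n
    induction n with
    | zero => intro f; simp
    | succ n ih =>
      intro f
      have h1 : (R ^ (n + 1)) f = (R ^ n) (R f) := by rw [pow_succ]; rfl
      have h2 : (R ^ (n + 1)) (B f) = (R ^ n) (R (B f)) := by rw [pow_succ]; rfl
      rw [h1, ih, hB, h2]
  refine ext_inner_right ℝ fun g => ?_
  have hadj : ∀ u, inner ℝ (B u) g = inner ℝ u (ContinuousLinearMap.adjoint B g) := fun u => by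
    rw [ContinuousLinearMap.adjoint_inner_right]
  rw [hadj, hR.inner_T hh, hR.inner_T hh]
  -- The identity between ⟨R^k f, B* g⟩ and ⟨R^k B f, g⟩ holds for every power and therefore for h.
  have := hR.sum_const_mul_integral_eq_zero
    ![f + ContinuousLinearMap.adjoint B g, f - ContinuousLinearMap.adjoint B g, B f + g, B f - g]
    ![1, -1, -1, 1]
    (fun k => by
      have e : inner ℝ ((R ^ k) (B f)) g =
          inner ℝ ((R ^ k) f) (ContinuousLinearMap.adjoint B g) := by
        rw [← hBpow, hadj]
      simp only [Fin.sum_univ_succ, Matrix.cons_val_zero, Matrix.cons_val_succ, map_add, map_sub,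
        inner_add_left, inner_add_right, inner_sub_left, inner_sub_right, Finset.univ_eq_empty,
        Finset.sum_empty, hR.pow_comm_inner k g, hR.pow_comm_inner k _ f, e]
      ring) hh
  simp only [Fin.sum_univ_succ, Matrix.cons_val_zero, Matrix.cons_val_succ, Finset.univ_eq_empty,
    Finset.sum_empty] at this
  simp only [pair]
  linarith

/-- By symmetry and multiplicativity, ⟨h(R) k(R) f, k(R) f⟩ = ⟨(h k²)(R) f, f⟩: applying k(R)
multiplies the spectral measure by k². -/
lemma integral_σ_T {k : ℝ → ℝ} (hh : BddMeas h) (hk : BddMeas k) (f : L) :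
    ∫ s, h s ∂(hR.σ (hR.T k f)) = ∫ s, h s * k s ^ 2 ∂(hR.σ f) := by
  rw [← hR.inner_T_self hh, ← hR.T_symm hk, hR.T_mul_apply hh hk, hR.T_mul_apply hk (hh.mul hk),
    hR.inner_T_self (hk.mul (hh.mul hk))]
  refine integral_congr_ae (Eventually.of_forall fun s => ?_)
  simp only
  ring

lemma σ_T_apply {k : ℝ → ℝ} (hk : BddMeas k) (f : L) {A : Set ℝ} (hA : MeasurableSet A) :
    (hR.σ (hR.T k f)).real A = ∫ s in A, k s ^ 2 ∂(hR.σ f) := by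
  have := hR.integral_σ_T (BddMeas.indicator_one hA) hk f
  rw [← Pi.one_def, integral_indicator_one hA] at this
  rw [this, ← integral_indicator hA]
  refine integral_congr_ae (Eventually.of_forall fun s => ?_)
  by_cases hs : s ∈ A <;> simp [hs]

lemma σ_T_absolutelyContinuous {k : ℝ → ℝ} (hk : BddMeas k) (f : L) :
    hR.σ (hR.T k f) ≪ hR.σ f := by
  refine Measure.AbsolutelyContinuous.mk fun A hA h0 => ?_
  have := hR.σ_T_apply hk f hA
  rw [Measure.restrict_eq_zero.2 h0, integral_zero_measure] at this
  exact (measureReal_eq_zero_iff).1 this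

/-- The spectral projections of `R`. -/
def E (A : Set ℝ) : L →L[ℝ] L := hR.T (A.indicator fun _ => 1)

lemma σ_E {A : Set ℝ} (hA : MeasurableSet A) (f : L) :
    hR.σ (hR.E A f) = (hR.σ f).restrict A := by
  ext B hB
  have := hR.σ_T_apply (BddMeas.indicator_one hA) f hB
  rw [← ENNReal.toReal_eq_toReal_iff' (measure_ne_top _ _) (measure_ne_top _ _)]
  change (hR.σ (hR.T _ f)).real B = _
  rw [this, Measure.restrict_apply hB]
  have e : ∀ s, (A.indicator (fun _ => (1 : ℝ)) s) ^ 2 = A.indicator (fun _ => 1) s := fun s => by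
    by_cases hs : s ∈ A <;> simp [hs]
  simp only [e]
  rw [← Pi.one_def, integral_indicator_one hA, Measure.real, Measure.restrict_apply hA,
    Set.inter_comm]

lemma norm_E_sq {A : Set ℝ} (hA : MeasurableSet A) (f : L) :
    ‖hR.E A f‖ ^ 2 = (hR.σ f).real A := by
  rw [← hR.σ_real_univ, hR.σ_E hA, Measure.real, Measure.restrict_apply_univ]
  rfl

lemma E_symm {A : Set ℝ} (hA : MeasurableSet A) (f g : L) :
    inner ℝ (hR.E A f) g = inner ℝ f (hR.E A g) := hR.T_symm (BddMeas.indicator_one hA) f g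

lemma E_inter {A B : Set ℝ} (hA : MeasurableSet A) (hB : MeasurableSet B) :
    hR.E (A ∩ B) = hR.E A * hR.E B := by
  rw [E, E, E, ← hR.T_mul (BddMeas.indicator_one hA) (BddMeas.indicator_one hB)]
  congr 1
  ext s
  by_cases h1 : s ∈ A <;> by_cases h2 : s ∈ B <;> simp [h1, h2]

lemma E_union {A B : Set ℝ} (hA : MeasurableSet A) (hB : MeasurableSet B) (hd : Disjoint A B) :
    hR.E (A ∪ B) = hR.E A + hR.E B := by
  rw [E, E, E, ← hR.T_add (BddMeas.indicator_one hA) (BddMeas.indicator_one hB)]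
  congr 1
  ext s
  by_cases h1 : s ∈ A
  · simp [h1, Set.disjoint_left.1 hd h1]
  · by_cases h2 : s ∈ B <;> simp [h1, h2]

lemma E_univ : hR.E Set.univ = 1 := by
  rw [E, Set.indicator_univ, hR.T_one]

lemma E_empty : hR.E ∅ = 0 := by
  have := hR.E_union MeasurableSet.empty MeasurableSet.empty (disjoint_bot_left (a := (∅ : Set ℝ)))
  simpa using this

lemma E_compl_add {A : Set ℝ} (hA : MeasurableSet A) : hR.E A + hR.E Aᶜ = 1 := by
  rw [← hR.E_union hA hA.compl disjoint_compl_right, Set.union_compl_self, hR.E_univ]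

lemma σ_T_eq {k : ℝ → ℝ} (hk : BddMeas k) (f : L) :
    hR.σ (hR.T k f) = (hR.σ f).withDensity fun s => ENNReal.ofReal (k s ^ 2) := by
  have hk2 : BddMeas fun s => k s ^ 2 := by simpa only [sq] using hk.mul hk
  ext A hA
  rw [withDensity_apply _ hA, ← ofReal_integral_eq_lintegral_ofReal
    (hk2.integrable (hR.σ_compl f)).integrableOn (Eventually.of_forall fun s => sq_nonneg _),
    ← hR.σ_T_apply hk f hA, ofReal_measureReal]

/-- The map h ↦ h(R) f is isometric for the L² norm of the spectral measure of f. -/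
lemma tendsto_T {h : ℕ → ℝ → ℝ} {k : ℝ → ℝ} (hh : ∀ n, BddMeas (h n)) (hk : BddMeas k) (f : L)
    (hlim : Tendsto (fun n => ∫ s, (h n s - k s) ^ 2 ∂(hR.σ f)) atTop (𝓝 0)) :
    Tendsto (fun n => hR.T (h n) f) atTop (𝓝 (hR.T k f)) := by
  rw [tendsto_iff_norm_sub_tendsto_zero]
  have : (fun n => ‖hR.T (h n) f - hR.T k f‖) =
      fun n => Real.sqrt (∫ s, (h n s - k s) ^ 2 ∂(hR.σ f)) := by
    ext n
    rw [← hR.norm_T_sq ((hh n).sub hk), hR.T_sub (hh n) hk, Real.sqrt_sq (norm_nonneg _)]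
    rfl
  rw [this]
  simpa using hlim.sqrt

end IsPosContraction

end FunctionalCalculus

/-! ### The spectral measures of an operator, by means of its resolvent -/

section Resolvents

variable {L : Type*} [NormedAddCommGroup L] [InnerProductSpace ℝ L] [CompleteSpace L]

/-- `R` is the resolvent `(1 - H)⁻¹` (extended by `0` to `Vᗮ`) of the operator `H` with graph `Γ`
in the closed subspace `V`. -/
structure IsResolvent (Γ : Set (L × L)) (V : Submodule ℝ L) (R : L →L[ℝ] L) : Prop where
  contraction : IsPosContraction R
  apply_eq_zero_iff : ∀ f, R f = 0 ↔ f ∈ Vᗮ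
  isClosed : IsClosed (V : Set L)
  mem_graph : ∀ f h, (f, h) ∈ Γ ↔ h ∈ V ∧ f = R (f - h)

/-- The spectral parameter of `H = 1 - R⁻¹` as a function of that of `R`. -/
def specMap (s : ℝ) : ℝ := 1 - s⁻¹

lemma measurable_specMap : Measurable specMap := measurable_const.sub measurable_inv

/-- Preimage of a set under `specMap`, away from `0`. -/
def specLift (A : Set ℝ) : Set ℝ := Set.Ioi 0 ∩ specMap ⁻¹' A

lemma measurableSet_specLift {A : Set ℝ} (hA : MeasurableSet A) : MeasurableSet (specLift A) :=
  measurableSet_Ioi.inter (measurable_specMap hA)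

namespace IsResolvent

variable {Γ : Set (L × L)} {V : Submodule ℝ L} {R : L →L[ℝ] L} (hH : IsResolvent Γ V R)

include hH

lemma orthogonal_orthogonal : Vᗮᗮ = V := by
  rw [Submodule.orthogonal_orthogonal_eq_closure, hH.isClosed.submodule_topologicalClosure_eq]

lemma apply_mem (f : L) : R f ∈ V := by
  rw [← hH.orthogonal_orthogonal, Submodule.mem_orthogonal']
  intro g hg
  rw [hH.contraction.symm, (hH.apply_eq_zero_iff g).2 hg, inner_zero_right]

lemma mem_of_mem_graph {f h : L} (hfh : (f, h) ∈ Γ) : f ∈ V :=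
  ((hH.mem_graph f h).1 hfh).2 ▸ hH.apply_mem _

lemma mem_graph_apply {w : L} (hw : w ∈ V) : (R w, R w - w) ∈ Γ := by
  rw [hH.mem_graph]
  exact ⟨V.sub_mem (hH.apply_mem w) hw, by simp⟩

omit [CompleteSpace L] in
lemma eq_zero_of_apply {w : L} (hw : w ∈ V) (h : R w = 0) : w = 0 := by
  have := (hH.apply_eq_zero_iff w).1 h
  rw [Submodule.mem_orthogonal'] at this
  exact inner_self_eq_zero.1 (this w hw)

/-- R annihilates the range of the projection on {0}, so this range lies in the orthogonal
complement of V; hence the spectral measure of a vector of V does not charge 0. -/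
lemma E_pos_eq_of_mem {f : L} (hf : f ∈ V) : hH.contraction.E (Set.Ioi 0) f = f := by
  have h0 : R (hH.contraction.E {0} f) = 0 := by
    have h1 := hH.contraction.T_mul_apply BddMeas.id
      (BddMeas.indicator_one (measurableSet_singleton (0 : ℝ))) f
    rw [hH.contraction.T_id] at h1
    have h2 : (fun s : ℝ => s * ({0} : Set ℝ).indicator (fun _ => 1) s) = fun s => 0 * 1 := by
      ext s
      by_cases hs : s = 0 <;> simp [hs]
    rw [h2, hH.contraction.T_smul 0 (BddMeas.const 1), zero_smul] at h1
    exact h1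
  have h1 : hH.contraction.E {0} f = 0 := by
    have := (hH.apply_eq_zero_iff _).1 h0
    rw [Submodule.mem_orthogonal] at this
    have h2 := this f hf
    have h3 := hH.contraction.E_inter (measurableSet_singleton (0 : ℝ))
      (measurableSet_singleton (0 : ℝ))
    rw [Set.inter_self] at h3
    rw [h3, ← inner_self_eq_zero (𝕜 := ℝ), ← h3]
    nth_rewrite 1 [h3]
    rw [mul_apply_eq_comp, hH.contraction.E_symm (measurableSet_singleton _),
      ← mul_apply_eq_comp, ← h3, hH.contraction.E_symm (measurableSet_singleton _),
      ← mul_apply_eq_comp, ← h3]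
    exact h2
  have h2 : hH.contraction.E (Set.Ioi 0 ∪ {0}) f = f := by
    rw [IsPosContraction.E, hH.contraction.T_congr (k := fun _ => 1) (BddMeas.indicator_one
      (measurableSet_Ioi.union (measurableSet_singleton _))) (BddMeas.const 1),
      hH.contraction.T_one]
    · rfl
    · intro s hs
      rcases hs.1.eq_or_lt with h | h
      · simp [← h]
      · simp [h.le]
  rw [hH.contraction.E_union measurableSet_Ioi (measurableSet_singleton _) (by simp)] at h2
  simpa [h1] using h2

/-- For g orthogonal to V the first moment ⟨R g, g⟩ vanishes, so its spectral measure is carried by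
{0} and g is orthogonal to f. -/
lemma mem_of_E_pos_eq {f : L} (hf : hH.contraction.E (Set.Ioi 0) f = f) : f ∈ V := by
  rw [← hH.orthogonal_orthogonal, Submodule.mem_orthogonal']
  intro g hg
  have hg0 : hH.contraction.E (Set.Ioi 0) g = 0 := by
    have h1 := hH.contraction.integral_pow g 1
    rw [pow_one, (hH.apply_eq_zero_iff g).2 hg, inner_zero_left] at h1
    simp only [pow_one] at h1
    have h2 := (integral_eq_zero_iff_of_nonneg_ae
      ((hH.contraction.ae_mem_Icc g).mono fun s hs => hs.1)
      (BddMeas.id.integrable (hH.contraction.σ_compl g))).1 h1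
    have h3 : hH.contraction.σ g (Set.Ioi 0) = 0 := by
      refine measure_mono_null (fun s hs => ?_) (ae_iff.1 h2)
      exact (Set.mem_Ioi.1 hs).ne'
    rw [← norm_eq_zero, ← sq_eq_zero_iff, hH.contraction.norm_E_sq measurableSet_Ioi, Measure.real,
      h3]
    rfl
  rw [← hf, hH.contraction.E_symm measurableSet_Ioi, hg0, inner_zero_right]

/-- The spectral projections of `H`. -/
def P (A : Set ℝ) : L →L[ℝ] L := hH.contraction.E (specLift A)

/-- The spectral measures of `H`. -/
def σ (f : L) : Measure ℝ := ((hH.contraction.σ f).restrict (Set.Ioi 0)).map specMap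

omit [CompleteSpace L] in
lemma σ_apply {A : Set ℝ} (hA : MeasurableSet A) (f : L) :
    hH.σ f A = hH.contraction.σ f (specLift A) := by
  rw [σ, Measure.map_apply measurable_specMap hA, Measure.restrict_apply (measurable_specMap hA),
    Set.inter_comm]
  rfl

lemma norm_P_sq {A : Set ℝ} (hA : MeasurableSet A) (f : L) : ‖hH.P A f‖ ^ 2 = (hH.σ f).real A := by
  rw [P, hH.contraction.norm_E_sq (measurableSet_specLift hA), Measure.real, Measure.real,
    hH.σ_apply hA]

instance (f : L) : IsFiniteMeasure (hH.σ f) := by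
  rw [σ]; infer_instance

lemma P_symm {A : Set ℝ} (hA : MeasurableSet A) (f g : L) :
    inner ℝ (hH.P A f) g = inner ℝ f (hH.P A g) :=
  hH.contraction.E_symm (measurableSet_specLift hA) f g

lemma P_inter {A B : Set ℝ} (hA : MeasurableSet A) (hB : MeasurableSet B) :
    hH.P (A ∩ B) = hH.P A * hH.P B := by
  rw [P, P, P, ← hH.contraction.E_inter (measurableSet_specLift hA) (measurableSet_specLift hB)]
  congr 1
  ext s
  simp only [specLift, Set.mem_inter_iff, Set.mem_preimage]
  tauto

lemma P_inter_apply {A B : Set ℝ} (hA : MeasurableSet A) (hB : MeasurableSet B) (f : L) :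
    hH.P A (hH.P B f) = hH.P (A ∩ B) f := by
  rw [hH.P_inter hA hB]; rfl

lemma P_union {A B : Set ℝ} (hA : MeasurableSet A) (hB : MeasurableSet B) (hd : Disjoint A B) :
    hH.P (A ∪ B) = hH.P A + hH.P B := by
  rw [P, P, P, ← hH.contraction.E_union (measurableSet_specLift hA) (measurableSet_specLift hB)]
  · congr 1
    ext s
    simp only [specLift, Set.mem_inter_iff, Set.mem_preimage, Set.mem_union]
    tauto
  · exact Set.disjoint_left.2 fun s h1 h2 => Set.disjoint_left.1 hd h1.2 h2.2

lemma P_univ : hH.P Set.univ = hH.contraction.E (Set.Ioi 0) := by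
  simp [P, specLift]

lemma P_univ_of_mem {f : L} (hf : f ∈ V) : hH.P Set.univ f = f := by
  rw [P_univ, hH.E_pos_eq_of_mem hf]

lemma P_mem (A : Set ℝ) (hA : MeasurableSet A) (f : L) : hH.P A f ∈ V := by
  refine hH.mem_of_E_pos_eq ?_
  rw [← hH.P_univ, hH.P_inter_apply MeasurableSet.univ hA, Set.univ_inter]

lemma P_empty : hH.P ∅ = 0 := by
  simp [P, specLift, hH.contraction.E_empty]

lemma isStarProjection_P {A : Set ℝ} (hA : MeasurableSet A) : IsStarProjection (hH.P A) := by
  refine ⟨?_, ?_⟩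
  · rw [IsIdempotentElem, ← hH.P_inter hA hA, Set.inter_self]
  · rw [ContinuousLinearMap.isSelfAdjoint_iff_isSymmetric]
    exact fun f g => hH.P_symm hA f g

/-- The squared norm of the remainder is the spectral mass not yet covered, so this is countable
additivity of a finite measure. -/
lemma hasSum_P {A : ℕ → Set ℝ} (hA : ∀ n, MeasurableSet (A n))
    (hd : Pairwise fun m n => Disjoint (A m) (A n)) (f : L) :
    HasSum (fun n => hH.P (A n) f) (hH.P (⋃ n, A n) f) := by
  have hfin : ∀ t : Finset ℕ, ∑ n ∈ t, hH.P (A n) f = hH.P (⋃ n ∈ t, A n) f := by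
    intro t
    induction t using Finset.induction_on with
    | empty => simp [hH.P_empty]
    | insert a t ha ih =>
      rw [Finset.sum_insert ha, ih, Finset.set_biUnion_insert, hH.P_union (hA a)
        (t.measurableSet_biUnion fun n _ => hA n)]
      · rfl
      · rw [Set.disjoint_iUnion₂_right]
        intro n hn
        exact hd (fun h => ha (h ▸ hn))
  have hU : MeasurableSet (⋃ n, A n) := MeasurableSet.iUnion hA
  have hs : HasSum (fun n => (hH.σ f).real (A n)) ((hH.σ f).real (⋃ n, A n)) := by
    have h1 := measure_iUnion (μ := hH.σ f) hd hA
    have h2 : ∑' n, hH.σ f (A n) ≠ ⊤ := h1 ▸ measure_ne_top _ _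
    have h3 := ENNReal.hasSum_toReal h2
    rwa [← ENNReal.tsum_toReal_eq fun n => measure_ne_top _ _, ← h1] at h3
  rw [HasSum, tendsto_iff_norm_sub_tendsto_zero]
  have h3 : Tendsto (fun t : Finset ℕ => Real.sqrt ((hH.σ f).real (⋃ n, A n) -
      ∑ n ∈ t, (hH.σ f).real (A n))) (SummationFilter.unconditional ℕ).filter (𝓝 0) := by
    have := (tendsto_const_nhds (x := (hH.σ f).real (⋃ n, A n))).sub hs
    rw [sub_self] at this
    simpa using this.sqrt
  refine h3.congr fun t => ?_
  rw [hfin, norm_sub_rev]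
  have htm : MeasurableSet (⋃ n ∈ t, A n) := t.measurableSet_biUnion fun n _ => hA n
  have hsub : (⋃ n ∈ t, A n) ⊆ ⋃ n, A n := Set.iUnion₂_subset fun n _ => Set.subset_iUnion A n
  have h4 : hH.P (⋃ n, A n) = hH.P (⋃ n ∈ t, A n) + hH.P ((⋃ n, A n) \ ⋃ n ∈ t, A n) := by
    rw [← hH.P_union htm (hU.diff htm) Set.disjoint_sdiff_right, Set.union_sdiff_cancel hsub]
  rw [h4, _root_.add_apply, add_sub_cancel_left]
  rw [← Real.sqrt_sq (norm_nonneg (hH.P _ f)), hH.norm_P_sq (hU.diff htm),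
    measureReal_sdiff hsub htm, measureReal_biUnion_finset (fun i _ j _ hij => hd hij)
      (fun n _ => hA n)]

/-- The spectral measure of R w, seen by R, has density s² with respect to that of w; the change of
variable t = 1 - 1/s does the rest. -/
lemma integral_σ_apply {g : ℝ → ℝ} (hg : Continuous g) (w : L) :
    ∫ t, g t ∂(hH.σ (R w)) = ∫ s in Set.Ioi 0, s ^ 2 * g (1 - s⁻¹) ∂(hH.contraction.σ w) := by
  rw [σ, integral_map measurable_specMap.aemeasurable hg.aestronglyMeasurable]
  have h1 : hH.contraction.σ (R w) =
      (hH.contraction.σ w).withDensity fun s => ENNReal.ofReal (s ^ 2) := by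
    rw [← hH.contraction.σ_T_eq BddMeas.id, hH.contraction.T_id]
  rw [h1, restrict_withDensity measurableSet_Ioi, integral_withDensity_eq_integral_toReal_smul
    (by fun_prop) (Eventually.of_forall fun s => ENNReal.ofReal_lt_top)]
  refine integral_congr_ae (Eventually.of_forall fun s => ?_)
  simp [specMap, ENNReal.toReal_ofReal (sq_nonneg s)]

/-- The integrand becomes s² (1 - 1/s) = s² - s, a combination of two moments. -/
lemma integral_id_σ_apply (w : L) :
    ∫ t, t ∂(hH.σ (R w)) = inner ℝ ((R ^ 2) w) w - inner ℝ (R w) w := by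
  have h1 := hH.contraction.integral_pow w 1
  rw [pow_one] at h1
  rw [hH.integral_σ_apply (g := fun t => t) continuous_id, ← hH.contraction.integral_pow w 2, ← h1,
    ← integral_sub
      ((BddMeas.pow 2).integrable (hH.contraction.σ_compl w))
      ((BddMeas.pow 1).integrable (hH.contraction.σ_compl w)),
    setIntegral_eq_integral_of_ae_compl_eq_zero]
  · refine integral_congr_ae (Eventually.of_forall fun s => ?_)
    rcases eq_or_ne s 0 with rfl | hs
    · simp
    · field_simp
  · filter_upwards [hH.contraction.ae_mem_Icc w] with s hs hs'
    have : s = 0 := le_antisymm (not_lt.1 hs') hs.1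
    simp [this]

/-- The integrand becomes s² (1 - 1/s)² = (s - 1)², which is bounded on [0, 1]. -/
lemma integrable_sq_σ_apply (w : L) : Integrable (fun t : ℝ => t ^ 2) (hH.σ (R w)) := by
  rw [σ, integrable_map_measure (by fun_prop) measurable_specMap.aemeasurable]
  have h1 : hH.contraction.σ (R w) =
      (hH.contraction.σ w).withDensity fun s => ENNReal.ofReal (s ^ 2) := by
    rw [← hH.contraction.σ_T_eq BddMeas.id, hH.contraction.T_id]
  rw [h1, restrict_withDensity measurableSet_Ioi, integrable_withDensity_iff_integrable_smul'
    (by fun_prop) (Eventually.of_forall fun s => ENNReal.ofReal_lt_top)]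
  have h2 : Integrable (fun s : ℝ => (s - 1) ^ 2) ((hH.contraction.σ w).restrict (Set.Ioi 0)) :=
    ((BddMeas.of_continuous (by fun_prop : Continuous fun s : ℝ => (s - 1) ^ 2)).integrable
      (hH.contraction.σ_compl w)).integrableOn
  refine h2.congr ?_
  filter_upwards [ae_restrict_mem measurableSet_Ioi] with s hs
  have hs0 : s ≠ 0 := (Set.mem_Ioi.1 hs).ne'
  simp only [Function.comp, specMap, ENNReal.toReal_ofReal (sq_nonneg s), smul_eq_mul]
  field_simp

end IsResolvent

end Resolvents

/-! ### The spectral theorem -/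

section SpectralTheorem

variable {L : Type*} [NormedAddCommGroup L] [InnerProductSpace ℝ L] [CompleteSpace L]

namespace IsResolvent

variable {Γ : Set (L × L)} {V : Submodule ℝ L} {R : L →L[ℝ] L} (hH : IsResolvent Γ V R)

include hH

/-- The domain of `H` is the range of the resolvent. -/
lemma exists_apply_eq {g : L} (hg : g ∈ V) (hi : Integrable (fun t : ℝ => t ^ 2) (hH.σ g)) :
    ∃ z ∈ V, R z = g := by
  rw [σ, integrable_map_measure (by fun_prop) measurable_specMap.aemeasurable] at hi
  -- The preimage z should be R⁻¹ g. It is the limit of h_n(R) g for the truncations h_n of 1/s away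
  -- from 0, which converge to 1/s in L² of the spectral measure of g.
  let h : ℕ → ℝ → ℝ := fun n => (Set.Ici ((n : ℝ) + 1)⁻¹).indicator fun s => s⁻¹
  let k : ℝ → ℝ := (Set.Ioi 0).indicator fun s => s⁻¹
  have hpos : ∀ n : ℕ, (0 : ℝ) < ((n : ℝ) + 1)⁻¹ := fun n => by positivity
  have hh : ∀ n, BddMeas (h n) := by
    intro n
    refine ⟨measurable_inv.indicator measurableSet_Ici, (n : ℝ) + 1, fun s _ => ?_⟩
    by_cases hs : ((n : ℝ) + 1)⁻¹ ≤ s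
    · have hs0 := (hpos n).trans_le hs
      simp only [h, Set.indicator_of_mem (Set.mem_Ici.2 hs), abs_of_pos (inv_pos.2 hs0)]
      exact inv_le_of_inv_le₀ (by positivity) hs
    · simp only [h, Set.indicator_of_notMem (fun h' => hs (Set.mem_Ici.1 h')), abs_zero]
      positivity
  have hkint : Integrable (fun s => k s ^ 2) (hH.contraction.σ g) := by
    have h1 : (fun s => k s ^ 2) = (Set.Ioi 0).indicator fun s => (s⁻¹) ^ 2 := by
      ext s
      by_cases hs : s ∈ Set.Ioi (0 : ℝ) <;> simp [k, hs]
    rw [h1, integrable_indicator_iff measurableSet_Ioi]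
    -- With x = 1/s, the bound x² ≤ 2 (1 - x)² + 2 is (x - 2)² ≥ 0.
    have h2 : Integrable (fun s : ℝ => 2 * (1 - s⁻¹) ^ 2 + 2)
        ((hH.contraction.σ g).restrict (Set.Ioi 0)) :=
      (hi.const_mul 2).add (integrable_const _)
    refine h2.mono' (measurable_inv.pow_const 2).aestronglyMeasurable
      (Eventually.of_forall fun s => ?_)
    rw [Real.norm_eq_abs, abs_of_nonneg (sq_nonneg _)]
    nlinarith [sq_nonneg (s⁻¹ - 2)]
  have hle : ∀ n s, (h n s - k s) ^ 2 ≤ k s ^ 2 := by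
    intro n s
    by_cases hs : ((n : ℝ) + 1)⁻¹ ≤ s
    · have hs0 : s ∈ Set.Ioi (0 : ℝ) := (hpos n).trans_le hs
      simp only [h, k, Set.indicator_of_mem (Set.mem_Ici.2 hs), Set.indicator_of_mem hs0, sub_self,
        zero_pow two_ne_zero]
      positivity
    · simp [h, hs]
  have hkm : Measurable k := measurable_inv.indicator measurableSet_Ioi
  have hlim0 : ∀ s, Tendsto (fun n => (h n s - k s) ^ 2) atTop (𝓝 0) := by
    intro s
    refine tendsto_const_nhds.congr' ?_
    rcases le_or_gt s 0 with hs | hs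
    · refine Eventually.of_forall fun n => ?_
      have h1 : ¬ ((n : ℝ) + 1)⁻¹ ≤ s := not_le.2 (hs.trans_lt (hpos n))
      simp [h, k, hs, h1]
    · have := tendsto_one_div_add_atTop_nhds_zero_nat (𝕜 := ℝ)
      filter_upwards [this.eventually (gt_mem_nhds hs)] with n hn
      rw [one_div] at hn
      simp [h, k, hs, hn.le]
  have hlim : Tendsto (fun n => ∫ s, (h n s - k s) ^ 2 ∂(hH.contraction.σ g)) atTop (𝓝 0) := by
    have := tendsto_integral_of_dominated_convergence (μ := hH.contraction.σ g)
      (F := fun n s => (h n s - k s) ^ 2) (f := fun _ => 0) (fun s => k s ^ 2)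
      (fun n => (((hh n).measurable.sub hkm).pow_const 2).aestronglyMeasurable) hkint
      (fun n => Eventually.of_forall fun s => by
        rw [Real.norm_eq_abs, abs_of_nonneg (sq_nonneg _)]
        exact hle n s) (Eventually.of_forall hlim0)
    simpa using this
  have hint : ∀ n, Integrable (fun s => (h n s - k s) ^ 2) (hH.contraction.σ g) := fun n =>
    hkint.mono' (((hh n).measurable.sub hkm).pow_const 2).aestronglyMeasurable
      (Eventually.of_forall fun s => by
        rw [Real.norm_eq_abs, abs_of_nonneg (sq_nonneg _)]
        exact hle n s)
  have hcauchy : CauchySeq fun n => hH.contraction.T (h n) g := by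
    rw [Metric.cauchySeq_iff']
    intro ε hε
    have h4 := hlim.eventually (gt_mem_nhds (show (0 : ℝ) < ε ^ 2 / 4 by positivity))
    obtain ⟨n₀, hn₀⟩ := eventually_atTop.1 h4
    refine ⟨n₀, fun n hn => ?_⟩
    rw [dist_eq_norm]
    have h5 : ‖hH.contraction.T (h n) g - hH.contraction.T (h n₀) g‖ ^ 2 < ε ^ 2 := by
      have h6 := hH.contraction.norm_T_sq ((hh n).sub (hh n₀)) g
      rw [hH.contraction.T_sub (hh n) (hh n₀), _root_.sub_apply] at h6
      rw [h6]
      calc ∫ s, (h n s - h n₀ s) ^ 2 ∂(hH.contraction.σ g)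
          ≤ ∫ s, (2 * (h n s - k s) ^ 2 + 2 * (h n₀ s - k s) ^ 2) ∂(hH.contraction.σ g) := by
            refine integral_mono_of_nonneg (Eventually.of_forall fun s => sq_nonneg _)
              (((hint n).const_mul 2).add ((hint n₀).const_mul 2))
              (Eventually.of_forall fun s => ?_)
            simp only
            nlinarith [sq_nonneg ((h n s - k s) + (h n₀ s - k s))]
        _ = 2 * ∫ s, (h n s - k s) ^ 2 ∂(hH.contraction.σ g) +
            2 * ∫ s, (h n₀ s - k s) ^ 2 ∂(hH.contraction.σ g) := by
            rw [integral_add ((hint n).const_mul 2) ((hint n₀).const_mul 2), integral_const_mul,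
              integral_const_mul]
        _ < ε ^ 2 := by
            have := hn₀ n hn
            have := hn₀ n₀ le_rfl
            linarith
    exact lt_of_pow_lt_pow_left₀ 2 hε.le h5
  obtain ⟨z, hz⟩ := cauchySeq_tendsto_of_complete hcauchy
  have hRz : R z = g := by
    have h1 : Tendsto (fun n => R (hH.contraction.T (h n) g)) atTop (𝓝 (R z)) :=
      (R.continuous.tendsto z).comp hz
    have h2 : ∀ n, R (hH.contraction.T (h n) g) = hH.contraction.T (fun s => s * h n s) g := by
      intro n
      rw [← hH.contraction.T_mul_apply BddMeas.id (hh n), hH.contraction.T_id]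
    have h3 : Tendsto (fun n => R (hH.contraction.T (h n) g)) atTop
        (𝓝 (hH.contraction.E (Set.Ioi 0) g)) := by
      simp only [h2]
      refine hH.contraction.tendsto_T (fun n => BddMeas.id.mul (hh n))
        (BddMeas.indicator_one measurableSet_Ioi) g ?_
      refine tendsto_of_tendsto_of_tendsto_of_le_of_le tendsto_const_nhds hlim
        (fun n => integral_nonneg fun s => sq_nonneg _) fun n => ?_
      refine integral_mono_of_nonneg (Eventually.of_forall fun s => sq_nonneg _) (hint n) ?_
      filter_upwards [hH.contraction.ae_mem_Icc g] with s hs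
      have e : (Set.Ioi (0 : ℝ)).indicator (fun _ => 1) s = s * k s := by
        rcases hs.1.eq_or_lt with h | h
        · simp [← h]
        · simp [k, h, h.ne']
      rw [e, ← mul_sub, mul_pow]
      exact mul_le_of_le_one_left (sq_nonneg _) (pow_le_one₀ hs.1 hs.2)
    rw [hH.E_pos_eq_of_mem hg] at h3
    exact tendsto_nhds_unique h1 h3
  -- The limit z is projected on V; this projection commutes with R and fixes g.
  refine ⟨hH.P Set.univ z, hH.P_mem _ MeasurableSet.univ z, ?_⟩
  rw [P_univ, ← hRz]
  have hcomm := hH.contraction.T_comm (B := R) (BddMeas.indicator_one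
    (measurableSet_Ioi (a := (0 : ℝ)))) (fun _ => rfl) z
  change R (hH.contraction.E (Set.Ioi 0) z) = hH.contraction.E (Set.Ioi 0) (R z) at hcomm
  rw [hcomm, hRz, hH.E_pos_eq_of_mem hg]

/-- Polarization of `integral_id_σ_apply`, where R w - w plays the role of H R w. -/
lemma inner_eq_of_apply (w z : L) :
    inner ℝ (R w - w) (R z) =
      (∫ t, t ∂(hH.σ (R w + R z)) - ∫ t, t ∂(hH.σ (R w - R z))) / 4 := by
  have hC := hH.contraction
  have e1 : ∀ x y : L, inner ℝ ((R ^ 2) x) y = inner ℝ (R x) (R y) := fun x y => by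
    rw [sq, mul_apply_eq_comp, hC.symm]
  have e2 : inner ℝ (R z) w = inner ℝ (R w) z := by rw [hC.symm, real_inner_comm]
  have e3 : inner ℝ (R z) (R w) = inner ℝ (R w) (R z) := real_inner_comm _ _
  rw [← map_add, ← map_sub, hH.integral_id_σ_apply, hH.integral_id_σ_apply, e1, e1]
  simp only [map_add, map_sub, inner_add_left, inner_add_right, inner_sub_left, inner_sub_right, e2,
    e3]
  rw [← hC.symm w z]
  ring

omit [CompleteSpace L] in
-- With z = R x the hypothesis gives ‖R x‖² = 0, and R is injective on V.
lemma dense_range {x : L} (hx : x ∈ V) (h : ∀ z, inner ℝ x (R z) = 0) : x = 0 := by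
  refine hH.eq_zero_of_apply hx ?_
  refine inner_self_eq_zero (𝕜 := ℝ).1 ?_
  rw [hH.contraction.symm]
  exact h _

/-- The spectral theorem for `H`. -/
def spectralResolution : SpectralResolution Γ V where
  P := hH.P
  σ := hH.σ
  isStarProjection _ hA := hH.isStarProjection_P hA
  univ_apply_eq_iff f := ⟨fun h => h ▸ hH.P_mem _ MeasurableSet.univ f, fun h => hH.P_univ_of_mem h⟩
  empty := hH.P_empty
  inter _ _ hA hB := hH.P_inter hA hB
  iUnion _ hA hd f := hH.hasSum_P hA hd f
  σ_apply f A hA := by rw [hH.norm_P_sq hA, ofReal_measureReal]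
  mem_graph_iff f h := by
    constructor
    · intro hfh
      obtain ⟨hh, hf⟩ := (hH.mem_graph f h).1 hfh
      have hfV := hH.mem_of_mem_graph hfh
      refine ⟨hfV, hh, hf ▸ hH.integrable_sq_σ_apply _, fun g hg hgi => ?_⟩
      obtain ⟨z, -, rfl⟩ := hH.exists_apply_eq hg hgi
      have := hH.inner_eq_of_apply (f - h) z
      rwa [← hf, sub_sub_cancel] at this
    · rintro ⟨hf, hh, hfi, hin⟩
      obtain ⟨w, hw, rfl⟩ := hH.exists_apply_eq hf hfi
      -- Both sides have the same inner product with every R z, and these vectors are dense in V.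
      have h1 : h = R w - w := by
        rw [← sub_eq_zero]
        refine hH.dense_range (V.sub_mem hh (V.sub_mem hf hw)) fun z => ?_
        rw [inner_sub_left, hin _ (hH.apply_mem z) (hH.integrable_sq_σ_apply z),
          hH.inner_eq_of_apply, sub_self]
      rw [h1]
      exact hH.mem_graph_apply hw

end IsResolvent

end SpectralTheorem

/-! ### Uniqueness of the spectral resolution -/

section Uniqueness

/-- A finite measure is determined by upper bounds on compact intervals and its total mass. -/
lemma measure_eq_of_Icc_le {μ ν : Measure ℝ} [IsFiniteMeasure μ] [IsFiniteMeasure ν]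
    (huniv : μ Set.univ = ν Set.univ) (h : ∀ a b, μ (Set.Icc a b) ≤ ν (Set.Icc a b)) : μ = ν := by
  have hIic : ∀ b, μ (Set.Iic b) ≤ ν (Set.Iic b) := by
    intro b
    have hm : Monotone fun n : ℕ => Set.Icc (-(n : ℝ)) b := fun m n hmn =>
      Set.Icc_subset_Icc_left (by simpa using hmn)
    have hU : ⋃ n : ℕ, Set.Icc (-(n : ℝ)) b = Set.Iic b := by
      ext x
      simp only [Set.mem_iUnion, Set.mem_Icc, Set.mem_Iic]
      refine ⟨fun ⟨n, hn⟩ => hn.2, fun hx => ?_⟩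
      obtain ⟨n, hn⟩ := exists_nat_ge (-x)
      exact ⟨n, by linarith, hx⟩
    rw [← hU]
    exact le_of_tendsto_of_tendsto' (tendsto_measure_iUnion_atTop hm)
      (tendsto_measure_iUnion_atTop hm) fun n => h _ _
  have hIoi : ∀ b, μ (Set.Ioi b) ≤ ν (Set.Ioi b) := by
    intro b
    have hm : Monotone fun n : ℕ => Set.Icc (b + ((n : ℝ) + 1)⁻¹) (b + n) := fun m n hmn => by
      have hmn' : (m : ℝ) ≤ n := by exact_mod_cast hmn
      refine Set.Icc_subset_Icc ?_ (by linarith)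
      gcongr
    have hU : ⋃ n : ℕ, Set.Icc (b + ((n : ℝ) + 1)⁻¹) (b + n) = Set.Ioi b := by
      ext x
      simp only [Set.mem_iUnion, Set.mem_Icc, Set.mem_Ioi]
      constructor
      · rintro ⟨n, hn, -⟩
        have : (0 : ℝ) < ((n : ℝ) + 1)⁻¹ := by positivity
        linarith
      · intro hx
        obtain ⟨n, hn⟩ := exists_nat_ge (x - b)
        obtain ⟨m, hm'⟩ := exists_nat_ge (x - b)⁻¹
        refine ⟨max n m, ?_, ?_⟩
        · have h1 : (x - b)⁻¹ ≤ ((max n m : ℕ) : ℝ) + 1 := by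
            have : (m : ℝ) ≤ ((max n m : ℕ) : ℝ) := by exact_mod_cast le_max_right n m
            linarith
          have h2 := inv_le_of_inv_le₀ (sub_pos.2 hx) h1
          linarith
        · have : (n : ℝ) ≤ ((max n m : ℕ) : ℝ) := by exact_mod_cast le_max_left n m
          linarith
    rw [← hU]
    exact le_of_tendsto_of_tendsto' (tendsto_measure_iUnion_atTop hm)
      (tendsto_measure_iUnion_atTop hm) fun n => h _ _
  refine Measure.ext_of_Iic _ _ fun b => le_antisymm (hIic b) ?_
  -- A strict inequality on (-∞, b] would have to be compensated on (b, ∞), where μ does not exceed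
  -- ν either.
  have h1 := measure_add_measure_compl (μ := μ) (measurableSet_Iic (a := b))
  have h2 := measure_add_measure_compl (μ := ν) (measurableSet_Iic (a := b))
  rw [Set.compl_Iic] at h1 h2
  have h3 : ν (Set.Iic b) + μ (Set.Ioi b) ≤ μ (Set.Iic b) + μ (Set.Ioi b) := by
    rw [h1, huniv, ← h2]
    exact add_le_add le_rfl (hIoi b)
  exact (ENNReal.add_le_add_iff_right (measure_ne_top _ _)).1 h3

variable {L : Type*} [NormedAddCommGroup L] [InnerProductSpace ℝ L] [CompleteSpace L]

namespace SpectralResolution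

variable {Γ : Set (L × L)} {V : Submodule ℝ L} (Q : SpectralResolution Γ V)

lemma P_symm {A : Set ℝ} (hA : MeasurableSet A) (f g : L) :
    inner ℝ (Q.P A f) g = inner ℝ f (Q.P A g) :=
  (ContinuousLinearMap.isSelfAdjoint_iff_isSymmetric.1 (Q.isStarProjection A hA).isSelfAdjoint) f g

lemma P_inter_apply {A B : Set ℝ} (hA : MeasurableSet A) (hB : MeasurableSet B) (f : L) :
    Q.P A (Q.P B f) = Q.P (A ∩ B) f := by
  rw [Q.inter A B hA hB]; rfl

lemma P_mem {A : Set ℝ} (hA : MeasurableSet A) (f : L) : Q.P A f ∈ V := by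
  rw [← Q.univ_apply_eq_iff, Q.P_inter_apply MeasurableSet.univ hA, Set.univ_inter]

instance (f : L) : IsFiniteMeasure (Q.σ f) :=
  ⟨by rw [Q.σ_apply f _ MeasurableSet.univ]; exact ENNReal.ofReal_lt_top⟩

lemma σ_real {A : Set ℝ} (hA : MeasurableSet A) (f : L) : (Q.σ f).real A = ‖Q.P A f‖ ^ 2 := by
  rw [Measure.real, Q.σ_apply f A hA, ENNReal.toReal_ofReal (sq_nonneg _)]

lemma measure_ext {μ ν : Measure ℝ} [IsFiniteMeasure μ] [IsFiniteMeasure ν]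
    (h : ∀ A, MeasurableSet A → μ.real A = ν.real A) : μ = ν := by
  ext A hA
  rw [← ENNReal.toReal_eq_toReal_iff' (measure_ne_top _ _) (measure_ne_top _ _)]
  exact h A hA

lemma σ_P {A : Set ℝ} (hA : MeasurableSet A) (f : L) : Q.σ (Q.P A f) = (Q.σ f).restrict A := by
  refine measure_ext fun B hB => ?_
  rw [measureReal_restrict_apply hB, Q.σ_real hB, Q.P_inter_apply hB hA, Q.σ_real (hB.inter hA)]

lemma σ_neg (f : L) : Q.σ (-f) = Q.σ f :=
  measure_ext fun A hA => by rw [Q.σ_real hA, Q.σ_real hA, map_neg, norm_neg]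

/-- The parallelogram law bounds ‖x + y‖² by 2‖x‖² + 2‖y‖². It makes the domain condition stable
under sums. -/
lemma σ_add_le (f g : L) : Q.σ (f + g) ≤ (2 : NNReal) • Q.σ f + (2 : NNReal) • Q.σ g := by
  refine Measure.le_iff.2 fun A hA => ?_
  have h1 : ‖Q.P A f + Q.P A g‖ ^ 2 ≤ 2 * ‖Q.P A f‖ ^ 2 + 2 * ‖Q.P A g‖ ^ 2 := by
    have := parallelogram_law_with_norm ℝ (Q.P A f) (Q.P A g)
    nlinarith [sq_nonneg ‖Q.P A f - Q.P A g‖]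
  rw [Measure.add_apply, Measure.smul_apply, Measure.smul_apply, Q.σ_apply _ A hA,
    Q.σ_apply _ A hA, Q.σ_apply _ A hA, map_add]
  refine (ENNReal.ofReal_le_ofReal h1).trans ?_
  rw [ENNReal.ofReal_add (by positivity) (by positivity), ENNReal.ofReal_mul (by norm_num),
    ENNReal.ofReal_mul (by norm_num)]
  simp [ENNReal.smul_def]

lemma integrable_sq_add {f g : L} (hf : Integrable (fun t : ℝ => t ^ 2) (Q.σ f))
    (hg : Integrable (fun t : ℝ => t ^ 2) (Q.σ g)) :
    Integrable (fun t : ℝ => t ^ 2) (Q.σ (f + g)) :=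
  (((hf.smul_measure_nnreal).add_measure (hg.smul_measure_nnreal))).mono_measure (Q.σ_add_le f g)

lemma integrable_id {f : L} (hf : Integrable (fun t : ℝ => t ^ 2) (Q.σ f)) :
    Integrable (fun t : ℝ => t) (Q.σ f) := by
  refine (hf.add (integrable_const (1 : ℝ))).mono' (by fun_prop) (Eventually.of_forall fun t => ?_)
  rw [Real.norm_eq_abs, Pi.add_apply]
  nlinarith [sq_nonneg (|t| - 1), sq_abs t]

lemma integral_id_eq {f : L} (hf : Integrable (fun t : ℝ => t ^ 2) (Q.σ f)) {A : Set ℝ}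
    (hA : MeasurableSet A) :
    ∫ t, t ∂(Q.σ f) = ∫ t, t ∂(Q.σ (Q.P A f)) + ∫ t, t ∂(Q.σ (Q.P Aᶜ f)) := by
  rw [Q.σ_P hA, Q.σ_P hA.compl, integral_add_compl hA (Q.integrable_id hf)]

/-- The spectral projections leave the operator invariant. -/
lemma P_mem_graph {f h : L} (hfh : (f, h) ∈ Γ) {A : Set ℝ} (hA : MeasurableSet A) :
    (Q.P A f, Q.P A h) ∈ Γ := by
  obtain ⟨hf, hh, hfi, hin⟩ := (Q.mem_graph_iff f h).1 hfh
  have hres : ∀ x {B : Set ℝ}, MeasurableSet B → Integrable (fun t : ℝ => t ^ 2) (Q.σ x) →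
      Integrable (fun t : ℝ => t ^ 2) (Q.σ (Q.P B x)) := fun x B hB hx => by
    rw [Q.σ_P hB]; exact hx.integrableOn
  have hneg : ∀ x, Integrable (fun t : ℝ => t ^ 2) (Q.σ x) →
      Integrable (fun t : ℝ => t ^ 2) (Q.σ (-x)) := fun x hx => by rwa [Q.σ_neg]
  refine (Q.mem_graph_iff _ _).2 ⟨Q.P_mem hA f, Q.P_mem hA h, hres f hA hfi, fun g hg hgi => ?_⟩
  rw [Q.P_symm hA, hin _ (Q.P_mem hA g) (hres g hA hgi)]
  have hAA : ∀ x, Q.P A (Q.P A x) = Q.P A x := fun x => by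
    rw [Q.P_inter_apply hA hA, Set.inter_self]
  have hAcA : ∀ x, Q.P Aᶜ (Q.P A x) = 0 := fun x => by
    rw [Q.P_inter_apply hA.compl hA, Set.compl_inter_self, Q.empty]; rfl
  -- The spectral integral is cut along A and its complement. The part on the complement involves x
  -- only, so it cancels in the polarization, and what remains is symmetric in x and y.
  have i1 : ∀ x y, Integrable (fun t : ℝ => t ^ 2) (Q.σ x) →
      Integrable (fun t : ℝ => t ^ 2) (Q.σ y) →
      ∫ t, t ∂(Q.σ (x + Q.P A y)) = ∫ t, t ∂(Q.σ (Q.P A (x + y))) + ∫ t, t ∂(Q.σ (Q.P Aᶜ x)) := by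
    intro x y hx hy
    rw [Q.integral_id_eq (Q.integrable_sq_add hx (hres y hA hy)) hA]
    simp only [map_add, hAA, hAcA, add_zero]
  have e1 := i1 f g hfi hgi
  have e2 := i1 f (-g) hfi (hneg g hgi)
  have e3 := i1 g f hgi hfi
  have e4 := i1 (-g) f (hneg g hgi) hfi
  rw [map_neg, ← sub_eq_add_neg, ← sub_eq_add_neg] at e2
  rw [add_comm (-g), ← sub_eq_add_neg, map_neg _ g, Q.σ_neg, add_comm (-g), ← sub_eq_add_neg] at e4
  rw [add_comm g, add_comm g] at e3
  rw [e1, e2, e3, e4]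
  ring

variable {R : L →L[ℝ] L} (hH : IsResolvent Γ V R)

include hH

/-- On V this is the invariance of the graph under spectral projections; on the orthogonal
complement both sides vanish. -/
lemma P_comm {A : Set ℝ} (hA : MeasurableSet A) (x : L) : Q.P A (R x) = R (Q.P A x) := by
  have hV : ∀ x ∈ V, Q.P A (R x) = R (Q.P A x) := by
    intro x hx
    have h1 := Q.P_mem_graph (hH.mem_graph_apply hx) hA
    have h2 := ((hH.mem_graph _ _).1 h1).2
    rw [h2]
    simp
  have hVo : ∀ x ∈ Vᗮ, Q.P A (R x) = R (Q.P A x) := by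
    intro x hx
    have h1 : Q.P A x = 0 := by
      refine ext_inner_right ℝ fun y => ?_
      rw [Q.P_symm hA, inner_zero_left]
      exact (Submodule.mem_orthogonal' _ _).1 hx _ (Q.P_mem hA y)
    rw [h1, (hH.apply_eq_zero_iff x).2 hx, map_zero, map_zero]
  have hcl := hH.isClosed
  have : IsClosed (V : Set L) := hcl
  have : CompleteSpace V := this.completeSpace_coe
  obtain ⟨y, hy, z, hz, rfl⟩ := V.exists_add_mem_mem_orthogonal x
  simp only [map_add, hV y hy, hVo z hz]

/-- The vector R w is again fixed by the projection on [a, b], so ⟨H R w, R w⟩ = ⟨R w - w, R w⟩ is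
the integral of t against a measure of mass ‖R w‖² on [a, b]. -/
lemma inner_apply_bounds {a b : ℝ} {w : L} (hw : Q.P (Set.Icc a b) w = w) :
    (1 - b) * ‖R w‖ ^ 2 ≤ inner ℝ (R w) w ∧ inner ℝ (R w) w ≤ (1 - a) * ‖R w‖ ^ 2 := by
  have hA : MeasurableSet (Set.Icc a b) := measurableSet_Icc
  have hwV : w ∈ V := hw ▸ Q.P_mem hA w
  obtain ⟨hf, hh, hfi, hin⟩ := (Q.mem_graph_iff _ _).1 (hH.mem_graph_apply hwV)
  have h1 := hin (R w) hf hfi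
  have hPf : Q.P (Set.Icc a b) (R w) = R w := by rw [Q.P_comm hH hA, hw]
  have hσ : Q.σ (R w) = (Q.σ (R w)).restrict (Set.Icc a b) := by rw [← Q.σ_P hA, hPf]
  -- Polarization is applied with equal arguments: doubling a vector multiplies its spectral measure
  -- by 4, which absorbs the division by 4.
  have hσ2 : Q.σ (R w + R w) = (4 : NNReal) • Q.σ (R w) := by
    refine measure_ext fun A hA => ?_
    rw [Q.σ_real hA, ← two_smul ℝ (R w), map_smul, norm_smul, mul_pow, ← Q.σ_real hA]
    simp only [Real.norm_ofNat, measureReal_nnreal_smul_apply]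
    norm_num
  have hσ0 : Q.σ (R w - R w) = 0 := by
    refine measure_ext fun A hA => ?_
    rw [Q.σ_real hA]
    simp
  have hint := Q.integrable_id hfi
  rw [hσ2, hσ0, integral_zero_measure, integral_smul_nnreal_measure] at h1
  have h2 : inner ℝ (R w - w) (R w) = ∫ t, t ∂(Q.σ (R w)) := by
    rw [h1, NNReal.smul_def]
    simp
  have hun : (Q.σ (R w)).real Set.univ = ‖R w‖ ^ 2 := by
    rw [Q.σ_real MeasurableSet.univ, (Q.univ_apply_eq_iff _).2 hf]
  have hae : ∀ᵐ t ∂(Q.σ (R w)), t ∈ Set.Icc a b := by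
    rw [hσ]; exact ae_restrict_mem hA
  have h3 : a * ‖R w‖ ^ 2 ≤ ∫ t, t ∂(Q.σ (R w)) := by
    rw [← hun, mul_comm, ← smul_eq_mul, ← integral_const]
    exact integral_mono_ae (integrable_const _) hint (hae.mono fun t ht => ht.1)
  have h4 : ∫ t, t ∂(Q.σ (R w)) ≤ b * ‖R w‖ ^ 2 := by
    rw [← hun, mul_comm, ← smul_eq_mul, ← integral_const]
    exact integral_mono_ae hint (integrable_const _) (hae.mono fun t ht => ht.2)
  rw [← h2, inner_sub_left, real_inner_self_eq_norm_sq, real_inner_comm] at h3 h4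
  constructor <;> linarith

/-- One resolution places w in [a, b], the other above b or below a. The first gives a sign to the
integral of ±((1 - c) s² - s), with c = b or c = a; the second makes this integrand strictly
positive almost everywhere with the opposite sign constraint, so the measure is zero. -/
lemma eq_zero_of_P_eq {a b : ℝ} {w : L} (hw : Q.P (Set.Icc a b) w = w)
    (h : hH.P (Set.Ioi b) w = w ∨ hH.P (Set.Iio a) w = w) : w = 0 := by
  have hA : MeasurableSet (Set.Icc a b) := measurableSet_Icc
  have hC := hH.contraction
  obtain ⟨h1, h2⟩ := Q.inner_apply_bounds hH hw
  have i1 : inner ℝ (R w) w = ∫ s, s ∂(hH.contraction.σ w) := by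
    have := hH.contraction.integral_pow w 1
    simpa using this.symm
  have i2 : ‖R w‖ ^ 2 = ∫ s, s ^ 2 ∂(hH.contraction.σ w) := by
    rw [hH.contraction.integral_pow w 2, sq R, mul_apply_eq_comp, hC.symm,
      real_inner_self_eq_norm_sq]
  have hi : ∀ c : ℝ, Integrable (fun s : ℝ => c * s ^ 2 - s) (hH.contraction.σ w) := fun c =>
    (BddMeas.of_continuous (by fun_prop)).integrable (hH.contraction.σ_compl w)
  have i3 : ∀ c : ℝ, ∫ s, (c * s ^ 2 - s) ∂(hH.contraction.σ w) =
      c * ‖R w‖ ^ 2 - inner ℝ (R w) w := by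
    intro c
    rw [integral_sub, integral_const_mul, i1, i2]
    · exact (BddMeas.of_continuous (by fun_prop)).integrable (hH.contraction.σ_compl w)
    · exact BddMeas.id.integrable (hH.contraction.σ_compl w)
  have key : ∀ B : Set ℝ, MeasurableSet B → hH.P B w = w → ∀ g : ℝ → ℝ,
      Integrable g (hH.contraction.σ w) → ∫ s, g s ∂(hH.contraction.σ w) ≤ 0 →
      (∀ s ∈ specLift B, 0 < g s) → w = 0 := by
    intro B hB hBw g hg hle hpos
    have hσ : hH.contraction.σ w = (hH.contraction.σ w).restrict (specLift B) := by
      rw [← hH.contraction.σ_E (measurableSet_specLift hB)]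
      congr 1
      exact hBw.symm
    have hae : ∀ᵐ s ∂(hH.contraction.σ w), s ∈ specLift B := by
      rw [hσ]; exact ae_restrict_mem (measurableSet_specLift hB)
    have h0 : 0 ≤ᵐ[hH.contraction.σ w] g := hae.mono fun s hs => (hpos s hs).le
    have h3 := (integral_eq_zero_iff_of_nonneg_ae h0 hg).1
      (le_antisymm hle (integral_nonneg_of_ae h0))
    have h4 : ∀ᵐ s ∂(hH.contraction.σ w), False := by
      filter_upwards [h3, hae] with s hs hs'
      exact (hpos s hs').ne' hs
    have h5 : hH.contraction.σ w = 0 := by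
      rwa [eventually_false_iff_eq_bot, ae_eq_bot] at h4
    rw [← norm_eq_zero, ← sq_eq_zero_iff, ← hH.contraction.σ_real_univ, h5]
    simp
  rcases h with h | h
  · refine key (Set.Ioi b) measurableSet_Ioi h (fun s => (1 - b) * s ^ 2 - s) (hi _)
      (by rw [i3]; linarith) fun s hs => ?_
    have hs0 : 0 < s := hs.1
    have hs1 : b < 1 - s⁻¹ := hs.2
    have : s ^ 2 * s⁻¹ = s := by field_simp
    nlinarith [sq_pos_of_pos hs0]
  · refine key (Set.Iio a) measurableSet_Iio h (fun s => -((1 - a) * s ^ 2 - s)) (hi _).neg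
      (by rw [integral_neg, i3]; linarith) fun s hs => ?_
    have hs0 : 0 < s := hs.1
    have hs1 : 1 - s⁻¹ < a := hs.2
    have : s ^ 2 * s⁻¹ = s := by field_simp
    nlinarith [sq_pos_of_pos hs0]

/-- Uniqueness of the spectral measures. -/
theorem σ_eq {f : L} (hf : f ∈ V) : Q.σ f = hH.σ f := by
  have hun : Q.σ f Set.univ = hH.σ f Set.univ := by
    rw [← ENNReal.toReal_eq_toReal_iff' (measure_ne_top _ _) (measure_ne_top _ _)]
    change (Q.σ f).real _ = (hH.σ f).real _
    rw [Q.σ_real MeasurableSet.univ, ← hH.norm_P_sq MeasurableSet.univ, hH.P_univ_of_mem hf,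
      (Q.univ_apply_eq_iff f).2 hf]
  refine measure_eq_of_Icc_le hun fun a b => ?_
  have hA : MeasurableSet (Set.Icc a b) := measurableSet_Icc
  set w := Q.P (Set.Icc a b) f with hw
  have hwV : w ∈ V := Q.P_mem hA f
  -- The projections of the two resolutions commute, so `hH.P B w` is fixed by both, and the
  -- intervals are disjoint.
  have hzero : ∀ B, MeasurableSet B → (B = Set.Ioi b ∨ B = Set.Iio a) → hH.P B w = 0 := by
    intro B hB hBab
    have h1 : Q.P (Set.Icc a b) (hH.P B w) = hH.P B w := by
      have := hH.contraction.T_comm (B := Q.P (Set.Icc a b))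
        (BddMeas.indicator_one (measurableSet_specLift hB)) (Q.P_comm hH hA) w
      change Q.P (Set.Icc a b) (hH.P B w) = hH.P B (Q.P (Set.Icc a b) w) at this
      rw [this, hw, Q.P_inter_apply hA hA, Set.inter_self]
    have h2 : hH.P B (hH.P B w) = hH.P B w := by
      rw [hH.P_inter_apply hB hB, Set.inter_self]
    refine Q.eq_zero_of_P_eq hH h1 ?_
    rcases hBab with rfl | rfl
    · exact Or.inl h2
    · exact Or.inr h2
  have h3 : hH.P (Set.Icc a b) w = w := by
    conv_rhs => rw [← hH.P_univ_of_mem hwV]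
    have hd : Disjoint (Set.Icc a b) (Set.Ioi b ∪ Set.Iio a) := by
      rw [Set.disjoint_left]
      rintro x ⟨h1, h2⟩ (h3 | h3)
      · exact absurd h2 (not_le.2 h3)
      · exact absurd h1 (not_le.2 h3)
    have hsum : ∀ (hab : a ≤ b), (Set.univ : Set ℝ) = Set.Icc a b ∪ (Set.Ioi b ∪ Set.Iio a) := by
      intro hab
      ext x
      simp only [Set.mem_univ, Set.mem_union, Set.mem_Icc, Set.mem_Ioi, Set.mem_Iio, true_iff]
      rcases lt_or_ge x a with h | h
      · exact Or.inr (Or.inr h)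
      · rcases le_or_gt x b with h' | h'
        · exact Or.inl ⟨h, h'⟩
        · exact Or.inr (Or.inl h')
    rcases le_or_gt a b with hab | hab
    · have hd2 : Disjoint (Set.Ioi b) (Set.Iio a) := by
        rw [Set.disjoint_left]
        intro x h1 h2
        exact absurd (hab.trans_lt h1) (not_lt.2 (le_of_lt h2))
      rw [hsum hab, hH.P_union hA (measurableSet_Ioi.union measurableSet_Iio) hd,
        hH.P_union measurableSet_Ioi measurableSet_Iio hd2, _root_.add_apply, _root_.add_apply,
        hzero _ measurableSet_Ioi (Or.inl rfl), hzero _ measurableSet_Iio (Or.inr rfl)]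
      simp
    · have : w = 0 := by rw [hw, Set.Icc_eq_empty (not_le.2 hab), Q.empty]; rfl
      rw [this, map_zero, map_zero]
  -- Since w is fixed by both projections, Cauchy-Schwarz yields ‖w‖ ≤ ‖`hH.P` f‖ on [a, b].
  -- One-sided bounds on intervals suffice because the total masses agree.
  have h4 : ‖w‖ ^ 2 = inner ℝ w (hH.P (Set.Icc a b) f) := by
    rw [← hH.P_symm hA, h3, ← real_inner_self_eq_norm_sq]
    have h6 : Q.P (Set.Icc a b) w = w := by rw [hw, Q.P_inter_apply hA hA, Set.inter_self]
    have h7 := Q.P_symm hA f w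
    rw [← hw, h6] at h7
    rw [h7, real_inner_comm]
  have h5 : ‖w‖ ≤ ‖hH.P (Set.Icc a b) f‖ := by
    have := real_inner_le_norm w (hH.P (Set.Icc a b) f)
    rw [← h4, sq] at this
    rcases eq_or_ne ‖w‖ 0 with h0 | h0
    · rw [h0]; exact norm_nonneg _
    · exact le_of_mul_le_mul_left this (lt_of_le_of_ne (norm_nonneg _) h0.symm)
  rw [← ENNReal.toReal_le_toReal (measure_ne_top _ _) (measure_ne_top _ _)]
  change (Q.σ f).real _ ≤ (hH.σ f).real _
  rw [Q.σ_real hA, ← hH.norm_P_sq hA]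
  exact pow_le_pow_left₀ (norm_nonneg _) h5 2

end SpectralResolution

end Uniqueness

/-! ### Spectra on reducing subspaces -/

section ReducingSubspaces

variable {L : Type*} [NormedAddCommGroup L] [InnerProductSpace ℝ L] [CompleteSpace L]

/-- Neumann series: near t the inverse at s is (1 - (t - s) R_t)⁻¹ R_t. Completeness of W makes the
series converge. -/
lemma isClosed_spectrumOn (Γ : Set (L × L)) {W : Submodule ℝ L} (hW : IsClosed (W : Set L)) :
    IsClosed (spectrumOn Γ W) := by
  have : CompleteSpace W := hW.completeSpace_coe
  rw [← isOpen_compl_iff, Metric.isOpen_iff]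
  intro t ht
  simp only [spectrumOn, Set.mem_compl_iff, Set.mem_ofPred_eq, not_not] at ht
  obtain ⟨Rt, hRt⟩ := ht
  refine ⟨(‖Rt‖ + 1)⁻¹, by positivity, fun s hs => ?_⟩
  rw [Metric.mem_ball, dist_comm, Real.dist_eq] at hs
  simp only [spectrumOn, Set.mem_compl_iff, Set.mem_ofPred_eq, not_not]
  have hnorm : ‖(t - s) • Rt‖ < 1 := by
    refine (ContinuousLinearMap.opNorm_smul_le _ _).trans_lt ?_
    rw [Real.norm_eq_abs]
    have h1 : (‖Rt‖ + 1)⁻¹ * (‖Rt‖ + 1) = 1 := inv_mul_cancel₀ (by positivity)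
    nlinarith [Rt.opNorm_nonneg, abs_nonneg (t - s)]
  let A : (W →L[ℝ] W)ˣ := Units.oneSub ((t - s) • Rt) hnorm
  have hA : (A : W →L[ℝ] W) = 1 - (t - s) • Rt := rfl
  refine ⟨(↑A⁻¹ : W →L[ℝ] W) * Rt, fun u v => ?_⟩
  have h1 : ((u : L), s • (u : L) - (v : L)) =
      ((u : L), t • (u : L) - ((v + (t - s) • u : W) : L)) := by
    ext
    · rfl
    · simp only [Submodule.coe_add, Submodule.coe_smul]; module
  rw [h1, ← hRt]
  have h2 : Rt (v + (t - s) • u) = u ↔ (A : W →L[ℝ] W) u = Rt v := by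
    rw [hA, map_add, map_smul, _root_.sub_apply, _root_.smul_apply,
      one_apply_eq_self, sub_eq_iff_eq_add, eq_comm]
  rw [h2, mul_apply_eq_comp]
  constructor
  · rintro rfl
    rw [← mul_apply_eq_comp, Units.mul_inv]; rfl
  · intro h
    rw [← h, ← mul_apply_eq_comp, Units.inv_mul]; rfl

namespace IsResolvent

variable {Γ : Set (L × L)} {V : Submodule ℝ L} {R : L →L[ℝ] L} (hH : IsResolvent Γ V R)

/-- Closed subspaces of `V` that reduce `H`. -/
structure Reducing (W : Submodule ℝ L) : Prop where
  le : W ≤ V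
  isClosed : IsClosed (W : Set L)
  T_mem : ∀ h, BddMeas h → ∀ f ∈ W, hH.contraction.T h f ∈ W

include hH

lemma T_P_comm {h : ℝ → ℝ} (hh : BddMeas h) {A : Set ℝ} (hA : MeasurableSet A) (f : L) :
    hH.contraction.T h (hH.P A f) = hH.P A (hH.contraction.T h f) := by
  have h1 := BddMeas.indicator_one (measurableSet_specLift hA)
  rw [P, IsPosContraction.E, hH.contraction.T_mul_apply hh h1, hH.contraction.T_mul_apply h1 hh]
  simp only [mul_comm]

lemma σ_T_absolutelyContinuous {h : ℝ → ℝ} (hh : BddMeas h) (f : L) :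
    hH.σ (hH.contraction.T h f) ≪ hH.σ f :=
  ((hH.contraction.σ_T_absolutelyContinuous hh f).restrict _).map measurable_specMap

lemma σ_P {A : Set ℝ} (hA : MeasurableSet A) (f : L) :
    hH.σ (hH.P A f) = (hH.σ f).restrict A := by
  ext B hB
  rw [Measure.restrict_apply hB, hH.σ_apply hB, hH.σ_apply (hB.inter hA), P,
    hH.contraction.σ_E (measurableSet_specLift hA),
    Measure.restrict_apply (measurableSet_specLift hB)]
  congr 1
  ext s
  simp only [specLift, Set.mem_inter_iff, Set.mem_preimage]
  tauto

lemma P_eq_zero_iff {A : Set ℝ} (hA : MeasurableSet A) (f : L) : hH.P A f = 0 ↔ hH.σ f A = 0 := by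
  rw [← norm_eq_zero, ← sq_eq_zero_iff, hH.norm_P_sq hA, measureReal_eq_zero_iff]

/-- Applying R turns the unbounded equation (t - H) u = v into (1 - (1 - t) R) u = R v, within reach
of the bounded calculus. -/
lemma mem_graph_iff_T {u v : L} (hu : u ∈ V) (hv : v ∈ V) (t : ℝ) :
    (u, t • u - v) ∈ Γ ↔ hH.contraction.T (fun s => 1 - (1 - t) * s) u = R v := by
  have h1 : hH.contraction.T (fun s => 1 - (1 - t) * s) = 1 - (1 - t) • R := by
    rw [hH.contraction.T_sub (BddMeas.const 1) ((BddMeas.const _).mul BddMeas.id),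
      hH.contraction.T_smul _ BddMeas.id, hH.contraction.T_one, hH.contraction.T_id]
  rw [hH.mem_graph, h1]
  have h2 : u = R (u - (t • u - v)) ↔ ((1 - (1 - t) • R : L →L[ℝ] L)) u = R v := by
    simp only [map_sub, map_smul, _root_.sub_apply, one_apply_eq_self,
      _root_.smul_apply]
    constructor
    · intro h
      nth_rewrite 1 [h]
      module
    · intro h
      rw [← h]
      module
  rw [h2]
  exact and_iff_right (V.sub_mem (V.smul_mem t hu) hv)

lemma Reducing.P_mem {W : Submodule ℝ L} (hW : hH.Reducing W) {A : Set ℝ} (hA : MeasurableSet A)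
    {f : L} (hf : f ∈ W) : hH.P A f ∈ W :=
  hW.T_mem _ (BddMeas.indicator_one (measurableSet_specLift hA)) f hf

/-- The spectrum on a reducing subspace in terms of spectral projections. -/
theorem Ioo_inter_spectrumOn {W : Submodule ℝ L} (hW : hH.Reducing W) (p q : ℝ) :
    Set.Ioo p q ∩ spectrumOn Γ W = ∅ ↔ ∀ f ∈ W, hH.P (Set.Ioo p q) f = 0 := by
  have hC := hH.contraction
  have hId : ∀ f ∈ W, R f ∈ W := fun f hf => by
    have := hW.T_mem _ BddMeas.id f hf
    rwa [hH.contraction.T_id] at this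
  have ha : ∀ t : ℝ, BddMeas fun s => 1 - (1 - t) * s := fun t =>
    BddMeas.of_continuous (by fun_prop)
  constructor
  · intro h f hf
    rw [hH.P_eq_zero_iff measurableSet_Ioo]
    refine measure_null_of_locally_null _ fun t ht => ?_
    have ht' : t ∉ spectrumOn Γ W := fun h' => by
      have : t ∈ Set.Ioo p q ∩ spectrumOn Γ W := ⟨ht, h'⟩
      rw [h] at this
      exact this
    simp only [spectrumOn, Set.mem_ofPred_eq, not_not] at ht'
    obtain ⟨Rt, hRt⟩ := ht'
    -- On the spectral window of radius ε around t, the operator t - H has norm at most ε. As it is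
    -- inverted by `Rt` and ε ‖`Rt`‖ < 1, the window carries no vector of W.
    set ε : ℝ := (‖Rt‖ + 1)⁻¹ with hε
    have hε0 : 0 < ε := by positivity
    have hI : MeasurableSet (Set.Ioo (t - ε) (t + ε)) := measurableSet_Ioo
    refine ⟨Set.Ioo (t - ε) (t + ε), mem_nhdsWithin_of_mem_nhds
      (Ioo_mem_nhds (by linarith) (by linarith)), ?_⟩
    rw [← hH.P_eq_zero_iff hI]
    set w := hH.P (Set.Ioo (t - ε) (t + ε)) f with hw
    have hwW : w ∈ W := Reducing.P_mem hH hW hI hf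
    set v := hH.contraction.T (fun s => 1 - (1 - t) * s) w with hv
    have hvW : v ∈ W := hW.T_mem _ (ha t) w hwW
    have h1 : (R w, t • R w - v) ∈ Γ := by
      rw [hH.mem_graph_iff_T (hW.le (hId w hwW)) (hW.le hvW), hv,
        hH.contraction.T_comm (B := R) (ha t) (fun _ => rfl)]
    have h2 := (hRt ⟨R w, hId w hwW⟩ ⟨v, hvW⟩).2 h1
    have h3 : ‖R w‖ ≤ ‖Rt‖ * ‖v‖ := by
      have := Rt.le_opNorm ⟨v, hvW⟩
      rw [h2] at this
      exact this
    have h4 : ‖v‖ ≤ ε * ‖R w‖ := by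
      refine le_of_sq_le_sq ?_ (by positivity)
      have e1 : ‖R w‖ ^ 2 = ∫ s, s ^ 2 ∂(hH.contraction.σ w) := by
        rw [← hH.contraction.norm_T_sq BddMeas.id, hH.contraction.T_id]
      rw [mul_pow, e1, hv, hH.contraction.norm_T_sq (ha t), ← integral_const_mul]
      have hσ : hH.contraction.σ w = (hH.contraction.σ f).restrict
          (specLift (Set.Ioo (t - ε) (t + ε))) :=
        hH.contraction.σ_E (measurableSet_specLift hI) f
      have hae : ∀ᵐ s ∂(hH.contraction.σ w), s ∈ specLift (Set.Ioo (t - ε) (t + ε)) := by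
        rw [hσ]; exact ae_restrict_mem (measurableSet_specLift hI)
      refine integral_mono_ae
        ((BddMeas.of_continuous (by fun_prop)).integrable (hH.contraction.σ_compl w))
        ((BddMeas.of_continuous (by fun_prop)).integrable (hH.contraction.σ_compl w)) ?_
      filter_upwards [hae] with s hs
      have hs0 : 0 < s := hs.1
      have e2 : 1 - (1 - t) * s = s * (t - specMap s) := by
        rw [specMap]; field_simp
        ring
      have e3 : |t - specMap s| ≤ ε := by
        have := hs.2
        rw [Set.mem_preimage, Set.mem_Ioo] at this
        rw [abs_le]; constructor <;> linarith
      have e4 : (t - specMap s) ^ 2 ≤ ε ^ 2 :=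
        sq_le_sq' (by linarith [(abs_le.1 e3).1]) (abs_le.1 e3).2
      rw [e2, mul_pow, mul_comm]
      exact mul_le_mul_of_nonneg_right e4 (sq_nonneg _)
    have h5 : ε * (‖Rt‖ + 1) = 1 := inv_mul_cancel₀ (by positivity)
    have h6 : ‖R w‖ = 0 := by
      by_contra hne
      have hpos : 0 < ‖R w‖ := lt_of_le_of_ne (norm_nonneg _) (Ne.symm hne)
      have h7 : ‖R w‖ ≤ ‖Rt‖ * (ε * ‖R w‖) :=
        h3.trans (mul_le_mul_of_nonneg_left h4 Rt.opNorm_nonneg)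
      nlinarith [mul_pos hε0 hpos]
    exact hH.eq_zero_of_apply (hW.le hwW) (norm_eq_zero.1 h6)
  · intro h
    rw [Set.eq_empty_iff_forall_notMem]
    rintro t ⟨ht, hts⟩
    refine hts ?_
    set O : Set ℝ := (specLift (Set.Ioo p q))ᶜ with hO
    have hOm : MeasurableSet O := (measurableSet_specLift measurableSet_Ioo).compl
    set δ : ℝ := min (t - p) (q - t) with hδ
    have hδ0 : 0 < δ := lt_min (by linarith [ht.1]) (by linarith [ht.2])
    -- Two regimes for the lower bound of |1 - (1 - t) s| = s |t - (1 - 1/s)|: for s ≤ s₀ it is at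
    -- least 1/2, and for larger s the distance from t to the complement of (p, q) gives s₀ δ.
    set s₀ : ℝ := (2 * (|1 - t| + 1))⁻¹ with hs₀
    have hs₀0 : 0 < s₀ := by positivity
    set c : ℝ := min (1 / 2) (s₀ * δ) with hc
    have hc0 : 0 < c := lt_min (by norm_num) (by positivity)
    have hlow : ∀ s ∈ Set.Icc (0 : ℝ) 1, s ∈ O → c ≤ |1 - (1 - t) * s| := by
      intro s hs hsO
      rcases le_or_gt s s₀ with h1 | h1
      · have h2 : |1 - t| * s ≤ 1 / 2 := by
          have h3 : s₀ * (2 * (|1 - t| + 1)) = 1 := inv_mul_cancel₀ (by positivity)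
          nlinarith [abs_nonneg (1 - t), hs.1]
        have h3 : (1 - t) * s ≤ |1 - t| * s := mul_le_mul_of_nonneg_right (le_abs_self _) hs.1
        refine (min_le_left _ _).trans ((le_abs_self _).trans' ?_)
        linarith
      · have hs0 : 0 < s := hs₀0.trans h1
        have e2 : 1 - (1 - t) * s = s * (t - specMap s) := by
          rw [specMap]; field_simp
          ring
        have h2 : specMap s ∉ Set.Ioo p q := fun h' => hsO ⟨hs0, h'⟩
        have h3 : δ ≤ |t - specMap s| := by
          rw [Set.mem_Ioo, not_and_or, not_lt, not_lt] at h2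
          rcases h2 with h2 | h2
          · exact (min_le_left _ _).trans ((le_abs_self _).trans' (by linarith))
          · exact (min_le_right _ _).trans ((neg_le_abs _).trans' (by linarith))
        rw [e2, abs_mul, abs_of_pos hs0]
        exact (min_le_right _ _).trans (mul_le_mul h1.le h3 hδ0.le hs0.le)
    -- k inverts 1 - (1 - t) s outside of the lift of (p, q). As the projection on (p, q) vanishes
    -- on W, k(R) R is the inverse of t - H there.
    let k : ℝ → ℝ := O.indicator fun s => (1 - (1 - t) * s)⁻¹
    have hk : BddMeas k := by
      refine ⟨((ha t).measurable.inv).indicator hOm, c⁻¹, fun s hs => ?_⟩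
      by_cases hsO : s ∈ O
      · simp only [k, Set.indicator_of_mem hsO, abs_inv]
        exact inv_anti₀ hc0 (hlow s hs hsO)
      · simp only [k, Set.indicator_of_notMem hsO, abs_zero]
        positivity
    have hka : ∀ u ∈ W, hH.contraction.T k (hH.contraction.T (fun s => 1 - (1 - t) * s) u) = u := by
      intro u hu
      rw [hH.contraction.T_mul_apply hk (ha t), hH.contraction.T_congr
        (k := O.indicator fun _ => 1) (hk.mul (ha t)) (BddMeas.indicator_one hOm)]
      · have h1 := hH.contraction.E_compl_add
          (measurableSet_specLift (measurableSet_Ioo (a := p) (b := q)))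
        have h2 : hH.contraction.E (specLift (Set.Ioo p q)) u = 0 := h u hu
        have h3 := DFunLike.congr_fun h1 u
        rw [_root_.add_apply, h2, zero_add] at h3
        exact h3
      · intro s hs
        by_cases hsO : s ∈ O
        · have := hc0.trans_le (hlow s hs hsO)
          simp only [k, Set.indicator_of_mem hsO]
          exact inv_mul_cancel₀ (abs_pos.1 this)
        · simp [k, hsO]
    have hcom : ∀ u, hH.contraction.T (fun s => 1 - (1 - t) * s) (hH.contraction.T k u) =
        hH.contraction.T k (hH.contraction.T (fun s => 1 - (1 - t) * s) u) := fun u => by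
      rw [hH.contraction.T_mul_apply hk (ha t), hH.contraction.T_mul_apply (ha t) hk]
      simp only [mul_comm]
    let Rt : W →L[ℝ] W := ((hH.contraction.T k ∘L R) ∘L W.subtypeL).codRestrict W
      fun f => hW.T_mem _ hk _ (hId f f.2)
    have hRt : ∀ v : W, (Rt v : L) = hH.contraction.T k (R v) := fun v => rfl
    refine ⟨Rt, fun u v => ?_⟩
    rw [hH.mem_graph_iff_T (hW.le u.2) (hW.le v.2), Subtype.ext_iff, hRt]
    constructor
    · intro h1
      rw [← h1, hcom, hka _ (hId v v.2)]
    · intro h1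
      rw [← h1, hka u u.2]

lemma reducing_of_span {G : Set L} (hGV : G ⊆ V)
    (hG : ∀ h, BddMeas h → ∀ f ∈ G, hH.contraction.T h f ∈ Submodule.span ℝ G) :
    hH.Reducing (Submodule.span ℝ G).topologicalClosure := by
  refine ⟨?_, Submodule.isClosed_topologicalClosure _, fun h hh f hf => ?_⟩
  · exact Submodule.topologicalClosure_minimal _ (Submodule.span_le.2 hGV) hH.isClosed
  · have h1 : Submodule.span ℝ G ≤ (Submodule.span ℝ G).comap (hH.contraction.T h).toLinearMap :=
      Submodule.span_le.2 fun f hf => hG h hh f hf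
    exact map_mem_closure (hH.contraction.T h).continuous hf fun x hx => h1 hx

lemma reducing_self : hH.Reducing V := by
  refine ⟨le_rfl, hH.isClosed, fun h hh f hf => ?_⟩
  rw [← hH.P_univ_of_mem hf, hH.T_P_comm hh MeasurableSet.univ]
  exact hH.P_mem _ MeasurableSet.univ _

/-- The spectral theorem provides one resolution and uniqueness identifies the spectral measures of
all others with it. -/
lemma spectralSubspace_eq (p : Measure ℝ → Prop) :
    spectralSubspace Γ V p =
      (Submodule.span ℝ {f | f ∈ V ∧ p (hH.σ f)}).topologicalClosure := by
  rw [spectralSubspace]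
  congr 2
  ext f
  refine and_congr_right fun hf => ⟨?_, fun h => ⟨hH.spectralResolution, h⟩⟩
  rintro ⟨Q, hQ⟩
  rwa [Q.σ_eq hH hf] at hQ

/-- Functions of R replace a spectral measure by an absolutely continuous one. The properties ac, sc
and pp are all hereditary in this sense. -/
lemma reducing_spectralSubspace {p : Measure ℝ → Prop} (hp : ∀ μ ν : Measure ℝ, ν ≪ μ → p μ → p ν) :
    hH.Reducing (spectralSubspace Γ V p) := by
  rw [hH.spectralSubspace_eq]
  refine hH.reducing_of_span (fun f hf => hf.1) fun h hh f hf => Submodule.subset_span ⟨?_, ?_⟩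
  · exact hH.reducing_self.T_mem h hh f hf.1
  · exact hp _ _ (hH.σ_T_absolutelyContinuous hh f) hf.2

/-- A set that separates the measures has a spectral projection that fixes one of the vectors and
kills the other. -/
lemma inner_eq_zero_of_mutuallySingular {f g : L} (hf : f ∈ V)
    (h : (hH.σ f).MutuallySingular (hH.σ g)) : inner ℝ f g = 0 := by
  obtain ⟨C, hC, h1, h2⟩ := h
  have h3 := hH.P_union hC hC.compl disjoint_compl_right
  rw [Set.union_compl_self] at h3
  have h4 := DFunLike.congr_fun h3 f
  rw [hH.P_univ_of_mem hf, _root_.add_apply, (hH.P_eq_zero_iff hC f).2 h1, zero_add] at h4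
  rw [h4, hH.P_symm hC.compl, (hH.P_eq_zero_iff hC.compl g).2 h2, inner_zero_right]

lemma inner_sub_P_of_mem {g : L} (hg : g ∈ V) {M : Set ℝ} (hM : MeasurableSet M) (e : L) :
    inner ℝ (e - hH.P M e) g = inner ℝ (hH.P Mᶜ e) g := by
  have h3 := hH.P_union hM hM.compl disjoint_compl_right
  rw [Set.union_compl_self] at h3
  have h4 := DFunLike.congr_fun h3 g
  rw [hH.P_univ_of_mem hg, _root_.add_apply] at h4
  rw [inner_sub_left, hH.P_symm hM, hH.P_symm hM.compl, ← inner_sub_right]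
  nth_rewrite 1 [h4]
  rw [add_sub_cancel_left]

/-- The part of `e` in a spectral subspace is cut out by a spectral projection. -/
lemma P_mem_and_sub_mem_orthogonal {p : Measure ℝ → Prop} {e : L} {M : Set ℝ}
    (hM : MeasurableSet M) (h1 : p ((hH.σ e).restrict M))
    (h2 : ∀ ν : Measure ℝ, p ν → ((hH.σ e).restrict Mᶜ).MutuallySingular ν) :
    hH.P M e ∈ spectralSubspace Γ V p ∧ e - hH.P M e ∈ (spectralSubspace Γ V p)ᗮ := by
  rw [hH.spectralSubspace_eq]
  refine ⟨subset_closure (Submodule.subset_span ⟨hH.P_mem _ hM e, by rwa [hH.σ_P hM]⟩), ?_⟩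
  rw [Submodule.orthogonal_closure, Submodule.mem_orthogonal']
  intro g hg
  induction hg using Submodule.span_induction with
  | mem g hg =>
    rw [hH.inner_sub_P_of_mem hg.1 hM]
    refine hH.inner_eq_zero_of_mutuallySingular (hH.P_mem _ hM.compl e) ?_
    rw [hH.σ_P hM.compl]
    exact h2 _ hg.2
  | zero => simp
  | add x y _ _ hx hy => rw [inner_add_right, hx, hy, add_zero]
  | smul c x _ hx => rw [inner_smul_right, hx, mul_zero]

/-- Testing the spectrum on a reducing subspace by a total family. -/
lemma Ioo_inter_spectrumOn_iff_of_total {W : Submodule ℝ L} (hW : hH.Reducing W) {ι : Type*}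
    {e d : ι → L} (he : (Submodule.span ℝ (Set.range e)).topologicalClosure = ⊤)
    (hd : ∀ i, d i ∈ W) (hed : ∀ i, e i - d i ∈ Wᗮ) (p q : ℝ) :
    Set.Ioo p q ∩ spectrumOn Γ W = ∅ ↔ ∀ i, hH.P (Set.Ioo p q) (d i) = 0 := by
  rw [hH.Ioo_inter_spectrumOn hW]
  refine ⟨fun h i => h _ (hd i), fun h f hf => ?_⟩
  have hI : MeasurableSet (Set.Ioo p q) := measurableSet_Ioo
  set y := hH.P (Set.Ioo p q) f with hy
  have hyW : y ∈ W := Reducing.P_mem hH hW hI hf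
  have hyy : hH.P (Set.Ioo p q) y = y := by rw [hy, hH.P_inter_apply hI hI, Set.inter_self]
  -- As y lies in W and is fixed by the projection, its inner product with e i equals that with d i,
  -- then that with the projection of d i, which is 0.
  have h1 : ∀ x ∈ (Submodule.span ℝ (Set.range e)).topologicalClosure, inner ℝ y x = 0 := by
    have h2 : (Submodule.span ℝ (Set.range e)).topologicalClosure ≤ (ℝ ∙ y)ᗮ := by
      refine Submodule.topologicalClosure_minimal _ (Submodule.span_le.2 ?_)
        (Submodule.isClosed_orthogonal _)
      rintro _ ⟨i, rfl⟩
      rw [SetLike.mem_coe, Submodule.mem_orthogonal_singleton_iff_inner_right]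
      have h3 : inner ℝ y (e i - d i) = 0 := (Submodule.mem_orthogonal _ _).1 (hed i) y hyW
      rw [inner_sub_right, sub_eq_zero] at h3
      rw [h3, ← hyy, hH.P_symm hI, h i, inner_zero_right]
    exact fun x hx => Submodule.mem_orthogonal_singleton_iff_inner_right.1 (h2 hx)
  exact inner_self_eq_zero.1 (h1 y (by rw [he]; trivial))

end IsResolvent

end ReducingSubspaces

/-! ### Spectral subspaces -/

section SpectralSubspaces

variable {L : Type*} [NormedAddCommGroup L] [InnerProductSpace ℝ L] [CompleteSpace L]

namespace IsResolvent

variable {Γ : Set (L × L)} {V : Submodule ℝ L} {R : L →L[ℝ] L} (hH : IsResolvent Γ V R)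

include hH

omit [CompleteSpace L] in
-- The graph relation reads u = (1 - t) R u, and 0 ≤ R ≤ 1 locates the eigenvalue of R.
lemma eigenvalue_props {u : L} {t : ℝ} (hu : (u, t • u) ∈ Γ) (h0 : u ≠ 0) :
    0 < (1 - t)⁻¹ ∧ (1 - t)⁻¹ ≤ 1 ∧ R u = (1 - t)⁻¹ • u := by
  have h1 := ((hH.mem_graph _ _).1 hu).2
  have h2 : u = (1 - t) • R u := by
    rw [← map_smul, sub_smul, one_smul]; exact h1
  have ht : 1 - t ≠ 0 := fun h => h0 (by rw [h2, h, zero_smul])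
  have h3 : R u = (1 - t)⁻¹ • u := by
    nth_rewrite 2 [h2]
    rw [smul_smul, inv_mul_cancel₀ ht, one_smul]
  have hpos : 0 < inner ℝ u u := real_inner_self_pos.2 h0
  have h4 := hH.contraction.nonneg u
  have h5 := hH.contraction.le_one u
  rw [h3, inner_smul_left, conj_trivial] at h4 h5
  refine ⟨lt_of_le_of_ne ?_ (inv_ne_zero ht).symm, ?_, h3⟩
  · exact nonneg_of_mul_nonneg_left h4 hpos
  · nlinarith

/-- The moments identify the spectral measure of u as a point mass at (1 - t)⁻¹, so h - h((1 - t)⁻¹)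
vanishes in its L² space. -/
lemma T_apply_of_eigenvector {u : L} {t : ℝ} (hu : (u, t • u) ∈ Γ) {h : ℝ → ℝ} (hh : BddMeas h) :
    hH.contraction.T h u = h (1 - t)⁻¹ • u := by
  rcases eq_or_ne u 0 with rfl | h0
  · simp
  obtain ⟨hs0, hs1, hR⟩ := hH.eigenvalue_props hu h0
  set s := (1 - t)⁻¹
  have hRk : ∀ k : ℕ, (R ^ k) u = s ^ k • u := by
    intro k
    induction k with
    | zero => simp
    | succ k ih =>
      have : (R ^ (k + 1)) u = (R ^ k) (R u) := by rw [pow_succ]; rfl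
      rw [this, hR, map_smul, ih, smul_smul, pow_succ, mul_comm]
  have hσ : hH.contraction.σ u = ENNReal.ofReal (‖u‖ ^ 2) • Measure.dirac s := by
    have : IsFiniteMeasure (ENNReal.ofReal (‖u‖ ^ 2) • Measure.dirac s) :=
      Measure.smul_finite _ ENNReal.ofReal_ne_top
    refine measure_ext_of_moments (hH.contraction.σ_compl u) ?_ fun k => ?_
    · simp [hs0.le, hs1]
    · rw [hH.contraction.integral_pow, hRk, inner_smul_left, real_inner_self_eq_norm_sq,
        integral_smul_measure, integral_dirac, ENNReal.toReal_ofReal (sq_nonneg _), smul_eq_mul,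
        conj_trivial, mul_comm]
  have h1 := hH.contraction.norm_T_sq (hh.sub (BddMeas.const (h s))) u
  have h2 : hH.contraction.T (fun _ => h s) = h s • (1 : L →L[ℝ] L) := by
    have := hH.contraction.T_smul (h s) (BddMeas.const 1)
    simpa [hH.contraction.T_one] using this
  rw [hσ, integral_smul_measure, integral_dirac, sub_self, hH.contraction.T_sub hh
    (BddMeas.const _), h2] at h1
  simp only [zero_pow two_ne_zero, smul_zero, sq_eq_zero_iff, norm_eq_zero] at h1
  exact sub_eq_zero.1 h1

lemma P_apply_of_eigenvector {u : L} {t : ℝ} (hu : (u, t • u) ∈ Γ) {A : Set ℝ}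
    (hA : MeasurableSet A) : hH.P A u = A.indicator (fun _ => (1 : ℝ)) t • u := by
  rcases eq_or_ne u 0 with rfl | h0
  · simp
  have hs := hH.eigenvalue_props hu h0
  rw [P, IsPosContraction.E, hH.T_apply_of_eigenvector hu
    (BddMeas.indicator_one (measurableSet_specLift hA))]
  have : (1 - t)⁻¹ ∈ specLift A ↔ t ∈ A := by
    simp only [specLift, specMap, Set.mem_inter_iff, Set.mem_preimage, Set.mem_Ioi, hs.1, true_and,
      inv_inv, sub_sub_cancel]
  by_cases ht : t ∈ A
  · rw [Set.indicator_of_mem (this.2 ht), Set.indicator_of_mem ht]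
  · rw [Set.indicator_of_notMem (fun h => ht (this.1 h)), Set.indicator_of_notMem ht]

lemma purePoint_of_eigenvector {u : L} {t : ℝ} (hu : (u, t • u) ∈ Γ) : PurePoint (hH.σ u) := by
  refine ⟨{t}, Set.countable_singleton t, ?_⟩
  have hm : MeasurableSet ({t}ᶜ : Set ℝ) := (measurableSet_singleton t).compl
  rw [← hH.P_eq_zero_iff hm, hH.P_apply_of_eigenvector hu hm]
  simp

variable {G : Set L} (hG : ∀ u ∈ G, ∃ t : ℝ, (u, t • u) ∈ Γ)

include hG

lemma reducing_eigenvectors : hH.Reducing (Submodule.span ℝ G).topologicalClosure := by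
  refine hH.reducing_of_span (fun u hu => ?_) fun h hh u hu => ?_
  · obtain ⟨t, ht⟩ := hG u hu
    exact hH.mem_of_mem_graph ht
  · obtain ⟨t, ht⟩ := hG u hu
    rw [hH.T_apply_of_eigenvector ht hh]
    exact Submodule.smul_mem _ _ (Submodule.subset_span hu)

lemma eigenvectors_le_ppSubspace :
    (Submodule.span ℝ G).topologicalClosure ≤ ppSubspace Γ V := by
  rw [ppSubspace, hH.spectralSubspace_eq]
  refine closure_mono (Submodule.span_mono fun u hu => ?_)
  obtain ⟨t, ht⟩ := hG u hu
  exact ⟨hH.mem_of_mem_graph ht, hH.purePoint_of_eigenvector ht⟩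

/-- For y the projection of e in question, 2⟨e, z⟩ - ‖z‖² = ‖y‖² - ‖y - z‖² when z is a combination
of eigenvectors with eigenvalue in (p, q), and such z are dense around y. So ‖y‖² is a supremum of
expressions without projections, which is what measurability in ω requires. -/
lemma lt_norm_sq_P_starProjection_iff (p q : ℝ) (e : L) (c : ℝ) :
    c < ‖hH.P (Set.Ioo p q) ((Submodule.span ℝ G).topologicalClosure.starProjection e)‖ ^ 2 ↔
      ∃ z ∈ Submodule.span ℝ {u | u ∈ G ∧ ∃ t ∈ Set.Ioo p q, (u, t • u) ∈ Γ},
        c < 2 * inner ℝ e z - ‖z‖ ^ 2 := by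
  set N := (Submodule.span ℝ G).topologicalClosure with hN
  set I := Set.Ioo p q with hI
  have hIm : MeasurableSet I := measurableSet_Ioo
  set GI := {u | u ∈ G ∧ ∃ t ∈ I, (u, t • u) ∈ Γ} with hGI
  set y := hH.P I (N.starProjection e) with hy
  have hzN : Submodule.span ℝ GI ≤ N :=
    (Submodule.span_mono fun u (hu : u ∈ GI) => hu.1).trans (Submodule.le_topologicalClosure _)
  have hzP : ∀ z ∈ Submodule.span ℝ GI, hH.P I z = z := by
    intro z hz
    induction hz using Submodule.span_induction with
    | mem u hu =>
      obtain ⟨-, t, ht, hut⟩ := hu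
      rw [hH.P_apply_of_eigenvector hut hIm, Set.indicator_of_mem ht, one_smul]
    | zero => simp
    | add x y _ _ hx hy => rw [map_add, hx, hy]
    | smul c x _ hx => rw [map_smul, hx]
  have key : ∀ z ∈ Submodule.span ℝ GI, 2 * inner ℝ e z - ‖z‖ ^ 2 = ‖y‖ ^ 2 - ‖y - z‖ ^ 2 := by
    intro z hz
    have h1 : inner ℝ e z = inner ℝ y z := by
      rw [hy, hH.P_symm hIm, hzP z hz]
      have := N.starProjection_inner_eq_zero e z (hzN hz)
      rw [inner_sub_left, sub_eq_zero] at this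
      exact this
    rw [h1, norm_sub_sq_real]
    ring
  constructor
  · intro hc
    have hycl : y ∈ (Submodule.span ℝ GI).topologicalClosure := by
      have h1 : Submodule.span ℝ G ≤ (Submodule.span ℝ GI).comap (hH.P I).toLinearMap := by
        refine Submodule.span_le.2 fun u hu => ?_
        obtain ⟨t, ht⟩ := hG u hu
        change hH.P I u ∈ Submodule.span ℝ GI
        rw [hH.P_apply_of_eigenvector ht hIm]
        by_cases htI : t ∈ I
        · exact Submodule.smul_mem _ _ (Submodule.subset_span ⟨hu, t, htI, ht⟩)
        · simp [htI]
      have h2 : N.starProjection e ∈ closure ((Submodule.span ℝ G : Submodule ℝ L) : Set L) :=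
        N.starProjection_apply_mem e
      exact map_mem_closure (t := ((Submodule.span ℝ GI : Submodule ℝ L) : Set L))
        (hH.P I).continuous h2 fun x hx => h1 hx
    have hcont : Continuous fun z : L => ‖y‖ ^ 2 - ‖y - z‖ ^ 2 := by fun_prop
    have hopen : IsOpen {z : L | c < ‖y‖ ^ 2 - ‖y - z‖ ^ 2} := isOpen_lt continuous_const hcont
    obtain ⟨z, hz1, hz2⟩ := mem_closure_iff.1 hycl _ hopen (by simpa using hc)
    exact ⟨z, hz2, by rw [key z hz2]; exact hz1⟩
  · rintro ⟨z, hz, hc⟩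
    rw [key z hz] at hc
    linarith [sq_nonneg ‖y - z‖]

lemma ndSpectrum_iff (p q : ℝ) {ι : Type*} {e : ι → L}
    (he : (Submodule.span ℝ (Set.range e)).topologicalClosure = ⊤) :
    Set.Ioo p q ∩ spectrumOn Γ (Submodule.span ℝ G).topologicalClosure = ∅ ↔
      ∀ i, ‖hH.P (Set.Ioo p q)
        ((Submodule.span ℝ G).topologicalClosure.starProjection (e i))‖ ^ 2 = 0 := by
  rw [hH.Ioo_inter_spectrumOn_iff_of_total (hH.reducing_eigenvectors hG) he
    (d := fun i => (Submodule.span ℝ G).topologicalClosure.starProjection (e i))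
    (fun i => Submodule.starProjection_apply_mem _ _)
    (fun i => Submodule.sub_starProjection_mem_orthogonal _)]
  simp

omit hG in
lemma reducing_inf_orthogonal {W₁ W₂ : Submodule ℝ L} (h₁ : hH.Reducing W₁) (h₂ : hH.Reducing W₂) :
    hH.Reducing (W₁ ⊓ W₂ᗮ) := by
  refine ⟨inf_le_left.trans h₁.le, h₁.isClosed.inter (Submodule.isClosed_orthogonal _),
    fun h hh f hf => ⟨h₁.T_mem h hh f hf.1, ?_⟩⟩
  rw [SetLike.mem_coe, Submodule.mem_orthogonal']
  intro g hg
  rw [hH.contraction.T_symm hh]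
  exact (Submodule.mem_orthogonal' _ _).1 hf.2 _ (h₂.T_mem h hh g hg)

omit hG in
lemma reducing_ppSubspace : hH.Reducing (ppSubspace Γ V) :=
  hH.reducing_spectralSubspace fun _ _ h ⟨s, hs, h0⟩ => ⟨s, hs, h h0⟩

/-- The eigenvectors in G lie in the pure point subspace, so by Pythagoras the remaining pure point
component of e i vanishes on (p, q) exactly when the two squared norms agree. -/
lemma ppTilde_iff (p q : ℝ) {ι : Type*} {e : ι → L}
    (he : (Submodule.span ℝ (Set.range e)).topologicalClosure = ⊤) {M : ι → Set ℝ}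
    (hM : ∀ i, MeasurableSet (M i)) (h1 : ∀ i, PurePoint ((hH.σ (e i)).restrict (M i)))
    (h2 : ∀ i, ∀ ν : Measure ℝ, PurePoint ν →
      ((hH.σ (e i)).restrict (M i)ᶜ).MutuallySingular ν) :
    Set.Ioo p q ∩ spectrumOn Γ (ppSubspace Γ V ⊓ (Submodule.span ℝ G).topologicalClosureᗮ) = ∅ ↔
      ∀ i, (hH.σ (e i)).real (Set.Ioo p q ∩ M i) = ‖hH.P (Set.Ioo p q)
        ((Submodule.span ℝ G).topologicalClosure.starProjection (e i))‖ ^ 2 := by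
  set N := (Submodule.span ℝ G).topologicalClosure with hN
  set I := Set.Ioo p q with hI
  have hIm : MeasurableSet I := measurableSet_Ioo
  have hNred : hH.Reducing N := hH.reducing_eigenvectors hG
  have hred := hH.reducing_inf_orthogonal hH.reducing_ppSubspace hNred
  have hpp := fun i => hH.P_mem_and_sub_mem_orthogonal (hM i) (h1 i) (h2 i)
  have hNpp : N ≤ ppSubspace Γ V := hH.eigenvectors_le_ppSubspace hG
  have hd : ∀ i, hH.P (M i) (e i) - N.starProjection (e i) ∈ ppSubspace Γ V ⊓ Nᗮ := by
    intro i
    refine ⟨Submodule.sub_mem _ (hpp i).1 (hNpp (N.starProjection_apply_mem _)), ?_⟩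
    have : hH.P (M i) (e i) - N.starProjection (e i) =
        (e i - N.starProjection (e i)) - (e i - hH.P (M i) (e i)) := by abel
    rw [this]
    exact Submodule.sub_mem _ (N.sub_starProjection_mem_orthogonal _)
      (Submodule.orthogonal_le hNpp (hpp i).2)
  rw [hH.Ioo_inter_spectrumOn_iff_of_total hred he hd]
  · refine forall_congr' fun i => ?_
    set z := hH.P I (N.starProjection (e i)) with hz
    set y := hH.P I (hH.P (M i) (e i)) with hy
    have hzN : z ∈ N := Reducing.P_mem hH hNred hIm (N.starProjection_apply_mem _)
    have hyz : hH.P I (hH.P (M i) (e i) - N.starProjection (e i)) = y - z := map_sub _ _ _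
    have horth : inner ℝ (y - z) z = 0 := by
      have h3 := Reducing.P_mem hH hred hIm (hd i)
      rw [hyz] at h3
      exact (Submodule.mem_orthogonal' _ _).1 h3.2 z hzN
    have hnorm : ‖y‖ ^ 2 = ‖y - z‖ ^ 2 + ‖z‖ ^ 2 := by
      have : y = (y - z) + z := by abel
      nth_rewrite 1 [this]
      rw [norm_add_sq_real, horth]
      ring
    have hσ : (hH.σ (e i)).real (I ∩ M i) = ‖y‖ ^ 2 := by
      rw [hy, hH.P_inter_apply hIm (hM i), hH.norm_P_sq (hIm.inter (hM i))]
    rw [hyz, hσ, hnorm]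
    simp
  · intro i
    have : e i - (hH.P (M i) (e i) - N.starProjection (e i)) =
      (e i - hH.P (M i) (e i)) + N.starProjection (e i) := by abel
    rw [this]
    refine Submodule.add_mem _ (Submodule.orthogonal_le inf_le_left (hpp i).2) ?_
    exact Submodule.orthogonal_le inf_le_right
      (Submodule.le_orthogonal_orthogonal N (N.starProjection_apply_mem _))

end IsResolvent

/-! ### Absolutely continuous, singular continuous and atomic parts of a measure, as restrictions -/

section Decomposition

variable {σ : Measure ℝ}

lemma countable_atoms (σ : Measure ℝ) [IsFiniteMeasure σ] : {t : ℝ | σ {t} ≠ 0}.Countable := by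
  have := Measure.countable_meas_pos_of_disjoint_iUnion (μ := σ) (As := fun t : ℝ => {t})
    (fun t => measurableSet_singleton t) (fun s t hst => by simpa using hst)
  simpa [pos_iff_ne_zero] using this

lemma atoms_null {s : Set ℝ} (hs : s.Countable) (ν : Measure ℝ) (h : ∀ t ∈ s, ν {t} = 0) :
    ν s = 0 := by
  rw [← Set.biUnion_of_singleton s, measure_biUnion_null_iff hs]
  exact h

lemma purePoint_restrict_atoms [IsFiniteMeasure σ] : PurePoint (σ.restrict {t | σ {t} ≠ 0}) :=
  ⟨_, countable_atoms σ, by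
    rw [Measure.restrict_apply (countable_atoms σ).measurableSet.compl]; simp⟩

/-- A countable carrier of ν meets the complement of the atoms of σ in a countable set of points
without mass. -/
lemma mutuallySingular_restrict_compl_atoms {ν : Measure ℝ} (hν : PurePoint ν) :
    (σ.restrict {t | σ {t} ≠ 0}ᶜ).MutuallySingular ν := by
  obtain ⟨s, hs, h0⟩ := hν
  refine ⟨s, hs.measurableSet, ?_, h0⟩
  rw [Measure.restrict_apply hs.measurableSet]
  refine atoms_null (hs.mono Set.inter_subset_left) _ fun t ht => ?_
  simpa using ht.2

variable {N : Set ℝ} (hNm : MeasurableSet N) (hN : volume N = 0)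
  (hN' : ∀ A, volume A = 0 → σ (A ∩ Nᶜ) = 0)

include hN'

lemma restrict_compl_absolutelyContinuous : σ.restrict Nᶜ ≪ volume := by
  refine Measure.AbsolutelyContinuous.mk fun A hA h0 => ?_
  rw [Measure.restrict_apply hA]
  exact hN' A h0

include hNm hN

omit hN' in
lemma mutuallySingular_restrict_of_absolutelyContinuous {ν : Measure ℝ} (hν : ν ≪ volume) :
    (σ.restrict Nᶜᶜ).MutuallySingular ν := by
  refine ⟨Nᶜ, hNm.compl, ?_, ?_⟩
  · rw [Measure.restrict_apply hNm.compl]; simp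
  · rw [compl_compl]; exact hν hN

omit hN' in
lemma singularContinuous_restrict : SingularContinuous (σ.restrict (N \ {t | σ {t} ≠ 0})) := by
  refine ⟨fun t => ?_, Nᶜ, hNm.compl, ?_, by rwa [compl_compl]⟩
  · rw [Measure.restrict_apply (measurableSet_singleton t)]
    by_cases ht : σ {t} = 0
    · exact measure_mono_null Set.inter_subset_left ht
    · have : ({t} : Set ℝ) ∩ (N \ {t | σ {t} ≠ 0}) = ∅ := by
        ext x
        simp only [Set.mem_inter_iff, Set.mem_singleton_iff, Set.mem_sdiff, Set.mem_empty_iff_false,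
          iff_false, not_and, not_not]
        rintro rfl _
        exact ht
      rw [this, measure_empty]
  · rw [Measure.restrict_apply hNm.compl]
    have : Nᶜ ∩ (N \ {t | σ {t} ≠ 0}) = ∅ := by
      ext x
      simp only [Set.mem_inter_iff, Set.mem_compl_iff, Set.mem_sdiff, Set.mem_empty_iff_false,
        iff_false, not_and]
      tauto
    rw [this, measure_empty]

omit hNm hN in
-- ν lives on a Lebesgue-null set and ignores the countably many atoms of σ. Outside of N the
-- measure σ ignores Lebesgue-null sets, and what remains of it inside N is atomic.
lemma mutuallySingular_restrict_of_singularContinuous [IsFiniteMeasure σ] {ν : Measure ℝ}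
    (hν : SingularContinuous ν) :
    (σ.restrict (N \ {t | σ {t} ≠ 0})ᶜ).MutuallySingular ν := by
  obtain ⟨h0, C, hC, h1, h2⟩ := hν
  have hat := (countable_atoms σ).measurableSet
  refine ⟨Cᶜ \ {t | σ {t} ≠ 0}, hC.compl.diff hat, ?_, ?_⟩
  · rw [Measure.restrict_apply (hC.compl.diff hat)]
    refine measure_mono_null (fun x hx => ?_) (hN' Cᶜ h2)
    simp only [Set.mem_inter_iff, Set.mem_sdiff, Set.mem_compl_iff] at hx ⊢
    tauto
  · refine measure_mono_null (t := C ∪ {t | σ {t} ≠ 0}) (fun x hx => ?_)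
      (measure_union_null h1 (atoms_null (countable_atoms σ) _ fun t _ => h0 t))
    simp only [Set.mem_union, Set.mem_sdiff, Set.mem_compl_iff] at hx ⊢
    tauto

end Decomposition

end SpectralSubspaces

/-! ### Measurable families of operators -/

section MeasurableFields

open ProbabilityTheory

variable {Ω : Type*} [MeasurableSpace Ω]

/-- Measurability of a family of finite measures on `[0, 1]` follows from that of the moments. -/
lemma measurable_of_moments {μ : Ω → Measure ℝ} [∀ ω, IsFiniteMeasure (μ ω)]
    (hμ : ∀ ω, μ ω (Set.Icc 0 1)ᶜ = 0) (h : ∀ k : ℕ, Measurable fun ω => ∫ s, s ^ k ∂(μ ω)) :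
    Measurable μ := by
  have hpoly : ∀ p : Polynomial ℝ, Measurable fun ω => ∫ s, p.eval s ∂(μ ω) := by
    intro p
    have : (fun ω => ∫ s, p.eval s ∂(μ ω)) =
        fun ω => ∑ i ∈ Finset.range (p.natDegree + 1), p.coeff i * ∫ s, s ^ i ∂(μ ω) := by
      ext ω
      simp only [Polynomial.eval_eq_sum_range]
      rw [integral_finsetSum _ fun i _ =>
        (BddMeas.of_continuous (by fun_prop)).integrable (hμ ω)]
      simp only [integral_const_mul]
    rw [this]
    exact Finset.measurable_fun_sum _ fun i _ => (h i).const_mul _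
  -- Weierstrass approximation with explicit accuracy 1/(n + 1): the polynomials do not depend on ω,
  -- so the limit is one of measurable functions.
  have hcont : ∀ g : ℝ → ℝ, Continuous g → Measurable fun ω => ∫ s, g s ∂(μ ω) := by
    intro g hg
    have hex : ∀ n : ℕ, ∃ p : Polynomial ℝ, ∀ x ∈ Set.Icc (0 : ℝ) 1,
        |p.eval x - g x| < ((n : ℝ) + 1)⁻¹ := fun n =>
      exists_polynomial_near_of_continuousOn 0 1 g hg.continuousOn _ (by positivity)
    choose p hp using hex
    refine measurable_of_tendsto_metrizable (fun n => hpoly (p n)) (tendsto_pi_nhds.2 fun ω => ?_)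
    rw [tendsto_iff_norm_sub_tendsto_zero]
    have hlim : Tendsto (fun n : ℕ => ((n : ℝ) + 1)⁻¹ * (μ ω).real Set.univ) atTop (𝓝 0) := by
      have := tendsto_one_div_add_atTop_nhds_zero_nat (𝕜 := ℝ)
      simpa using this.mul_const ((μ ω).real Set.univ)
    refine squeeze_zero (fun n => norm_nonneg _) (fun n => ?_) hlim
    rw [← integral_sub ((BddMeas.of_continuous (by fun_prop)).integrable (hμ ω))
      ((BddMeas.of_continuous hg).integrable (hμ ω))]
    refine norm_integral_le_of_norm_le_const ?_
    have : ∀ᵐ x ∂(μ ω), x ∈ Set.Icc (0 : ℝ) 1 := hμ ω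
    filter_upwards [this] with x hx using (hp n x hx).le
  -- Closed sets form a generating π-system, and their indicators are pointwise limits of continuous
  -- thickened indicators.
  refine Measurable.measure_of_isPiSystem (S := {s | IsClosed s})
    (BorelSpace.measurable_eq.trans borel_eq_generateFrom_isClosed) isPiSystem_isClosed ?_ ?_
  · intro F hF
    have hcl : ∀ ω, μ ω F = ENNReal.ofReal ((μ ω).real F) := fun ω => (ofReal_measureReal).symm
    simp only [hcl]
    refine ENNReal.measurable_ofReal.comp ?_
    have happ : ∀ n : ℕ, Measurable fun ω => ∫ s,
        ((thickenedIndicator (δ := ((n : ℝ) + 1)⁻¹) (by positivity) F s : NNReal) : ℝ) ∂(μ ω) :=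
      fun n => hcont _ (by fun_prop)
    refine measurable_of_tendsto_metrizable happ (tendsto_pi_nhds.2 fun ω => ?_)
    have hlim := tendsto_integral_of_dominated_convergence (μ := μ ω)
      (F := fun (n : ℕ) s =>
        ((thickenedIndicator (δ := ((n : ℝ) + 1)⁻¹) (by positivity) F s : NNReal) : ℝ))
      (f := F.indicator fun _ => (1 : ℝ)) (fun _ => 1)
      (fun n => (by fun_prop : Continuous _).aestronglyMeasurable) (integrable_const _)
      (fun n => Eventually.of_forall fun s => by
        rw [Real.norm_eq_abs, abs_of_nonneg (NNReal.coe_nonneg _)]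
        exact_mod_cast thickenedIndicator_le_one _ F s)
      (Eventually.of_forall fun s => by
        have h1 := thickenedIndicator_tendsto_indicator_closure
          (δseq := fun n : ℕ => ((n : ℝ) + 1)⁻¹) (fun n => by positivity)
          (by simpa using tendsto_one_div_add_atTop_nhds_zero_nat (𝕜 := ℝ)) F
        rw [hF.closure_eq] at h1
        have h2 := (tendsto_pi_nhds.1 h1) s
        have h3 := (NNReal.continuous_coe.tendsto _).comp h2
        have h4 : ((F.indicator (fun _ => (1 : NNReal)) s : NNReal) : ℝ) =
            F.indicator (fun _ => (1 : ℝ)) s := by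
          by_cases hs : s ∈ F <;> simp [hs]
        rw [h4] at h3
        exact h3)
    rw [← Pi.one_def, integral_indicator_one hF.measurableSet] at hlim
    exact hlim
  · have h0 : ∀ ω, μ ω Set.univ = ENNReal.ofReal (∫ s, s ^ 0 ∂(μ ω)) := fun ω => by simp
    simp only [h0]
    exact ENNReal.measurable_ofReal.comp (h 0)

/-! ### Measurable fields of vectors and operators over varying Hilbert spaces -/

section Fields

variable {L : Ω → Type*} [∀ ω, NormedAddCommGroup (L ω)] [∀ ω, InnerProductSpace ℝ (L ω)]
  {ι : Type*} (e : ι → ∀ ω, L ω)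

/-- Measurable vector fields with respect to a fundamental family `e`. -/
def MeasurableField (x : ∀ ω, L ω) : Prop := ∀ i, Measurable fun ω => inner ℝ (x ω) (e i ω)

variable {e} [Countable ι]
  (he : ∀ ω, (Submodule.span ℝ (Set.range fun i => e i ω)).topologicalClosure = ⊤)
  (hin : ∀ i j, Measurable fun ω => inner ℝ (e i ω) (e j ω))

include he in
omit [MeasurableSpace Ω] [Countable ι] in
-- The closure of the rational combinations is stable under real multiples, by density of ℚ, so it
-- is a closed subspace containing the total family.
lemma dense_rat_combinations (ω : Ω) :
    Dense (Set.range fun c : ι →₀ ℚ => c.sum fun i q => (q : ℝ) • e i ω) := by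
  let φ : (ι →₀ ℚ) →+ L ω := Finsupp.liftAddHom fun i =>
    ((AddMonoidHom.flip (smulAddHom ℝ (L ω))) (e i ω)).comp (Rat.castHom ℝ).toAddMonoidHom
  have hφ : ∀ c, φ c = c.sum fun i q => (q : ℝ) • e i ω := fun c => rfl
  let D : AddSubgroup (L ω) := φ.range.topologicalClosure
  have hD : (D : Set (L ω)) = closure (Set.range φ) := rfl
  have hratφ : ∀ (q : ℚ) c, (q : ℝ) • φ c = φ (q • c) := by
    intro q c
    rw [hφ, hφ, Finsupp.sum_smul_index' (by simp), Finsupp.smul_sum]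
    simp [smul_smul]
  have hrat : ∀ (q : ℚ), ∀ x ∈ D, (q : ℝ) • x ∈ D := by
    intro q x hx
    refine map_mem_closure (continuous_const_smul (q : ℝ)) hx ?_
    rintro _ ⟨c, rfl⟩
    exact ⟨q • c, (hratφ q c).symm⟩
  have hreal : ∀ (r : ℝ), ∀ x ∈ D, r • x ∈ D := by
    intro r x hx
    have h1 : r ∈ closure (Set.range ((↑) : ℚ → ℝ)) := by
      rw [Rat.denseRange_cast.closure_range]; trivial
    have h2 : Continuous fun r : ℝ => r • x := by fun_prop
    have h3 := map_mem_closure (t := (D : Set (L ω))) h2 h1 (by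
      rintro _ ⟨q, rfl⟩
      exact hrat q x hx)
    rwa [hD, closure_closure, ← hD] at h3
  let D' : Submodule ℝ (L ω) :=
    { D with smul_mem' := fun r x hx => hreal r x hx }
  have hle : (⊤ : Submodule ℝ (L ω)) ≤ D' := by
    rw [← he ω]
    refine Submodule.topologicalClosure_minimal _ (Submodule.span_le.2 ?_) isClosed_closure
    rintro _ ⟨i, rfl⟩
    refine subset_closure ⟨Finsupp.single i 1, ?_⟩
    rw [hφ]
    simp
  intro x
  exact hle (trivial : x ∈ (⊤ : Submodule ℝ (L ω)))

omit [Countable ι] in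
lemma MeasurableField.add {x y : ∀ ω, L ω} (hx : MeasurableField e x) (hy : MeasurableField e y) :
    MeasurableField e fun ω => x ω + y ω := fun i => by
  simp only [inner_add_left]
  exact (hx i).add (hy i)

omit [Countable ι] in
lemma MeasurableField.sub {x y : ∀ ω, L ω} (hx : MeasurableField e x) (hy : MeasurableField e y) :
    MeasurableField e fun ω => x ω - y ω := fun i => by
  simp only [inner_sub_left]
  exact (hx i).sub (hy i)

include he hin

/-- ‖x‖² is the supremum of 2⟨x, z⟩ - ‖z‖² over the countable dense set of rational combinations of
the e i, and each term is measurable. -/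
lemma MeasurableField.norm_sq {x : ∀ ω, L ω} (hx : MeasurableField e x) :
    Measurable fun ω => ‖x ω‖ ^ 2 := by
  refine measurable_of_Ioi fun a => ?_
  let E : (ι →₀ ℚ) → ∀ ω, L ω := fun c ω => c.sum fun i q => (q : ℝ) • e i ω
  have hEx : ∀ c, Measurable fun ω => inner ℝ (x ω) (E c ω) := by
    intro c
    simp only [E, Finsupp.sum, inner_sum, inner_smul_right]
    exact Finset.measurable_fun_sum _ fun i _ => (hx i).const_mul _
  have hEE : ∀ c, Measurable fun ω => ‖E c ω‖ ^ 2 := by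
    intro c
    simp only [← real_inner_self_eq_norm_sq, E, Finsupp.sum, inner_sum, sum_inner, inner_smul_right,
      inner_smul_left]
    exact Finset.measurable_fun_sum _ fun i _ => (Finset.measurable_fun_sum _ fun j _ =>
      (hin j i).const_mul _).const_mul _
  have hset : (fun ω => ‖x ω‖ ^ 2) ⁻¹' Set.Ioi a =
      ⋃ c : ι →₀ ℚ, {ω | a < 2 * inner ℝ (x ω) (E c ω) - ‖E c ω‖ ^ 2} := by
    ext ω
    simp only [Set.mem_preimage, Set.mem_Ioi, Set.mem_iUnion, Set.mem_ofPred_eq]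
    have key : ∀ z : L ω, 2 * inner ℝ (x ω) z - ‖z‖ ^ 2 = ‖x ω‖ ^ 2 - ‖x ω - z‖ ^ 2 := fun z => by
      rw [norm_sub_sq_real]; ring
    simp only [key]
    constructor
    · intro h
      have hopen : IsOpen {z : L ω | a < ‖x ω‖ ^ 2 - ‖x ω - z‖ ^ 2} :=
        isOpen_lt continuous_const (by fun_prop)
      obtain ⟨z, hz1, c, rfl⟩ := (dense_rat_combinations he ω).inter_open_nonempty _ hopen
        ⟨x ω, by simpa using h⟩
      exact ⟨c, hz1⟩
    · rintro ⟨c, hc⟩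
      linarith [sq_nonneg ‖x ω - E c ω‖]
  rw [hset]
  exact MeasurableSet.iUnion fun c =>
    measurableSet_lt measurable_const (((hEx c).const_mul 2).sub (hEE c))

lemma MeasurableField.measurable_inner {x y : ∀ ω, L ω} (hx : MeasurableField e x)
    (hy : MeasurableField e y) :
    Measurable fun ω => inner ℝ (x ω) (y ω) := by
  have h1 := (hx.add hy).norm_sq he hin
  have h2 := (hx.sub hy).norm_sq he hin
  have : (fun ω => inner ℝ (x ω) (y ω)) = fun ω => (‖x ω + y ω‖ ^ 2 - ‖x ω - y ω‖ ^ 2) / 4 := by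
    ext ω
    rw [norm_add_sq_real, norm_sub_sq_real]
    ring
  rw [this]
  exact (h1.sub h2).div_const 4

variable {R : ∀ ω, L ω →L[ℝ] L ω} (hR : ∀ ω, IsPosContraction (R ω))
  (hRm : ∀ i j, Measurable fun ω => inner ℝ (R ω (e i ω)) (e j ω))

include hR hRm in
-- By symmetry ⟨R x, e i⟩ = ⟨x, R e i⟩, an inner product of two measurable fields.
lemma MeasurableField.resolvent_apply {x : ∀ ω, L ω} (hx : MeasurableField e x) :
    MeasurableField e fun ω => R ω (x ω) := by
  intro i
  have h1 : MeasurableField e fun ω => R ω (e i ω) := fun j => hRm i j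
  have h2 := hx.measurable_inner he hin h1
  simpa only [(hR _).symm] using h2

include hR hRm in
-- The moments are the numbers ⟨R^k e i, e i⟩, and R preserves measurable fields.
lemma measurable_σ (i : ι) : Measurable fun ω => (hR ω).σ (e i ω) := by
  refine measurable_of_moments (fun ω => (hR ω).σ_compl _) fun k => ?_
  have h1 : ∀ k : ℕ, MeasurableField e fun ω => (R ω ^ k) (e i ω) := by
    intro k
    induction k with
    | zero => exact fun j => by simpa using hin i j
    | succ k ih =>
      have := MeasurableField.resolvent_apply he hin hR hRm ih
      have h2 : ∀ ω, (R ω ^ (k + 1)) (e i ω) = R ω ((R ω ^ k) (e i ω)) := fun ω => by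
        rw [pow_succ']; rfl
      simpa only [h2] using this
  simp only [(hR _).integral_pow]
  exact h1 k i

end Fields

end MeasurableFields

/-! ### Measurability of the components of the spectrum -/

section MeasurableSpectra

open ProbabilityTheory

variable {Ω : Type*} [MeasurableSpace Ω]

/-! ### Singular supports and atoms that depend measurably on the parameter -/

section Kernels

variable {μ : Ω → Measure ℝ} [∀ ω, IsFiniteMeasure (μ ω)] (hμ : Measurable μ)

include hμ

omit [∀ ω, IsFiniteMeasure (μ ω)] in
-- The normalization makes the masses uniformly bounded, as a finite kernel requires, and keeps the
-- null sets.
lemma exists_finiteKernel : ∃ κ : Kernel Ω ℝ, IsFiniteKernel κ ∧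
    ∀ ω, κ ω = (1 + μ ω Set.univ)⁻¹ • μ ω := by
  have hm : ∀ A, MeasurableSet A → Measurable fun ω => μ ω A := fun A hA =>
    (Measure.measurable_coe hA).comp hμ
  refine ⟨⟨fun ω => (1 + μ ω Set.univ)⁻¹ • μ ω, ?_⟩, ⟨⟨1, ENNReal.one_lt_top, fun ω => ?_⟩⟩,
    fun ω => rfl⟩
  · refine Measure.measurable_of_measurable_coe _ fun A hA => ?_
    simp only [Measure.smul_apply, smul_eq_mul]
    exact (measurable_const.add (hm _ MeasurableSet.univ)).inv.mul (hm A hA)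
  · change ((1 + μ ω Set.univ)⁻¹ • μ ω) Set.univ ≤ 1
    rw [Measure.smul_apply, smul_eq_mul, mul_comm, ← div_eq_mul_inv]
    exact ENNReal.div_le_of_le_mul (by rw [one_mul]; exact le_add_self)

/-- Lebesgue decomposition of kernels, relative to a finite measure with the same null sets as
Lebesgue measure. Joint measurability of N is the point. -/
lemma exists_measurable_singular_support : ∃ N : Set (Ω × ℝ), MeasurableSet N ∧ ∀ ω,
    volume (Prod.mk ω ⁻¹' N) = 0 ∧
      ∀ A : Set ℝ, volume A = 0 → μ ω (A ∩ (Prod.mk ω ⁻¹' N)ᶜ) = 0 := by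
  obtain ⟨κ, hκ, h⟩ := exists_finiteKernel hμ
  set η : Kernel Ω ℝ := Kernel.const Ω (volume : Measure ℝ).toFinite with hη
  refine ⟨Kernel.mutuallySingularSet κ η, Kernel.measurableSet_mutuallySingularSet κ η, fun ω => ?_⟩
  have hsl : Prod.mk ω ⁻¹' Kernel.mutuallySingularSet κ η = Kernel.mutuallySingularSetSlice κ η ω :=
    rfl
  rw [hsl]
  have hms := Kernel.measurableSet_mutuallySingularSetSlice κ η ω
  constructor
  · have := Kernel.measure_mutuallySingularSetSlice κ η ω
    rwa [hη, Kernel.const_apply, toFinite_apply_eq_zero_iff] at this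
  · intro A hA
    obtain ⟨B, hAB, hB, hB0⟩ := exists_measurable_superset_of_null hA
    refine measure_mono_null (Set.inter_subset_inter_left _ hAB) ?_
    have h1 := Kernel.withDensity_rnDeriv_of_subset_compl_mutuallySingularSetSlice (κ := κ) (η := η)
      (hB.inter hms.compl) Set.inter_subset_right
    rw [Kernel.withDensity_apply' _ (Kernel.measurable_rnDeriv κ η), setLIntegral_measure_zero, h,
      Measure.smul_apply, smul_eq_mul] at h1
    · rcases mul_eq_zero.1 h1.symm with h2 | h2
      · exact absurd h2 (ENNReal.inv_ne_zero.2 (by finiteness))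
      · exact h2
    · rw [hη, Kernel.const_apply, toFinite_apply_eq_zero_iff]
      exact measure_mono_null Set.inter_subset_left hB0

lemma measurable_measure_slice {N : Set (Ω × ℝ)} (hN : MeasurableSet N) :
    Measurable fun ω => μ ω (Prod.mk ω ⁻¹' N) := by
  obtain ⟨κ, hκ, h⟩ := exists_finiteKernel hμ
  have h1 := Kernel.measurable_kernel_prodMk_left (κ := κ) hN
  have h2 : (fun ω => μ ω (Prod.mk ω ⁻¹' N)) =
      fun ω => (1 + μ ω Set.univ) * κ ω (Prod.mk ω ⁻¹' N) := by
    ext ω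
    rw [h, Measure.smul_apply, smul_eq_mul, ← mul_assoc, ENNReal.mul_inv_cancel, one_mul]
    · simp
    · finiteness
  rw [h2]
  exact (measurable_const.add ((Measure.measurable_coe MeasurableSet.univ).comp hμ)).mul h1

/-- The mass of {t} is the mass of a slice of the diagonal, when (ω, t) is taken as the parameter.
-/
lemma measurableSet_atoms : MeasurableSet {p : Ω × ℝ | μ p.1 {p.2} ≠ 0} := by
  have h1 : Measurable fun p : Ω × ℝ => μ p.1 := hμ.comp measurable_fst
  have hD : MeasurableSet {p : (Ω × ℝ) × ℝ | p.2 = p.1.2} :=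
    measurableSet_eq_fun measurable_snd (measurable_snd.comp measurable_fst)
  have h2 := measurable_measure_slice h1 hD
  have h3 : (fun p : Ω × ℝ => μ p.1 (Prod.mk p ⁻¹' {p : (Ω × ℝ) × ℝ | p.2 = p.1.2})) =
      fun p : Ω × ℝ => μ p.1 {p.2} := by
    ext p
    congr 1
  rw [h3] at h2
  exact (h2 (measurableSet_singleton 0)).compl

end Kernels

/-! ### Measurability of the event that a part of the spectrum misses an interval -/

section Spectra

variable {L : Ω → Type*} [∀ ω, NormedAddCommGroup (L ω)] [∀ ω, InnerProductSpace ℝ (L ω)]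
  [∀ ω, CompleteSpace (L ω)] {ι : Type*} [Countable ι] {e : ι → ∀ ω, L ω}
  (he : ∀ ω, (Submodule.span ℝ (Set.range fun i => e i ω)).topologicalClosure = ⊤)
  (hin : ∀ i j, Measurable fun ω => inner ℝ (e i ω) (e j ω))
  {Γ : ∀ ω, Set (L ω × L ω)} {V : ∀ ω, Submodule ℝ (L ω)} {R : ∀ ω, L ω →L[ℝ] L ω}
  (hH : ∀ ω, IsResolvent (Γ ω) (V ω) (R ω))
  (hRm : ∀ i j, Measurable fun ω => inner ℝ (R ω (e i ω)) (e j ω))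

include he hin hRm in
omit [∀ ω, CompleteSpace (L ω)] in
lemma measurable_spectralMeasure (i : ι) : Measurable fun ω => (hH ω).σ (e i ω) := by
  have h1 := measurable_σ he hin (fun ω => (hH ω).contraction) hRm i
  refine Measure.measurable_of_measurable_coe _ fun A hA => ?_
  simp only [(hH _).σ_apply hA]
  exact (Measure.measurable_coe (measurableSet_specLift hA)).comp h1

include he hin hH hRm

/-- The slices of M i project e i on the spectral subspace, so the event says that countably many
spectral masses vanish. -/
lemma measurableSet_inter_spectralSubspace (p : Measure ℝ → Prop)
    (hp : ∀ μ ν : Measure ℝ, ν ≪ μ → p μ → p ν) {M : ι → Set (Ω × ℝ)}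
    (hM : ∀ i, MeasurableSet (M i))
    (h1 : ∀ i ω, p (((hH ω).σ (e i ω)).restrict (Prod.mk ω ⁻¹' M i)))
    (h2 : ∀ i ω (ν : Measure ℝ), p ν →
      (((hH ω).σ (e i ω)).restrict (Prod.mk ω ⁻¹' M i)ᶜ).MutuallySingular ν) (a b : ℝ) :
    MeasurableSet {ω | Set.Ioo a b ∩ spectrumOn (Γ ω) (spectralSubspace (Γ ω) (V ω) p) = ∅} := by
  have hMs : ∀ i ω, MeasurableSet (Prod.mk ω ⁻¹' M i) := fun i ω => measurable_prodMk_left (hM i)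
  have hset : {ω | Set.Ioo a b ∩ spectrumOn (Γ ω) (spectralSubspace (Γ ω) (V ω) p) = ∅} =
      ⋂ i, {ω | (hH ω).σ (e i ω) (Prod.mk ω ⁻¹' (Prod.snd ⁻¹' Set.Ioo a b ∩ M i)) = 0} := by
    ext ω
    have hP := fun i => (hH ω).P_mem_and_sub_mem_orthogonal (hMs i ω) (h1 i ω) (h2 i ω)
    rw [Set.mem_ofPred_eq, (hH ω).Ioo_inter_spectrumOn_iff_of_total
      ((hH ω).reducing_spectralSubspace hp) (he ω) (fun i => (hP i).1) (fun i => (hP i).2)]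
    simp only [Set.mem_iInter, Set.mem_ofPred_eq]
    refine forall_congr' fun i => ?_
    rw [(hH ω).P_inter_apply measurableSet_Ioo (hMs i ω),
      (hH ω).P_eq_zero_iff (measurableSet_Ioo.inter (hMs i ω))]
    rfl
  rw [hset]
  refine MeasurableSet.iInter fun i => ?_
  exact measurable_measure_slice (measurable_spectralMeasure he hin hH hRm i)
    ((measurable_snd measurableSet_Ioo).inter (hM i)) (measurableSet_singleton 0)

/-- The full spectrum is the case of the property that holds for every measure. -/
lemma measurableSet_inter_spectrum (a b : ℝ) :
    MeasurableSet {ω | Set.Ioo a b ∩ spectrumOn (Γ ω) (V ω) = ∅} := by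
  have hV : ∀ ω, spectralSubspace (Γ ω) (V ω) (fun _ => True) = V ω := by
    intro ω
    rw [(hH ω).spectralSubspace_eq]
    simp only [and_true]
    have : {f | f ∈ V ω} = (V ω : Set (L ω)) := rfl
    rw [this, Submodule.span_eq]
    exact (hH ω).isClosed.submodule_topologicalClosure_eq
  have := measurableSet_inter_spectralSubspace he hin hH hRm (fun _ => True)
    (fun _ _ _ _ => trivial) (M := fun _ => Set.univ) (fun _ => MeasurableSet.univ)
    (fun _ _ => trivial) (fun i ω ν _ => by simp) a b
  simpa only [hV] using this

lemma measurableSet_inter_acSpectrum (a b : ℝ) :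
    MeasurableSet {ω | Set.Ioo a b ∩ spectrumOn (Γ ω) (acSubspace (Γ ω) (V ω)) = ∅} := by
  have hσ := measurable_spectralMeasure he hin hH hRm
  choose N hN h1 using fun i => exists_measurable_singular_support (hσ i)
  refine measurableSet_inter_spectralSubspace he hin hH hRm _ (fun μ ν h h' => h.trans h')
    (M := fun i => (N i)ᶜ) (fun i => (hN i).compl) (fun i ω => ?_) (fun i ω ν hν => ?_) a b
  · exact restrict_compl_absolutelyContinuous (h1 i ω).2
  · exact mutuallySingular_restrict_of_absolutelyContinuous (measurable_prodMk_left (hN i))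
      (h1 i ω).1 hν

lemma measurableSet_inter_scSpectrum (a b : ℝ) :
    MeasurableSet {ω | Set.Ioo a b ∩ spectrumOn (Γ ω) (scSubspace (Γ ω) (V ω)) = ∅} := by
  have hσ := measurable_spectralMeasure he hin hH hRm
  choose N hN h1 using fun i => exists_measurable_singular_support (hσ i)
  refine measurableSet_inter_spectralSubspace he hin hH hRm _
    (fun μ ν h h' => ⟨fun t => h (h'.1 t), h'.2.mono_ac h Measure.AbsolutelyContinuous.rfl⟩)
    (M := fun i => N i \ {p : Ω × ℝ | (hH p.1).σ (e i p.1) {p.2} ≠ 0})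
    (fun i => (hN i).diff (measurableSet_atoms (hσ i))) (fun i ω => ?_) (fun i ω ν hν => ?_) a b
  · exact singularContinuous_restrict (measurable_prodMk_left (hN i)) (h1 i ω).1
  · exact mutuallySingular_restrict_of_singularContinuous  
      (h1 i ω).2 hν

lemma measurableSet_inter_ppSpectrum (a b : ℝ) :
    MeasurableSet {ω | Set.Ioo a b ∩ spectrumOn (Γ ω) (ppSubspace (Γ ω) (V ω)) = ∅} := by
  have hσ := measurable_spectralMeasure he hin hH hRm
  refine measurableSet_inter_spectralSubspace he hin hH hRm _
    (fun _ _ h ⟨s, hs, h0⟩ => ⟨s, hs, h h0⟩)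
    (M := fun i => {p : Ω × ℝ | (hH p.1).σ (e i p.1) {p.2} ≠ 0})
    (fun i => measurableSet_atoms (hσ i)) (fun i ω => ?_) (fun i ω ν hν => ?_) a b
  · exact purePoint_restrict_atoms
  · exact mutuallySingular_restrict_compl_atoms hν

variable {G : ∀ ω, Set (L ω)} (hG : ∀ ω, ∀ u ∈ G ω, ∃ t : ℝ, (u, t • u) ∈ Γ ω)
  (hGm : ∀ (p q : ℝ) i (c : ℝ), MeasurableSet {ω | ∃ z ∈ Submodule.span ℝ
    {u | u ∈ G ω ∧ ∃ t ∈ Set.Ioo p q, (u, t • u) ∈ Γ ω}, c < 2 * inner ℝ (e i ω) z - ‖z‖ ^ 2})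

include hG hGm

omit he hin hRm [Countable ι] in
lemma measurable_norm_sq_starProjection (p q : ℝ) (i : ι) : Measurable fun ω =>
    ‖(hH ω).P (Set.Ioo p q)
      ((Submodule.span ℝ (G ω)).topologicalClosure.starProjection (e i ω))‖ ^ 2 := by
  refine measurable_of_Ioi fun c => ?_
  have := hGm p q i c
  simp only [← (hH _).lt_norm_sq_P_starProjection_iff (hG _)] at this
  exact this

omit hin hRm in
lemma measurableSet_inter_ndSpectrum (p q : ℝ) : MeasurableSet
    {ω | Set.Ioo p q ∩ spectrumOn (Γ ω) (Submodule.span ℝ (G ω)).topologicalClosure = ∅} := by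
  simp only [(hH _).ndSpectrum_iff (hG _) p q (he _), Set.ofPred_forall]
  exact MeasurableSet.iInter fun i =>
    measurable_norm_sq_starProjection hH hG hGm p q i (measurableSet_singleton 0)

lemma measurableSet_inter_ppTildeSpectrum (p q : ℝ) : MeasurableSet
    {ω | Set.Ioo p q ∩ spectrumOn (Γ ω)
      (ppSubspace (Γ ω) (V ω) ⊓ (Submodule.span ℝ (G ω)).topologicalClosureᗮ) = ∅} := by
  have hσ := measurable_spectralMeasure he hin hH hRm
  have hiff := fun ω => (hH ω).ppTilde_iff (hG ω) p q (he ω)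
    (M := fun i => {t | (hH ω).σ (e i ω) {t} ≠ 0})
    (fun i => (countable_atoms _).measurableSet) (fun i => purePoint_restrict_atoms)
    (fun i ν hν => mutuallySingular_restrict_compl_atoms hν)
  simp only [hiff, Set.ofPred_forall]
  refine MeasurableSet.iInter fun i => measurableSet_eq_fun ?_
    (measurable_norm_sq_starProjection hH hG hGm p q i)
  exact (measurable_measure_slice (hσ i)
    ((measurable_snd measurableSet_Ioo).inter (measurableSet_atoms (hσ i)))).ennreal_toReal

end Spectra

end MeasurableSpectra

/-! ### Blow-ups -/

section BlowUps

namespace FormSequence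

variable {E : Type*} [MeasurableSpace E] {T : FormSequence E}

/-- Properties shared by the blow-ups of a lattice and of a self-similar set. -/
structure IsBlowUp (T : FormSequence E) : Prop where
  measurableSet_carrier : ∀ n, MeasurableSet (T.carrier n)
  measurableSet_boundary : ∀ n, MeasurableSet (T.boundary n)
  carrier_succ : ∀ n, T.carrier n ⊆ T.carrier (n + 1)
  boundary_subset : ∀ n, T.boundary n ⊆ T.carrier n
  boundary_succ : ∀ n, T.boundary (n + 1) ∩ T.carrier n ⊆ T.boundary n
  isFiniteMeasure : ∀ n, IsFiniteMeasure (T.measure n)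
  measure_compl : ∀ n, T.measure n (T.carrier n)ᶜ = 0
  measure_succ : ∀ n, ∃ ρ : Measure E, T.measure (n + 1) = T.measure n + ρ ∧
    ρ (T.carrier n \ T.boundary n) = 0
  zero_mem : ∀ n, 0 ∈ T.dom n
  add_smul_mem : ∀ n, ∀ u ∈ T.dom n, ∀ v ∈ T.dom n, ∀ c : ℝ, u + c • v ∈ T.dom n
  dom_congr : ∀ n, ∀ u ∈ T.dom n, ∀ v, Set.EqOn u v (T.carrier n) → v ∈ T.dom n
  form_congr : ∀ n u v w, Set.EqOn u v (T.carrier n) → T.form n u w = T.form n v w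
  dom_succ : ∀ n, T.dom (n + 1) ⊆ T.dom n
  memLp : ∀ n, ∀ u ∈ T.dom n, MemLp u 2 (T.measure n)
  form_add_smul : ∀ n, ∀ u ∈ T.dom n, ∀ v ∈ T.dom n, ∀ w ∈ T.dom n, ∀ c : ℝ,
    T.form n (u + c • v) w = T.form n u w + c * T.form n v w
  form_symm : ∀ n, ∀ u ∈ T.dom n, ∀ v ∈ T.dom n, T.form n u v = T.form n v u
  form_nonneg : ∀ n, ∀ u ∈ T.dom n, 0 ≤ T.form n u u
  form_le_succ : ∀ n, ∀ u ∈ T.dom (n + 1), T.form n u u ≤ T.form (n + 1) u u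
  complete : ∀ n (u : ℕ → E → ℝ), (∀ k, u k ∈ T.dom n) →
    (∀ δ > 0, ∃ k₀, ∀ p ≥ k₀, ∀ q ≥ k₀, T.form n (u p - u q) (u p - u q) +
      ∫ x, (u p x - u q x) ^ 2 ∂(T.measure n) < δ) →
    ∃ v ∈ T.dom n, Tendsto (fun k => T.form n (u k - v) (u k - v) +
      ∫ x, (u k x - v x) ^ 2 ∂(T.measure n)) atTop (𝓝 0)
  eqOn_of_ae_eq : ∀ n, ∀ u ∈ T.dom n, ∀ v ∈ T.dom n, u =ᵐ[T.measure n] v →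
    Set.EqOn u v (T.carrier n)
  extend : ∀ n, ∀ u ∈ T.dom n, (∀ x ∈ T.boundary n, u x = 0) → (∀ x ∉ T.carrier n, u x = 0) →
    u ∈ T.dom (n + 1) ∧ ∀ v ∈ T.dom (n + 1), T.form (n + 1) u v = T.form n u v

/-- The boundaries eventually leave every finite level. -/
def Exhausts (T : FormSequence E) : Prop := ∀ n, ∃ m ≥ n, Disjoint (T.carrier n) (T.boundary m)

namespace IsBlowUp

variable (hT : T.IsBlowUp)

include hT

lemma carrier_mono : Monotone T.carrier := monotone_nat_of_le_succ hT.carrier_succ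

lemma dom_anti : Antitone T.dom := antitone_nat_of_succ_le hT.dom_succ

lemma measure_monotone : Monotone T.measure := monotone_nat_of_le_succ fun n => by
  obtain ⟨ρ, h, -⟩ := hT.measure_succ n
  rw [h]
  exact Measure.le_add_right le_rfl

lemma boundary_inter {m n : ℕ} (h : m ≤ n) : T.boundary n ∩ T.carrier m ⊆ T.boundary m := by
  induction n, h using Nat.le_induction with
  | base => exact Set.inter_subset_left
  | succ n hmn ih =>
    exact fun x hx => ih ⟨hT.boundary_succ n ⟨hx.1, hT.carrier_mono hmn hx.2⟩, hx.2⟩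

/-- The increments of the measures. -/
lemma exists_increments : ∃ ρ : ℕ → Measure E,
    (∀ n, T.measure (n + 1) = T.measure n + ρ n) ∧
    (∀ n, ρ n (T.carrier n \ T.boundary n) = 0) ∧
    T.limMeasure = T.measure 0 + Measure.sum ρ := by
  choose ρ h1 h2 using hT.measure_succ
  refine ⟨ρ, h1, h2, ?_⟩
  have hn : ∀ n, T.measure n = T.measure 0 + ∑ k ∈ Finset.range n, ρ k := by
    intro n
    induction n with
    | zero => simp
    | succ n ih => rw [h1, ih, Finset.sum_range_succ, add_assoc]
  refine le_antisymm (iSup_le fun n => ?_) ?_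
  · rw [hn]
    refine add_le_add le_rfl ?_
    refine Measure.le_iff.2 fun A hA => ?_
    rw [Measure.sum_apply _ hA, Measure.finsetSum_apply]
    exact ENNReal.sum_le_tsum _
  · refine Measure.le_iff.2 fun A hA => ?_
    rw [Measure.add_apply, Measure.sum_apply _ hA, ENNReal.tsum_eq_iSup_nat, ENNReal.add_iSup]
    refine iSup_le fun n => ?_
    rw [← Measure.finsetSum_apply, ← Measure.add_apply, ← hn]
    exact le_iSup T.measure n A

lemma tendsto_lintegral (f : E → ENNReal) :
    Tendsto (fun n => ∫⁻ x, f x ∂(T.measure n)) atTop (𝓝 (∫⁻ x, f x ∂T.limMeasure)) := by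
  obtain ⟨ρ, h1, -, h3⟩ := hT.exists_increments
  have hn : ∀ n, ∫⁻ x, f x ∂(T.measure n) =
      ∫⁻ x, f x ∂(T.measure 0) + ∑ k ∈ Finset.range n, ∫⁻ x, f x ∂(ρ k) := by
    intro n
    induction n with
    | zero => simp
    | succ n ih => rw [h1, lintegral_add_measure, ih, Finset.sum_range_succ, add_assoc]
  refine Tendsto.congr (fun n => (hn n).symm) ?_
  rw [h3, lintegral_add_measure, lintegral_sum_measure]
  exact tendsto_const_nhds.add (ENNReal.tendsto_nat_tsum _)

lemma tendsto_measure {A : Set E} (hA : MeasurableSet A) :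
    Tendsto (fun n => T.measure n A) atTop (𝓝 (T.limMeasure A)) := by
  have := hT.tendsto_lintegral (A.indicator 1)
  simpa only [lintegral_indicator_one hA] using this

lemma tendsto_integral {f : E → ℝ} (hf : Integrable f T.limMeasure) :
    Tendsto (fun n => ∫ x, f x ∂(T.measure n)) atTop (𝓝 (∫ x, f x ∂T.limMeasure)) := by
  obtain ⟨ρ, h1, -, h3⟩ := hT.exists_increments
  have hi : ∀ n, Integrable f (T.measure n) := fun n => hf.mono_measure (le_iSup T.measure n)
  have hρ : ∀ n, Integrable f (ρ n) := fun n =>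
    (hi (n + 1)).mono_measure (by rw [h1]; exact Measure.le_add_left le_rfl)
  have hs : Integrable f (Measure.sum ρ) :=
    hf.mono_measure (by rw [h3]; exact Measure.le_add_left le_rfl)
  have hn : ∀ n, ∫ x, f x ∂(T.measure n) =
      ∫ x, f x ∂(T.measure 0) + ∑ k ∈ Finset.range n, ∫ x, f x ∂(ρ k) := by
    intro n
    induction n with
    | zero => simp
    | succ n ih => rw [h1, integral_add_measure (hi n) (hρ n), ih, Finset.sum_range_succ, add_assoc]
  refine Tendsto.congr (fun n => (hn n).symm) ?_
  rw [h3, integral_add_measure (hi 0) hs]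
  exact tendsto_const_nhds.add (hasSum_integral_measure hs).tendsto_sum_nat

lemma sdiff_boundary_mono : Monotone fun n => T.carrier n \ T.boundary n :=
  monotone_nat_of_le_succ fun n _ hx =>
    ⟨hT.carrier_succ n hx.1, fun h => hx.2 (hT.boundary_succ n ⟨h, hx.1⟩)⟩

/-- Later increments of the measure do not charge the interior of level m, since the interiors
increase with the level. -/
lemma restrict_sdiff_boundary {m n : ℕ} (h : m ≤ n) :
    (T.measure n).restrict (T.carrier m \ T.boundary m) =
      (T.measure m).restrict (T.carrier m \ T.boundary m) := by
  induction n, h using Nat.le_induction with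
  | base => rfl
  | succ n hmn ih =>
    obtain ⟨ρ, h1, h2⟩ := hT.measure_succ n
    have h3 : ρ.restrict (T.carrier m \ T.boundary m) = 0 :=
      Measure.restrict_eq_zero.2 (measure_mono_null (hT.sdiff_boundary_mono hmn) h2)
    rw [h1, Measure.restrict_add, ih, h3, add_zero]

lemma measurableSet_sdiff_boundary (n : ℕ) : MeasurableSet (T.carrier n \ T.boundary n) :=
  (hT.measurableSet_carrier n).diff (hT.measurableSet_boundary n)

lemma limMeasure_restrict_sdiff_boundary (m : ℕ) :
    T.limMeasure.restrict (T.carrier m \ T.boundary m) =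
      (T.measure m).restrict (T.carrier m \ T.boundary m) := by
  have hm := hT.measurableSet_sdiff_boundary m
  ext A hA
  rw [Measure.restrict_apply hA]
  refine tendsto_nhds_unique (hT.tendsto_measure (hA.inter hm)) ?_
  refine tendsto_const_nhds.congr' ?_
  filter_upwards [eventually_ge_atTop m] with n hn
  rw [← hT.restrict_sdiff_boundary hn, Measure.restrict_apply hA]

lemma limMeasure_compl : T.limMeasure (⋃ n, T.carrier n)ᶜ = 0 := by
  have hm : MeasurableSet (⋃ n, T.carrier n)ᶜ :=
    (MeasurableSet.iUnion hT.measurableSet_carrier).compl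
  refine tendsto_nhds_unique (hT.tendsto_measure hm) ?_
  refine tendsto_const_nhds.congr fun n => ?_
  exact (measure_mono_null (Set.compl_subset_compl.2 (Set.subset_iUnion _ n))
    (hT.measure_compl n)).symm

/-- Level n lies in the interior of a later level, where the limit measure has already stabilized to
a finite one. -/
lemma limMeasure_carrier_lt_top (hE : T.Exhausts) (n : ℕ) : T.limMeasure (T.carrier n) < ⊤ := by
  obtain ⟨m, hm, hd⟩ := hE n
  have := hT.isFiniteMeasure m
  have hsub : T.carrier n ⊆ T.carrier m \ T.boundary m := fun x hx =>
    ⟨hT.carrier_mono hm hx, fun h => Set.disjoint_left.1 hd hx h⟩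
  refine (measure_mono hsub).trans_lt ?_
  rw [← Measure.restrict_apply_self, hT.limMeasure_restrict_sdiff_boundary,
    Measure.restrict_apply_self]
  exact measure_lt_top _ _

/-- A point of infinitely many boundaries belongs to some level, so it would belong to the boundary
of every later level. This makes the two boundary conditions equivalent. -/
lemma limBoundary_eq_empty (hE : T.Exhausts) : T.limBoundary = ∅ := by
  refine Set.eq_empty_of_forall_notMem fun x hx => ?_
  simp only [limBoundary, Set.mem_iInter, Set.mem_iUnion] at hx
  obtain ⟨n, -, hn⟩ := hx 0
  obtain ⟨m, hm, hd⟩ := hE n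
  obtain ⟨k, hk, hxk⟩ := hx m
  have hxn := hT.boundary_subset n hn
  exact Set.disjoint_left.1 hd hxn
    (hT.boundary_inter hk ⟨hxk, hT.carrier_mono hm hxn⟩)

lemma limDom_eq (hE : T.Exhausts) (ε : BC) : T.limDom ε = T.limDom .neumann := by
  cases ε
  · rfl
  · ext u
    simp [limDom, hT.limBoundary_eq_empty hE]

lemma space_eq (hE : T.Exhausts) (ε : BC) : T.space ε = T.space .neumann := by
  rw [space, hT.limDom_eq hE ε]; rfl

lemma graph_eq (hE : T.Exhausts) (ε : BC) : T.graph ε = T.graph .neumann := by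
  rw [graph, hT.limDom_eq hE ε, hT.space_eq hE ε]; rfl

/-! #### The forms of finite level -/

/-- The domain of level `n` as a vector space. -/
def domain (n : ℕ) : Submodule ℝ (E → ℝ) where
  carrier := T.dom n
  zero_mem' := hT.zero_mem n
  add_mem' := fun {u v} hu hv => by simpa using hT.add_smul_mem n u hu v hv 1
  smul_mem' := fun c u hu => by simpa using hT.add_smul_mem n 0 (hT.zero_mem n) u hu c

lemma form_zero_left {n : ℕ} {w : E → ℝ} (hw : w ∈ T.dom n) : T.form n 0 w = 0 := by
  have h0 := hT.zero_mem n
  have := hT.form_add_smul n 0 h0 0 h0 w hw 1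
  simp only [smul_zero, add_zero, one_mul] at this
  linarith

lemma form_smul_left {n : ℕ} {u w : E → ℝ} (hu : u ∈ T.dom n) (hw : w ∈ T.dom n) (c : ℝ) :
    T.form n (c • u) w = c * T.form n u w := by
  have := hT.form_add_smul n 0 (hT.zero_mem n) u hu w hw c
  rwa [zero_add, hT.form_zero_left hw, zero_add] at this

lemma form_add_smul_self {n : ℕ} {u v : E → ℝ} (hu : u ∈ T.dom n) (hv : v ∈ T.dom n) (c : ℝ) :
    T.form n (u + c • v) (u + c • v) =
      T.form n u u + 2 * c * T.form n u v + c ^ 2 * T.form n v v := by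
  have huv := hT.add_smul_mem n u hu v hv c
  rw [hT.form_add_smul n u hu v hv _ huv, hT.form_symm n u hu _ huv, hT.form_symm n v hv _ huv,
    hT.form_add_smul n u hu v hv u hu, hT.form_add_smul n u hu v hv v hv,
    hT.form_symm n v hv u hu]
  ring

lemma form_le {m n : ℕ} (h : m ≤ n) {u : E → ℝ} (hu : u ∈ T.dom n) :
    T.form m u u ≤ T.form n u u := by
  induction n, h using Nat.le_induction with
  | base => rfl
  | succ n hmn ih => exact (ih (hT.dom_succ n hu)).trans (hT.form_le_succ n u hu)

/-- The functional whose minimizer is the value at `e` of the resolvent of level `n`. -/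
def energy (T : FormSequence E) (n : ℕ) (e u : E → ℝ) : ℝ :=
  T.form n u u + ∫ x, (u x - e x) ^ 2 ∂(T.measure n)

omit hT in
lemma integral_sq_nonneg (u : E → ℝ) (μ : Measure E) : 0 ≤ ∫ x, u x ^ 2 ∂μ :=
  integral_nonneg fun x => sq_nonneg (u x)

lemma energy_nonneg {n : ℕ} (e : E → ℝ) {u : E → ℝ} (hu : u ∈ T.dom n) : 0 ≤ energy T n e u :=
  add_nonneg (hT.form_nonneg n u hu) (integral_sq_nonneg _ _)

lemma integrable_sub_sq {n : ℕ} {e : E → ℝ} (he : MemLp e 2 (T.measure n)) {u : E → ℝ}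
    (hu : u ∈ T.dom n) : Integrable (fun x => (u x - e x) ^ 2) (T.measure n) :=
  ((hT.memLp n u hu).sub he).integrable_sq

lemma energy_le {m n : ℕ} (h : m ≤ n) {e : E → ℝ} (he : MemLp e 2 (T.measure n)) {u : E → ℝ}
    (hu : u ∈ T.dom n) : energy T m e u ≤ energy T n e u := by
  refine add_le_add (hT.form_le h hu) ?_
  exact integral_mono_measure (hT.measure_monotone h) (Eventually.of_forall fun x => sq_nonneg _)
    (hT.integrable_sub_sq he hu)

/-- The energy is quadratic in u, so almost minimizers are close to each other in the form norm. -/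
lemma energy_parallelogram {n : ℕ} {e : E → ℝ} (he : MemLp e 2 (T.measure n)) {u v : E → ℝ}
    (hu : u ∈ T.dom n) (hv : v ∈ T.dom n) :
    T.form n (u - v) (u - v) + ∫ x, (u x - v x) ^ 2 ∂(T.measure n) =
      2 * (energy T n e u + energy T n e v - 2 * energy T n e ((1 / 2 : ℝ) • (u + v))) := by
  have hs : u + v ∈ T.dom n := (hT.domain n).add_mem hu hv
  have hh : (1 / 2 : ℝ) • (u + v) ∈ T.dom n := (hT.domain n).smul_mem _ hs
  have h1 : T.form n (u - v) (u - v) = T.form n u u - 2 * T.form n u v + T.form n v v := by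
    have := hT.form_add_smul_self hu hv (-1)
    rw [neg_one_smul, ← sub_eq_add_neg] at this
    rw [this]; ring
  have h2 : T.form n ((1 / 2 : ℝ) • (u + v)) ((1 / 2 : ℝ) • (u + v)) =
      1 / 4 * (T.form n u u + 2 * T.form n u v + T.form n v v) := by
    rw [hT.form_smul_left hs hh, hT.form_symm n _ hs _ hh, hT.form_smul_left hs hs]
    have := hT.form_add_smul_self hu hv 1
    rw [one_smul] at this
    rw [this]; ring
  have h3 : ∫ x, (u x - v x) ^ 2 ∂(T.measure n) =
      2 * (∫ x, (u x - e x) ^ 2 ∂(T.measure n) + ∫ x, (v x - e x) ^ 2 ∂(T.measure n) -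
        2 * ∫ x, (((1 / 2 : ℝ) • (u + v)) x - e x) ^ 2 ∂(T.measure n)) := by
    have i1 := hT.integrable_sub_sq he hu
    have i2 := hT.integrable_sub_sq he hv
    have i3 := hT.integrable_sub_sq he hh
    rw [← integral_add i1 i2, ← integral_const_mul,
      ← integral_sub (f := fun x => (u x - e x) ^ 2 + (v x - e x) ^ 2) (i1.add i2)
        (i3.const_mul 2), ← integral_const_mul]
    refine integral_congr_ae (Eventually.of_forall fun x => ?_)
    simp only [Pi.smul_apply, Pi.add_apply, smul_eq_mul]
    ring
  simp only [energy]
  rw [h1, h2, h3]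
  ring

/-- The minimal energy of level `n`. -/
def minEnergy (T : FormSequence E) (n : ℕ) (e : E → ℝ) : ℝ := sInf (energy T n e '' T.dom n)

lemma bddBelow_energy (n : ℕ) (e : E → ℝ) : BddBelow (energy T n e '' T.dom n) :=
  ⟨0, by rintro _ ⟨u, hu, rfl⟩; exact hT.energy_nonneg e hu⟩

lemma minEnergy_le {n : ℕ} (e : E → ℝ) {u : E → ℝ} (hu : u ∈ T.dom n) :
    minEnergy T n e ≤ energy T n e u :=
  csInf_le (hT.bddBelow_energy n e) ⟨u, hu, rfl⟩

/-- From one level to the next the domain shrinks while the form and the measure grow. -/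
lemma minEnergy_mono {m n : ℕ} (h : m ≤ n) {e : E → ℝ} (he : MemLp e 2 (T.measure n)) :
    minEnergy T m e ≤ minEnergy T n e := by
  refine le_csInf ⟨_, 0, hT.zero_mem n, rfl⟩ ?_
  rintro _ ⟨u, hu, rfl⟩
  exact (hT.minEnergy_le e (hT.dom_anti h hu)).trans (hT.energy_le h he hu)

lemma minEnergy_le_integral {e : E → ℝ} (he : MemLp e 2 T.limMeasure) (n : ℕ) :
    minEnergy T n e ≤ ∫ x, e x ^ 2 ∂T.limMeasure := by
  refine (hT.minEnergy_le e (hT.zero_mem n)).trans ?_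
  rw [energy, hT.form_zero_left (hT.zero_mem n), zero_add]
  simp only [Pi.zero_apply, zero_sub, neg_sq]
  exact integral_mono_measure (le_iSup T.measure n) (Eventually.of_forall fun x => sq_nonneg _)
    he.integrable_sq

lemma exists_energy_lt (n : ℕ) (e : E → ℝ) {δ : ℝ} (hδ : 0 < δ) :
    ∃ u ∈ T.dom n, energy T n e u < minEnergy T n e + δ := by
  obtain ⟨_, ⟨u, hu, rfl⟩, h⟩ := exists_lt_of_csInf_lt (s := energy T n e '' T.dom n)
    ⟨_, 0, hT.zero_mem n, rfl⟩ (lt_add_of_pos_right (minEnergy T n e) hδ)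
  exact ⟨u, hu, h⟩

end IsBlowUp

end FormSequence

end BlowUps

/-! ### Minimizers of the energies -/

section Minimizers

namespace FormSequence

variable {E : Type*} [MeasurableSpace E] {T : FormSequence E}

namespace IsBlowUp

variable (hT : T.IsBlowUp)

include hT

lemma energy_congr {n : ℕ} (e : E → ℝ) {u v : E → ℝ} (hu : u ∈ T.dom n)
    (h : Set.EqOn u v (T.carrier n)) : energy T n e u = energy T n e v := by
  have hv := hT.dom_congr n u hu v h
  have hae : ∀ᵐ x ∂(T.measure n), x ∈ T.carrier n := hT.measure_compl n
  rw [energy, energy, hT.form_congr n u v u h, hT.form_symm n v hv u hu, hT.form_congr n u v v h]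
  congr 1
  refine integral_congr_ae ?_
  filter_upwards [hae] with x hx
  simp only [h hx]

lemma energy_zero_add_le {n : ℕ} {u v : E → ℝ} (hu : u ∈ T.dom n) (hv : v ∈ T.dom n) :
    energy T n 0 (u - v) ≤ 2 * (energy T n 0 u + energy T n 0 v) := by
  have h := hT.energy_parallelogram (e := 0) (MemLp.zero' (ε := ℝ)) hu hv
  have h2 : energy T n 0 (u - v) =
      T.form n (u - v) (u - v) + ∫ x, (u x - v x) ^ 2 ∂(T.measure n) := by simp [energy]
  have h3 := hT.energy_nonneg 0
    ((hT.domain n).smul_mem (1 / 2 : ℝ) ((hT.domain n).add_mem hu hv))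
  rw [h2, h]
  linarith

/-- Young's inequality 2xy ≤ c x² + y²/c with a free parameter c, so that letting c tend to 0 makes
the energy pass to limits in the form norm. -/
lemma energy_le_add {n : ℕ} {e : E → ℝ} (he : MemLp e 2 (T.measure n)) {u v : E → ℝ}
    (hu : u ∈ T.dom n) (hv : v ∈ T.dom n) {c : ℝ} (hc : 0 < c) :
    energy T n e v ≤ (1 + c) * energy T n e u + (1 + c⁻¹) * energy T n 0 (u - v) := by
  have hw : u - v ∈ T.dom n := (hT.domain n).sub_mem hu hv
  have h1 : T.form n v v ≤ (1 + c) * T.form n u u + (1 + c⁻¹) * T.form n (u - v) (u - v) := by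
    have e1 := hT.form_add_smul_self hu hw (-1)
    have e2 := hT.form_add_smul_self hw hu c
    have e3 := hT.form_nonneg n _ (hT.add_smul_mem n _ hw u hu c)
    rw [neg_one_smul, neg_sub, add_sub_cancel] at e1
    rw [e2, hT.form_symm n _ hw u hu] at e3
    have e4 : c⁻¹ * (T.form n (u - v) (u - v) + 2 * c * T.form n u (u - v) + c ^ 2 * T.form n u u) =
        c⁻¹ * T.form n (u - v) (u - v) + 2 * T.form n u (u - v) + c * T.form n u u := by
      field_simp
    have e5 := mul_nonneg (inv_nonneg.2 hc.le) e3
    rw [e4] at e5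
    rw [e1]
    linarith
  have h2 : ∫ x, (v x - e x) ^ 2 ∂(T.measure n) ≤ (1 + c) * ∫ x, (u x - e x) ^ 2 ∂(T.measure n) +
      (1 + c⁻¹) * ∫ x, ((u - v) x - (0 : E → ℝ) x) ^ 2 ∂(T.measure n) := by
    have i1 := hT.integrable_sub_sq he hu
    have i2 := hT.integrable_sub_sq (e := 0) (MemLp.zero' (ε := ℝ)) hw
    rw [← integral_const_mul, ← integral_const_mul,
      ← integral_add (i1.const_mul _) (i2.const_mul _)]
    refine integral_mono (hT.integrable_sub_sq he hv) ((i1.const_mul _).add (i2.const_mul _))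
      fun x => ?_
    simp only [Pi.sub_apply, Pi.zero_apply, sub_zero]
    have e1 : 0 ≤ c⁻¹ * (c * (u x - e x) + (u x - v x)) ^ 2 := by positivity
    have e2 : c⁻¹ * (c * (u x - e x) + (u x - v x)) ^ 2 = c * (u x - e x) ^ 2 +
        2 * (u x - e x) * (u x - v x) + c⁻¹ * (u x - v x) ^ 2 := by
      field_simp
      ring
    rw [e2] at e1
    nlinarith [e1]
  simp only [energy]
  linarith

lemma aestronglyMeasurable_limMeasure {v : E → ℝ}
    (hv : ∀ n, AEStronglyMeasurable v (T.measure n)) : AEStronglyMeasurable v T.limMeasure := by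
  obtain ⟨ρ, h1, -, h3⟩ := hT.exists_increments
  refine AEMeasurable.aestronglyMeasurable ?_
  rw [h3, aemeasurable_add_measure_iff, aemeasurable_sum_measure_iff]
  refine ⟨(hv 0).aemeasurable, fun n => (hv (n + 1)).aemeasurable.mono_measure ?_⟩
  rw [h1]
  exact Measure.le_add_left le_rfl

/-- The integrals of v² against the increasing measures converge to that against the limit, so a
uniform bound suffices. -/
lemma memLp_limMeasure {v : E → ℝ} (hv : ∀ n, MemLp v 2 (T.measure n)) {C : ℝ}
    (hC : ∀ n, ∫ x, v x ^ 2 ∂(T.measure n) ≤ C) : MemLp v 2 T.limMeasure := by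
  have hm := hT.aestronglyMeasurable_limMeasure fun n => (hv n).aestronglyMeasurable
  rw [memLp_two_iff_integrable_sq hm]
  refine ⟨hm.pow 2, ?_⟩
  rw [hasFiniteIntegral_iff_ofReal (Eventually.of_forall fun x => sq_nonneg _)]
  refine lt_of_le_of_lt (le_of_tendsto' (hT.tendsto_lintegral _) fun n => ?_)
    (ENNReal.ofReal_lt_top (r := C))
  rw [← ofReal_integral_eq_lintegral_ofReal (hv n).integrable_sq
    (Eventually.of_forall fun x => sq_nonneg _)]
  exact ENNReal.ofReal_le_ofReal (hC n)

/-- The limit of the minimal energies. -/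
def limMinEnergy (T : FormSequence E) (e : E → ℝ) : ℝ := ⨆ n, minEnergy T n e

section Minimizer

variable {e : E → ℝ} (he : MemLp e 2 T.limMeasure)

include he

omit hT in
lemma memLp_measure (n : ℕ) : MemLp e 2 (T.measure n) := he.mono_measure (le_iSup T.measure n)

lemma bddAbove_minEnergy : BddAbove (Set.range fun n => minEnergy T n e) :=
  ⟨_, by rintro _ ⟨n, rfl⟩; exact hT.minEnergy_le_integral he n⟩

lemma minEnergy_le_lim (n : ℕ) : minEnergy T n e ≤ limMinEnergy T e :=
  le_ciSup (hT.bddAbove_minEnergy he) n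

lemma tendsto_minEnergy :
    Tendsto (fun n => minEnergy T n e) atTop (𝓝 (limMinEnergy T e)) :=
  tendsto_atTop_ciSup (fun _ n h => hT.minEnergy_mono h (memLp_measure he n))
    (hT.bddAbove_minEnergy he)

/-- Almost minimizers u n of level n form a Cauchy sequence in the form norm of every fixed level,
by the parallelogram identity and convergence of the minimal energies; each level is complete. -/
lemma exists_local_limits : ∃ u : ℕ → E → ℝ, (∀ n, u n ∈ T.dom n) ∧
    (∀ n, energy T n e (u n) ≤ limMinEnergy T e + 1 / ((n : ℝ) + 1)) ∧
    ∃ v : ℕ → E → ℝ, (∀ n, v n ∈ T.dom n) ∧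
      ∀ n, Tendsto (fun k => energy T n 0 (u (n + k) - v n)) atTop (𝓝 0) := by
  choose u hu hlt using fun n : ℕ =>
    hT.exists_energy_lt n e (δ := 1 / ((n : ℝ) + 1)) (by positivity)
  have hle : ∀ n, energy T n e (u n) ≤ limMinEnergy T e + 1 / ((n : ℝ) + 1) := fun n =>
    (hlt n).le.trans (by linarith [hT.minEnergy_le_lim he n])
  refine ⟨u, hu, hle, ?_⟩
  have hen := memLp_measure he
  -- The comparison is made at an intermediate level r ≤ p, q, where the midpoint has energy at
  -- least the minimum of level r. Taking r large makes the bound small even though n is fixed.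
  have key : ∀ n p q r, n ≤ r → r ≤ p → r ≤ q → energy T n 0 (u p - u q) ≤
      4 * (limMinEnergy T e - minEnergy T r e + 1 / ((r : ℝ) + 1)) := by
    intro n p q r hn hp hq
    have hup := hT.dom_anti hp (hu p)
    have huq := hT.dom_anti hq (hu q)
    have h1 := hT.energy_le (e := 0) hn (MemLp.zero' (ε := ℝ)) ((hT.domain r).sub_mem hup huq)
    have h2 := hT.energy_parallelogram (hen r) hup huq
    have h3 : energy T r 0 (u p - u q) = T.form r (u p - u q) (u p - u q) +
      ∫ x, (u p x - u q x) ^ 2 ∂(T.measure r) := by simp [energy]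
    have h4 := hT.minEnergy_le e
      ((hT.domain r).smul_mem (1 / 2 : ℝ) ((hT.domain r).add_mem hup huq))
    have h5 := (hT.energy_le hp (hen p) (hu p)).trans (hle p)
    have h6 := (hT.energy_le hq (hen q) (hu q)).trans (hle q)
    have h7 : 1 / ((p : ℝ) + 1) ≤ 1 / ((r : ℝ) + 1) := by gcongr
    have h8 : 1 / ((q : ℝ) + 1) ≤ 1 / ((r : ℝ) + 1) := by gcongr
    linarith
  have hlim : Tendsto (fun r : ℕ => 4 * (limMinEnergy T e - minEnergy T r e + 1 / ((r : ℝ) + 1)))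
      atTop (𝓝 0) := by
    have := ((tendsto_const_nhds (x := limMinEnergy T e)).sub (hT.tendsto_minEnergy he)).add
      tendsto_one_div_add_atTop_nhds_zero_nat |>.const_mul 4
    simpa using this
  have hex : ∀ n, ∃ v ∈ T.dom n,
      Tendsto (fun k => energy T n 0 (u (n + k) - v)) atTop (𝓝 0) := by
    intro n
    obtain ⟨v, hv, h⟩ := hT.complete n (fun k => u (n + k))
      (fun k => hT.dom_anti (Nat.le_add_right n k) (hu _)) (fun δ hδ => by
        obtain ⟨k₀, hk₀⟩ := eventually_atTop.1 ((tendsto_order.1 hlim).2 δ hδ)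
        refine ⟨k₀, fun p hp q hq => ?_⟩
        have h1 := key n (n + p) (n + q) (n + k₀) (by omega) (by omega) (by omega)
        have h2 := hk₀ (n + k₀) (by omega)
        have h3 : energy T n 0 (u (n + p) - u (n + q)) = T.form n (u (n + p) - u (n + q))
            (u (n + p) - u (n + q)) + ∫ x, (u (n + p) x - u (n + q) x) ^ 2 ∂(T.measure n) := by
          simp [energy]
        rw [← h3]
        exact h1.trans_lt h2)
    refine ⟨v, hv, ?_⟩
    simpa [energy] using h
  choose v hv h using hex
  exact ⟨v, hv, h⟩

/-- The local limits are compatible and glue to one function, whose energy at every level is bounded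
by the limit of the minimal energies. -/
lemma exists_minimizer : ∃ v ∈ T.limDom .neumann, ∀ n, energy T n e v ≤ limMinEnergy T e := by
  obtain ⟨u, hu, hle, v, hv, hlim⟩ := hT.exists_local_limits he
  have hen := memLp_measure he
  -- Both functions are limits of the same sequence in the form norm of level n, so they agree
  -- almost everywhere, hence on the carrier.
  have hsucc : ∀ n, Set.EqOn (v n) (v (n + 1)) (T.carrier n) := by
    intro n
    have hv' := hT.dom_succ n (hv (n + 1))
    refine hT.eqOn_of_ae_eq n _ (hv n) _ hv' ?_
    have hd : v n - v (n + 1) ∈ T.dom n := (hT.domain n).sub_mem (hv n) hv'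
    have h0 : energy T n 0 (v n - v (n + 1)) ≤ 0 := by
      have l1 := hlim n
      rw [← tendsto_add_atTop_iff_nat 1] at l1
      have l3 := (l1.add (hlim (n + 1))).const_mul 2
      rw [add_zero, mul_zero] at l3
      refine ge_of_tendsto' l3 fun k => ?_
      have hk : u (n + (k + 1)) ∈ T.dom n := hT.dom_anti (by omega) (hu _)
      have h2 := hT.energy_zero_add_le ((hT.domain n).sub_mem hk hv')
        ((hT.domain n).sub_mem hk (hv n))
      have h3 : u (n + (k + 1)) - v (n + 1) - (u (n + (k + 1)) - v n) = v n - v (n + 1) := by abel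
      have hidx : n + 1 + k = n + (k + 1) := by omega
      have hk' : u (n + (k + 1)) ∈ T.dom (n + 1) := hT.dom_anti (by omega) (hu _)
      have h4 := hT.energy_le (e := 0) (Nat.le_succ n) (MemLp.zero' (ε := ℝ))
        ((hT.domain (n + 1)).sub_mem hk' (hv (n + 1)))
      rw [h3] at h2
      rw [hidx]
      linarith
    have h1 : ∫ x, (v n x - v (n + 1) x) ^ 2 ∂(T.measure n) = 0 := by
      refine le_antisymm ?_ (integral_nonneg fun x => sq_nonneg _)
      have := hT.form_nonneg n _ hd
      simp only [energy, Pi.sub_apply, Pi.zero_apply, sub_zero] at h0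
      linarith
    have hint : Integrable (fun x => (v n x - v (n + 1) x) ^ 2) (T.measure n) :=
      ((hT.memLp n _ (hv n)).sub (hT.memLp n _ hv')).integrable_sq
    rw [integral_eq_zero_iff_of_nonneg (fun x => sq_nonneg _) hint] at h1
    filter_upwards [h1] with x hx
    exact sub_eq_zero.1 (pow_eq_zero_iff two_ne_zero |>.1 hx)
  have heq : ∀ m n, m ≤ n → Set.EqOn (v m) (v n) (T.carrier m) := by
    intro m n hmn
    induction n, hmn using Nat.le_induction with
    | base => exact fun x _ => rfl
    | succ n hmn ih => exact fun x hx => (ih hx).trans (hsucc n (hT.carrier_mono hmn hx))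
  classical
  -- Each point takes its value from the first level that contains it; outside of all levels the
  -- value is 0.
  set w : E → ℝ := fun x => if h : ∃ n, x ∈ T.carrier n then v (Nat.find h) x else 0 with hw
  have hwv : ∀ n, Set.EqOn (v n) w (T.carrier n) := by
    intro n x hx
    have hex : ∃ n, x ∈ T.carrier n := ⟨n, hx⟩
    rw [hw]
    simp only [hex, dif_pos]
    exact (heq _ n (Nat.find_min' hex hx) (Nat.find_spec hex)).symm
  have hwd : ∀ n, w ∈ T.dom n := fun n => hT.dom_congr n _ (hv n) _ (hwv n)
  have henergy : ∀ n, energy T n e w ≤ limMinEnergy T e := by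
    intro n
    rw [← hT.energy_congr e (hv n) (hwv n)]
    -- First k tends to infinity with c fixed, which removes the error term; then c tends to 0.
    have h1 : ∀ c : ℝ, 0 < c → energy T n e (v n) ≤ (1 + c) * limMinEnergy T e := by
      intro c hc
      have l1 : Tendsto (fun k : ℕ => (1 + c) * (limMinEnergy T e + 1 / ((k : ℝ) + 1)) +
          (1 + c⁻¹) * energy T n 0 (u (n + k) - v n)) atTop
          (𝓝 ((1 + c) * (limMinEnergy T e + 0) + (1 + c⁻¹) * 0)) :=
        ((tendsto_const_nhds.add tendsto_one_div_add_atTop_nhds_zero_nat).const_mul _).add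
          ((hlim n).const_mul _)
      rw [add_zero, mul_zero, add_zero] at l1
      refine ge_of_tendsto' l1 fun k => ?_
      have hk : u (n + k) ∈ T.dom n := hT.dom_anti (by omega) (hu _)
      refine (hT.energy_le_add (hen n) hk (hv n) hc).trans ?_
      have h2 := (hT.energy_le (Nat.le_add_right n k) (hen _) (hu _)).trans (hle _)
      have h3 : 1 / (((n + k : ℕ) : ℝ) + 1) ≤ 1 / ((k : ℝ) + 1) := by gcongr; omega
      gcongr
      linarith
    have l2 : Tendsto (fun c : ℝ => (1 + c) * limMinEnergy T e) (𝓝[>] 0)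
        (𝓝 ((1 + 0) * limMinEnergy T e)) := by
      refine Tendsto.mono_left ?_ nhdsWithin_le_nhds
      exact Continuous.tendsto (by fun_prop) 0
    rw [add_zero, one_mul] at l2
    exact ge_of_tendsto l2 (eventually_mem_nhdsWithin.mono fun c hc => h1 c hc)
  refine ⟨w, ⟨?_, hwd, ⟨limMinEnergy T e, ?_⟩⟩, henergy⟩
  · have hme : MemLp (fun x => w x - e x) 2 T.limMeasure :=
      hT.memLp_limMeasure (fun n => (hT.memLp n _ (hwd n)).sub (hen n)) (C := limMinEnergy T e)
        fun n => by
          have := henergy n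
          have h2 := hT.form_nonneg n _ (hwd n)
          simp only [energy] at this
          linarith
    have := hme.add he
    convert this using 1
    ext x
    simp
  · rintro _ ⟨n, rfl⟩
    have := henergy n
    have h2 : 0 ≤ ∫ x, (w x - e x) ^ 2 ∂(T.measure n) := integral_nonneg fun x => sq_nonneg _
    simp only [energy] at this
    linarith

end Minimizer

/-! #### The limit form -/

lemma limDom_zero_mem : 0 ∈ T.limDom .neumann := by
  refine ⟨MemLp.zero, hT.zero_mem, 0, ?_⟩
  rintro _ ⟨n, rfl⟩
  exact (hT.form_zero_left (hT.zero_mem n)).le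

/-- The parallelogram bound 2A + 2c²B is uniform in the level. -/
lemma limDom_add_smul_mem {u v : E → ℝ} (hu : u ∈ T.limDom .neumann) (hv : v ∈ T.limDom .neumann)
    (c : ℝ) : u + c • v ∈ T.limDom .neumann := by
  obtain ⟨hu1, hu2, A, hA⟩ := hu
  obtain ⟨hv1, hv2, B, hB⟩ := hv
  refine ⟨hu1.add (hv1.const_smul c), fun n => hT.add_smul_mem n u (hu2 n) v (hv2 n) c,
    2 * A + 2 * c ^ 2 * B, ?_⟩
  rintro _ ⟨n, rfl⟩
  have h1 := hT.form_add_smul_self (hu2 n) (hv2 n) c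
  have h2 := hT.form_add_smul_self (hu2 n) (hv2 n) (-c)
  have h3 := hT.form_nonneg n _ (hT.add_smul_mem n u (hu2 n) v (hv2 n) (-c))
  have h4 : T.form n u u ≤ A := hA ⟨n, rfl⟩
  have h5 : T.form n v v ≤ B := hB ⟨n, rfl⟩
  have h6 : c ^ 2 * T.form n v v ≤ c ^ 2 * B := by gcongr
  dsimp only
  rw [h2] at h3
  rw [h1]
  nlinarith

lemma exists_tendsto_form_self {u : E → ℝ} (hu : u ∈ T.limDom .neumann) :
    ∃ l, Tendsto (fun n => T.form n u u) atTop (𝓝 l) :=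
  ⟨_, tendsto_atTop_ciSup (fun _ n h => hT.form_le h (hu.2.1 n)) hu.2.2⟩

/-- The diagonal values are bounded and increasing in the level; polarization gives the rest. -/
lemma exists_tendsto_form {u v : E → ℝ} (hu : u ∈ T.limDom .neumann) (hv : v ∈ T.limDom .neumann) :
    ∃ l, Tendsto (fun n => T.form n u v) atTop (𝓝 l) := by
  obtain ⟨a, ha⟩ := hT.exists_tendsto_form_self (hT.limDom_add_smul_mem hu hv 1)
  obtain ⟨b, hb⟩ := hT.exists_tendsto_form_self hu
  obtain ⟨c, hc⟩ := hT.exists_tendsto_form_self hv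
  refine ⟨(a - b - c) / 2, (((ha.sub hb).sub hc).div_const 2).congr fun n => ?_⟩
  rw [hT.form_add_smul_self (hu.2.1 n) (hv.2.1 n) 1]
  ring

omit hT in
lemma eq_zero_of_quadratic_nonneg {b c : ℝ} (h : ∀ t : ℝ, 0 ≤ 2 * t * b + t ^ 2 * c) : b = 0 := by
  by_contra hb
  have hc : 0 ≤ c := by
    have h1 := h 1
    have h2 := h (-1)
    nlinarith
  -- Nearly the minimum of the quadratic polynomial; c + 1 keeps the denominator positive when c =
  -- 0.
  have h1 := h (-b / (c + 1))
  have h2 : 2 * (-b / (c + 1)) * b + (-b / (c + 1)) ^ 2 * c = -b ^ 2 * (c + 2) / (c + 1) ^ 2 := by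
    field_simp
    ring
  rw [h2] at h1
  have h3 : 0 < b ^ 2 * (c + 2) / (c + 1) ^ 2 := by positivity
  rw [neg_mul, neg_div] at h1
  linarith

lemma energy_add_smul {n : ℕ} {e : E → ℝ} (he : MemLp e 2 (T.measure n)) {u w : E → ℝ}
    (hu : u ∈ T.dom n) (hw : w ∈ T.dom n) (t : ℝ) :
    energy T n e (u + t • w) = energy T n e u +
      2 * t * (T.form n u w + ∫ x, (u x - e x) * w x ∂(T.measure n)) +
      t ^ 2 * (T.form n w w + ∫ x, w x ^ 2 ∂(T.measure n)) := by
  have i1 := hT.integrable_sub_sq he hu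
  have i2 : Integrable (fun x => (u x - e x) * w x) (T.measure n) :=
    ((hT.memLp n u hu).sub he).integrable_mul (hT.memLp n w hw)
  have i3 := (hT.memLp n w hw).integrable_sq
  have h1 : ∫ x, ((u + t • w) x - e x) ^ 2 ∂(T.measure n) = ∫ x, (u x - e x) ^ 2 ∂(T.measure n) +
      2 * t * ∫ x, (u x - e x) * w x ∂(T.measure n) + t ^ 2 * ∫ x, w x ^ 2 ∂(T.measure n) := by
    rw [← integral_const_mul, ← integral_const_mul, ← integral_add i1 (i2.const_mul _),
      ← integral_add (f := fun x => (u x - e x) ^ 2 + 2 * t * ((u x - e x) * w x))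
        (i1.add (i2.const_mul _)) (i3.const_mul _)]
    refine integral_congr_ae (Eventually.of_forall fun x => ?_)
    simp only [Pi.add_apply, Pi.smul_apply, smul_eq_mul]
    ring
  simp only [energy]
  rw [h1, hT.form_add_smul_self hu hw]
  ring

/-- Euler-Lagrange equation: perturbing v by t w cannot lower the limit energy, so the coefficient
of t vanishes. -/
lemma tendsto_form_of_minimizer {e v w : E → ℝ} (he : MemLp e 2 T.limMeasure)
    (hv : v ∈ T.limDom .neumann) (hmin : ∀ n, energy T n e v ≤ limMinEnergy T e)
    (hw : w ∈ T.limDom .neumann) :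
    Tendsto (fun n => T.form n v w) atTop (𝓝 (∫ x, (e x - v x) * w x ∂T.limMeasure)) := by
  obtain ⟨l, hl⟩ := hT.exists_tendsto_form hv hw
  obtain ⟨c, hc⟩ := hT.exists_tendsto_form_self hw
  have hi : Integrable (fun x => (v x - e x) * w x) T.limMeasure :=
    (hv.1.sub he).integrable_mul hw.1
  have hlin := hl.add (hT.tendsto_integral hi)
  have hquad := hc.add (hT.tendsto_integral hw.1.integrable_sq)
  have h0 : l + ∫ x, (v x - e x) * w x ∂T.limMeasure = 0 := by
    refine eq_zero_of_quadratic_nonneg (c := c + ∫ x, w x ^ 2 ∂T.limMeasure) fun t => ?_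
    have h1 := ((hlin.const_mul (2 * t)).add (hquad.const_mul (t ^ 2))).const_add (limMinEnergy T e)
    have h2 := le_of_tendsto_of_tendsto' (hT.tendsto_minEnergy he) h1 fun n => by
      have h3 := hT.minEnergy_le e (hT.add_smul_mem n v (hv.2.1 n) w (hw.2.1 n) t)
      rw [hT.energy_add_smul (memLp_measure he n) (hv.2.1 n) (hw.2.1 n)] at h3
      have := hmin n
      linarith
    linarith
  have h1 : ∫ x, (e x - v x) * w x ∂T.limMeasure = -∫ x, (v x - e x) * w x ∂T.limMeasure := by
    rw [← integral_neg]
    congr 1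
    ext x
    ring
  rw [h1, ← eq_neg_of_add_eq_zero_left h0]
  exact hl

end IsBlowUp

end FormSequence

end Minimizers

/-! ### The limit operator -/

section LimitOperator

namespace FormSequence

variable {E : Type*} [MeasurableSpace E] {T : FormSequence E}

lemma inner_L2 (f g : T.L2) : inner ℝ f g = ∫ x, f x * g x ∂T.limMeasure := by
  rw [L2.inner_def]
  refine integral_congr_ae (Eventually.of_forall fun x => ?_)
  simp [mul_comm]

lemma integrable_mul_L2 (f : T.L2) {v : E → ℝ} (hv : MemLp v 2 T.limMeasure) :
    Integrable (fun x => f x * v x) T.limMeasure :=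
  (Lp.memLp f).integrable_mul hv

lemma integral_mul_of_ae_eq {f : T.L2} {u : E → ℝ} (hfu : f =ᵐ[T.limMeasure] u) (g : T.L2) :
    ∫ x, g x * u x ∂T.limMeasure = inner ℝ g f := by
  rw [inner_L2]
  refine integral_congr_ae ?_
  filter_upwards [hfu] with x hx
  rw [hx]

/-- `f = (1 - H)⁻¹ e`, in the weak sense. -/
def IsRes (T : FormSequence E) (e f : T.L2) : Prop :=
  ∃ u ∈ T.limDom .neumann, f =ᵐ[T.limMeasure] u ∧ ∀ v ∈ T.limDom .neumann,
    Tendsto (fun n => T.form n u v) atTop (𝓝 (∫ x, (e - f : T.L2) x * v x ∂T.limMeasure))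

lemma mem_graph_iff_isRes {f h : T.L2} :
    (f, h) ∈ T.graph .neumann ↔ h ∈ T.space .neumann ∧ T.IsRes (f - h) f := by
  have hneg : ∀ v : E → ℝ, ∫ x, (f - h - f : T.L2) x * v x ∂T.limMeasure =
      -∫ x, h x * v x ∂T.limMeasure := by
    intro v
    rw [← integral_neg]
    refine integral_congr_ae ?_
    have h1 : f - h - f = -h := by abel
    rw [h1]
    filter_upwards [Lp.coeFn_neg h] with x hx
    rw [hx]
    simp
  simp only [graph, IsRes, Set.mem_ofPred_eq, hneg]

namespace IsBlowUp

variable (hT : T.IsBlowUp)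

include hT

lemma isRes_toLp {e v : E → ℝ} (he : MemLp e 2 T.limMeasure)
    (hv : v ∈ T.limDom .neumann) (hmin : ∀ n, energy T n e v ≤ limMinEnergy T e) :
    T.IsRes he.toLp hv.1.toLp := by
  refine ⟨v, hv, hv.1.coeFn_toLp, fun w hw => ?_⟩
  convert hT.tendsto_form_of_minimizer he hv hmin hw using 2
  refine integral_congr_ae ?_
  rw [← MemLp.toLp_sub]
  filter_upwards [(he.sub hv.1).coeFn_toLp] with x hx
  rw [hx]
  rfl

lemma exists_isRes (e : T.L2) : ∃ f, T.IsRes e f := by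
  obtain ⟨v, hv, hmin⟩ := hT.exists_minimizer (Lp.memLp e)
  have := hT.isRes_toLp (Lp.memLp e) hv hmin
  rw [Lp.toLp_coeFn] at this
  exact ⟨_, this⟩

lemma isRes_add_smul {e f e' f' : T.L2} (h : T.IsRes e f) (h' : T.IsRes e' f') (c : ℝ) :
    T.IsRes (e + c • e') (f + c • f') := by
  obtain ⟨u, hu, hfu, hB⟩ := h
  obtain ⟨u', hu', hfu', hB'⟩ := h'
  refine ⟨u + c • u', hT.limDom_add_smul_mem hu hu' c, ?_, fun v hv => ?_⟩
  · filter_upwards [hfu, hfu', Lp.coeFn_add f (c • f'), Lp.coeFn_smul c f'] with x h1 h2 h3 h4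
    rw [h3, Pi.add_apply, h4, Pi.smul_apply, h1, h2, Pi.add_apply, Pi.smul_apply]
  · have h1 := (hB v hv).add ((hB' v hv).const_mul c)
    have h2 : ∫ x, (e + c • e' - (f + c • f') : T.L2) x * v x ∂T.limMeasure =
        ∫ x, (e - f : T.L2) x * v x ∂T.limMeasure +
          c * ∫ x, (e' - f' : T.L2) x * v x ∂T.limMeasure := by
      rw [← integral_const_mul, ← integral_add (integrable_mul_L2 _ hv.1)
        ((integrable_mul_L2 _ hv.1).const_mul c)]
      refine integral_congr_ae ?_
      have h3 : e + c • e' - (f + c • f') = (e - f) + c • (e' - f') := by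
        rw [smul_sub]; abel
      rw [h3]
      filter_upwards [Lp.coeFn_add (e - f) (c • (e' - f')), Lp.coeFn_smul c (e' - f')] with x h4 h5
      rw [h4, Pi.add_apply, h5, Pi.smul_apply, smul_eq_mul]
      ring
    rw [h2]
    refine h1.congr fun n => ?_
    rw [hT.form_add_smul n u (hu.2.1 n) u' (hu'.2.1 n) v (hv.2.1 n)]

/-- Each solution is used as the test function for the other, and the limit form is symmetric. -/
lemma isRes_inner_symm {e f e' f' : T.L2} (h : T.IsRes e f) (h' : T.IsRes e' f') :
    inner ℝ f e' = inner ℝ e f' := by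
  obtain ⟨u, hu, hfu, hB⟩ := h
  obtain ⟨u', hu', hfu', hB'⟩ := h'
  have h1 := hB u' hu'
  have h2 := hB' u hu
  have h3 := tendsto_nhds_unique h1
    (h2.congr fun n => hT.form_symm n u' (hu'.2.1 n) u (hu.2.1 n))
  rw [integral_mul_of_ae_eq hfu', integral_mul_of_ae_eq hfu, inner_sub_left, inner_sub_left,
    real_inner_comm f f', real_inner_comm f e'] at h3
  linarith

/-- Testing with the solution itself, nonnegativity of the form gives ⟨e - f, f⟩ ≥ 0. Uniqueness and
the contraction property follow. -/
lemma norm_sq_le_inner_of_isRes {e f : T.L2} (h : T.IsRes e f) : ‖f‖ ^ 2 ≤ inner ℝ e f := by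
  obtain ⟨u, hu, hfu, hB⟩ := h
  have h1 := ge_of_tendsto' (hB u hu) fun n => hT.form_nonneg n u (hu.2.1 n)
  rw [integral_mul_of_ae_eq hfu, inner_sub_left, real_inner_self_eq_norm_sq] at h1
  linarith

lemma norm_le_of_isRes {e f : T.L2} (h : T.IsRes e f) : ‖f‖ ≤ ‖e‖ := by
  have h1 := (hT.norm_sq_le_inner_of_isRes h).trans (real_inner_le_norm e f)
  rcases (norm_nonneg f).eq_or_lt with h2 | h2
  · rw [← h2]; exact norm_nonneg e
  · nlinarith

lemma isRes_unique {e f f' : T.L2} (h : T.IsRes e f) (h' : T.IsRes e f') : f = f' := by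
  have h1 := hT.norm_le_of_isRes (hT.isRes_add_smul h h' (-1))
  rw [neg_one_smul, neg_one_smul, add_neg_cancel, norm_zero, ← sub_eq_add_neg] at h1
  exact sub_eq_zero.1 (norm_le_zero_iff.1 h1)

/-- The resolvent `(1 - H)⁻¹`. -/
def resolvent : T.L2 →L[ℝ] T.L2 :=
  LinearMap.mkContinuous
    { toFun := fun e => (hT.exists_isRes e).choose
      map_add' := fun e e' => by
        have := hT.isRes_add_smul (hT.exists_isRes e).choose_spec (hT.exists_isRes e').choose_spec 1
        rw [one_smul, one_smul] at this
        exact hT.isRes_unique (hT.exists_isRes (e + e')).choose_spec this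
      map_smul' := fun c e => by
        have h0 : T.IsRes 0 0 := ⟨0, hT.limDom_zero_mem, Lp.coeFn_zero _ _ _, fun v hv => by
          have h1 : ∫ x, (0 - 0 : T.L2) x * v x ∂T.limMeasure = 0 := by
            rw [sub_zero]
            refine integral_eq_zero_of_ae ?_
            filter_upwards [Lp.coeFn_zero ℝ 2 T.limMeasure] with x hx
            rw [hx, Pi.zero_apply, zero_mul]
          rw [h1]
          exact tendsto_const_nhds.congr fun n => (hT.form_zero_left (hv.2.1 n)).symm⟩
        have := hT.isRes_add_smul h0 (hT.exists_isRes e).choose_spec c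
        rw [zero_add, zero_add] at this
        exact hT.isRes_unique (hT.exists_isRes (c • e)).choose_spec this } 1
    fun e => by
      rw [one_mul]
      exact hT.norm_le_of_isRes (hT.exists_isRes e).choose_spec

lemma isRes_resolvent (e : T.L2) : T.IsRes e (hT.resolvent e) := (hT.exists_isRes e).choose_spec

lemma resolvent_eq_iff {e f : T.L2} : f = hT.resolvent e ↔ T.IsRes e f :=
  ⟨fun h => h ▸ hT.isRes_resolvent e, fun h => hT.isRes_unique h (hT.isRes_resolvent e)⟩

lemma isPosContraction_resolvent : IsPosContraction hT.resolvent where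
  symm e e' := hT.isRes_inner_symm (hT.isRes_resolvent e) (hT.isRes_resolvent e')
  nonneg e := by
    rw [real_inner_comm]
    exact (sq_nonneg _).trans (hT.norm_sq_le_inner_of_isRes (hT.isRes_resolvent e))
  le_one e := by
    rw [real_inner_self_eq_norm_sq]
    refine (real_inner_le_norm _ _).trans ?_
    rw [sq]
    exact mul_le_mul_of_nonneg_right (hT.norm_le_of_isRes (hT.isRes_resolvent e)) (norm_nonneg e)

lemma form_eq_zero_of_ae_eq_zero {u v : E → ℝ} (hu : u ∈ T.limDom .neumann)
    (h0 : u =ᵐ[T.limMeasure] 0) (n : ℕ) (hv : v ∈ T.dom n) : T.form n u v = 0 := by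
  have h1 := hT.eqOn_of_ae_eq n u (hu.2.1 n) 0 (hT.zero_mem n)
    (ae_mono (le_iSup T.measure n) h0)
  rw [hT.form_congr n u 0 v h1, hT.form_zero_left hv]

omit hT in
lemma mem_orthogonal_space_iff (e : T.L2) :
    e ∈ (T.space .neumann)ᗮ ↔ ∀ v ∈ T.limDom .neumann, ∫ x, e x * v x ∂T.limMeasure = 0 := by
  rw [space, Submodule.orthogonal_closure, Submodule.mem_orthogonal']
  constructor
  · intro h v hv
    have h1 := h hv.1.toLp (Submodule.subset_span ⟨v, hv, hv.1.coeFn_toLp⟩)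
    rwa [← integral_mul_of_ae_eq hv.1.coeFn_toLp] at h1
  · intro h f hf
    induction hf using Submodule.span_induction with
    | mem f hf =>
      obtain ⟨v, hv, hfv⟩ := hf
      rw [← integral_mul_of_ae_eq hfv]
      exact h v hv
    | zero => simp
    | add f g _ _ hf hg => rw [inner_add_right, hf, hg, add_zero]
    | smul c f _ hf => rw [inner_smul_right, hf, mul_zero]

theorem isResolvent : IsResolvent (T.graph .neumann) (T.space .neumann) hT.resolvent where
  contraction := hT.isPosContraction_resolvent
  apply_eq_zero_iff e := by
    rw [eq_comm, hT.resolvent_eq_iff, mem_orthogonal_space_iff]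
    constructor
    · rintro ⟨u, hu, h0, hB⟩ v hv
      have h1 : u =ᵐ[T.limMeasure] 0 := by
        filter_upwards [h0, Lp.coeFn_zero ℝ 2 T.limMeasure] with x h1 h2
        rw [← h1, h2]
      have h2 := hB v hv
      rw [sub_zero] at h2
      exact tendsto_nhds_unique h2
        (tendsto_const_nhds.congr fun n => (hT.form_eq_zero_of_ae_eq_zero hu h1 n (hv.2.1 n)).symm)
    · intro h
      refine ⟨0, hT.limDom_zero_mem, Lp.coeFn_zero _ _ _, fun v hv => ?_⟩
      rw [sub_zero, h v hv]
      exact tendsto_const_nhds.congr fun n => (hT.form_zero_left (hv.2.1 n)).symm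
  isClosed := Submodule.isClosed_topologicalClosure _
  mem_graph f h := by rw [mem_graph_iff_isRes, hT.resolvent_eq_iff]

/-- The Euler-Lagrange equation tested on v itself replaces the form by ∫ (e - v) v. -/
lemma limMinEnergy_eq {e v : E → ℝ} (he : MemLp e 2 T.limMeasure)
    (hv : v ∈ T.limDom .neumann) (hmin : ∀ n, energy T n e v ≤ limMinEnergy T e) :
    limMinEnergy T e = ∫ x, e x ^ 2 ∂T.limMeasure - ∫ x, v x * e x ∂T.limMeasure := by
  have hi : Integrable (fun x => (v x - e x) ^ 2) T.limMeasure := (hv.1.sub he).integrable_sq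
  have i1 : Integrable (fun x => (e x - v x) * v x) T.limMeasure :=
    (he.sub hv.1).integrable_mul hv.1
  have i2 : Integrable (fun x => v x * e x) T.limMeasure := hv.1.integrable_mul he
  have h2 := (hT.tendsto_form_of_minimizer he hv hmin hv).add (hT.tendsto_integral hi)
  have h5 : Tendsto (fun n => energy T n e v) atTop (𝓝 (limMinEnergy T e)) :=
    tendsto_of_tendsto_of_tendsto_of_le_of_le (hT.tendsto_minEnergy he) tendsto_const_nhds
      (fun n => hT.minEnergy_le e (hv.2.1 n)) hmin
  have h3 : limMinEnergy T e = ∫ x, (e x - v x) * v x ∂T.limMeasure +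
      ∫ x, (v x - e x) ^ 2 ∂T.limMeasure := tendsto_nhds_unique h5 h2
  have h4 := integral_add i1 hi
  have h6 := integral_sub he.integrable_sq i2
  rw [h3, ← h4, ← h6]
  refine integral_congr_ae (Eventually.of_forall fun x => ?_)
  ring_nf

/-- This expresses the resolvent by minimal energies of finite level, and so makes it measurable in
the environment. -/
lemma inner_resolvent_toLp {e : E → ℝ} (he : MemLp e 2 T.limMeasure) :
    inner ℝ (hT.resolvent he.toLp) (he.toLp : T.L2) =
      ∫ x, e x ^ 2 ∂T.limMeasure - limMinEnergy T e := by
  obtain ⟨v, hv, hmin⟩ := hT.exists_minimizer he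
  have hres : hv.1.toLp = hT.resolvent he.toLp :=
    hT.resolvent_eq_iff.2 (hT.isRes_toLp he hv hmin)
  have h4 : inner ℝ (hv.1.toLp : T.L2) (he.toLp : T.L2) = ∫ x, v x * e x ∂T.limMeasure := by
    rw [inner_L2]
    refine integral_congr_ae ?_
    filter_upwards [hv.1.coeFn_toLp, he.coeFn_toLp] with x h5 h6
    rw [h5, h6]
  rw [← hres, h4, hT.limMinEnergy_eq he hv hmin]
  ring

end IsBlowUp

end FormSequence

end LimitOperator

/-! ### Neumann-Dirichlet eigenfunctions -/

section NeumannDirichlet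

namespace FormSequence

variable {E : Type*} [MeasurableSpace E] {T : FormSequence E}

/-- Neumann-Dirichlet eigenfunctions of level `n` with eigenvalue in `I`. -/
def ndEigenfunctionsIn (T : FormSequence E) (n : ℕ) (I : Set ℝ) : Set (E → ℝ) :=
  {u | u ∈ T.dom n ∧ (∀ x ∈ T.boundary n, u x = 0) ∧ (∀ x, x ∉ T.carrier n → u x = 0) ∧
    ∃ t ∈ I, ∀ v ∈ T.dom n, T.form n u v = -t * ∫ x, u x * v x ∂T.measure n}

lemma ndEigenfunctions_eq (n : ℕ) : T.ndEigenfunctions n = T.ndEigenfunctionsIn n Set.univ := by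
  simp [ndEigenfunctions, ndEigenfunctionsIn]

/-- The classes of the Neumann-Dirichlet eigenfunctions of all levels. -/
def ndClasses (T : FormSequence E) : Set T.L2 :=
  {f : T.L2 | ∃ n, ∃ u ∈ T.ndEigenfunctions n, f =ᵐ[T.limMeasure] u}

lemma integral_eq_of_restrict {μ ν : Measure E} {S : Set E} (h : μ.restrict S = ν.restrict S)
    {f : E → ℝ} (hf : ∀ x ∉ S, f x = 0) : ∫ x, f x ∂μ = ∫ x, f x ∂ν := by
  rw [← setIntegral_eq_integral_of_forall_compl_eq_zero hf, h,
    setIntegral_eq_integral_of_forall_compl_eq_zero hf]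

namespace IsBlowUp

variable (hT : T.IsBlowUp)

include hT

omit hT in
lemma eq_zero_of_notMem {n : ℕ} {I : Set ℝ} {u : E → ℝ} (hu : u ∈ T.ndEigenfunctionsIn n I) :
    ∀ x ∉ T.carrier n \ T.boundary n, u x = 0 := by
  intro x hx
  by_cases h : x ∈ T.carrier n
  · exact hu.2.1 x (by_contra fun h' => hx ⟨h, h'⟩)
  · exact hu.2.2.1 x h

/-- Both conditions are needed: vanishing on the boundary lets the function be extended by 0, and
the Neumann condition means that the extension creates no term there. The measure does not change
where the function is nonzero. -/
lemma ndEigenfunctionsIn_succ (n : ℕ) (I : Set ℝ) :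
    T.ndEigenfunctionsIn n I ⊆ T.ndEigenfunctionsIn (n + 1) I := by
  intro u hu
  have h0 := eq_zero_of_notMem hu
  obtain ⟨hd, hb, hc, t, ht, hB⟩ := hu
  obtain ⟨hd', hB'⟩ := hT.extend n u hd hb hc
  refine ⟨hd', fun x hx => ?_, fun x hx => hc x fun h => hx (hT.carrier_succ n h), t, ht,
    fun v hv => ?_⟩
  · by_cases h : x ∈ T.carrier n
    · exact hb x (hT.boundary_succ n ⟨hx, h⟩)
    · exact hc x h
  · rw [hB' v hv, hB v (hT.dom_succ n hv)]
    congr 1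
    exact (integral_eq_of_restrict (hT.restrict_sdiff_boundary (Nat.le_succ n))
      fun x hx => by rw [h0 x hx, zero_mul]).symm

lemma ndEigenfunctionsIn_mono {m n : ℕ} (h : m ≤ n) (I : Set ℝ) :
    T.ndEigenfunctionsIn m I ⊆ T.ndEigenfunctionsIn n I := by
  induction n, h using Nat.le_induction with
  | base => exact subset_rfl
  | succ n _ ih => exact ih.trans (hT.ndEigenfunctionsIn_succ n I)

lemma memLp_of_eq_zero {n : ℕ} {u : E → ℝ} (hu : MemLp u 2 (T.measure n))
    (h0 : ∀ x ∉ T.carrier n \ T.boundary n, u x = 0) : MemLp u 2 T.limMeasure := by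
  have hS := hT.measurableSet_sdiff_boundary n
  have h1 : (T.carrier n \ T.boundary n).indicator u = u := by
    rw [Set.indicator_eq_self]
    exact fun x hx => by_contra fun h => hx (h0 x h)
  rw [← h1, memLp_indicator_iff_restrict hS, hT.limMeasure_restrict_sdiff_boundary]
  exact hu.restrict _

lemma mem_limDom_of_nd {n : ℕ} {I : Set ℝ} {u : E → ℝ} (hu : u ∈ T.ndEigenfunctionsIn n I) :
    u ∈ T.limDom .neumann := by
  have h0 := eq_zero_of_notMem hu
  have hdom : ∀ m, u ∈ T.dom m := fun m =>
    hT.dom_anti (le_max_left m n) (hT.ndEigenfunctionsIn_mono (le_max_right m n) I hu).1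
  refine ⟨hT.memLp_of_eq_zero (hT.memLp n u hu.1) h0, hdom, T.form n u u, ?_⟩
  rintro _ ⟨m, rfl⟩
  dsimp only
  rcases le_total m n with h | h
  · exact hT.form_le h hu.1
  · refine le_of_eq ?_
    induction m, h using Nat.le_induction with
    | base => rfl
    | succ m hm ih =>
      obtain ⟨h1, h2, h3, -⟩ := hT.ndEigenfunctionsIn_mono hm I hu
      rw [(hT.extend m u h1 h2 h3).2 u (hdom _), ih]

omit hT in
lemma smul_mem_space {u : E → ℝ} (hu : u ∈ T.limDom .neumann) {f : T.L2}
    (hf : f =ᵐ[T.limMeasure] u) (t : ℝ) : t • f ∈ T.space .neumann :=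
  Submodule.smul_mem _ t (subset_closure (Submodule.subset_span ⟨u, hu, hf⟩))

/-- From level n on the forms against a fixed test function are constant, so the limit is reached
and gives the same eigenvalue. -/
lemma mem_graph_of_nd {n : ℕ} {I : Set ℝ} {u : E → ℝ} (hu : u ∈ T.ndEigenfunctionsIn n I)
    {f : T.L2} (hf : f =ᵐ[T.limMeasure] u) : ∃ t ∈ I, (f, t • f) ∈ T.graph .neumann := by
  have hlim := hT.mem_limDom_of_nd hu
  have h0 := eq_zero_of_notMem hu
  have hu' := hu
  obtain ⟨hd, hb, hc, t, ht, hB⟩ := hu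
  refine ⟨t, ht, smul_mem_space hlim hf t, u, hlim, hf, fun v hv => ?_⟩
  have hint : ∀ m ≥ n, T.form m u v = -t * ∫ x, u x * v x ∂T.measure n := by
    intro m hm
    induction m, hm using Nat.le_induction with
    | base => exact hB v (hv.2.1 n)
    | succ m hm ih =>
      obtain ⟨h1, h2, h3, -⟩ := hT.ndEigenfunctionsIn_mono hm I hu'
      rw [(hT.extend m u h1 h2 h3).2 v (hv.2.1 _), ih]
  have h1 : -∫ x, (t • f : T.L2) x * v x ∂T.limMeasure = -t * ∫ x, u x * v x ∂T.measure n := by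
    rw [← integral_eq_of_restrict (hT.limMeasure_restrict_sdiff_boundary n)
      fun x hx => by rw [h0 x hx, zero_mul], neg_mul, ← integral_const_mul]
    congr 1
    refine integral_congr_ae ?_
    filter_upwards [hf, Lp.coeFn_smul t f] with x h2 h3
    rw [h3, Pi.smul_apply, h2, smul_eq_mul, mul_assoc]
  dsimp only
  rw [h1]
  refine tendsto_const_nhds.congr' ?_
  filter_upwards [eventually_ge_atTop n] with m hm using (hint m hm).symm

lemma ndClasses_eigenvectors : ∀ f ∈ T.ndClasses, ∃ t : ℝ, (f, t • f) ∈ T.graph .neumann := by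
  rintro f ⟨n, u, hu, hf⟩
  rw [ndEigenfunctions_eq] at hu
  obtain ⟨t, -, h⟩ := hT.mem_graph_of_nd hu hf
  exact ⟨t, h⟩

/-- Finitely many eigenfunctions can be lifted to a common level, so spans of classes come from
spans inside a single finite level. -/
lemma mem_span_ndClasses_iff {I : Set ℝ} {z : T.L2} :
    z ∈ Submodule.span ℝ {f | f ∈ T.ndClasses ∧ ∃ t ∈ I, (f, t • f) ∈ T.graph .neumann} ↔
      ∃ n, ∃ w ∈ Submodule.span ℝ (T.ndEigenfunctionsIn n I), z =ᵐ[T.limMeasure] w := by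
  constructor
  · intro hz
    induction hz using Submodule.span_induction with
    | mem f hf =>
      obtain ⟨⟨n, u, hu, hfu⟩, t, ht, hft⟩ := hf
      rw [ndEigenfunctions_eq] at hu
      rcases eq_or_ne f 0 with rfl | hf0
      · exact ⟨0, 0, Submodule.zero_mem _, Lp.coeFn_zero _ _ _⟩
      · refine ⟨n, u, Submodule.subset_span ?_, hfu⟩
        obtain ⟨h1, h2, h3, t', -, hB⟩ := hu
        -- The eigenvalue of the finite-level form and the one read in the graph agree, because the
        -- resolvent has a single eigenvalue at a nonzero vector.
        obtain ⟨t'', ht'', hft'⟩ :=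
          hT.mem_graph_of_nd (I := {t'}) ⟨h1, h2, h3, t', rfl, hB⟩ hfu
        rw [Set.mem_singleton_iff] at ht''
        subst ht''
        have e1 := (hT.isResolvent.eigenvalue_props hft hf0).2.2
        have e2 := (hT.isResolvent.eigenvalue_props hft' hf0).2.2
        rw [e1] at e2
        have e3 := inv_injective (smul_left_injective ℝ hf0 e2)
        have e4 : t = t'' := by linarith
        exact ⟨h1, h2, h3, t, ht, by rwa [e4]⟩
    | zero => exact ⟨0, 0, Submodule.zero_mem _, Lp.coeFn_zero _ _ _⟩
    | add x y _ _ hx hy =>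
      obtain ⟨n, w, hw, hxw⟩ := hx
      obtain ⟨n', w', hw', hyw⟩ := hy
      refine ⟨max n n', w + w', Submodule.add_mem _
        (Submodule.span_mono (hT.ndEigenfunctionsIn_mono (le_max_left _ _) I) hw)
        (Submodule.span_mono (hT.ndEigenfunctionsIn_mono (le_max_right _ _) I) hw'), ?_⟩
      exact (Lp.coeFn_add x y).trans (hxw.add hyw)
    | smul c x _ hx =>
      obtain ⟨n, w, hw, hxw⟩ := hx
      exact ⟨n, c • w, Submodule.smul_mem _ c hw,
        (Lp.coeFn_smul c x).trans (hxw.const_smul c)⟩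
  · rintro ⟨n, w, hw, hzw⟩
    induction hw using Submodule.span_induction generalizing z with
    | mem u hu =>
      refine Submodule.subset_span ⟨⟨n, u, ?_, hzw⟩, hT.mem_graph_of_nd hu hzw⟩
      obtain ⟨h1, h2, h3, t, -, hB⟩ := hu
      exact ⟨h1, h2, h3, t, hB⟩
    | zero =>
      have : z = 0 := Lp.ext (hzw.trans (Lp.coeFn_zero _ _ _).symm)
      rw [this]
      exact Submodule.zero_mem _
    | add u v hu hv ihu ihv =>
      have hmem : ∀ y ∈ Submodule.span ℝ (T.ndEigenfunctionsIn n I), MemLp y 2 T.limMeasure := by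
        intro y hy
        induction hy using Submodule.span_induction with
        | mem y hy => exact (hT.mem_limDom_of_nd hy).1
        | zero => exact MemLp.zero
        | add y y' _ _ h h' => exact h.add h'
        | smul c y _ h => exact h.const_smul c
      have hz : z = (hmem u hu).toLp + (hmem v hv).toLp := by
        rw [← MemLp.toLp_add]
        exact Lp.ext (hzw.trans ((hmem u hu).add (hmem v hv)).coeFn_toLp.symm)
      rw [hz]
      exact Submodule.add_mem _ (ihu (MemLp.coeFn_toLp _)) (ihv (MemLp.coeFn_toLp _))
    | smul c u hu ihu =>
      rcases eq_or_ne c 0 with rfl | hc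
      · have : z = 0 := Lp.ext (hzw.trans (by rw [zero_smul]; exact (Lp.coeFn_zero _ _ _).symm))
        rw [this]
        exact Submodule.zero_mem _
      · have h1 : (c⁻¹ • z : T.L2) =ᵐ[T.limMeasure] u := by
          filter_upwards [hzw, Lp.coeFn_smul c⁻¹ z] with x h2 h3
          rw [h3, Pi.smul_apply, h2, Pi.smul_apply, smul_smul, inv_mul_cancel₀ hc, one_smul]
        have h2 := Submodule.smul_mem _ c (ihu h1)
        rwa [smul_smul, mul_inv_cancel₀ hc, one_smul] at h2

/-- Only data of level n remain on the right. Restricting to n ≥ m costs nothing, as eigenfunctions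
persist, and makes level n see all letters on which e depends. -/
lemma exists_span_ndClasses_iff {I : Set ℝ} {e : E → ℝ} (he : MemLp e 2 T.limMeasure) (c : ℝ)
    (m : ℕ) :
    (∃ z ∈ Submodule.span ℝ {f | f ∈ T.ndClasses ∧ ∃ t ∈ I, (f, t • f) ∈ T.graph .neumann},
      c < 2 * inner ℝ (he.toLp : T.L2) z - ‖z‖ ^ 2) ↔
    ∃ n ≥ m, ∃ w ∈ Submodule.span ℝ (T.ndEigenfunctionsIn n I),
      c < 2 * ∫ x, e x * w x ∂(T.measure n) - ∫ x, w x ^ 2 ∂(T.measure n) := by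
  have hspan : ∀ n, ∀ w ∈ Submodule.span ℝ (T.ndEigenfunctionsIn n I), MemLp w 2 T.limMeasure ∧
      ∀ x ∉ T.carrier n \ T.boundary n, w x = 0 := by
    intro n w hw
    induction hw using Submodule.span_induction with
    | mem y hy => exact ⟨(hT.mem_limDom_of_nd hy).1, eq_zero_of_notMem hy⟩
    | zero => exact ⟨MemLp.zero, fun x _ => rfl⟩
    | add y y' _ _ h h' =>
      exact ⟨h.1.add h'.1, fun x hx => by rw [Pi.add_apply, h.2 x hx, h'.2 x hx, add_zero]⟩
    | smul c y _ h =>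
      exact ⟨h.1.const_smul c, fun x hx => by rw [Pi.smul_apply, h.2 x hx, smul_zero]⟩
  have key : ∀ n, ∀ w ∈ Submodule.span ℝ (T.ndEigenfunctionsIn n I), ∀ z : T.L2,
      z =ᵐ[T.limMeasure] w → 2 * inner ℝ (he.toLp : T.L2) z - ‖z‖ ^ 2 =
        2 * ∫ x, e x * w x ∂(T.measure n) - ∫ x, w x ^ 2 ∂(T.measure n) := by
    intro n w hw z hz
    obtain ⟨h1, h0⟩ := hspan n w hw
    have hr := hT.limMeasure_restrict_sdiff_boundary n
    rw [← integral_eq_of_restrict hr fun x hx => by rw [h0 x hx, mul_zero],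
      ← integral_eq_of_restrict hr fun x hx => by rw [h0 x hx, sq, zero_mul],
      ← real_inner_self_eq_norm_sq, inner_L2, inner_L2]
    congr 1
    · congr 1
      refine integral_congr_ae ?_
      filter_upwards [hz, he.coeFn_toLp] with x h2 h3
      rw [h2, h3]
    · refine integral_congr_ae ?_
      filter_upwards [hz] with x h2
      rw [h2, sq]
  constructor
  · rintro ⟨z, hz, hc⟩
    obtain ⟨n, w, hw, hzw⟩ := hT.mem_span_ndClasses_iff.1 hz
    have hw' := Submodule.span_mono (hT.ndEigenfunctionsIn_mono (le_max_left n m) I) hw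
    exact ⟨max n m, le_max_right _ _, w, hw', by rwa [← key _ w hw' z hzw]⟩
  · rintro ⟨n, -, w, hw, hc⟩
    have h1 := (hspan n w hw).1
    refine ⟨h1.toLp, hT.mem_span_ndClasses_iff.2 ⟨n, w, hw, h1.coeFn_toLp⟩, ?_⟩
    rwa [key n w hw _ h1.coeFn_toLp]

end IsBlowUp

end FormSequence

end NeumannDirichlet

/-! ### Measurability of the spectra of random blow-ups -/

section RandomSpectra

/-- The function factors through a finite discrete space of words. -/
lemma measurable_of_dependsOn {N : ℕ} {β : Type*} [MeasurableSpace β] [Nonempty β]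
    {f : (ℕ → Fin N) → β} {n : ℕ} (h : DependsOn f (Set.Iio n)) : Measurable f := by
  obtain ⟨g, rfl⟩ := dependsOn_iff_exists_comp.1 h
  exact (Measurable.of_discrete (f := g)).comp
    (measurable_pi_iff.2 fun i => measurable_pi_apply _)

namespace FormSequence

variable {N : ℕ} {E : Type*} [MeasurableSpace E] {T : (ℕ → Fin N) → FormSequence E}

/-- The data of level `n` depend only on the first `n` coordinates of `ω`. -/
structure IsAdapted (T : (ℕ → Fin N) → FormSequence E) : Prop where
  carrier : ∀ n, DependsOn (fun ω => (T ω).carrier n) (Set.Iio n)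
  boundary : ∀ n, DependsOn (fun ω => (T ω).boundary n) (Set.Iio n)
  measure : ∀ n, DependsOn (fun ω => (T ω).measure n) (Set.Iio n)
  dom : ∀ n, DependsOn (fun ω => (T ω).dom n) (Set.Iio n)
  form : ∀ n, DependsOn (fun ω => (T ω).form n) (Set.Iio n)

/-- The environments whose boundaries leave every finite level. -/
abbrev Good (T : (ℕ → Fin N) → FormSequence E) : Type := {ω : ℕ → Fin N // (T ω).Exhausts}

/-- A total family in `L²`. -/
def cutIndicator (T : (ℕ → Fin N) → FormSequence E) (i : ℕ × Set E) (ω : ℕ → Fin N) : E → ℝ :=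
  (i.2 ∩ (T ω).carrier i.1).indicator fun _ => 1

variable (hT : ∀ ω, (T ω).IsBlowUp) (hA : IsAdapted T)

include hA in
lemma cutIndicator_dependsOn (i : ℕ × Set E) : DependsOn (cutIndicator T i) (Set.Iio i.1) := by
  intro ω ω' h
  have := hA.carrier i.1 h
  dsimp only at this
  rw [cutIndicator, cutIndicator, this]

lemma measurableSet_exhausts (hA : IsAdapted T) : MeasurableSet {ω | (T ω).Exhausts} := by
  have h : {ω | (T ω).Exhausts} =
      ⋂ n, ⋃ m, ⋃ (_ : m ≥ n), {ω | Disjoint ((T ω).carrier n) ((T ω).boundary m)} := by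
    ext ω
    simp [Exhausts]
  rw [h]
  refine MeasurableSet.iInter fun n => MeasurableSet.iUnion fun m =>
    MeasurableSet.iUnion fun hm => ?_
  refine measurableSet_setOfPred.2 (measurable_of_dependsOn (n := m) fun ω ω' hω => ?_)
  have h1 := hA.carrier n fun i hi => hω i (lt_of_lt_of_le hi hm)
  have h2 := hA.boundary m hω
  dsimp only at h1 h2
  rw [h1, h2]

include hT

lemma memLp_cutIndicator (ω : Good T) {i : ℕ × Set E} (hi : MeasurableSet i.2) :
    MemLp (cutIndicator T i ω) 2 (T ω).limMeasure := by
  have hm := (hT ω).measurableSet_carrier i.1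
  exact memLp_indicator_const 2 (hi.inter hm) 1 (Or.inr
    ((measure_mono Set.inter_subset_right).trans_lt
      ((hT ω).limMeasure_carrier_lt_top ω.2 i.1)).ne)

include hA

/-- Limit of the integrals of levels n + m, each of which depends on finitely many letters. -/
lemma measurable_integral {m : ℕ} {g : (ℕ → Fin N) → E → ℝ} (hg : DependsOn g (Set.Iio m))
    (hi : ∀ ω : Good T, Integrable (g ω) (T ω).limMeasure) :
    Measurable fun ω : Good T => ∫ x, g ω x ∂(T ω).limMeasure := by
  refine measurable_of_tendsto_metrizable
    (f := fun n (ω : Good T) => ∫ x, g ω x ∂(T ω).measure (n + m)) (fun n => ?_)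
    (tendsto_pi_nhds.2 fun ω => ((hT ω).tendsto_integral (hi ω)).comp (tendsto_add_atTop_nat m))
  refine (measurable_of_dependsOn (n := n + m)
    (f := fun ω => ∫ x, g ω x ∂(T ω).measure (n + m)) fun ω ω' hω => ?_).comp measurable_subtype_coe
  have h1 := hA.measure (n + m) hω
  have h2 := hg fun i hi => hω i (lt_of_lt_of_le hi (Nat.le_add_left m n))
  dsimp only at h1 ⊢
  rw [h1, h2]

/-- The infimum at each level runs over an uncountable domain, but it depends on finitely many
letters only, which settles its measurability. -/
lemma measurable_limMinEnergy {m : ℕ} {g : (ℕ → Fin N) → E → ℝ} (hg : DependsOn g (Set.Iio m))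
    (hi : ∀ ω : Good T, MemLp (g ω) 2 (T ω).limMeasure) :
    Measurable fun ω : Good T => IsBlowUp.limMinEnergy (T ω) (g ω) := by
  refine measurable_of_tendsto_metrizable
    (f := fun n (ω : Good T) => IsBlowUp.minEnergy (T ω) (n + m) (g ω)) (fun n => ?_)
    (tendsto_pi_nhds.2 fun ω => ((hT ω).tendsto_minEnergy (hi ω)).comp (tendsto_add_atTop_nat m))
  refine (measurable_of_dependsOn (n := n + m)
    (f := fun ω => IsBlowUp.minEnergy (T ω) (n + m) (g ω)) fun ω ω' hω => ?_).comp
      measurable_subtype_coe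
  have h1 := hA.measure (n + m) hω
  have h2 := hg fun i hi => hω i (lt_of_lt_of_le hi (Nat.le_add_left m n))
  have h3 := hA.dom (n + m) hω
  have h4 := hA.form (n + m) hω
  dsimp only at h1 h3 h4 ⊢
  have h5 : IsBlowUp.energy (T ω) (n + m) (g ω) = IsBlowUp.energy (T ω') (n + m) (g ω') := by
    funext u
    rw [IsBlowUp.energy, IsBlowUp.energy, h1, h2, h4]
  rw [IsBlowUp.minEnergy, IsBlowUp.minEnergy, h5, h3]

lemma measurable_inner_resolvent_self {m : ℕ} {g : (ℕ → Fin N) → E → ℝ}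
    (hg : DependsOn g (Set.Iio m)) (hi : ∀ ω : Good T, MemLp (g ω) 2 (T ω).limMeasure) :
    Measurable fun ω : Good T =>
      inner ℝ ((hT ω).resolvent (hi ω).toLp) ((hi ω).toLp : (T ω).L2) := by
  simp only [(hT _).inner_resolvent_toLp]
  refine (measurable_integral hT hA (m := m) (g := fun ω x => g ω x ^ 2) (fun ω ω' hω => ?_)
    fun ω => (hi ω).integrable_sq).sub (measurable_limMinEnergy hT hA hg hi)
  have h2 := hg hω
  dsimp only
  rw [h2]

lemma measurable_inner_resolvent {m : ℕ} {g g' : (ℕ → Fin N) → E → ℝ}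
    (hg : DependsOn g (Set.Iio m)) (hi : ∀ ω : Good T, MemLp (g ω) 2 (T ω).limMeasure)
    (hg' : DependsOn g' (Set.Iio m)) (hi' : ∀ ω : Good T, MemLp (g' ω) 2 (T ω).limMeasure) :
    Measurable fun ω : Good T =>
      inner ℝ ((hT ω).resolvent (hi ω).toLp) ((hi' ω).toLp : (T ω).L2) := by
  have h1 := measurable_inner_resolvent_self hT hA (m := m) (g := fun ω => g ω + g' ω)
    (fun ω ω' hω => by dsimp only; rw [hg hω, hg' hω]) (fun ω => (hi ω).add (hi' ω))
  have h2 := measurable_inner_resolvent_self hT hA (m := m) (g := fun ω => g ω - g' ω)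
    (fun ω ω' hω => by dsimp only; rw [hg hω, hg' hω]) (fun ω => (hi ω).sub (hi' ω))
  have h3 : (fun ω : Good T => inner ℝ ((hT ω).resolvent (hi ω).toLp) ((hi' ω).toLp : (T ω).L2)) =
      fun ω : Good T => (inner ℝ ((hT ω).resolvent ((hi ω).add (hi' ω)).toLp)
        (((hi ω).add (hi' ω)).toLp : (T ω).L2) -
        inner ℝ ((hT ω).resolvent ((hi ω).sub (hi' ω)).toLp)
        (((hi ω).sub (hi' ω)).toLp : (T ω).L2)) / 4 := by
    ext ω
    have h4 := (hT ω).isPosContraction_resolvent.symm (hi' ω).toLp (hi ω).toLp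
    rw [MemLp.toLp_add (hi ω) (hi' ω), MemLp.toLp_sub (hi ω) (hi' ω), map_add, map_sub,
      inner_add_left, inner_add_right,
      inner_add_right, inner_sub_left, inner_sub_right, inner_sub_right, h4,
      real_inner_comm ((hT ω).resolvent (hi ω).toLp) (hi' ω).toLp]
    ring
  rw [h3]
  exact (h1.sub h2).div_const 4

lemma measurable_inner {m : ℕ} {g g' : (ℕ → Fin N) → E → ℝ}
    (hg : DependsOn g (Set.Iio m)) (hi : ∀ ω : Good T, MemLp (g ω) 2 (T ω).limMeasure)
    (hg' : DependsOn g' (Set.Iio m)) (hi' : ∀ ω : Good T, MemLp (g' ω) 2 (T ω).limMeasure) :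
    Measurable fun ω : Good T => inner ℝ ((hi ω).toLp : (T ω).L2) ((hi' ω).toLp : (T ω).L2) := by
  have h1 := measurable_integral hT hA (m := m) (g := fun ω x => g ω x * g' ω x)
    (fun ω ω' hω => by dsimp only; rw [hg hω, hg' hω]) (fun ω => (hi ω).integrable_mul (hi' ω))
  convert h1 using 2 with ω
  rw [inner_L2]
  refine integral_congr_ae ?_
  filter_upwards [(hi ω).coeFn_toLp, (hi' ω).coeFn_toLp] with x h5 h6
  rw [h5, h6]

/-- A countable union over levels of events determined by finitely many letters. -/
lemma measurableSet_span_ndClasses {m : ℕ} {g : (ℕ → Fin N) → E → ℝ}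
    (hg : DependsOn g (Set.Iio m)) (hi : ∀ ω : Good T, MemLp (g ω) 2 (T ω).limMeasure)
    (I : Set ℝ) (c : ℝ) :
    MeasurableSet {ω : Good T | ∃ z ∈ Submodule.span ℝ
      {f | f ∈ (T ω).ndClasses ∧ ∃ t ∈ I, (f, t • f) ∈ (T ω).graph .neumann},
      c < 2 * inner ℝ ((hi ω).toLp : (T ω).L2) z - ‖z‖ ^ 2} := by
  simp only [(hT _).exists_span_ndClasses_iff (hi _) c m]
  have hset : {ω : Good T | ∃ n ≥ m, ∃ w ∈ Submodule.span ℝ ((T ω).ndEigenfunctionsIn n I),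
      c < 2 * ∫ x, g ω x * w x ∂((T ω).measure n) - ∫ x, w x ^ 2 ∂((T ω).measure n)} =
      ⋃ n, ⋃ (_ : n ≥ m), Subtype.val ⁻¹'
        {ω | ∃ w ∈ Submodule.span ℝ ((T ω).ndEigenfunctionsIn n I),
      c < 2 * ∫ x, g ω x * w x ∂((T ω).measure n) - ∫ x, w x ^ 2 ∂((T ω).measure n)} := by
    ext ω
    simp
  rw [hset]
  refine MeasurableSet.iUnion fun n => MeasurableSet.iUnion fun hn => measurable_subtype_coe ?_
  refine measurableSet_setOfPred.2 (measurable_of_dependsOn (n := n) fun ω ω' hω => ?_)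
  have h1 := hA.measure n hω
  have h2 := hg fun i hi => hω i (lt_of_lt_of_le hi hn)
  have h3 := hA.dom n hω
  have h4 := hA.form n hω
  have h5 := hA.carrier n hω
  have h6 := hA.boundary n hω
  dsimp only at h1 h3 h4 h5 h6
  simp only [ndEigenfunctionsIn, h1, h2, h3, h4, h5, h6]

end FormSequence

/-- A countable family of measurable sets, stable under intersections, that generates the
`σ`-algebra. -/
def cutSets (E : Type*) [MeasurableSpace E] [MeasurableSpace.CountablyGenerated E] : Set (Set E) :=
  generateSetAlgebra (MeasurableSpace.countableGeneratingSet E)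

section CutSets

variable {E : Type*} [mE : MeasurableSpace E] [MeasurableSpace.CountablyGenerated E]

lemma countable_cutSets : (cutSets E).Countable :=
  countable_generateSetAlgebra MeasurableSpace.countable_countableGeneratingSet

lemma generateFrom_cutSets : mE = MeasurableSpace.generateFrom (cutSets E) := by
  rw [cutSets, generateFrom_generateSetAlgebra_eq,
    MeasurableSpace.generateFrom_countableGeneratingSet]

lemma isPiSystem_cutSets : IsPiSystem (cutSets E) := fun _ hs _ ht _ =>
  isSetAlgebra_generateSetAlgebra.inter_mem hs ht

lemma univ_mem_cutSets : Set.univ ∈ cutSets E := isSetAlgebra_generateSetAlgebra.univ_mem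

lemma measurableSet_of_mem_cutSets {A : Set E} (hA : A ∈ cutSets E) : MeasurableSet A := by
  rw [generateFrom_cutSets (E := E)]
  exact MeasurableSpace.measurableSet_generateFrom hA

end CutSets

namespace FormSequence

variable {N : ℕ} {E : Type*} [mE : MeasurableSpace E] [MeasurableSpace.CountablyGenerated E]
  {T : (ℕ → Fin N) → FormSequence E} (hT : ∀ ω, (T ω).IsBlowUp)

/-- The classes of the indicators of a countable family of sets. -/
def cutField (hT : ∀ ω, (T ω).IsBlowUp) (i : ℕ × cutSets E) (ω : Good T) : (T ω).L2 :=
  (memLp_cutIndicator hT ω (i := (i.1, i.2.1)) (measurableSet_of_mem_cutSets i.2.2)).toLp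

/-- A function orthogonal to the family has zero integral over A ∩ carrier for A in a generating
π-system, hence for all measurable A, so it vanishes on every level. -/
lemma cutField_total (ω : Good T) :
    (Submodule.span ℝ (Set.range fun i => cutField hT i ω)).topologicalClosure = ⊤ := by
  rw [Submodule.topologicalClosure_eq_top_iff, Submodule.eq_bot_iff]
  intro f hf
  rw [Submodule.mem_orthogonal'] at hf
  have hfin := fun n => (hT ω).limMeasure_carrier_lt_top ω.2 n
  have hcm := (hT ω).measurableSet_carrier
  have hint : ∀ n, Integrable f ((T ω).limMeasure.restrict ((T ω).carrier n)) := fun n => by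
    have : IsFiniteMeasure ((T ω).limMeasure.restrict ((T ω).carrier n)) :=
      ⟨by rw [Measure.restrict_apply_univ]; exact hfin n⟩
    exact ((Lp.memLp f).restrict _).integrable (by norm_num)
  have h0 : ∀ n, ∀ A ∈ cutSets E,
      ∫ x in A, f x ∂((T ω).limMeasure.restrict ((T ω).carrier n)) = 0 := by
    intro n A hA
    have hAm := measurableSet_of_mem_cutSets hA
    have h1 := hf _ (Submodule.subset_span ⟨(n, ⟨A, hA⟩), rfl⟩)
    have h2 := (memLp_cutIndicator hT ω (i := (n, A)) hAm).coeFn_toLp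
    change inner ℝ f (memLp_cutIndicator hT ω (i := (n, A)) hAm).toLp = 0 at h1
    rw [← integral_mul_of_ae_eq h2] at h1
    rw [Measure.restrict_restrict hAm, ← integral_indicator (hAm.inter (hcm n)), ← h1]
    congr 1
    ext x
    simp only [cutIndicator]
    by_cases hx : x ∈ A ∩ (T ω).carrier n <;> simp [hx]
  have hall : ∀ n (A : Set E), MeasurableSet A →
      ∫ x in A, f x ∂((T ω).limMeasure.restrict ((T ω).carrier n)) = 0 := by
    intro n A hA
    refine MeasurableSpace.induction_on_inter (C := fun A _ =>
      ∫ x in A, f x ∂((T ω).limMeasure.restrict ((T ω).carrier n)) = 0) generateFrom_cutSets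
      isPiSystem_cutSets ?_ ?_ ?_ ?_ A hA
    · simp
    · exact fun A hA => h0 n A hA
    · intro A hA ih
      have h3 := integral_add_compl hA (hint n)
      have h4 := h0 n Set.univ univ_mem_cutSets
      rw [setIntegral_univ] at h4
      linarith
    · intro A hd hA ih
      rw [integral_iUnion hA hd (hint n).integrableOn]
      simp [ih]
  have hae : ∀ n, ∀ᵐ x ∂(T ω).limMeasure, x ∈ (T ω).carrier n → f x = 0 := by
    intro n
    have h2 : f =ᵐ[(T ω).limMeasure.restrict ((T ω).carrier n)] 0 :=
      (hint n).ae_eq_zero_of_forall_setIntegral_eq_zero fun A hA _ => hall n A hA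
    exact (ae_restrict_iff' (hcm n)).1 h2
  have hcov : ∀ᵐ x ∂(T ω).limMeasure, x ∈ ⋃ n, (T ω).carrier n := (hT ω).limMeasure_compl
  refine Lp.ext ?_
  filter_upwards [ae_all_iff.2 hae, hcov, Lp.coeFn_zero ℝ 2 (T ω).limMeasure] with x h1 h2 h3
  obtain ⟨n, hn⟩ := Set.mem_iUnion.1 h2
  rw [h3, h1 n hn, Pi.zero_apply]

/-- The six spectra. -/
def spectra (T : FormSequence E) (ε : BC) : Fin 6 → Set ℝ :=
  ![T.spec ε, T.acSpec ε, T.scSpec ε, T.ppSpec ε, T.ppTildeSpec ε, T.ndSpec ε]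

include hT in
theorem measurableSet_inter_spectra (hA : IsAdapted T) (j : Fin 6) (p q : ℝ) :
    MeasurableSet {ω : Good T | Set.Ioo p q ∩ (T ω).spectra .neumann j = ∅} := by
  have := (countable_cutSets (E := E)).to_subtype
  have he := cutField_total hT
  have hdep : ∀ (i : ℕ × cutSets E) (m : ℕ), i.1 ≤ m →
      DependsOn (cutIndicator T (i.1, i.2.1)) (Set.Iio m) := fun i m hm =>
    (cutIndicator_dependsOn hA (i.1, i.2.1)).mono (Set.Iio_subset_Iio hm)
  have hLp : ∀ (i : ℕ × cutSets E) (ω : Good T),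
      MemLp (cutIndicator T (i.1, i.2.1) ω) 2 (T ω).limMeasure := fun i ω =>
    memLp_cutIndicator hT ω (i := (i.1, i.2.1)) (measurableSet_of_mem_cutSets i.2.2)
  have hin : ∀ i j, Measurable fun ω => inner ℝ (cutField hT i ω) (cutField hT j ω) := fun i j =>
    measurable_inner hT hA (hdep i _ (le_max_left i.1 j.1)) (hLp i)
      (hdep j _ (le_max_right i.1 j.1)) (hLp j)
  have hH : ∀ ω : Good T, IsResolvent ((T ω).graph .neumann) ((T ω).space .neumann)
      (hT ω).resolvent := fun ω => (hT ω).isResolvent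
  have hRm : ∀ i j, Measurable fun ω : Good T =>
      inner ℝ ((hT ω).resolvent (cutField hT i ω)) (cutField hT j ω) := fun i j =>
    measurable_inner_resolvent hT hA (hdep i _ (le_max_left i.1 j.1)) (hLp i)
      (hdep j _ (le_max_right i.1 j.1)) (hLp j)
  have hG : ∀ ω : Good T, ∀ f ∈ (T ω).ndClasses, ∃ t : ℝ, (f, t • f) ∈ (T ω).graph .neumann :=
    fun ω => (hT ω).ndClasses_eigenvectors
  have hGm := fun (p q : ℝ) (i : ℕ × cutSets E) (c : ℝ) =>
    measurableSet_span_ndClasses hT hA (hdep i _ le_rfl) (hLp i) (Set.Ioo p q) c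
  fin_cases j
  · exact measurableSet_inter_spectrum he hin hH hRm p q
  · exact measurableSet_inter_acSpectrum he hin hH hRm p q
  · exact measurableSet_inter_scSpectrum he hin hH hRm p q
  · exact measurableSet_inter_ppSpectrum he hin hH hRm p q
  · exact measurableSet_inter_ppTildeSpectrum he hin hH hRm hG hGm p q
  · exact measurableSet_inter_ndSpectrum he hH hG hGm p q

end FormSequence

end RandomSpectra

/-! ### Transport by an isometry -/

section IsometricTransport

section Isometry

variable {L L' : Type*} [NormedAddCommGroup L] [InnerProductSpace ℝ L] [CompleteSpace L]
  [NormedAddCommGroup L'] [InnerProductSpace ℝ L'] [CompleteSpace L']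
  (U : L ≃ₗᵢ[ℝ] L') {Γ : Set (L × L)} {Γ' : Set (L' × L')}
  (hΓ : ∀ f h, (f, h) ∈ Γ ↔ (U f, U h) ∈ Γ')

include hΓ

omit [CompleteSpace L] [CompleteSpace L'] in
lemma mem_graph_symm (f h : L') : (f, h) ∈ Γ' ↔ (U.symm f, U.symm h) ∈ Γ := by
  rw [hΓ, U.apply_symm_apply, U.apply_symm_apply]

omit [CompleteSpace L] [CompleteSpace L'] in
lemma spectrumOn_subset_of_isometry {W : Submodule ℝ L} {W' : Submodule ℝ L'}
    (hW : ∀ f, f ∈ W ↔ U f ∈ W') : spectrumOn Γ' W' ⊆ spectrumOn Γ W := by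
  intro t ht hR
  refine ht ?_
  obtain ⟨R, hR⟩ := hR
  let A : W' →L[ℝ] W :=
    (U.symm.toContinuousLinearEquiv.toContinuousLinearMap ∘L W'.subtypeL).codRestrict W
    fun f => by
      rw [hW]
      simp
  let B : W →L[ℝ] W' :=
    (U.toContinuousLinearEquiv.toContinuousLinearMap ∘L W.subtypeL).codRestrict W'
    fun f => (hW f).1 f.2
  have hA : ∀ f, (A f : L) = U.symm f := fun f => rfl
  have hB : ∀ f, (B f : L') = U f := fun f => rfl
  have hAB : ∀ f, A (B f) = f := fun f => Subtype.ext (by rw [hA, hB, U.symm_apply_apply])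
  have hBA : ∀ f, B (A f) = f := fun f => Subtype.ext (by rw [hB, hA, U.apply_symm_apply])
  refine ⟨B ∘L R ∘L A, fun u v => ?_⟩
  have h1 : (B ∘L R ∘L A) v = u ↔ R (A v) = A u := by
    constructor
    · intro h
      rw [← h]
      exact (hAB _).symm
    · intro h
      change B (R (A v)) = u
      rw [h, hBA]
  rw [h1, hR, mem_graph_symm U hΓ, hA, hA, map_sub, map_smul]

omit [CompleteSpace L] [CompleteSpace L'] in
lemma spectrumOn_eq_of_isometry {W : Submodule ℝ L} {W' : Submodule ℝ L'}
    (hW : ∀ f, f ∈ W ↔ U f ∈ W') : spectrumOn Γ' W' = spectrumOn Γ W := by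
  refine (spectrumOn_subset_of_isometry U hΓ hW).antisymm ?_
  refine spectrumOn_subset_of_isometry U.symm (mem_graph_symm U hΓ) fun f => ?_
  rw [hW, U.apply_symm_apply]

/-- Transport of a spectral resolution by an isometry. -/
def SpectralResolution.transport {V : Submodule ℝ L} {V' : Submodule ℝ L'}
    (hV : ∀ f, f ∈ V ↔ U f ∈ V') (Q : SpectralResolution Γ V) : SpectralResolution Γ' V' where
  P A := U.toContinuousLinearEquiv.toContinuousLinearMap ∘L Q.P A ∘L
    U.symm.toContinuousLinearEquiv.toContinuousLinearMap
  σ f := Q.σ (U.symm f)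
  isStarProjection A hA := by
    obtain ⟨h1, h2⟩ := Q.isStarProjection A hA
    refine ⟨?_, ?_⟩
    · ext f
      have := DFunLike.congr_fun h1 (U.symm f)
      change U (Q.P A (U.symm (U (Q.P A (U.symm f))))) = U (Q.P A (U.symm f))
      rw [U.symm_apply_apply]
      exact congrArg U this
    · rw [ContinuousLinearMap.isSelfAdjoint_iff_isSymmetric] at h2 ⊢
      intro f g
      change inner ℝ (U (Q.P A (U.symm f))) g = inner ℝ f (U (Q.P A (U.symm g)))
      have h3 := h2 (U.symm f) (U.symm g)
      rw [← U.inner_map_map, ← U.inner_map_map, U.apply_symm_apply, U.apply_symm_apply] at h3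
      exact h3
  univ_apply_eq_iff f := by
    change U (Q.P Set.univ (U.symm f)) = f ↔ _
    rw [← U.apply_symm_apply f, ← hV, ← Q.univ_apply_eq_iff, U.apply_symm_apply]
    constructor
    · intro h
      rw [← U.injective.eq_iff, h, U.apply_symm_apply]
    · intro h
      rw [h, U.apply_symm_apply]
  empty := by
    ext f
    change U (Q.P ∅ (U.symm f)) = 0
    rw [Q.empty]
    simp
  inter A B hA hB := by
    ext f
    change U (Q.P (A ∩ B) (U.symm f)) = U (Q.P A (U.symm (U (Q.P B (U.symm f)))))
    rw [U.symm_apply_apply, Q.inter A B hA hB]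
    rfl
  iUnion A hA hd f :=
    (Q.iUnion A hA hd (U.symm f)).map U.toContinuousLinearEquiv.toContinuousLinearMap
      U.continuous
  σ_apply f A hA := by
    rw [Q.σ_apply _ A hA]
    change _ = ENNReal.ofReal (‖U (Q.P A (U.symm f))‖ ^ 2)
    rw [U.norm_map]
  mem_graph_iff f h := by
    have hV' : ∀ f, f ∈ V' ↔ U.symm f ∈ V := fun f => by rw [hV, U.apply_symm_apply]
    rw [mem_graph_symm U hΓ, Q.mem_graph_iff, ← hV', ← hV']
    refine and_congr_right fun _ => and_congr_right fun _ => and_congr_right fun _ => ?_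
    constructor
    · intro H g hg hi
      have := H (U.symm g) ((hV' g).1 hg) hi
      rwa [U.symm.inner_map_map, ← map_add, ← map_sub] at this
    · intro H g hg hi
      have := H (U g) ((hV g).1 hg) (by rwa [U.symm_apply_apply])
      rwa [map_add, map_sub, U.symm_apply_apply, ← U.symm.inner_map_map, U.symm_apply_apply] at this

omit hΓ [CompleteSpace L] [CompleteSpace L'] in
lemma mem_closure_span_of_isometry {G : Set L} {G' : Set L'} (hG : ∀ f ∈ G, U f ∈ G') {f : L}
    (hf : f ∈ (Submodule.span ℝ G).topologicalClosure) :
    U f ∈ (Submodule.span ℝ G').topologicalClosure := by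
  have h1 : Submodule.span ℝ G ≤ (Submodule.span ℝ G').comap U.toLinearEquiv.toLinearMap :=
    Submodule.span_le.2 fun g hg => Submodule.subset_span (hG g hg)
  exact map_mem_closure (s := (Submodule.span ℝ G : Set L)) (t := (Submodule.span ℝ G' : Set L'))
    U.continuous hf fun x hx => h1 hx

/-- Resolutions are transported in both directions without changing the spectral measures, so no
uniqueness is used here. -/
lemma mem_spectralSubspace_of_isometry {V : Submodule ℝ L} {V' : Submodule ℝ L'}
    (hV : ∀ f, f ∈ V ↔ U f ∈ V') (p : Measure ℝ → Prop) (f : L) :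
    f ∈ spectralSubspace Γ V p ↔ U f ∈ spectralSubspace Γ' V' p := by
  have hV' : ∀ f, f ∈ V' ↔ U.symm f ∈ V := fun f => by rw [hV, U.apply_symm_apply]
  constructor
  · refine mem_closure_span_of_isometry U ?_
    rintro g ⟨hg, Q, hQ⟩
    refine ⟨(hV g).1 hg, Q.transport U hΓ hV, ?_⟩
    change p (Q.σ (U.symm (U g)))
    rwa [U.symm_apply_apply]
  · intro hf
    rw [← U.symm_apply_apply f]
    refine mem_closure_span_of_isometry U.symm ?_ hf
    rintro g ⟨hg, Q, hQ⟩
    refine ⟨(hV' g).1 hg, Q.transport U.symm (mem_graph_symm U hΓ) hV', ?_⟩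
    change p (Q.σ (U.symm.symm (U.symm g)))
    rwa [U.symm_symm, U.apply_symm_apply]

end Isometry

end IsometricTransport

/-! ### Conjugate blow-ups -/

section Conjugation

namespace FormSequence

variable {E : Type*} [MeasurableSpace E]

/-- From level `n` on, `T'` is the image of `T` under `g`, up to a common factor `c`. -/
structure IsConj (T T' : FormSequence E) (g : E ≃ᵐ E) (c : ℝ) (n : ℕ) : Prop where
  pos : 0 < c
  carrier : ∀ m ≥ n, ∀ x, g x ∈ T'.carrier m ↔ x ∈ T.carrier m
  boundary : ∀ m ≥ n, ∀ x, g x ∈ T'.boundary m ↔ x ∈ T.boundary m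
  measure : ∀ m ≥ n, T'.measure m = ENNReal.ofReal c • (T.measure m).map g
  dom : ∀ m ≥ n, ∀ u, u ∈ T'.dom m ↔ u ∘ g ∈ T.dom m
  form : ∀ m ≥ n, ∀ u v, T'.form m u v = c * T.form m (u ∘ g) (v ∘ g)

namespace IsConj

variable {T T' : FormSequence E} {g : E ≃ᵐ E} {c : ℝ} {n : ℕ} (h : IsConj T T' g c n)
  (hT : T.IsBlowUp) (hT' : T'.IsBlowUp)

include h

lemma symm : IsConj T' T g.symm c⁻¹ n where
  pos := inv_pos.2 h.pos
  carrier m hm x := by rw [← h.carrier m hm, g.apply_symm_apply]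
  boundary m hm x := by rw [← h.boundary m hm, g.apply_symm_apply]
  measure m hm := by
    rw [h.measure m hm, Measure.map_smul, smul_smul,
      Measure.map_map g.symm.measurable g.measurable, g.symm_comp_self, Measure.map_id,
      ← ENNReal.ofReal_mul (inv_nonneg.2 h.pos.le), inv_mul_cancel₀ h.pos.ne', ENNReal.ofReal_one,
      one_smul]
  dom m hm u := by rw [h.dom m hm, Function.comp_assoc, g.symm_comp_self, Function.comp_id]
  form m hm u v := by
    rw [h.form m hm, Function.comp_assoc, Function.comp_assoc, g.symm_comp_self, Function.comp_id,
      Function.comp_id, inv_mul_cancel_left₀ h.pos.ne']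

lemma exhausts (hT' : T'.IsBlowUp) (hE : T.Exhausts) : T'.Exhausts := by
  intro k
  obtain ⟨m, hm, hd⟩ := hE (max k n)
  refine ⟨m, (le_max_left k n).trans hm, Set.disjoint_left.2 fun x hx hxb => ?_⟩
  have h1 := hT'.carrier_mono (le_max_left k n) hx
  rw [← g.apply_symm_apply x] at h1 hxb
  rw [h.carrier _ (le_max_right k n)] at h1
  rw [h.boundary _ ((le_max_right k n).trans hm)] at hxb
  exact Set.disjoint_left.1 hd h1 hxb

include hT hT'

lemma limMeasure : T'.limMeasure = ENNReal.ofReal c • T.limMeasure.map g := by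
  ext A hA
  rw [Measure.smul_apply, g.map_apply, smul_eq_mul]
  refine tendsto_nhds_unique (hT'.tendsto_measure hA) ?_
  refine Tendsto.congr' ?_ (ENNReal.Tendsto.const_mul (hT.tendsto_measure (g.measurable hA))
    (Or.inr ENNReal.ofReal_ne_top))
  filter_upwards [eventually_ge_atTop n] with m hm
  rw [h.measure m hm, Measure.smul_apply, g.map_apply, smul_eq_mul]

lemma ae_iff {p : E → Prop} :
    (∀ᵐ y ∂T'.limMeasure, p y) ↔ ∀ᵐ x ∂T.limMeasure, p (g x) := by
  rw [h.limMeasure hT hT', Measure.ae_ennreal_smul_measure_iff (ENNReal.ofReal_pos.2 h.pos).ne',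
    g.measurableEmbedding.ae_map_iff]

lemma memLp_iff {u : E → ℝ} : MemLp u 2 T'.limMeasure ↔ MemLp (u ∘ g) 2 T.limMeasure := by
  rw [h.limMeasure hT hT', ← g.memLp_map_measure_iff]
  refine ⟨fun hu => ?_, fun hu => hu.smul_measure ENNReal.ofReal_ne_top⟩
  have h1 := hu.smul_measure (c := ENNReal.ofReal c⁻¹) ENNReal.ofReal_ne_top
  rwa [smul_smul, ← ENNReal.ofReal_mul (inv_nonneg.2 h.pos.le), inv_mul_cancel₀ h.pos.ne',
    ENNReal.ofReal_one, one_smul] at h1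

lemma integral (F : E → ℝ) : ∫ x, F x ∂T'.limMeasure = c * ∫ x, F (g x) ∂T.limMeasure := by
  rw [h.limMeasure hT hT', integral_smul_measure, g.measurableEmbedding.integral_map,
    ENNReal.toReal_ofReal h.pos.le, smul_eq_mul]

/-- Conjugacy holds from level n on; lower levels are reached because domains decrease and forms
increase with the level. -/
lemma comp_mem_limDom {u : E → ℝ} (hu : u ∈ T'.limDom .neumann) : u ∘ g ∈ T.limDom .neumann := by
  obtain ⟨h1, h2, B, hB⟩ := hu
  have hdom : ∀ m, u ∘ g ∈ T.dom m := fun m =>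
    hT.dom_anti (le_max_left m n) ((h.dom _ (le_max_right m n) u).1 (h2 _))
  refine ⟨(h.memLp_iff hT hT').1 h1, hdom, c⁻¹ * B, ?_⟩
  rintro _ ⟨m, rfl⟩
  refine (hT.form_le (le_max_left m n) (hdom _)).trans ?_
  have h3 : T'.form (max m n) u u ≤ B := hB ⟨_, rfl⟩
  rw [h.form _ (le_max_right m n)] at h3
  rw [inv_mul_eq_div, le_div_iff₀ h.pos]
  linarith

/-- The unitary map `f ↦ √c • f ∘ g` from `L²` to `L²`. -/
def toFun (f : T'.L2) : T.L2 :=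
  Real.sqrt c • ((h.memLp_iff hT hT').1 (Lp.memLp f)).toLp

lemma coeFn_toFun (f : T'.L2) :
    h.toFun hT hT' f =ᵐ[T.limMeasure] fun x => Real.sqrt c * f (g x) := by
  filter_upwards [Lp.coeFn_smul (Real.sqrt c) ((h.memLp_iff hT hT').1 (Lp.memLp f)).toLp,
    ((h.memLp_iff hT hT').1 (Lp.memLp f)).coeFn_toLp] with x h1 h2
  rw [toFun, h1, Pi.smul_apply, h2]
  rfl

omit hT hT' in
lemma sqrt_mul_sqrt : Real.sqrt c * Real.sqrt c = c := Real.mul_self_sqrt h.pos.le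

lemma symm_toFun (f : T'.L2) : h.symm.toFun hT' hT (h.toFun hT hT' f) = f := by
  refine Lp.ext ?_
  have h1 := (h.symm.ae_iff hT' hT).1 (h.coeFn_toFun hT hT' f)
  filter_upwards [h.symm.coeFn_toFun hT' hT (h.toFun hT hT' f), h1] with x h2 h3
  rw [h2, h3, g.apply_symm_apply, ← mul_assoc, ← Real.sqrt_mul (inv_nonneg.2 h.pos.le),
    inv_mul_cancel₀ h.pos.ne', Real.sqrt_one, one_mul]

lemma toFun_symm (F : T.L2) : h.toFun hT hT' (h.symm.toFun hT' hT F) = F := by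
  refine Lp.ext ?_
  have h1 := (h.ae_iff hT hT').1 (h.symm.coeFn_toFun hT' hT F)
  filter_upwards [h.coeFn_toFun hT hT' (h.symm.toFun hT' hT F), h1] with x h2 h3
  rw [h2, h3, g.symm_apply_apply, ← mul_assoc, ← Real.sqrt_mul h.pos.le,
    mul_inv_cancel₀ h.pos.ne', Real.sqrt_one, one_mul]

/-- The unitary map `f ↦ √c • f ∘ g` from `L²` to `L²`, as a linear isometry equivalence. -/
def unitary : T'.L2 ≃ₗᵢ[ℝ] T.L2 :=
  LinearEquiv.isometryOfInner
    { toFun := h.toFun hT hT'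
      invFun := h.symm.toFun hT' hT
      left_inv := h.symm_toFun hT hT'
      right_inv := h.toFun_symm hT hT'
      map_add' := fun f f' => by
        refine Lp.ext ?_
        have h1 := (h.ae_iff hT hT').1 (Lp.coeFn_add f f')
        filter_upwards [h.coeFn_toFun hT hT' f, h.coeFn_toFun hT hT' f',
          h.coeFn_toFun hT hT' (f + f'), Lp.coeFn_add (h.toFun hT hT' f) (h.toFun hT hT' f'), h1]
          with x h2 h3 h4 h5 h6
        rw [h4, h5, h6, Pi.add_apply, Pi.add_apply, h2, h3, mul_add]
      map_smul' := fun a f => by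
        refine Lp.ext ?_
        have h1 := (h.ae_iff hT hT').1 (Lp.coeFn_smul a f)
        filter_upwards [h.coeFn_toFun hT hT' f, h.coeFn_toFun hT hT' (a • f),
          Lp.coeFn_smul a (h.toFun hT hT' f), h1] with x h2 h3 h4 h5
        simp only [RingHom.id_apply]
        rw [h3, h4, h5, Pi.smul_apply, Pi.smul_apply, h2, smul_eq_mul, smul_eq_mul]
        ring }
    fun f f' => by
      change inner ℝ (h.toFun hT hT' f) (h.toFun hT hT' f') = _
      rw [inner_L2, inner_L2, h.integral hT hT', ← integral_const_mul]
      refine integral_congr_ae ?_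
      filter_upwards [h.coeFn_toFun hT hT' f, h.coeFn_toFun hT hT' f'] with x h1 h2
      rw [h1, h2]
      linear_combination (f (g x) * f' (g x)) * h.sqrt_mul_sqrt

lemma unitary_apply (f : T'.L2) : h.unitary hT hT' f = h.toFun hT hT' f := rfl

lemma toFun_mem_space {f : T'.L2} (hf : f ∈ T'.space .neumann) :
    h.toFun hT hT' f ∈ T.space .neumann := by
  refine mem_closure_span_of_isometry (h.unitary hT hT') ?_ hf
  rintro f ⟨u, hu, hfu⟩
  refine ⟨Real.sqrt c • (u ∘ g), ?_, ?_⟩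
  · have := hT.limDom_add_smul_mem hT.limDom_zero_mem (h.comp_mem_limDom hT hT' hu) (Real.sqrt c)
    rwa [zero_add] at this
  · filter_upwards [h.coeFn_toFun hT hT' f, (h.ae_iff hT hT').1 hfu] with x h1 h2
    rw [unitary_apply, h1, h2]
    rfl

lemma mem_space_iff (f : T'.L2) :
    f ∈ T'.space .neumann ↔ h.unitary hT hT' f ∈ T.space .neumann := by
  refine ⟨h.toFun_mem_space hT hT', fun hf => ?_⟩
  have := h.symm.toFun_mem_space hT' hT hf
  rwa [unitary_apply, h.symm_toFun] at this

/-- The same factor c multiplies the form and the measure, so it cancels in the weak equation and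
the operator is not rescaled. -/
lemma toFun_mem_graph {f k : T'.L2} (hf : (f, k) ∈ T'.graph .neumann) :
    (h.toFun hT hT' f, h.toFun hT hT' k) ∈ T.graph .neumann := by
  obtain ⟨hk, u, hu, hfu, hB⟩ := hf
  have hug := h.comp_mem_limDom hT hT' hu
  have hmem := hT.limDom_add_smul_mem hT.limDom_zero_mem hug (Real.sqrt c)
  rw [zero_add] at hmem
  refine ⟨h.toFun_mem_space hT hT' hk, Real.sqrt c • (u ∘ g), hmem, ?_, fun v hv => ?_⟩
  · filter_upwards [h.coeFn_toFun hT hT' f, (h.ae_iff hT hT').1 hfu] with x h1 h2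
    rw [h1, h2]
    rfl
  · have hv' := h.symm.comp_mem_limDom hT' hT hv
    have h1 := (hB _ hv').const_mul (Real.sqrt c * c⁻¹)
    have h2 : Real.sqrt c * c⁻¹ * -∫ x, k x * (v ∘ g.symm) x ∂T'.limMeasure =
        -∫ x, h.toFun hT hT' k x * v x ∂T.limMeasure := by
      rw [h.integral hT hT', mul_neg, mul_assoc, inv_mul_cancel_left₀ h.pos.ne',
        ← integral_const_mul]
      congr 1
      refine integral_congr_ae ?_
      filter_upwards [h.coeFn_toFun hT hT' k] with x h3
      rw [h3, Function.comp_apply, g.symm_apply_apply, mul_assoc]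
    dsimp only at h1
    rw [h2] at h1
    refine h1.congr' ?_
    filter_upwards [eventually_ge_atTop n] with m hm
    rw [h.form m hm, Function.comp_assoc, g.symm_comp_self, Function.comp_id,
      hT.form_smul_left (hug.2.1 m) (hv.2.1 m), mul_assoc, inv_mul_cancel_left₀ h.pos.ne']

lemma mem_graph_iff (f k : T'.L2) : (f, k) ∈ T'.graph .neumann ↔
    (h.unitary hT hT' f, h.unitary hT hT' k) ∈ T.graph .neumann := by
  refine ⟨h.toFun_mem_graph hT hT', fun hf => ?_⟩
  have := h.symm.toFun_mem_graph hT' hT hf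
  rwa [unitary_apply, unitary_apply, h.symm_toFun, h.symm_toFun] at this

/-- An eigenfunction is first lifted to a level where the conjugacy is available. -/
lemma toFun_mem_ndSubspace {f : T'.L2} (hf : f ∈ T'.ndSubspace) :
    h.toFun hT hT' f ∈ T.ndSubspace := by
  refine mem_closure_span_of_isometry (h.unitary hT hT') ?_ hf
  rintro f ⟨m, u, hu, hfu⟩
  rw [ndEigenfunctions_eq] at hu
  obtain ⟨h1, h2, h3, t, -, hB⟩ := hT'.ndEigenfunctionsIn_mono (le_max_left m n) _ hu
  set k := max m n with hk
  have hkn : k ≥ n := le_max_right m n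
  have hd : u ∘ g ∈ T.dom k := (h.dom k hkn u).1 h1
  refine ⟨k, Real.sqrt c • (u ∘ g), ⟨(hT.domain k).smul_mem _ hd, fun x hx => ?_, fun x hx => ?_,
    t, fun v hv => ?_⟩, ?_⟩
  · simp [h2 (g x) ((h.boundary k hkn x).2 hx)]
  · simp [h3 (g x) (fun h' => hx ((h.carrier k hkn x).1 h'))]
  · have hv' : v ∘ g.symm ∈ T'.dom k := (h.symm.dom k hkn v).1 hv
    have h4 := hB _ hv'
    rw [h.form k hkn, h.measure k hkn, integral_smul_measure, g.measurableEmbedding.integral_map,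
      ENNReal.toReal_ofReal h.pos.le, Function.comp_assoc, g.symm_comp_self, Function.comp_id,
      smul_eq_mul] at h4
    simp only [Function.comp_apply, g.symm_apply_apply] at h4
    have h5 : T.form k (u ∘ g) v = -t * ∫ x, u (g x) * v x ∂T.measure k := by
      refine mul_left_cancel₀ h.pos.ne' ?_
      rw [h4]
      ring
    rw [hT.form_smul_left hd hv, h5]
    simp only [Pi.smul_apply, Function.comp_apply, smul_eq_mul, mul_assoc, integral_const_mul]
    ring
  · filter_upwards [h.coeFn_toFun hT hT' f, (h.ae_iff hT hT').1 hfu] with x h6 h7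
    rw [unitary_apply, h6, h7]
    rfl

lemma mem_ndSubspace_iff (f : T'.L2) :
    f ∈ T'.ndSubspace ↔ h.unitary hT hT' f ∈ T.ndSubspace := by
  refine ⟨h.toFun_mem_ndSubspace hT hT', fun hf => ?_⟩
  have := h.symm.toFun_mem_ndSubspace hT' hT hf
  rwa [unitary_apply, h.symm_toFun] at this

lemma spectra_eq (j : Fin 6) : T.spectra .neumann j = T'.spectra .neumann j := by
  have hΓ := h.mem_graph_iff hT hT'
  have hV := h.mem_space_iff hT hT'
  have hN := h.mem_ndSubspace_iff hT hT'
  have hp := fun p => mem_spectralSubspace_of_isometry (h.unitary hT hT') hΓ hV p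
  fin_cases j
  · exact spectrumOn_eq_of_isometry _ hΓ hV
  · exact spectrumOn_eq_of_isometry _ hΓ (hp _)
  · exact spectrumOn_eq_of_isometry _ hΓ (hp _)
  · exact spectrumOn_eq_of_isometry _ hΓ (hp _)
  · refine spectrumOn_eq_of_isometry _ hΓ fun f => ?_
    refine and_congr (hp _ f) ?_
    simp only [SetLike.mem_coe, Submodule.mem_orthogonal']
    constructor
    · intro H F hF
      have h1 := H ((h.unitary hT hT').symm F)
        ((hN _).2 (by rwa [LinearIsometryEquiv.apply_symm_apply]))
      rwa [← (h.unitary hT hT').inner_map_map, LinearIsometryEquiv.apply_symm_apply] at h1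
    · intro H F hF
      rw [← (h.unitary hT hT').inner_map_map]
      exact H _ ((hN F).1 hF)
  · exact spectrumOn_eq_of_isometry _ hΓ hN

end IsConj

end FormSequence

end Conjugation

/-! ### Deterministic spectra -/

section DeterministicSpectra

open ProbabilityTheory

variable {N : ℕ} [NeZero N]

instance : IsProbabilityMeasure (blowUpLaw N) := by
  rw [blowUpLaw]; infer_instance

/-- Zero-one law for the events that do not depend on finitely many coordinates. -/
lemma blowUpLaw_zero_or_one {A : Set (ℕ → Fin N)} (hA : MeasurableSet A)
    (hinv : ∀ n (ω ω' : ℕ → Fin N), (∀ k ≥ n, ω k = ω' k) → ω ∈ A → ω' ∈ A) :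
    blowUpLaw N A = 0 ∨ blowUpLaw N A = 1 := by
  have hind : iIndepFun (fun (i : ℕ) (ω : ℕ → Fin N) => ω i) (blowUpLaw N) :=
    iIndepFun_infinitePi (X := fun _ x => x) fun _ => measurable_id
  set s : ℕ → MeasurableSpace (ℕ → Fin N) := fun i =>
    MeasurableSpace.comap (fun ω : ℕ → Fin N => ω i) inferInstance with hs
  have hle : ∀ i, s i ≤ MeasurableSpace.pi := fun i => (measurable_pi_apply i).comap_le
  refine measure_zero_or_one_of_measurableSet_limsup_atTop hle hind ?_
  rw [limsup_eq_iInf_iSup_of_nat, MeasurableSpace.measurableSet_iInf]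
  intro n
  -- Resetting the first n letters is measurable for the later coordinates alone, and A is its own
  -- preimage; so A is a tail event.
  let φ : (ℕ → Fin N) → ℕ → Fin N := fun ω k => if k < n then 0 else ω k
  have hφ : @Measurable _ _ (⨆ i, ⨆ (_ : i ≥ n), s i) MeasurableSpace.pi φ := by
    refine @measurable_pi_lambda _ _ _ (⨆ i, ⨆ (_ : i ≥ n), s i) _ φ fun k => ?_
    by_cases hk : k < n
    · simp only [φ, hk, if_true]
      exact @measurable_const _ _ _ (⨆ i, ⨆ (_ : i ≥ n), s i) _
    · simp only [φ, hk, if_false]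
      have h1 : s k ≤ ⨆ i, ⨆ (_ : i ≥ n), s i := le_iSup₂_of_le k (not_lt.1 hk) le_rfl
      exact Measurable.mono (comap_measurable fun ω : ℕ → Fin N => ω k) h1 le_rfl
  have hpre : A = φ ⁻¹' A := by
    ext ω
    have hag : ∀ k ≥ n, ω k = φ ω k := fun k hk => by simp [φ, not_lt.2 hk]
    exact ⟨hinv n _ _ hag, hinv n _ _ fun k hk => (hag k hk).symm⟩
  rw [hpre]
  exact hφ hA

/-- A point of one set outside of the other has a rational interval around it that misses the other
set. -/
lemma isClosed_eq_of_inter_Ioo {F G : Set ℝ} (hF : IsClosed F) (hG : IsClosed G)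
    (h : ∀ p q : ℚ, Set.Ioo (p : ℝ) q ∩ F = ∅ ↔ Set.Ioo (p : ℝ) q ∩ G = ∅) : F = G := by
  have key : ∀ {F G : Set ℝ}, IsClosed G →
      (∀ p q : ℚ, Set.Ioo (p : ℝ) q ∩ G = ∅ → Set.Ioo (p : ℝ) q ∩ F = ∅) → F ⊆ G := by
    intro F G hG h x hxF
    by_contra hxG
    obtain ⟨ε, hε, hball⟩ := Metric.isOpen_iff.1 hG.isOpen_compl x hxG
    obtain ⟨p, hp1, hp2⟩ := exists_rat_btwn (show x - ε < x by linarith)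
    obtain ⟨q, hq1, hq2⟩ := exists_rat_btwn (show x < x + ε by linarith)
    have h1 : Set.Ioo (p : ℝ) q ∩ G = ∅ := by
      refine Set.eq_empty_of_forall_notMem fun y hy => hball ?_ hy.2
      rw [Real.ball_eq_Ioo]
      exact ⟨hp1.trans hy.1.1, hy.1.2.trans hq2⟩
    exact (Set.ext_iff.1 (h p q h1) x).1 ⟨⟨hp2, hq1⟩, hxF⟩
  exact (key hG fun p q => (h p q).2).antisymm (key hF fun p q => (h p q).1)

namespace FormSequence

variable {E : Type*} [MeasurableSpace E]

lemma isClosed_spectra (T : FormSequence E) (j : Fin 6) :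
    IsClosed (T.spectra .neumann j) := by
  have hN : IsClosed (T.ndSubspace : Set T.L2) := Submodule.isClosed_topologicalClosure _
  fin_cases j
  · exact isClosed_spectrumOn _ (Submodule.isClosed_topologicalClosure _)
  · exact isClosed_spectrumOn _ (Submodule.isClosed_topologicalClosure _)
  · exact isClosed_spectrumOn _ (Submodule.isClosed_topologicalClosure _)
  · exact isClosed_spectrumOn _ (Submodule.isClosed_topologicalClosure _)
  · exact isClosed_spectrumOn _
      ((Submodule.isClosed_topologicalClosure _).inter (Submodule.isClosed_orthogonal _))
  · exact isClosed_spectrumOn _ hN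

lemma spectra_eq_neumann {T : FormSequence E} (hT : T.IsBlowUp) (hE : T.Exhausts) (ε : BC) :
    T.spectra ε = T.spectra .neumann := by
  simp only [spectra, spec, acSpec, scSpec, ppSpec, ppTildeSpec, ndSpec, hT.graph_eq hE ε,
    hT.space_eq hE ε]

/-- Conjugacy makes the events insensitive to finitely many letters, the zero-one law applies to
countably many of them, and any environment in the resulting full-measure set serves as the
reference. -/
theorem hasDeterministicSpectra [MeasurableSpace.CountablyGenerated E]
    {T : (ℕ → Fin N) → FormSequence E} (hT : ∀ ω, (T ω).IsBlowUp) (hA : IsAdapted T)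
    (hconj : ∀ n (ω ω' : ℕ → Fin N), (∀ k ≥ n, ω k = ω' k) →
      ∃ (g : E ≃ᵐ E) (c : ℝ), IsConj (T ω) (T ω') g c n)
    (hE : ∀ᵐ ω ∂(blowUpLaw N), (T ω).Exhausts) : HasDeterministicSpectra T := by
  -- Measurability is known on the subtype of exhausting environments, a measurable set of full
  -- measure; the events are its images in the whole space.
  set A : Fin 6 → ℚ → ℚ → Set (ℕ → Fin N) := fun j p q =>
    Subtype.val '' {ω : Good T | Set.Ioo (p : ℝ) q ∩ (T ω).spectra .neumann j = ∅} with hAdef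
  have hmemA : ∀ j p q ω, (T ω).Exhausts →
      (ω ∈ A j p q ↔ Set.Ioo (p : ℝ) q ∩ (T ω).spectra .neumann j = ∅) := by
    intro j p q ω hω
    constructor
    · rintro ⟨ω', h, rfl⟩
      exact h
    · exact fun h => ⟨⟨ω, hω⟩, h, rfl⟩
  have h01 : ∀ j p q, blowUpLaw N (A j p q) = 0 ∨ blowUpLaw N (A j p q) = 1 := by
    intro j p q
    refine blowUpLaw_zero_or_one ((measurableSet_exhausts hA).subtype_image
      (measurableSet_inter_spectra hT hA j p q)) ?_
    rintro n _ ω' hag ⟨ω, h, rfl⟩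
    obtain ⟨g, c, hc⟩ := hconj n ω ω' hag
    refine (hmemA j p q ω' (hc.exhausts (hT ω') ω.2)).2 ?_
    rw [← hc.spectra_eq (hT _) (hT _)]
    exact h
  have hae : ∀ᵐ ω ∂(blowUpLaw N), (T ω).Exhausts ∧
      ∀ j p q, (ω ∈ A j p q ↔ blowUpLaw N (A j p q) = 1) := by
    refine hE.and ?_
    refine ae_all_iff.2 fun j => ae_all_iff.2 fun p => ae_all_iff.2 fun q => ?_
    have hmeas : MeasurableSet (A j p q) := (measurableSet_exhausts hA).subtype_image
      (measurableSet_inter_spectra hT hA j p q)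
    rcases h01 j p q with h | h
    · filter_upwards [measure_eq_zero_iff_ae_notMem.1 h] with ω hω
      simp [hω, h]
    · have : ∀ᵐ ω ∂(blowUpLaw N), ω ∈ A j p q := (prob_compl_eq_zero_iff hmeas).2 h
      filter_upwards [this] with ω hω
      simp [hω, h]
  obtain ⟨ω₀, hω₀, h₀⟩ := hae.exists
  have heq : ∀ᵐ ω ∂(blowUpLaw N), ∀ ε j, (T ω).spectra ε j = (T ω₀).spectra .neumann j := by
    filter_upwards [hae] with ω ⟨hω, h⟩ ε j
    rw [spectra_eq_neumann (hT ω) hω ε]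
    refine isClosed_eq_of_inter_Ioo (isClosed_spectra (T ω) j) (isClosed_spectra (T ω₀) j)
      fun p q => ?_
    rw [← hmemA j p q ω hω, ← hmemA j p q ω₀ hω₀, h, h₀]
  refine ⟨(T ω₀).spectra .neumann 0, (T ω₀).spectra .neumann 1, (T ω₀).spectra .neumann 2,
    (T ω₀).spectra .neumann 3, (T ω₀).spectra .neumann 4, (T ω₀).spectra .neumann 5, ?_⟩
  filter_upwards [heq] with ω h ε
  exact ⟨h ε 0, h ε 1, h ε 2, h ε 3, h ε 4, h ε 5⟩

end FormSequence

end DeterministicSpectra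

/-! ### Cells of the blow-ups -/

section SelfSimilarSets

namespace SelfSimilarSet

variable {d N : ℕ} (S : SelfSimilarSet d N)

lemma blowMap_succ (ω : ℕ → Fin N) (n : ℕ) :
    S.blowMap ω (n + 1) = S.blowMap ω n * (S.Ψ (ω n))⁻¹ := by
  rw [blowMap, List.ofFn_succ', List.concat_eq_append, List.prod_append, List.prod_singleton]
  rfl

lemma blowMap_succ_apply (ω : ℕ → Fin N) (n : ℕ) (z : EuclideanSpace ℝ (Fin d)) :
    S.blowMap ω (n + 1) (S.Ψ (ω n) z) = S.blowMap ω n z := by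
  rw [blowMap_succ]
  change S.blowMap ω n ((S.Ψ (ω n))⁻¹ (S.Ψ (ω n) z)) = _
  congr 1
  exact (S.Ψ (ω n)).symm_apply_apply z

lemma wordMap_cons {n : ℕ} (i : Fin N) (w : Fin n → Fin N) (z : EuclideanSpace ℝ (Fin d)) :
    S.wordMap (Fin.cons i w) z = S.Ψ i (S.wordMap w z) := by
  rw [wordMap, List.ofFn_succ, List.prod_cons]
  simp only [Fin.cons_zero, Fin.cons_succ]
  rfl

lemma wordMap_zero (w : Fin 0 → Fin N) (z : EuclideanSpace ℝ (Fin d)) : S.wordMap w z = z := by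
  simp [wordMap]

lemma wordMap_mem {n : ℕ} (w : Fin n → Fin N) {z : EuclideanSpace ℝ (Fin d)} (hz : z ∈ S.X) :
    S.wordMap w z ∈ S.X := by
  induction n with
  | zero => rwa [wordMap_zero]
  | succ n ih =>
    rw [← Fin.cons_self_tail w, wordMap_cons]
    exact S.map_mem _ (ih _)

lemma iterate_apply_pt (i : Fin N) (n : ℕ) : (S.Ψ i)^[n] (S.pt i) = S.pt i :=
  Function.iterate_fixed (S.apply_pt i) n

lemma dist_iterate (i : Fin N) (n : ℕ) (x y : EuclideanSpace ℝ (Fin d)) :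
    dist ((S.Ψ i)^[n] x) ((S.Ψ i)^[n] y) = (Dilation.ratio (S.Ψ i) : ℝ) ^ n * dist x y := by
  induction n with
  | zero => simp
  | succ n ih =>
    rw [Function.iterate_succ_apply', Function.iterate_succ_apply', Dilation.dist_eq, ih, pow_succ']
    ring

lemma pt_mem (i : Fin N) : S.pt i ∈ S.X := by
  obtain ⟨x, hx⟩ := S.isConnected.nonempty
  have hmem : ∀ n, (S.Ψ i)^[n] x ∈ S.X := by
    intro n
    induction n with
    | zero => exact hx
    | succ n ih => rw [Function.iterate_succ_apply']; exact S.map_mem i ih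
  refine S.isCompact.isClosed.mem_of_tendsto (f := fun n : ℕ => (S.Ψ i)^[n] x) (b := atTop) ?_
    (Eventually.of_forall hmem)
  rw [tendsto_iff_dist_tendsto_zero]
  have h1 : ∀ n : ℕ, dist ((S.Ψ i)^[n] x) (S.pt i) =
      (Dilation.ratio (S.Ψ i) : ℝ) ^ n * dist x (S.pt i) := fun n => by
    rw [← S.dist_iterate, S.iterate_apply_pt]
  simp only [h1]
  have h2 := tendsto_pow_atTop_nhds_zero_of_lt_one
    (NNReal.coe_nonneg (Dilation.ratio (S.Ψ i))) (by exact_mod_cast S.ratio_lt_one i)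
  simpa using h2.mul_const (dist x (S.pt i))

lemma F_subset_X : (S.F : Set (EuclideanSpace ℝ (Fin d))) ⊆ S.X := fun x hx => by
  obtain ⟨i, rfl⟩ := S.F_subset hx
  exact S.pt_mem i

/-- The point of F is the fixed point of some Ψ_j. If j = i, then z is that point; otherwise it lies
in two cells, and these meet only in images of F. -/
lemma mem_F_of_map_mem {i : Fin N} {z : EuclideanSpace ℝ (Fin d)} (hz : z ∈ S.X)
    (h : S.Ψ i z ∈ S.F) : z ∈ S.F := by
  obtain ⟨j, hj⟩ := S.F_subset h
  by_cases hij : i = j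
  · subst hij
    have h1 : S.pt i = z := (S.Ψ i).injective (by rw [S.apply_pt, hj])
    have h2 : S.Ψ i z = z := by rw [← h1, S.apply_pt]
    rwa [h2] at h
  · have h1 : S.Ψ i z ∈ S.Ψ i '' S.X ∩ S.Ψ j '' S.X :=
      ⟨⟨z, hz, rfl⟩, S.pt j, S.pt_mem j, by rw [S.apply_pt, hj]⟩
    rw [S.inter_eq i j hij] at h1
    obtain ⟨⟨y, hy, hyz⟩, -⟩ := h1
    rw [← (S.Ψ i).injective hyz]
    exact hy

/-- The point `Ψ_{w_n} ⋯ Ψ_{w_1} z`. -/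
def act (w : List (Fin N)) (z : EuclideanSpace ℝ (Fin d)) : EuclideanSpace ℝ (Fin d) :=
  w.foldl (fun y i => S.Ψ i y) z

lemma act_cons (i : Fin N) (w : List (Fin N)) (z : EuclideanSpace ℝ (Fin d)) :
    S.act (i :: w) z = S.act w (S.Ψ i z) := rfl

lemma act_append (w w' : List (Fin N)) (z : EuclideanSpace ℝ (Fin d)) :
    S.act (w ++ w') z = S.act w' (S.act w z) := List.foldl_append

lemma act_mem (w : List (Fin N)) {z : EuclideanSpace ℝ (Fin d)} (hz : z ∈ S.X) :
    S.act w z ∈ S.X := by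
  induction w generalizing z with
  | nil => exact hz
  | cons i w ih => exact ih (S.map_mem i hz)

/-- Read backwards: a point of X outside of F never enters F again. -/
lemma mem_F_of_act_mem (w : List (Fin N)) {z : EuclideanSpace ℝ (Fin d)} (hz : z ∈ S.X)
    (h : S.act w z ∈ S.F) : z ∈ S.F := by
  induction w generalizing z with
  | nil => exact h
  | cons i w ih => exact S.mem_F_of_map_mem hz (ih (S.map_mem i hz) h)

lemma act_replicate (i : Fin N) (n : ℕ) (z : EuclideanSpace ℝ (Fin d)) :
    S.act (List.replicate n i) z = (S.Ψ i)^[n] z := by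
  induction n generalizing z with
  | zero => rfl
  | succ n ih => rw [List.replicate_succ, act_cons, ih, Function.iterate_succ_apply]

lemma eq_pt_of_iterate_eq {i : Fin N} {n : ℕ} (hn : n ≠ 0) {z : EuclideanSpace ℝ (Fin d)}
    (h : (S.Ψ i)^[n] z = z) : z = S.pt i := by
  have h1 := S.dist_iterate i n z (S.pt i)
  rw [S.iterate_apply_pt, h] at h1
  have h2 : (Dilation.ratio (S.Ψ i) : ℝ) ^ n < 1 :=
    pow_lt_one₀ (NNReal.coe_nonneg _) (by exact_mod_cast S.ratio_lt_one i) hn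
  rw [← dist_eq_zero]
  have h3 := dist_nonneg (x := z) (y := S.pt i)
  nlinarith

/-- If all iterates stayed in the finite set F, two would coincide; then z would be periodic for a
strict contraction, hence its fixed point. -/
lemma exists_iterate_notMem {i : Fin N} {z : EuclideanSpace ℝ (Fin d)} (hz : z ≠ S.pt i) :
    ∃ n : ℕ, (S.Ψ i)^[n] z ∉ S.F := by
  by_contra! h
  obtain ⟨a, b, hab, heq⟩ := Finite.exists_ne_map_eq_of_infinite
    (fun n : ℕ => (⟨(S.Ψ i)^[n] z, h n⟩ : S.F))
  have heq' : (S.Ψ i)^[a] z = (S.Ψ i)^[b] z := congrArg Subtype.val heq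
  have key : ∀ a b : ℕ, a < b → (S.Ψ i)^[a] z = (S.Ψ i)^[b] z → False := by
    intro a b hlt he
    obtain ⟨k, rfl⟩ := Nat.exists_eq_add_of_lt hlt
    have h1 : (S.Ψ i)^[a] z = (S.Ψ i)^[a] ((S.Ψ i)^[k + 1] z) := by
      rw [he, ← Function.iterate_add_apply, add_assoc]
    exact hz (S.eq_pt_of_iterate_eq (Nat.succ_ne_zero k)
      (((S.Ψ i).injective.iterate a) h1).symm)
  rcases lt_or_gt_of_ne hab with h1 | h1
  · exact key a b h1 heq'
  · exact key b a h1 heq'.symm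

/-- A word that drives all the points of `F` out of `F`. -/
lemma exists_exit_word (hN : ∃ i j : Fin N, i ≠ j) :
    ∃ w : List (Fin N), ∀ z ∈ S.F, S.act w z ∉ S.F := by
  have key : ∀ s : Finset (EuclideanSpace ℝ (Fin d)), (∀ z ∈ s, z ∈ S.X) →
      ∃ w : List (Fin N), ∀ z ∈ s, S.act w z ∉ S.F := by
    intro s
    induction s using Finset.induction_on with
    | empty => exact fun _ => ⟨[], by simp⟩
    | insert z s _ ih =>
      intro hs
      obtain ⟨w, hw⟩ := ih fun y hy => hs y (Finset.mem_insert_of_mem hy)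
      -- Two distinct fixed points exist, so one of them differs from the current image of z, and
      -- repeating that letter expels it. Points already expelled stay out.
      obtain ⟨i, hi⟩ : ∃ i, S.act w z ≠ S.pt i := by
        obtain ⟨i, j, hij⟩ := hN
        by_contra! h
        exact hij (S.pt_injective ((h i).symm.trans (h j)))
      obtain ⟨n, hn⟩ := S.exists_iterate_notMem hi
      refine ⟨w ++ List.replicate n i, fun y hy => ?_⟩
      rw [act_append]
      rcases Finset.mem_insert.1 hy with rfl | hy'
      · rwa [act_replicate]
      · exact fun h => hw y hy' (S.mem_F_of_act_mem _ (S.act_mem w (hs y hy)) h)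
  exact key S.F fun z hz => S.F_subset_X hz

/-- Reading w after time k undoes, one inverse map per letter, the action of w. -/
lemma blowMap_act (ω : ℕ → Fin N) (w : List (Fin N)) (k : ℕ)
    (h : ∀ j (hj : j < w.length), ω (k + j) = w[j]) (z : EuclideanSpace ℝ (Fin d)) :
    S.blowMap ω (k + w.length) (S.act w z) = S.blowMap ω k z := by
  induction w generalizing k z with
  | nil => rfl
  | cons i w ih =>
    have h0 : ω k = i := h 0 (by simp)
    have h1 := ih (k + 1) (fun j hj => by
      have := h (j + 1) (by simpa using hj)
      rw [add_assoc, add_comm 1 j]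
      simpa using this) (S.Ψ i z)
    rw [act_cons, List.length_cons, ← add_assoc, add_right_comm, h1, ← h0, S.blowMap_succ_apply]

lemma blowX_mono (ω : ℕ → Fin N) : Monotone (S.blowX ω) := by
  refine monotone_nat_of_le_succ fun n => ?_
  rintro _ ⟨z, hz, rfl⟩
  exact ⟨S.Ψ (ω n) z, S.map_mem _ hz, S.blowMap_succ_apply ω n z⟩

lemma blowBoundary_subset (ω : ℕ → Fin N) (n : ℕ) : S.blowBoundary ω n ⊆ S.blowX ω n :=
  Set.image_mono S.F_subset_X

lemma blowBoundary_succ (ω : ℕ → Fin N) (n : ℕ) :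
    S.blowBoundary ω (n + 1) ∩ S.blowX ω n ⊆ S.blowBoundary ω n := by
  rintro _ ⟨⟨y, hy, rfl⟩, z, hz, hzy⟩
  rw [← S.blowMap_succ_apply] at hzy
  have h1 := (S.blowMap ω (n + 1)).injective hzy
  refine ⟨z, S.mem_F_of_map_mem hz (by rw [h1]; exact hy), ?_⟩
  rw [← S.blowMap_succ_apply, h1]

/-- Inside level n + 1, level n is the cell of index ω n, and distinct cells meet only in images of
F. So new cells touch the old level at its boundary only. -/
lemma mem_blowBoundary_of_ne {ω : ℕ → Fin N} {n : ℕ} {i : Fin N} (hi : i ≠ ω n)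
    {z : EuclideanSpace ℝ (Fin d)} (hz : z ∈ S.X)
    (h : S.blowMap ω (n + 1) (S.Ψ i z) ∈ S.blowX ω n) :
    S.blowMap ω (n + 1) (S.Ψ i z) ∈ S.blowBoundary ω n := by
  obtain ⟨y, hy, hyz⟩ := h
  rw [← S.blowMap_succ_apply] at hyz
  have h1 := (S.blowMap ω (n + 1)).injective hyz
  have h2 : S.Ψ i z ∈ S.Ψ i '' S.X ∩ S.Ψ (ω n) '' S.X := ⟨⟨z, hz, rfl⟩, y, hy, h1⟩
  rw [S.inter_eq i _ hi] at h2
  obtain ⟨-, x, hx, hxz⟩ := h2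
  exact ⟨x, hx, by rw [← hxz, S.blowMap_succ_apply]⟩

/-- If the word `w` that empties `F` is read in `ω` at arbitrarily large places, the boundaries
leave every finite level. -/
lemma exists_disjoint {w : List (Fin N)} (hw : ∀ z ∈ S.F, S.act w z ∉ S.F) {ω : ℕ → Fin N}
    (hω : ∀ n, ∃ k ≥ n, ∀ j (hj : j < w.length), ω (k + j) = w[j]) (n : ℕ) :
    ∃ m ≥ n, Disjoint (S.blowX ω n) (S.blowBoundary ω m) := by
  obtain ⟨k, hk, h⟩ := hω n
  refine ⟨k + w.length, hk.trans (Nat.le_add_right _ _), Set.disjoint_left.2 ?_⟩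
  intro x hx hxb
  -- In the coordinates of level k + |w|, a point of level k is the image under w of a point z of X.
  -- If it were a boundary point, z would be in F and w would not have expelled it.
  obtain ⟨z, hz, rfl⟩ := S.blowX_mono ω hk hx
  obtain ⟨y, hy, hyz⟩ := hxb
  rw [← S.blowMap_act ω w k h] at hyz
  rw [(S.blowMap ω (k + w.length)).injective hyz] at hy
  exact hw z (S.mem_F_of_act_mem w hz hy) hy

end SelfSimilarSet

/-- Almost surely, every word is read at arbitrarily large places. -/
lemma ae_exists_word {N : ℕ} [NeZero N] (w : List (Fin N)) : ∀ᵐ ω ∂(blowUpLaw N),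
    ∀ n, ∃ k ≥ n, ∀ j (hj : j < w.length), ω (k + j) = w[j] := by
  set A : ℕ → Set (ℕ → Fin N) := fun k => {ω | ∀ j (hj : j < w.length), ω (k + j) = w[j]} with hA
  have hAm : ∀ k, MeasurableSet (A k) := by
    intro k
    have h1 : A k = ⋂ j, ⋂ (hj : j < w.length), (fun ω : ℕ → Fin N => ω (k + j)) ⁻¹' {w[j]} := by
      ext ω
      simp [hA]
    rw [h1]
    exact MeasurableSet.iInter fun j => MeasurableSet.iInter fun hj =>
      measurable_pi_apply _ (measurableSet_singleton _)
  set p : ENNReal := (N : ENNReal)⁻¹ ^ w.length with hp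
  have hp0 : p ≠ 0 := pow_ne_zero _ (ENNReal.inv_ne_zero.2 (ENNReal.natCast_ne_top N))
  have hPA : ∀ k, blowUpLaw N (A k) = p := by
    intro k
    have h1 : A k = Set.pi (Finset.Ico k (k + w.length) : Finset ℕ)
        fun i => {x | ∀ hi : i - k < w.length, x = w[i - k]} := by
      ext ω
      simp only [hA, Set.mem_ofPred_eq, Set.mem_pi, Finset.coe_Ico, Set.mem_Ico]
      constructor
      · intro h i hi hlt
        have := h (i - k) hlt
        rwa [Nat.add_sub_cancel' hi.1] at this
      · intro h j hj
        have := h (k + j) ⟨by omega, by omega⟩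
        simp only [Nat.add_sub_cancel_left] at this
        exact this hj
    rw [h1, blowUpLaw, Measure.infinitePi_pi _ (fun i _ => MeasurableSet.of_discrete), hp]
    rw [Finset.prod_congr rfl (g := fun _ => (N : ENNReal)⁻¹)]
    · simp
    · intro i hi
      rw [Finset.mem_Ico] at hi
      have hlt : i - k < w.length := by omega
      have h2 : {x : Fin N | ∀ hi : i - k < w.length, x = w[i - k]} = {w[i - k]} := by
        ext x
        simp [hlt]
      rw [h2, PMF.toMeasure_apply_singleton _ _ (measurableSet_singleton _),
        PMF.uniformOfFintype_apply, Fintype.card_fin]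
  set B : Set (ℕ → Fin N) := ⋂ n, ⋃ k, ⋃ (_ : k ≥ n), A k with hB
  have hCm : ∀ n, MeasurableSet (⋃ k, ⋃ (_ : k ≥ n), A k) := fun n =>
    MeasurableSet.iUnion fun k => MeasurableSet.iUnion fun _ => hAm k
  have hBm : MeasurableSet B := MeasurableSet.iInter hCm
  have hinv : ∀ n (ω ω' : ℕ → Fin N), (∀ k ≥ n, ω k = ω' k) → ω ∈ B → ω' ∈ B := by
    intro n ω ω' hag hω
    simp only [hB, Set.mem_iInter, Set.mem_iUnion] at hω ⊢
    intro m
    obtain ⟨k, hk, h⟩ := hω (max m n)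
    refine ⟨k, (le_max_left m n).trans hk, fun j hj => ?_⟩
    rw [← hag _ (((le_max_right m n).trans hk).trans (Nat.le_add_right k j))]
    exact h j hj
  -- Each event has the same probability p > 0, so their limsup has probability at least p; being a
  -- tail event, it has probability 1.
  have hBp : p ≤ blowUpLaw N B := by
    have hanti : Antitone fun n => ⋃ k, ⋃ (_ : k ≥ n), A k := fun m n hmn =>
      Set.iUnion_mono fun k => Set.iUnion_mono' fun hk => ⟨hmn.trans hk, subset_rfl⟩
    have hlim := tendsto_measure_iInter_atTop (μ := blowUpLaw N)
      (fun n => (hCm n).nullMeasurableSet) hanti ⟨0, measure_ne_top _ _⟩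
    refine ge_of_tendsto' hlim fun n => ?_
    rw [← hPA n]
    exact measure_mono (Set.subset_iUnion₂_of_subset n le_rfl subset_rfl)
  have hB1 : blowUpLaw N B = 1 := (blowUpLaw_zero_or_one hBm hinv).resolve_left fun h =>
    hp0 (le_zero_iff.1 (h ▸ hBp))
  have hae : ∀ᵐ ω ∂(blowUpLaw N), ω ∈ B := (prob_compl_eq_zero_iff hBm).2 hB1
  filter_upwards [hae] with ω hω n
  simp only [hB, Set.mem_iInter, Set.mem_iUnion] at hω
  obtain ⟨k, hk, h⟩ := hω n
  exact ⟨k, hk, h⟩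

end SelfSimilarSets

/-! ### Conjugate environments and lattices -/

section LatticeBlowUps

namespace SelfSimilarSet

variable {d N : ℕ} (S : SelfSimilarSet d N)

/-- A single weight would have to equal 1. -/
lemma exists_ne_of_sum_eq_one {β : Fin N → ℝ} (hβ : ∀ i, β i ∈ Set.Ioo (0 : ℝ) 1)
    (hβ_sum : ∑ i, β i = 1) : ∃ i j : Fin N, i ≠ j := by
  by_contra! h
  rcases isEmpty_or_nonempty (Fin N) with h0 | ⟨⟨i⟩⟩
  · simp at hβ_sum
  · have : Unique (Fin N) := ⟨⟨i⟩, fun j => h j i⟩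
    rw [Fintype.sum_unique] at hβ_sum
    exact (hβ _).2.ne hβ_sum

lemma blowMap_congr {ω ω' : ℕ → Fin N} {n : ℕ} (h : ∀ k ∈ Set.Iio n, ω k = ω' k) :
    S.blowMap ω n = S.blowMap ω' n := by
  rw [blowMap, blowMap]
  congr 2
  funext k
  rw [h k k.2]

lemma prod_congr_Iio (f : Fin N → ℝ) {ω ω' : ℕ → Fin N} {n : ℕ}
    (h : ∀ k ∈ Set.Iio n, ω k = ω' k) : ∏ k : Fin n, f (ω k) = ∏ k : Fin n, f (ω' k) :=
  Finset.prod_congr rfl fun k _ => by rw [h k k.2]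

/-! ### Blow-ups whose sequences agree from some place on -/

section Shift

variable (ω ω' : ℕ → Fin N) (n : ℕ)

/-- The similitude that maps the blow-up `ω` to the blow-up `ω'`, when both sequences agree from
`n` on. -/
def shift : EuclideanSpace ℝ (Fin d) ≃ᵐ EuclideanSpace ℝ (Fin d) :=
  (S.blowMap ω' n * (S.blowMap ω n)⁻¹).toHomeomorph.toMeasurableEquiv

/-- The factor between the weights of the blow-ups `ω` and `ω'`. -/
def shiftFactor (α : Fin N → ℝ) : ℝ := (∏ k : Fin n, α (ω' k)) / ∏ k : Fin n, α (ω k)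

variable {ω ω' n}

lemma shift_apply (h : ∀ k ≥ n, ω k = ω' k) {m : ℕ} (hm : m ≥ n) (z : EuclideanSpace ℝ (Fin d)) :
    S.shift ω ω' n (S.blowMap ω m z) = S.blowMap ω' m z := by
  change (S.blowMap ω' n * (S.blowMap ω n)⁻¹ * S.blowMap ω m) z = _
  congr 1
  induction m, hm using Nat.le_induction with
  | base => rw [mul_assoc, inv_mul_cancel, mul_one]
  | succ m hm ih => rw [S.blowMap_succ, S.blowMap_succ, ← mul_assoc, ih, h m hm]

lemma shift_mem_image (h : ∀ k ≥ n, ω k = ω' k) {m : ℕ} (hm : m ≥ n)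
    (A : Set (EuclideanSpace ℝ (Fin d))) (x : EuclideanSpace ℝ (Fin d)) :
    S.shift ω ω' n x ∈ S.blowMap ω' m '' A ↔ x ∈ S.blowMap ω m '' A := by
  constructor
  · rintro ⟨z, hz, hzx⟩
    rw [← S.shift_apply h hm] at hzx
    exact ⟨z, hz, (S.shift ω ω' n).injective hzx⟩
  · rintro ⟨z, hz, rfl⟩
    exact ⟨z, hz, (S.shift_apply h hm z).symm⟩

lemma pull_shift (h : ∀ k ≥ n, ω k = ω' k) {m : ℕ} (hm : m ≥ n)
    (u : EuclideanSpace ℝ (Fin d) → ℝ) :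
    S.pull ω m (u ∘ S.shift ω ω' n) = S.pull ω' m u := by
  funext x
  exact congrArg u (S.shift_apply h hm x)

lemma shift_cellPoint (h : ∀ k ≥ n, ω k = ω' k) {m : ℕ} (hm : m ≥ n) (w : Fin m → Fin N)
    (x : S.F) : S.shift ω ω' n (S.cellPoint ω w x) = S.cellPoint ω' w x :=
  S.shift_apply h hm _

lemma shiftFactor_pos {α : Fin N → ℝ} (hα : ∀ i, 0 < α i) : 0 < shiftFactor ω ω' n α :=
  div_pos (Finset.prod_pos fun _ _ => hα _) (Finset.prod_pos fun _ _ => hα _)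

lemma prod_shift {α : Fin N → ℝ} (hα : ∀ i, 0 < α i) (h : ∀ k ≥ n, ω k = ω' k) {m : ℕ}
    (hm : m ≥ n) : ∏ k : Fin m, α (ω' k) = shiftFactor ω ω' n α * ∏ k : Fin m, α (ω k) := by
  induction m, hm using Nat.le_induction with
  | base =>
    exact (div_mul_cancel₀ _ (Finset.prod_pos fun (k : Fin n) _ => hα (ω k)).ne').symm
  | succ m hm ih =>
    rw [Fin.prod_univ_castSucc, Fin.prod_univ_castSucc]
    simp only [Fin.val_castSucc, Fin.val_last]
    rw [ih, h m hm, mul_assoc]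

/-- As α_i β_i is constant, 1/β_i is proportional to α_i with one constant for all i, so measures
scale like forms. -/
lemma prod_inv_shift {α β : Fin N → ℝ} (hα : ∀ i, 0 < α i)
    (hH : ∀ i j, α i * β i = α j * β j) (h : ∀ k ≥ n, ω k = ω' k) {m : ℕ} (hm : m ≥ n) :
    ∏ k : Fin m, (β (ω' k))⁻¹ = shiftFactor ω ω' n α * ∏ k : Fin m, (β (ω k))⁻¹ := by
  have key : ∀ ω : ℕ → Fin N, ∏ k : Fin m, (β (ω k))⁻¹ =
      (∏ k : Fin m, α (ω k)) * ∏ _k : Fin m, (α (ω' 0) * β (ω' 0))⁻¹ := by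
    intro ω
    rw [← Finset.prod_mul_distrib]
    refine Finset.prod_congr rfl fun k _ => ?_
    rw [hH (ω' 0) (ω k), mul_inv, mul_inv_cancel_left₀ (hα _).ne']
  rw [key ω', key ω, prod_shift hα h hm, mul_assoc]

end Shift

lemma ae_exists_disjoint [NeZero N] (hN : ∃ i j : Fin N, i ≠ j) : ∀ᵐ ω ∂(blowUpLaw N),
    ∀ n, ∃ m ≥ n, Disjoint (S.blowX ω n) (S.blowBoundary ω m) := by
  obtain ⟨w, hw⟩ := S.exists_exit_word hN
  filter_upwards [ae_exists_word w] with ω hω n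
  exact S.exists_disjoint hw hω n

/-! #### The lattice -/

section Lattice

lemma wordMap_const_pt (i : Fin N) (n : ℕ) : S.wordMap (fun _ : Fin n => i) (S.pt i) = S.pt i := by
  induction n with
  | zero => exact S.wordMap_zero _ _
  | succ n ih =>
    have : (fun _ : Fin (n + 1) => i) = Fin.cons i fun _ : Fin n => i := by
      funext k
      refine Fin.cases ?_ (fun _ => ?_) k <;> simp
    rw [this, S.wordMap_cons, ih, S.apply_pt]

variable {S} {ω : ℕ → Fin N} {n : ℕ}

lemma cellPoint_cons (w : Fin n → Fin N) (x : S.F) :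
    S.cellPoint ω (Fin.cons (ω n) w : Fin (n + 1) → Fin N) x = S.cellPoint ω w x := by
  rw [cellPoint, S.wordMap_cons, S.blowMap_succ_apply, cellPoint]

lemma mem_blowF {p : EuclideanSpace ℝ (Fin d)} :
    p ∈ S.blowF ω n ↔ ∃ (w : Fin n → Fin N) (x : S.F), S.cellPoint ω w x = p := by
  constructor
  · rintro ⟨z, hz, rfl⟩
    obtain ⟨w, x, hx, rfl⟩ := Set.mem_iUnion.1 hz
    exact ⟨w, ⟨x, hx⟩, rfl⟩
  · rintro ⟨w, x, rfl⟩
    exact ⟨_, Set.mem_iUnion.2 ⟨w, x, x.2, rfl⟩, rfl⟩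

lemma cellPoint_mem (w : Fin n → Fin N) (x : S.F) : S.cellPoint ω w x ∈ S.blowF ω n :=
  mem_blowF.2 ⟨w, x, rfl⟩

lemma blowF_subset_blowX : S.blowF ω n ⊆ S.blowX ω n := by
  intro p hp
  obtain ⟨w, x, rfl⟩ := mem_blowF.1 hp
  exact ⟨_, S.wordMap_mem w (S.F_subset_X x.2), rfl⟩

lemma finite_blowF : (S.blowF ω n).Finite :=
  (Set.finite_iUnion fun _ => S.F.finite_toSet.image _).image _

lemma blowBoundary_subset_blowF : S.blowBoundary ω n ⊆ S.blowF ω n := by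
  rintro _ ⟨z, hz, rfl⟩
  obtain ⟨i, rfl⟩ := S.F_subset hz
  refine mem_blowF.2 ⟨fun _ => i, ⟨S.pt i, hz⟩, ?_⟩
  rw [cellPoint, S.wordMap_const_pt]

lemma blowF_succ : S.blowF ω n ⊆ S.blowF ω (n + 1) := by
  intro p hp
  obtain ⟨w, x, rfl⟩ := mem_blowF.1 hp
  rw [← cellPoint_cons]
  exact cellPoint_mem _ _

lemma cellPoint_mem_blowBoundary {i : Fin N} (hi : i ≠ ω n) (w : Fin n → Fin N) (x : S.F)
    (h : S.cellPoint ω (Fin.cons i w : Fin (n + 1) → Fin N) x ∈ S.blowF ω n) :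
    S.cellPoint ω (Fin.cons i w : Fin (n + 1) → Fin N) x ∈ S.blowBoundary ω n := by
  have h' := blowF_subset_blowX h
  rw [cellPoint, S.wordMap_cons] at h' ⊢
  exact S.mem_blowBoundary_of_ne hi (S.wordMap_mem w (S.F_subset_X x.2)) h'

omit S in
lemma sum_words {M : Type*} [AddCommMonoid M] (i : Fin N) (f : (Fin (n + 1) → Fin N) → M) :
    ∑ w, f w = ∑ w : Fin n → Fin N, f (Fin.cons i w) +
      ∑ j ∈ Finset.univ.erase i, ∑ w : Fin n → Fin N, f (Fin.cons j w) := by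
  rw [Finset.add_sum_erase _ (fun j => ∑ w : Fin n → Fin N, f (Fin.cons j w)) (Finset.mem_univ i),
    ← Fintype.sum_prod_type' (fun j (w : Fin n → Fin N) => f (Fin.cons j w))]
  exact (Fintype.sum_equiv (Fin.consEquiv fun _ => Fin N) _ _ fun _ => rfl).symm

omit S in
-- The new blow-up factor cancels against the new first letter, so an old cell keeps its weight at
-- the next level.
lemma weight_cons {f : Fin N → ℝ} (hf : ∀ i, f i ≠ 0) (w : Fin n → Fin N) :
    (∏ k : Fin (n + 1), (f (ω k))⁻¹) * ∏ k, f ((Fin.cons (ω n) w : Fin (n + 1) → Fin N) k) =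
      (∏ k : Fin n, (f (ω k))⁻¹) * ∏ k, f (w k) := by
  rw [Fin.prod_univ_castSucc, Fin.prod_univ_succ
    (fun k : Fin (n + 1) => f ((Fin.cons (ω n) w : Fin (n + 1) → Fin N) k))]
  simp only [Fin.val_castSucc, Fin.val_last, Fin.cons_zero, Fin.cons_succ]
  rw [mul_assoc, inv_mul_cancel_left₀ (hf _)]

lemma laplacian_eq (a : S.F → S.F → ℝ) (f : S.F → ℝ) (x : S.F) :
    S.laplacian a f x = -∑ y, a x y * (f y - f x) := by
  rw [laplacian, Finset.sum_erase _ (by simp)]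

/-- Summation by parts: exchanging x and y in half of the sum exhibits the Dirichlet form. Symmetry
and positivity are read off from it. -/
lemma two_mul_sum_laplacian {a : S.F → S.F → ℝ} (ha : S.IsConductance a) (f g : S.F → ℝ) :
    2 * ∑ x, S.laplacian a f x * g x = ∑ x, ∑ y, a x y * ((f y - f x) * (g y - g x)) := by
  have h1 : ∑ x, S.laplacian a f x * g x = ∑ x, ∑ y, -(a x y * ((f y - f x) * g x)) := by
    refine Finset.sum_congr rfl fun x _ => ?_
    rw [laplacian_eq, ← Finset.sum_neg_distrib, Finset.sum_mul]
    exact Finset.sum_congr rfl fun y _ => by ring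
  have h2 : ∑ x, S.laplacian a f x * g x = ∑ x, ∑ y, a x y * ((f y - f x) * g y) := by
    rw [h1, Finset.sum_comm]
    refine Finset.sum_congr rfl fun x _ => Finset.sum_congr rfl fun y _ => ?_
    rcases eq_or_ne x y with rfl | hxy
    · simp
    · rw [ha.symm x y hxy]
      ring
  rw [two_mul]
  nth_rw 1 [h2]
  rw [h1, ← Finset.sum_add_distrib]
  refine Finset.sum_congr rfl fun x _ => ?_
  rw [← Finset.sum_add_distrib]
  exact Finset.sum_congr rfl fun y _ => by ring

lemma sum_laplacian_symm {a : S.F → S.F → ℝ} (ha : S.IsConductance a) (f g : S.F → ℝ) :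
    ∑ x, S.laplacian a f x * g x = ∑ x, S.laplacian a g x * f x := by
  refine mul_left_cancel₀ (two_ne_zero (α := ℝ)) ?_
  rw [two_mul_sum_laplacian ha, two_mul_sum_laplacian ha]
  exact Finset.sum_congr rfl fun x _ => Finset.sum_congr rfl fun y _ => by ring

lemma sum_laplacian_nonneg {a : S.F → S.F → ℝ} (ha : S.IsConductance a) (f : S.F → ℝ) :
    0 ≤ ∑ x, S.laplacian a f x * f x := by
  refine nonneg_of_mul_nonneg_right ?_ (two_pos (α := ℝ))
  rw [two_mul_sum_laplacian ha]
  refine Finset.sum_nonneg fun x _ => Finset.sum_nonneg fun y _ => ?_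
  rcases eq_or_ne x y with rfl | hxy
  · simp
  · exact mul_nonneg (ha.nonneg x y hxy) (mul_self_nonneg _)

lemma laplacian_add_smul (a : S.F → S.F → ℝ) (f g : S.F → ℝ) (c : ℝ) (x : S.F) :
    S.laplacian a (fun y => f y + c * g y) x = S.laplacian a f x + c * S.laplacian a g x := by
  rw [laplacian_eq, laplacian_eq, laplacian_eq, mul_neg, ← neg_add, Finset.mul_sum,
    ← Finset.sum_add_distrib]
  congr 1
  exact Finset.sum_congr rfl fun y _ => by ring

lemma laplacian_zero (a : S.F → S.F → ℝ) (x : S.F) : S.laplacian a (fun _ => 0) x = 0 := by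
  simp [laplacian]

variable {α β : Fin N → ℝ} {a : S.F → S.F → ℝ} {b : S.F → ℝ}

/-- The words that begin with ω n are the old cells, with unchanged points and weights; the
remaining sum is over the new cells. -/
lemma latticeForm_succ (hα : ∀ i, 0 < α i) (f g : EuclideanSpace ℝ (Fin d) → ℝ) :
    S.latticeForm α a ω (n + 1) f g = S.latticeForm α a ω n f g +
      ∑ i ∈ Finset.univ.erase (ω n), ∑ w : Fin n → Fin N,
        (∏ k : Fin (n + 1), α (ω k)) *
          (∏ k, (α ((Fin.cons i w : Fin (n + 1) → Fin N) k))⁻¹) *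
        ∑ x : S.F, S.laplacian a
          (fun y => f (S.cellPoint ω (Fin.cons i w : Fin (n + 1) → Fin N) y)) x *
            g (S.cellPoint ω (Fin.cons i w : Fin (n + 1) → Fin N) x) := by
  rw [latticeForm, sum_words (ω n)]
  congr 1
  refine Finset.sum_congr rfl fun w _ => ?_
  have h := weight_cons (ω := ω) (f := fun i => (α i)⁻¹) (fun i => inv_ne_zero (hα i).ne') w
  simp only [inv_inv] at h
  simp only [h, cellPoint_cons]

lemma latticeForm_nonneg (hα : ∀ i, 0 < α i) (ha : S.IsConductance a)
    (f : EuclideanSpace ℝ (Fin d) → ℝ) : 0 ≤ S.latticeForm α a ω n f f :=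
  Finset.sum_nonneg fun _ _ => mul_nonneg
    (mul_nonneg (Finset.prod_nonneg fun _ _ => (hα _).le)
      (Finset.prod_nonneg fun _ _ => inv_nonneg.2 (hα _).le))
    (sum_laplacian_nonneg ha _)

lemma latticeForm_zero (g : EuclideanSpace ℝ (Fin d) → ℝ) :
    S.latticeForm α a ω n 0 g = 0 := by
  simp [latticeForm, laplacian]

lemma tendsto_latticeForm {f : ℕ → EuclideanSpace ℝ (Fin d) → ℝ} {g : EuclideanSpace ℝ (Fin d) → ℝ}
    (h : ∀ x ∈ S.blowF ω n, Tendsto (fun k => f k x) atTop (𝓝 (g x))) :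
    Tendsto (fun k => S.latticeForm α a ω n (f k) (f k)) atTop
      (𝓝 (S.latticeForm α a ω n g g)) := by
  have h' := fun w x => h _ (cellPoint_mem (n := n) (ω := ω) w x)
  refine tendsto_finsetSum _ fun w _ => Tendsto.const_mul _ <| tendsto_finsetSum _ fun x _ =>
    Tendsto.mul (Tendsto.neg ?_) (h' w x)
  exact tendsto_finsetSum _ fun y _ => Tendsto.const_mul _ ((h' w y).sub (h' w x))

lemma latticeMeasure_apply (A : Set (EuclideanSpace ℝ (Fin d))) :
    S.latticeMeasure β b ω n A = ∑ w : Fin n → Fin N, ∑ x : S.F,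
      ENNReal.ofReal ((∏ k : Fin n, (β (ω k))⁻¹) * (∏ k, β (w k)) * b x) *
        A.indicator 1 (S.cellPoint ω w x) := by
  simp [latticeMeasure, Measure.finsetSum_apply]

lemma weight_pos (hβ : ∀ i, 0 < β i) (hb : ∀ x, 0 < b x) (w : Fin n → Fin N) (x : S.F) :
    0 < (∏ k : Fin n, (β (ω k))⁻¹) * (∏ k, β (w k)) * b x :=
  mul_pos (mul_pos (Finset.prod_pos fun _ _ => inv_pos.2 (hβ _))
    (Finset.prod_pos fun _ _ => hβ _)) (hb x)

instance isFiniteMeasure_latticeMeasure : IsFiniteMeasure (S.latticeMeasure β b ω n) where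
  measure_univ_lt_top := by
    rw [latticeMeasure_apply]
    simp [ENNReal.sum_lt_top]

lemma integral_latticeMeasure (hβ : ∀ i, 0 < β i) (hb : ∀ x, 0 < b x)
    (f : EuclideanSpace ℝ (Fin d) → ℝ) :
    ∫ x, f x ∂(S.latticeMeasure β b ω n) = ∑ w : Fin n → Fin N, ∑ x : S.F,
      (∏ k : Fin n, (β (ω k))⁻¹) * (∏ k, β (w k)) * b x * f (S.cellPoint ω w x) := by
  have hi : ∀ (w : Fin n → Fin N) (x : S.F), Integrable f
      (ENNReal.ofReal ((∏ k : Fin n, (β (ω k))⁻¹) * (∏ k, β (w k)) * b x) •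
        Measure.dirac (S.cellPoint ω w x)) := fun w x =>
    (integrable_dirac (by simp)).smul_measure ENNReal.ofReal_ne_top
  rw [latticeMeasure, integral_finsetSum_measure fun w _ =>
    integrable_finsetSum_measure.2 fun x _ => hi w x]
  refine Finset.sum_congr rfl fun w _ => ?_
  rw [integral_finsetSum_measure fun x _ => hi w x]
  refine Finset.sum_congr rfl fun x _ => ?_
  rw [integral_smul_measure, integral_dirac, ENNReal.toReal_ofReal (weight_pos hβ hb w x).le,
    smul_eq_mul]

lemma latticeMeasure_compl : S.latticeMeasure β b ω n (S.blowF ω n)ᶜ = 0 := by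
  rw [latticeMeasure_apply]
  simp [cellPoint_mem]

/-- The function may be non-measurable, but it agrees almost everywhere with its restriction to the
finite vertex set, a finite sum of indicators. -/
lemma memLp_latticeMeasure (u : EuclideanSpace ℝ (Fin d) → ℝ) :
    MemLp u 2 (S.latticeMeasure β b ω n) := by
  have hf := finite_blowF (S := S) (ω := ω) (n := n)
  have hae : (S.blowF ω n).indicator u =ᵐ[S.latticeMeasure β b ω n] u := by
    refine measure_mono_null (fun x hx => ?_) (latticeMeasure_compl (S := S) (β := β) (b := b))
    exact fun h => hx (Set.indicator_of_mem h u)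
  have hm : Measurable ((S.blowF ω n).indicator u) := by
    have h1 : (S.blowF ω n).indicator u =
        fun p => ∑ x ∈ hf.toFinset, ({x} : Set (EuclideanSpace ℝ (Fin d))).indicator
          (fun _ => u x) p := by
      funext p
      by_cases hp : p ∈ S.blowF ω n
      · rw [Set.indicator_of_mem hp, Finset.sum_eq_single p]
        · simp
        · intro x _ hx
          exact Set.indicator_of_notMem (fun h => hx (Set.mem_singleton_iff.1 h).symm) _
        · simp [hp]
      · rw [Set.indicator_of_notMem hp, Finset.sum_eq_zero]
        intro x hx
        refine Set.indicator_of_notMem (fun h => hp ?_) _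
        rw [Set.mem_singleton_iff.1 h]
        exact hf.mem_toFinset.1 hx
    rw [h1]
    exact Finset.measurable_sum _ fun x _ => measurable_const.indicator (measurableSet_singleton x)
  refine (MemLp.of_bound hm.aestronglyMeasurable (∑ x ∈ hf.toFinset, |u x|) ?_).ae_eq hae
  refine Eventually.of_forall fun p => ?_
  by_cases hp : p ∈ S.blowF ω n
  · rw [Set.indicator_of_mem hp, Real.norm_eq_abs]
    exact Finset.single_le_sum (f := fun x => |u x|) (fun _ _ => abs_nonneg _)
      (hf.mem_toFinset.2 hp)
  · rw [Set.indicator_of_notMem hp, norm_zero]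
    exact Finset.sum_nonneg fun _ _ => abs_nonneg _

lemma exists_latticeMeasure_succ (hβ : ∀ i, 0 < β i) :
    ∃ ρ : Measure (EuclideanSpace ℝ (Fin d)),
      S.latticeMeasure β b ω (n + 1) = S.latticeMeasure β b ω n + ρ ∧
      ρ (S.blowF ω n \ S.blowBoundary ω n) = 0 := by
  refine ⟨∑ i ∈ Finset.univ.erase (ω n), ∑ w : Fin n → Fin N, ∑ x : S.F,
    ENNReal.ofReal ((∏ k : Fin (n + 1), (β (ω k))⁻¹) *
      (∏ k, β ((Fin.cons i w : Fin (n + 1) → Fin N) k)) * b x) •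
      Measure.dirac (S.cellPoint ω (Fin.cons i w : Fin (n + 1) → Fin N) x), ?_, ?_⟩
  · rw [latticeMeasure, sum_words (ω n)]
    congr 1
    refine Finset.sum_congr rfl fun w _ => ?_
    have h := weight_cons (ω := ω) (fun i => (hβ i).ne') w
    simp only [h, cellPoint_cons]
  · simp only [Measure.finsetSum_apply, Measure.smul_apply, Measure.dirac_apply, smul_eq_mul]
    refine Finset.sum_eq_zero fun i hi => Finset.sum_eq_zero fun w _ =>
      Finset.sum_eq_zero fun x _ => ?_
    rw [Set.indicator_of_notMem, mul_zero]
    exact fun h => h.2 (cellPoint_mem_blowBoundary (Finset.ne_of_mem_erase hi) w x h.1)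

lemma eqOn_blowF (hβ : ∀ i, 0 < β i) (hb : ∀ x, 0 < b x) {u v : EuclideanSpace ℝ (Fin d) → ℝ}
    (h : u =ᵐ[S.latticeMeasure β b ω n] v) : Set.EqOn u v (S.blowF ω n) := by
  intro p hp
  obtain ⟨w, x, rfl⟩ := mem_blowF.1 hp
  by_contra hne
  have h1 : S.latticeMeasure β b ω n {p | ¬ u p = v p} = 0 := h
  rw [latticeMeasure_apply] at h1
  have h2 := (Finset.sum_eq_zero_iff.1 ((Finset.sum_eq_zero_iff.1 h1) w (Finset.mem_univ _))) x
    (Finset.mem_univ _)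
  rw [Set.indicator_of_mem (by exact hne), Pi.one_apply, mul_one, ENNReal.ofReal_eq_zero] at h2
  exact absurd h2 (not_le.2 (weight_pos hβ hb w x))

/-- Every vertex has positive mass, so a Cauchy sequence for the form norm converges at each of the
finitely many vertices. -/
lemma lattice_complete (hα : ∀ i, 0 < α i) (ha : S.IsConductance a) (hβ : ∀ i, 0 < β i)
    (hb : ∀ x, 0 < b x) (u : ℕ → EuclideanSpace ℝ (Fin d) → ℝ)
    (hu : ∀ δ > 0, ∃ k₀, ∀ p ≥ k₀, ∀ q ≥ k₀, S.latticeForm α a ω n (u p - u q) (u p - u q) +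
      ∫ x, (u p x - u q x) ^ 2 ∂(S.latticeMeasure β b ω n) < δ) :
    ∃ v : EuclideanSpace ℝ (Fin d) → ℝ,
      Tendsto (fun k => S.latticeForm α a ω n (u k - v) (u k - v) +
        ∫ x, (u k x - v x) ^ 2 ∂(S.latticeMeasure β b ω n)) atTop (𝓝 0) := by
  have hlim : ∀ x, ∃ l, x ∈ S.blowF ω n → Tendsto (fun k => u k x) atTop (𝓝 l) := by
    intro p
    by_cases hp : p ∈ S.blowF ω n
    · obtain ⟨w, x, rfl⟩ := mem_blowF.1 hp
      have hc : CauchySeq fun k => u k (S.cellPoint ω w x) := by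
        rw [Metric.cauchySeq_iff]
        intro δ hδ
        have hw := weight_pos (ω := ω) hβ hb w x
        obtain ⟨k₀, hk⟩ := hu (_ * δ ^ 2) (mul_pos hw (pow_pos hδ 2))
        refine ⟨k₀, fun p hp q hq => ?_⟩
        have h1 := hk p hp q hq
        rw [integral_latticeMeasure hβ hb] at h1
        have h2 := latticeForm_nonneg (ω := ω) (n := n) hα ha (u p - u q)
        have hnn : ∀ (w : Fin n → Fin N) (x : S.F),
            0 ≤ (∏ k : Fin n, (β (ω k))⁻¹) * (∏ k, β (w k)) * b x *
              (u p (S.cellPoint ω w x) - u q (S.cellPoint ω w x)) ^ 2 := fun w x =>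
          mul_nonneg (weight_pos hβ hb w x).le (sq_nonneg _)
        have h3 := (Finset.single_le_sum (fun x _ => hnn w x) (Finset.mem_univ x)).trans
          (Finset.single_le_sum (fun w _ => Finset.sum_nonneg fun x _ => hnn w x)
            (Finset.mem_univ w))
        have h4 := lt_of_mul_lt_mul_left ((h3.trans (le_add_of_nonneg_left h2)).trans_lt h1) hw.le
        rw [Real.dist_eq]
        exact lt_of_pow_lt_pow_left₀ 2 hδ.le (by rwa [sq_abs])
      obtain ⟨l, hl⟩ := cauchySeq_tendsto_of_complete hc
      exact ⟨l, fun _ => hl⟩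
    · exact ⟨0, fun h => absurd h hp⟩
  choose v hv using hlim
  have h0 : ∀ x ∈ S.blowF ω n, Tendsto (fun k => (u k - v) x) atTop
      (𝓝 ((0 : EuclideanSpace ℝ (Fin d) → ℝ) x)) := by
    intro x hx
    simpa using (hv x hx).sub_const (v x)
  refine ⟨v, ?_⟩
  have h1 := tendsto_latticeForm (α := α) (a := a) h0
  rw [latticeForm_zero] at h1
  have h2 : Tendsto (fun k => ∫ x, (u k x - v x) ^ 2 ∂(S.latticeMeasure β b ω n)) atTop (𝓝 0) := by
    simp only [integral_latticeMeasure hβ hb]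
    have h3 : (0 : ℝ) = ∑ w : Fin n → Fin N, ∑ x : S.F,
        (∏ k : Fin n, (β (ω k))⁻¹) * (∏ k, β (w k)) * b x * 0 ^ 2 := by simp
    rw [h3]
    exact tendsto_finsetSum _ fun w _ => tendsto_finsetSum _ fun x _ =>
      ((h0 _ (cellPoint_mem w x)).pow 2).const_mul _
  simpa using h1.add h2

/-- New cells meet the old level only at its boundary, where the function vanishes; so it vanishes
on all new cells. -/
lemma lattice_extend (hα : ∀ i, 0 < α i) {u : EuclideanSpace ℝ (Fin d) → ℝ}
    (hu : ∀ x ∈ S.blowBoundary ω n, u x = 0) (hu' : ∀ x ∉ S.blowF ω n, u x = 0)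
    (v : EuclideanSpace ℝ (Fin d) → ℝ) :
    S.latticeForm α a ω (n + 1) u v = S.latticeForm α a ω n u v := by
  rw [latticeForm_succ hα, add_eq_left]
  refine Finset.sum_eq_zero fun i hi => Finset.sum_eq_zero fun w _ => ?_
  have h : (fun y => u (S.cellPoint ω (Fin.cons i w : Fin (n + 1) → Fin N) y)) = fun _ => 0 := by
    funext y
    by_cases hy : S.cellPoint ω (Fin.cons i w : Fin (n + 1) → Fin N) y ∈ S.blowF ω n
    · exact hu _ (cellPoint_mem_blowBoundary (Finset.ne_of_mem_erase hi) w y hy)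
    · exact hu' _ hy
  rw [h, Finset.sum_eq_zero, mul_zero]
  exact fun x _ => by rw [laplacian_zero, zero_mul]

theorem isBlowUp_lattice (hα : ∀ i, 0 < α i) (hβ : ∀ i, 0 < β i) (ha : S.IsConductance a)
    (hb : ∀ x, 0 < b x) (ω : ℕ → Fin N) : (S.lattice α β a b ω).IsBlowUp where
  measurableSet_carrier _ := finite_blowF.measurableSet
  measurableSet_boundary _ := (finite_blowF.subset blowBoundary_subset_blowF).measurableSet
  carrier_succ _ := blowF_succ
  boundary_subset _ := blowBoundary_subset_blowF
  boundary_succ n := (Set.inter_subset_inter_right _ blowF_subset_blowX).trans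
    (S.blowBoundary_succ ω n)
  isFiniteMeasure _ := isFiniteMeasure_latticeMeasure
  measure_compl _ := latticeMeasure_compl
  measure_succ _ := exists_latticeMeasure_succ hβ
  zero_mem _ := Set.mem_univ _
  add_smul_mem _ _ _ _ _ _ := Set.mem_univ _
  dom_congr _ _ _ _ _ := Set.mem_univ _
  form_congr n u v w h := by
    change S.latticeForm α a ω n u w = S.latticeForm α a ω n v w
    simp only [latticeForm, h (cellPoint_mem _ _)]
  dom_succ _ := subset_rfl
  memLp _ u _ := memLp_latticeMeasure u
  form_add_smul n u _ v _ w _ c := by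
    change S.latticeForm α a ω n (u + c • v) w =
      S.latticeForm α a ω n u w + c * S.latticeForm α a ω n v w
    simp only [latticeForm]
    rw [Finset.mul_sum, ← Finset.sum_add_distrib]
    refine Finset.sum_congr rfl fun z _ => ?_
    rw [mul_left_comm c, ← mul_add]
    congr 1
    rw [Finset.mul_sum, ← Finset.sum_add_distrib]
    refine Finset.sum_congr rfl fun x _ => ?_
    rw [← mul_assoc, ← add_mul, ← laplacian_add_smul]
    rfl
  form_symm n u _ v _ := Finset.sum_congr rfl fun w _ => by rw [sum_laplacian_symm ha]
  form_nonneg n u _ := latticeForm_nonneg hα ha u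
  form_le_succ n u _ := by
    change S.latticeForm α a ω n u u ≤ S.latticeForm α a ω (n + 1) u u
    rw [latticeForm_succ hα]
    refine le_add_of_nonneg_right <| Finset.sum_nonneg fun _ _ => Finset.sum_nonneg fun _ _ =>
      mul_nonneg (mul_nonneg (Finset.prod_nonneg fun _ _ => (hα _).le)
        (Finset.prod_nonneg fun _ _ => inv_nonneg.2 (hα _).le)) (sum_laplacian_nonneg ha _)
  complete n u _ h := by
    obtain ⟨v, hv⟩ := lattice_complete hα ha hβ hb u h
    exact ⟨v, Set.mem_univ _, hv⟩
  eqOn_of_ae_eq _ _ _ _ _ h := eqOn_blowF hβ hb h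
  extend _ _ _ h h' := ⟨Set.mem_univ _, fun v _ => lattice_extend hα h h' v⟩

lemma isAdapted_lattice : FormSequence.IsAdapted (S.lattice α β a b) where
  carrier n ω ω' h := by
    change S.blowF ω n = S.blowF ω' n
    rw [blowF, blowF, S.blowMap_congr h]
  boundary n ω ω' h := by
    change S.blowBoundary ω n = S.blowBoundary ω' n
    rw [blowBoundary, blowBoundary, S.blowMap_congr h]
  measure n ω ω' h := by
    change S.latticeMeasure β b ω n = S.latticeMeasure β b ω' n
    simp only [latticeMeasure, cellPoint]
    rw [S.blowMap_congr h, prod_congr_Iio (fun i => (β i)⁻¹) h]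
  dom n ω ω' _ := rfl
  form n ω ω' h := by
    change S.latticeForm α a ω n = S.latticeForm α a ω' n
    funext f g
    simp only [latticeForm, cellPoint]
    rw [S.blowMap_congr h, prod_congr_Iio α h]

lemma isConj_lattice (hα : ∀ i, 0 < α i)
    (hH : ∀ i j, α i * β i = α j * β j) {ω ω' : ℕ → Fin N} (h : ∀ k ≥ n, ω k = ω' k) :
    FormSequence.IsConj (S.lattice α β a b ω) (S.lattice α β a b ω') (S.shift ω ω' n)
      (shiftFactor ω ω' n α) n where
  pos := shiftFactor_pos hα
  carrier m hm x := S.shift_mem_image h hm _ x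
  boundary m hm x := S.shift_mem_image h hm _ x
  measure m hm := by
    change S.latticeMeasure β b ω' m = _ • (S.latticeMeasure β b ω m).map _
    have hmap : ∀ μ : Measure (EuclideanSpace ℝ (Fin d)),
        μ.map (S.shift ω ω' n) = Measure.mapₗ (S.shift ω ω' n) μ := fun μ =>
      (Measure.mapₗ_apply_of_measurable (S.shift ω ω' n).measurable μ).symm
    rw [hmap, latticeMeasure, latticeMeasure, map_sum, Finset.smul_sum]
    refine Finset.sum_congr rfl fun w _ => ?_
    rw [map_sum, Finset.smul_sum]
    refine Finset.sum_congr rfl fun x _ => ?_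
    rw [← hmap, Measure.map_smul, Measure.map_dirac' (S.shift ω ω' n).measurable,
      S.shift_cellPoint h hm, smul_smul, ← ENNReal.ofReal_mul (shiftFactor_pos hα).le,
      prod_inv_shift hα hH h hm]
    simp only [mul_assoc]
  dom _ _ _ := Iff.rfl
  form m hm u v := by
    change S.latticeForm α a ω' m u v = _ * S.latticeForm α a ω m _ _
    rw [latticeForm, latticeForm, Finset.mul_sum]
    refine Finset.sum_congr rfl fun w _ => ?_
    simp only [Function.comp_apply, S.shift_cellPoint h hm]
    rw [prod_shift hα h hm]
    simp only [mul_assoc]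

end Lattice

theorem hasDeterministicSpectra_lattice [NeZero N] {α β : Fin N → ℝ} {a : S.F → S.F → ℝ}
    {b : S.F → ℝ} (hα : ∀ i, α i ∈ Set.Ioo (0 : ℝ) 1) (hβ : ∀ i, β i ∈ Set.Ioo (0 : ℝ) 1)
    (hβ_sum : ∑ i, β i = 1) (hH : ∀ i j, α i * β i = α j * β j) (ha : S.IsConductance a)
    (hb : ∀ x, 0 < b x) : HasDeterministicSpectra (S.lattice α β a b) := by
  refine FormSequence.hasDeterministicSpectra
    (isBlowUp_lattice (fun i => (hα i).1) (fun i => (hβ i).1) ha hb) isAdapted_lattice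
    (fun n ω ω' h => ⟨_, _, isConj_lattice (fun i => (hα i).1) hH h⟩) ?_
  filter_upwards [S.ae_exists_disjoint (exists_ne_of_sum_eq_one hβ hβ_sum)] with ω hω n
  obtain ⟨m, hm, h⟩ := hω n
  exact ⟨m, hm, h.mono_left blowF_subset_blowX⟩

end SelfSimilarSet

end LatticeBlowUps

/-! ### Continuous blow-ups -/

section ContinuousBlowUps

namespace SelfSimilarSet

variable {d N : ℕ} {S : SelfSimilarSet d N}

/-! #### The self-similar set -/

instance : CompactSpace S.X := isCompact_iff_compactSpace.1 S.isCompact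

lemma continuous_cellMap (i : Fin N) : Continuous (S.cellMap i) :=
  ((S.Ψ i).toHomeomorph.continuous.comp continuous_subtype_val).subtype_mk _

lemma exists_cellMap_eq (x : S.X) : ∃ i y, S.cellMap i y = x := by
  obtain ⟨i, y, hy, hyx⟩ := Set.mem_iUnion.1 (S.eq_iUnion.subset x.2)
  exact ⟨i, ⟨y, hy⟩, Subtype.ext hyx⟩

/-- The preimage of a closed set is a finite union of images of compact sets, one for each cell. -/
lemma continuous_of_cells {u : S.X → ℝ} (h : ∀ i, Continuous (u ∘ S.cellMap i)) :
    Continuous u := by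
  refine continuous_iff_isClosed.2 fun K hK => ?_
  have h1 : u ⁻¹' K = ⋃ i, S.cellMap i '' ((u ∘ S.cellMap i) ⁻¹' K) := by
    ext x
    rw [Set.mem_iUnion]
    constructor
    · intro hx
      obtain ⟨i, y, rfl⟩ := exists_cellMap_eq x
      exact ⟨i, y, hx, rfl⟩
    · rintro ⟨i, y, hy, rfl⟩
      exact hy
  rw [h1]
  exact isClosed_iUnion_of_finite fun i =>
    ((hK.preimage (h i)).isCompact.image (continuous_cellMap i)).isClosed

/-- Every small ball contains the image under some Ψ_i of a larger ball, whose mass is counted with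
the positive weight β_i. Induction goes over the radii 2D r^k, with r the largest ratio and 2D a
bound for the diameter. -/
lemma IsSelfSimilarMeasure.isOpenPosMeasure {β : Fin N → ℝ} {m : Measure S.X}
    (hm : S.IsSelfSimilarMeasure β m) (hβ : ∀ i, 0 < β i) : m.IsOpenPosMeasure := by
  have := hm.1
  obtain ⟨x₀, hx₀⟩ := S.isConnected.nonempty
  obtain ⟨i₀, -, -⟩ := exists_cellMap_eq (⟨x₀, hx₀⟩ : S.X)
  have : Nonempty (Fin N) := ⟨i₀⟩
  obtain ⟨j, hj⟩ := Finite.exists_max fun i => Dilation.ratio (S.Ψ i)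
  set r : ℝ := (Dilation.ratio (S.Ψ j) : ℝ)
  have hr0 : 0 ≤ r := NNReal.coe_nonneg _
  have hr1 : r < 1 := by exact_mod_cast S.ratio_lt_one j
  obtain ⟨D, hD⟩ := S.isCompact.isBounded.exists_norm_le
  have key : ∀ (k : ℕ) (x : S.X), m (Metric.closedBall x (2 * D * r ^ k)) ≠ 0 := by
    intro k
    induction k with
    | zero =>
      intro x
      have h1 : Metric.closedBall x (2 * D * r ^ 0) = Set.univ := by
        refine Set.eq_univ_of_forall fun y => ?_
        rw [Metric.mem_closedBall, Subtype.dist_eq, pow_zero, mul_one, two_mul]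
        exact (dist_le_norm_add_norm _ _).trans (add_le_add (hD _ y.2) (hD _ x.2))
      rw [h1, measure_univ]
      exact one_ne_zero
    | succ k ih =>
      intro x
      obtain ⟨i, y, rfl⟩ := exists_cellMap_eq x
      intro h0
      rw [hm.2, Measure.finsetSum_apply] at h0
      have h1 := Finset.sum_eq_zero_iff.1 h0 i (Finset.mem_univ i)
      rw [Measure.smul_apply, smul_eq_mul, mul_eq_zero, ENNReal.ofReal_eq_zero,
        Measure.map_apply (continuous_cellMap i).measurable
          Metric.isClosed_closedBall.measurableSet]
        at h1
      refine ih y (measure_mono_null (fun z hz => ?_) (h1.resolve_left (hβ i).not_ge))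
      rw [Metric.mem_closedBall] at hz
      rw [Set.mem_preimage, Metric.mem_closedBall]
      change dist (S.Ψ i z) (S.Ψ i y) ≤ _
      rw [Dilation.dist_eq, pow_succ', mul_left_comm]
      exact mul_le_mul (by exact_mod_cast hj i) hz dist_nonneg hr0
  refine ⟨fun U hU ⟨x, hx⟩ h0 => ?_⟩
  obtain ⟨ε, hε, hball⟩ := Metric.isOpen_iff.1 hU x hx
  have hlim : Tendsto (fun k : ℕ => 2 * D * r ^ k) atTop (𝓝 0) := by
    simpa using (tendsto_pow_atTop_nhds_zero_of_lt_one hr0 hr1).const_mul (2 * D)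
  obtain ⟨k, hk⟩ := (hlim.eventually (gt_mem_nhds hε)).exists
  exact key k x (measure_mono_null ((Metric.closedBall_subset_ball hk).trans hball) h0)

namespace DirichletForm

variable {α : Fin N → ℝ} {m : Measure S.X} (a : S.DirichletForm α m)

lemma form_zero_left {v : S.X → ℝ} (hv : v ∈ a.dom) : a.form 0 v = 0 := by
  have h := a.form_smul 0 0 a.dom.zero_mem v hv
  rwa [zero_smul, zero_mul] at h

lemma form_add_self {u v : S.X → ℝ} (hu : u ∈ a.dom) (hv : v ∈ a.dom) :
    a.form (u + v) (u + v) = a.form u u + 2 * a.form u v + a.form v v := by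
  have huv := a.dom.add_mem hu hv
  rw [a.form_add u hu v hv _ huv, a.form_symm u hu _ huv, a.form_symm v hv _ huv,
    a.form_add u hu v hv u hu, a.form_add u hu v hv v hv, a.form_symm v hv u hu]
  ring

lemma comp_cellMap_mem {u : S.X → ℝ} (hu : u ∈ a.dom) (i : Fin N) : u ∘ S.cellMap i ∈ a.dom :=
  (a.mem_dom_iff u (a.continuous u hu)).1 hu i

lemma mem_dom_of_cells {u : S.X → ℝ} (h : ∀ i, u ∘ S.cellMap i ∈ a.dom) : u ∈ a.dom :=
  (a.mem_dom_iff u (continuous_of_cells fun i => a.continuous _ (h i))).2 h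

/-- Polarization of the self-similarity of the quadratic form. -/
lemma form_eq_sum {u v : S.X → ℝ} (hu : u ∈ a.dom) (hv : v ∈ a.dom) :
    a.form u v = ∑ i, (α i)⁻¹ * a.form (u ∘ S.cellMap i) (v ∘ S.cellMap i) := by
  have h1 := a.self_similar (u + v) (a.dom.add_mem hu hv)
  have h2 : ∀ i, (α i)⁻¹ * a.form ((u + v) ∘ S.cellMap i) ((u + v) ∘ S.cellMap i) =
      (α i)⁻¹ * a.form (u ∘ S.cellMap i) (u ∘ S.cellMap i) +
      2 * ((α i)⁻¹ * a.form (u ∘ S.cellMap i) (v ∘ S.cellMap i)) +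
      (α i)⁻¹ * a.form (v ∘ S.cellMap i) (v ∘ S.cellMap i) := by
    intro i
    have := a.form_add_self (a.comp_cellMap_mem hu i) (a.comp_cellMap_mem hv i)
    change (α i)⁻¹ * a.form (u ∘ S.cellMap i + v ∘ S.cellMap i)
      (u ∘ S.cellMap i + v ∘ S.cellMap i) = _
    rw [this]
    ring
  rw [a.form_add_self hu hv, Finset.sum_congr rfl fun i _ => h2 i, Finset.sum_add_distrib,
    Finset.sum_add_distrib, ← Finset.mul_sum, ← a.self_similar u hu, ← a.self_similar v hv] at h1
  linarith

end DirichletForm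

/-! #### The forms of finite level -/

section Continuum

variable {ω : ℕ → Fin N} {n : ℕ}

variable (S ω n) in
lemma measurableEmbedding_blowMap : MeasurableEmbedding fun x : S.X => S.blowMap ω n x :=
  ((S.blowMap ω n).toHomeomorph.isClosedEmbedding.comp
    S.isCompact.isClosed.isClosedEmbedding_subtypeVal).measurableEmbedding

lemma pull_succ_comp (u : EuclideanSpace ℝ (Fin d) → ℝ) :
    S.pull ω (n + 1) u ∘ S.cellMap (ω n) = S.pull ω n u := by
  funext x
  exact congrArg u (S.blowMap_succ_apply ω n x)

lemma pull_succ_comp_of_ne {i : Fin N} (hi : i ≠ ω n) {u : EuclideanSpace ℝ (Fin d) → ℝ}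
    (hu : ∀ x ∈ S.blowBoundary ω n, u x = 0) (hu' : ∀ x ∉ S.blowX ω n, u x = 0) :
    S.pull ω (n + 1) u ∘ S.cellMap i = 0 := by
  funext x
  by_cases hx : S.blowMap ω (n + 1) (S.Ψ i x) ∈ S.blowX ω n
  · exact hu _ (S.mem_blowBoundary_of_ne hi x.2 hx)
  · exact hu' _ hx

lemma pull_congr_Iio {ω ω' : ℕ → Fin N} (h : ∀ k ∈ Set.Iio n, ω k = ω' k) :
    S.pull ω n = S.pull ω' n := by
  funext u x
  rw [pull, pull, S.blowMap_congr h]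

lemma pull_congr {u v : EuclideanSpace ℝ (Fin d) → ℝ} (h : Set.EqOn u v (S.blowX ω n)) :
    S.pull ω n u = S.pull ω n v :=
  funext fun x => h ⟨x, x.2, rfl⟩

lemma exists_pull_eq (v : S.X → ℝ) : ∃ u, S.pull ω n u = v :=
  ⟨Function.extend (fun x : S.X => S.blowMap ω n x) v 0,
    funext fun x => (measurableEmbedding_blowMap S ω n).injective.extend_apply v 0 x⟩

variable {α β : Fin N → ℝ} {m : Measure S.X}

lemma measurableSet_blowX : MeasurableSet (S.blowX ω n) :=
  (S.isCompact.image (S.blowMap ω n).toHomeomorph.continuous).isClosed.measurableSet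

lemma measurableSet_blowBoundary : MeasurableSet (S.blowBoundary ω n) :=
  (S.F.finite_toSet.image _).measurableSet

lemma isFiniteMeasure_continuumMeasure [IsFiniteMeasure m] :
    IsFiniteMeasure (S.continuumMeasure β m ω n) :=
  Measure.smul_finite _ ENNReal.ofReal_ne_top

lemma continuumMeasure_compl : S.continuumMeasure β m ω n (S.blowX ω n)ᶜ = 0 := by
  rw [continuumMeasure, Measure.smul_apply, (measurableEmbedding_blowMap S ω n).map_apply]
  have : (fun x : S.X => S.blowMap ω n x) ⁻¹' (S.blowX ω n)ᶜ = ∅ :=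
    Set.eq_empty_of_forall_notMem fun x hx => hx ⟨x, x.2, rfl⟩
  rw [this, measure_empty, smul_zero]

/-- Self-similarity of m splits level n + 1 into cells: the cell of index ω n carries exactly the
measure of level n, and the others meet its interior nowhere. -/
lemma exists_continuumMeasure_succ (hβ : ∀ i, 0 < β i) (hm : S.IsSelfSimilarMeasure β m) :
    ∃ ρ : Measure (EuclideanSpace ℝ (Fin d)),
      S.continuumMeasure β m ω (n + 1) = S.continuumMeasure β m ω n + ρ ∧
      ρ (S.blowX ω n \ S.blowBoundary ω n) = 0 := by
  set φ : S.X → EuclideanSpace ℝ (Fin d) := fun x => S.blowMap ω (n + 1) x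
  have hφ : Measurable φ := (measurableEmbedding_blowMap S ω (n + 1)).measurable
  set c : ENNReal := ENNReal.ofReal (∏ k : Fin (n + 1), (β (ω k))⁻¹)
  have hc : ∀ i, Measurable (φ ∘ S.cellMap i) := fun i => hφ.comp (continuous_cellMap i).measurable
  have hsum : S.continuumMeasure β m ω (n + 1) =
      ∑ i, (c * ENNReal.ofReal (β i)) • m.map (φ ∘ S.cellMap i) := by
    rw [continuumMeasure]
    conv_lhs => rw [hm.2]
    rw [← Measure.mapₗ_apply_of_measurable hφ, map_sum, Finset.smul_sum]
    refine Finset.sum_congr rfl fun i _ => ?_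
    rw [Measure.mapₗ_apply_of_measurable hφ, Measure.map_smul,
      Measure.map_map hφ (continuous_cellMap i).measurable, smul_smul]
  refine ⟨∑ i ∈ Finset.univ.erase (ω n),
    (c * ENNReal.ofReal (β i)) • m.map (φ ∘ S.cellMap i), ?_, ?_⟩
  · rw [hsum, ← Finset.add_sum_erase _ _ (Finset.mem_univ (ω n))]
    congr 1
    have h1 : φ ∘ S.cellMap (ω n) = fun x : S.X => S.blowMap ω n x :=
      funext fun x => S.blowMap_succ_apply ω n x
    rw [h1, continuumMeasure, ← ENNReal.ofReal_mul
      (Finset.prod_nonneg fun _ _ => inv_nonneg.2 (hβ _).le), Fin.prod_univ_castSucc]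
    simp only [Fin.val_castSucc, Fin.val_last]
    rw [inv_mul_cancel_right₀ (hβ _).ne']
  · rw [Measure.finsetSum_apply]
    refine Finset.sum_eq_zero fun i hi => ?_
    rw [Measure.smul_apply,
      Measure.map_apply (hc i) (measurableSet_blowX.diff measurableSet_blowBoundary)]
    have : φ ∘ S.cellMap i ⁻¹' (S.blowX ω n \ S.blowBoundary ω n) = ∅ :=
      Set.eq_empty_of_forall_notMem fun x hx =>
        hx.2 (S.mem_blowBoundary_of_ne (Finset.ne_of_mem_erase hi) x.2 hx.1)
    rw [this, measure_empty, smul_zero]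

lemma memLp_continuumMeasure [IsFiniteMeasure m] {u : EuclideanSpace ℝ (Fin d) → ℝ}
    (hu : Continuous (S.pull ω n u)) : MemLp u 2 (S.continuumMeasure β m ω n) := by
  refine MemLp.smul_measure ?_ ENNReal.ofReal_ne_top
  rw [(measurableEmbedding_blowMap S ω n).memLp_map_measure_iff]
  obtain ⟨C, hC⟩ := isCompact_univ.exists_bound_of_continuousOn hu.continuousOn
  exact MemLp.of_bound hu.aestronglyMeasurable C (Eventually.of_forall fun x => hC x trivial)

lemma integral_continuumMeasure (hβ : ∀ i, 0 < β i) (f : EuclideanSpace ℝ (Fin d) → ℝ) :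
    ∫ x, f x ∂(S.continuumMeasure β m ω n) =
      (∏ k : Fin n, (β (ω k))⁻¹) * ∫ x, S.pull ω n f x ∂m := by
  rw [continuumMeasure, integral_smul_measure, (measurableEmbedding_blowMap S ω n).integral_map,
    ENNReal.toReal_ofReal (Finset.prod_nonneg fun _ _ => inv_nonneg.2 (hβ _).le), smul_eq_mul]
  rfl

lemma pull_ae_eq (hβ : ∀ i, 0 < β i) {u v : EuclideanSpace ℝ (Fin d) → ℝ}
    (h : u =ᵐ[S.continuumMeasure β m ω n] v) : S.pull ω n u =ᵐ[m] S.pull ω n v := by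
  have hc : ENNReal.ofReal (∏ k : Fin n, (β (ω k))⁻¹) ≠ 0 := by
    rw [ne_eq, ENNReal.ofReal_eq_zero, not_le]
    exact Finset.prod_pos fun _ _ => inv_pos.2 (hβ _)
  rw [continuumMeasure, EventuallyEq, Measure.ae_ennreal_smul_measure_iff hc,
    (measurableEmbedding_blowMap S ω n).ae_map_iff] at h
  exact h

variable {a : S.DirichletForm α m}

/-- The norm of level n is that of the original form up to the positive weights A and B, and every
function on X is the pullback of an ambient one. -/
lemma continuum_complete (hα : ∀ i, 0 < α i) (hβ : ∀ i, 0 < β i)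
    (u : ℕ → EuclideanSpace ℝ (Fin d) → ℝ) (hu : ∀ k, S.pull ω n (u k) ∈ a.dom)
    (h : ∀ δ > 0, ∃ k₀, ∀ p ≥ k₀, ∀ q ≥ k₀,
      (∏ k : Fin n, α (ω k)) * a.form (S.pull ω n (u p - u q)) (S.pull ω n (u p - u q)) +
        ∫ x, (u p x - u q x) ^ 2 ∂(S.continuumMeasure β m ω n) < δ) :
    ∃ v, S.pull ω n v ∈ a.dom ∧ Tendsto (fun k =>
      (∏ k : Fin n, α (ω k)) * a.form (S.pull ω n (u k - v)) (S.pull ω n (u k - v)) +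
        ∫ x, (u k x - v x) ^ 2 ∂(S.continuumMeasure β m ω n)) atTop (𝓝 0) := by
  set A : ℝ := ∏ k : Fin n, α (ω k)
  set B : ℝ := ∏ k : Fin n, (β (ω k))⁻¹ with hB
  have hA0 : 0 < A := Finset.prod_pos fun _ _ => hα _
  have hB0 : 0 < B := Finset.prod_pos fun _ _ => inv_pos.2 (hβ _)
  have hint : ∀ f g : EuclideanSpace ℝ (Fin d) → ℝ,
      ∫ x, (f x - g x) ^ 2 ∂(S.continuumMeasure β m ω n) =
        B * ∫ x, (S.pull ω n f x - S.pull ω n g x) ^ 2 ∂m := fun f g =>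
    integral_continuumMeasure hβ fun x => (f x - g x) ^ 2
  have hnn : ∀ f g : S.X → ℝ, 0 ≤ ∫ x, (f x - g x) ^ 2 ∂m := fun f g =>
    integral_nonneg fun x => sq_nonneg _
  obtain ⟨v₀, hv₀, hlim⟩ := a.closed (fun k => S.pull ω n (u k)) hu fun δ hδ => by
    obtain ⟨k₀, hk⟩ := h (min A B * δ) (mul_pos (lt_min hA0 hB0) hδ)
    refine ⟨k₀, fun p hp q hq => ?_⟩
    have h1 := hk p hp q hq
    rw [hint] at h1
    have h2 := a.form_nonneg _ (a.dom.sub_mem (hu p) (hu q))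
    refine lt_of_mul_lt_mul_left (lt_of_le_of_lt ?_ h1) (lt_min hA0 hB0).le
    rw [mul_add]
    exact add_le_add (mul_le_mul_of_nonneg_right (min_le_left A B) h2)
      (mul_le_mul_of_nonneg_right (min_le_right A B) (hnn _ _))
  obtain ⟨v, rfl⟩ := exists_pull_eq (ω := ω) (n := n) v₀
  refine ⟨v, hv₀, ?_⟩
  have h0 := hlim.const_mul (A + B)
  rw [mul_zero] at h0
  refine squeeze_zero (fun k => ?_) (fun k => ?_) h0
  · rw [hint]
    exact add_nonneg (mul_nonneg hA0.le (a.form_nonneg _ (a.dom.sub_mem (hu k) hv₀)))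
      (mul_nonneg hB0.le (hnn _ _))
  · rw [hint, mul_add]
    exact add_le_add (mul_le_mul_of_nonneg_right (le_add_of_nonneg_right hB0.le)
      (a.form_nonneg _ (a.dom.sub_mem (hu k) hv₀)))
      (mul_le_mul_of_nonneg_right (le_add_of_nonneg_left hA0.le) (hnn _ _))

/-- In the decomposition into cells, the factor of the cell ω n cancels the last weight and leaves
the form of level n. -/
lemma continuum_form_succ (hα : ∀ i, 0 < α i) {u v : EuclideanSpace ℝ (Fin d) → ℝ}
    (hu : S.pull ω (n + 1) u ∈ a.dom) (hv : S.pull ω (n + 1) v ∈ a.dom) :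
    (∏ k : Fin (n + 1), α (ω k)) * a.form (S.pull ω (n + 1) u) (S.pull ω (n + 1) v) =
      (∏ k : Fin n, α (ω k)) * a.form (S.pull ω n u) (S.pull ω n v) +
      (∏ k : Fin (n + 1), α (ω k)) * ∑ i ∈ Finset.univ.erase (ω n), (α i)⁻¹ *
        a.form (S.pull ω (n + 1) u ∘ S.cellMap i) (S.pull ω (n + 1) v ∘ S.cellMap i) := by
  rw [a.form_eq_sum hu hv, ← Finset.add_sum_erase _ _ (Finset.mem_univ (ω n)), mul_add,
    pull_succ_comp, pull_succ_comp]
  congr 1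
  rw [Fin.prod_univ_castSucc]
  simp only [Fin.val_castSucc, Fin.val_last]
  rw [mul_assoc, mul_inv_cancel_left₀ (hα _).ne']

/-- Membership in the domain is checked cell by cell: the cell ω n carries the given function, the
others carry 0. -/
lemma pull_succ_mem {u : EuclideanSpace ℝ (Fin d) → ℝ} (h : S.pull ω n u ∈ a.dom)
    (hu : ∀ x ∈ S.blowBoundary ω n, u x = 0) (hu' : ∀ x ∉ S.blowX ω n, u x = 0) :
    S.pull ω (n + 1) u ∈ a.dom := by
  refine a.mem_dom_of_cells fun i => ?_
  by_cases hi : i = ω n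
  · rw [hi, pull_succ_comp]
    exact h
  · rw [pull_succ_comp_of_ne hi hu hu']
    exact a.dom.zero_mem

theorem isBlowUp_continuum (hα : ∀ i, 0 < α i) (hβ : ∀ i, 0 < β i)
    (hm : S.IsSelfSimilarMeasure β m) (ω : ℕ → Fin N) : (S.continuum β a ω).IsBlowUp where
  measurableSet_carrier _ := measurableSet_blowX
  measurableSet_boundary _ := measurableSet_blowBoundary
  carrier_succ n := S.blowX_mono ω n.le_succ
  boundary_subset := S.blowBoundary_subset ω
  boundary_succ := S.blowBoundary_succ ω
  isFiniteMeasure n := by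
    have := hm.1
    exact isFiniteMeasure_continuumMeasure
  measure_compl _ := continuumMeasure_compl
  measure_succ _ := exists_continuumMeasure_succ hβ hm
  zero_mem _ := a.dom.zero_mem
  add_smul_mem _ _ hu _ hv c := a.dom.add_mem hu (a.dom.smul_mem c hv)
  dom_congr n u hu v h := by
    change S.pull ω n v ∈ a.dom
    rw [← pull_congr h]
    exact hu
  form_congr n u v w h := by
    change _ * a.form (S.pull ω n u) _ = _ * a.form (S.pull ω n v) _
    rw [pull_congr h]
  dom_succ n u hu := by
    change S.pull ω n u ∈ a.dom
    rw [← pull_succ_comp]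
    exact a.comp_cellMap_mem hu _
  memLp n u hu := by
    have := hm.1
    exact memLp_continuumMeasure (a.continuous _ hu)
  form_add_smul n u hu v hv w hw c := by
    change _ * a.form (S.pull ω n u + c • S.pull ω n v) (S.pull ω n w) =
      _ * a.form (S.pull ω n u) (S.pull ω n w) + c * (_ * a.form (S.pull ω n v) (S.pull ω n w))
    rw [a.form_add _ hu _ (a.dom.smul_mem c hv) _ hw, a.form_smul c _ hv _ hw]
    ring
  form_symm n u hu v hv := congrArg _ (a.form_symm _ hu _ hv)
  form_nonneg n u hu := mul_nonneg (Finset.prod_nonneg fun _ _ => (hα _).le) (a.form_nonneg _ hu)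
  form_le_succ n u hu := by
    change _ * a.form (S.pull ω n u) (S.pull ω n u) ≤
      _ * a.form (S.pull ω (n + 1) u) (S.pull ω (n + 1) u)
    rw [continuum_form_succ hα hu hu]
    exact le_add_of_nonneg_right <| mul_nonneg (Finset.prod_nonneg fun _ _ => (hα _).le) <|
      Finset.sum_nonneg fun i _ => mul_nonneg (inv_nonneg.2 (hα i).le)
        (a.form_nonneg _ (a.comp_cellMap_mem hu i))
  complete n u hu h := continuum_complete hα hβ u hu h
  eqOn_of_ae_eq n u hu v hv h := by
    -- Elements of the domain are continuous and m charges every nonempty open set, so equality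
    -- almost everywhere is equality.
    have := hm.isOpenPosMeasure hβ
    have h1 := (Continuous.ae_eq_iff_eq m (a.continuous _ hu) (a.continuous _ hv)).1
      (pull_ae_eq hβ h)
    rintro _ ⟨x, hx, rfl⟩
    exact congrFun h1 ⟨x, hx⟩
  extend n u hu h h' := by
    have hu1 := pull_succ_mem hu h h'
    refine ⟨hu1, fun v hv => ?_⟩
    refine (continuum_form_succ hα hu1 hv).trans ?_
    rw [Finset.sum_eq_zero, mul_zero, add_zero]
    · rfl
    · intro i hi
      rw [pull_succ_comp_of_ne (Finset.ne_of_mem_erase hi) h h',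
        a.form_zero_left (a.comp_cellMap_mem hv i), mul_zero]

lemma isAdapted_continuum : FormSequence.IsAdapted (S.continuum β a) where
  carrier n ω ω' h := by
    change S.blowX ω n = S.blowX ω' n
    rw [blowX, blowX, S.blowMap_congr h]
  boundary n ω ω' h := by
    change S.blowBoundary ω n = S.blowBoundary ω' n
    rw [blowBoundary, blowBoundary, S.blowMap_congr h]
  measure n ω ω' h := by
    change S.continuumMeasure β m ω n = S.continuumMeasure β m ω' n
    rw [continuumMeasure, continuumMeasure, S.blowMap_congr h, prod_congr_Iio (fun i => (β i)⁻¹) h]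
  dom n ω ω' h := by
    change {f | S.pull ω n f ∈ a.dom} = {f | S.pull ω' n f ∈ a.dom}
    rw [pull_congr_Iio h]
  form n ω ω' h := by
    funext f g
    change _ * a.form (S.pull ω n f) (S.pull ω n g) = _ * a.form (S.pull ω' n f) (S.pull ω' n g)
    rw [pull_congr_Iio h, prod_congr_Iio α h]

lemma isConj_continuum (hα : ∀ i, 0 < α i) (hH : ∀ i j, α i * β i = α j * β j)
    {ω ω' : ℕ → Fin N} (h : ∀ k ≥ n, ω k = ω' k) :
    FormSequence.IsConj (S.continuum β a ω) (S.continuum β a ω') (S.shift ω ω' n)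
      (shiftFactor ω ω' n α) n where
  pos := shiftFactor_pos hα
  carrier k hk x := S.shift_mem_image h hk _ x
  boundary k hk x := S.shift_mem_image h hk _ x
  measure k hk := by
    change S.continuumMeasure β m ω' k = _ • (S.continuumMeasure β m ω k).map _
    rw [continuumMeasure, continuumMeasure, Measure.map_smul,
      Measure.map_map (S.shift ω ω' n).measurable (measurableEmbedding_blowMap S ω k).measurable,
      smul_smul, ← ENNReal.ofReal_mul (shiftFactor_pos hα).le, ← prod_inv_shift hα hH h hk]
    congr 2
    funext x
    exact (S.shift_apply h hk x).symm
  dom k hk u := by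
    change S.pull ω' k u ∈ a.dom ↔ S.pull ω k _ ∈ a.dom
    rw [S.pull_shift h hk]
  form k hk u v := by
    change _ * a.form (S.pull ω' k u) (S.pull ω' k v) =
      _ * (_ * a.form (S.pull ω k _) (S.pull ω k _))
    rw [S.pull_shift h hk, S.pull_shift h hk, prod_shift hα h hk, mul_assoc]

end Continuum

theorem hasDeterministicSpectra_continuum [NeZero N] {α β : Fin N → ℝ} {m : Measure S.X}
    (hα : ∀ i, α i ∈ Set.Ioo (0 : ℝ) 1) (hβ : ∀ i, β i ∈ Set.Ioo (0 : ℝ) 1)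
    (hβ_sum : ∑ i, β i = 1) (hH : ∀ i j, α i * β i = α j * β j)
    (hm : S.IsSelfSimilarMeasure β m) (a : S.DirichletForm α m) :
    HasDeterministicSpectra (S.continuum β a) :=
  FormSequence.hasDeterministicSpectra
    (isBlowUp_continuum (fun i => (hα i).1) (fun i => (hβ i).1) hm) isAdapted_continuum
    (fun _ _ _ h => ⟨_, _, isConj_continuum (fun i => (hα i).1) hH h⟩)
    (S.ae_exists_disjoint (exists_ne_of_sum_eq_one hβ hβ_sum))

end SelfSimilarSet

end ContinuousBlowUps

end FractalBlowUp

end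

theorem proposition2 {d N : ℕ} [NeZero N] (S : FractalBlowUp.SelfSimilarSet d N)
    (α β : Fin N → ℝ)
    (hα : ∀ i, α i ∈ Set.Ioo (0 : ℝ) 1) (hβ : ∀ i, β i ∈ Set.Ioo (0 : ℝ) 1)
    (hβ_sum : ∑ i, β i = 1) (hH : ∀ i j, α i * β i = α j * β j) :
    (∀ (a : S.F → S.F → ℝ) (b : S.F → ℝ), S.IsConductance a → (∀ x, 0 < b x) →
      FractalBlowUp.HasDeterministicSpectra (S.lattice α β a b)) ∧
    (∀ (m : MeasureTheory.Measure S.X), S.IsSelfSimilarMeasure β m →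
      ∀ a : S.DirichletForm α m,
        FractalBlowUp.HasDeterministicSpectra (S.continuum β a)) := by
  exact ⟨fun _ _ ha hb => S.hasDeterministicSpectra_lattice hα hβ hβ_sum hH ha hb, fun _ hm a =>
    FractalBlowUp.SelfSimilarSet.hasDeterministicSpectra_continuum hα hβ hβ_sum hH hm a⟩
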